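/- Let $M$ be a complete, simply connected smooth Riemannian manifold (without boundary) all of whose sectional curvatures are at most $1$. Let $c\colon[0,\pi]\to M$ be a unit speed geodesic (so of length $\pi$) from $p$ to $q$, and let $(s,t)\mapsto c_s(t)$, $(-\delta,\delta)\times[0,\pi]\to M$ with $\delta>0$, be a smooth variation of $c=c_0$ through curves from $p$ to $q$, i.e. $c_s(0)=p$ and $c_s(\pi)=q$, such that the length of $c_s$ is at most $\pi$ for every $s$. Then there is $\varepsilon\in(0,\delta]$ such that for every $\sigma$ with $|\sigma|<\varepsilon$ for which $c_\sigma$ is not a reparametrization of $c$, the curves $c$ and $c_\sigma$ span a totally geodesic spherical slice of constant curvature $1$. Here a curve $b\colon[0,\pi]\to M$ is a reparametrization of $a\colon[0,\pi]\to M$ if $b=a\circ\tau$ for a smooth $\tau\colon[0,\pi]\to[0,\pi]$ with $\tau'>0$, $\tau(0)=0$, $\tau(\pi)=\pi$. For $\alpha\in(0,\pi/2)$ let $L_\alpha=\{m_\theta(t): 0\le\theta\le\alpha,\ 0\le t\le\pi\}$ with $m_\theta(t)=(\cos t,\sin t\cos\theta,\sin t\sin\theta)$ be the lune of angle $\alpha$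 in the round unit sphere $\mathbf S^2\subset\mathbf R^3$, bounded by the two great semicircles $m_0$ and $m_\alpha$. That $c$ and $c_\sigma$ span a totally geodesic spherical slice means: for some $\alpha\in(0,\pi/2)$ there is a map $F\colon L_\alpha\to M$ which is a smooth isometric immersion, is totally geodesic (it maps every great circle arc contained in $L_\alpha$ to a geodesic of $M$), and satisfies $F(m_0(t))=c(t)$ for all $t\in[0,\pi]$, while $c_\sigma$ is a reparametrization of $t\mapsto F(m_\alpha(t))$. -/

import Mathlib

open Set Manifold Bundle
open scoped ContDiff

/-! ## Riemannian geometry in charts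

`M` is a manifold without boundary modelled on `ℝⁿ`, and its tangent spaces carry inner products.
The Levi-Civita connection and its curvature are given by the classical formulas in the
coordinates `extChartAt (𝓡 n) x₀`, the point being represented by its coordinate vector `y`. -/

section Riemannian

variable (n : ℕ) {M : Type*} [TopologicalSpace M] [ChartedSpace (EuclideanSpace ℝ (Fin n)) M]

/-- The coordinate vector field `∂ᵢ` of the chart at `x₀`, at the point with coordinates `y`. -/
noncomputable def coordVec (x₀ : M) (y : EuclideanSpace ℝ (Fin n)) (i : Fin n) :
    TangentSpace (𝓡 n) ((extChartAt (𝓡 n) x₀).symm y) :=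
  mfderiv 𝓘(ℝ, EuclideanSpace ℝ (Fin n)) (𝓡 n) (extChartAt (𝓡 n) x₀).symm y
    (EuclideanSpace.single i (1 : ℝ))

/-- The partial derivative `∂ᵢ f` on `ℝⁿ`. -/
noncomputable def partialDeriv (i : Fin n) (f : EuclideanSpace ℝ (Fin n) → ℝ)
    (y : EuclideanSpace ℝ (Fin n)) : ℝ :=
  fderiv ℝ f y (EuclideanSpace.single i (1 : ℝ))

variable [RiemannianBundle (fun x : M ↦ TangentSpace (𝓡 n) x)]

/-- The metric coefficients `g_{ij} = ⟨∂ᵢ, ∂ⱼ⟩`. -/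
noncomputable def metricCoeff (x₀ : M) (y : EuclideanSpace ℝ (Fin n)) :
    Matrix (Fin n) (Fin n) ℝ :=
  Matrix.of fun i j ↦ inner ℝ (coordVec n x₀ y i) (coordVec n x₀ y j)

/-- The Christoffel symbols
`Γᵏ_{ij} = ½ ∑ₗ gᵏˡ (∂ᵢ g_{jl} + ∂ⱼ g_{il} - ∂ₗ g_{ij})` of the Levi-Civita connection. -/
noncomputable def christoffel (x₀ : M) (k i j : Fin n) (y : EuclideanSpace ℝ (Fin n)) : ℝ :=
  (1 / 2 : ℝ) * ∑ l, (metricCoeff n x₀ y)⁻¹ k l *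
    (partialDeriv n i (fun z ↦ metricCoeff n x₀ z j l) y
      + partialDeriv n j (fun z ↦ metricCoeff n x₀ z i l) y
      - partialDeriv n l (fun z ↦ metricCoeff n x₀ z i j) y)

/-- The coefficient of `∂ₗ` in `R(∂ᵢ, ∂ⱼ)∂ₖ`, where
`R(X, Y)Z = ∇_X ∇_Y Z - ∇_Y ∇_X Z - ∇_{[X, Y]} Z`. -/
noncomputable def curvatureCoeff (x₀ : M) (l i j k : Fin n) (y : EuclideanSpace ℝ (Fin n)) : ℝ :=
  partialDeriv n i (christoffel n x₀ l j k) y - partialDeriv n j (christoffel n x₀ l i k) y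
    + ∑ m, (christoffel n x₀ m j k y * christoffel n x₀ l i m y
      - christoffel n x₀ m i k y * christoffel n x₀ l j m y)

/-- The inner product `g(u, v)` of the tangent vectors with coordinates `u` and `v`. -/
noncomputable def metricForm (x₀ : M) (y u v : EuclideanSpace ℝ (Fin n)) : ℝ :=
  ∑ i, ∑ j, metricCoeff n x₀ y i j * u i * v j

/-- The vector `R(u, v)w`, in coordinates. -/
noncomputable def curvatureVec (x₀ : M) (y u v w : EuclideanSpace ℝ (Fin n)) :
    EuclideanSpace ℝ (Fin n) :=
  WithLp.toLp 2 fun l ↦ ∑ i, ∑ j, ∑ k, curvatureCoeff n x₀ l i j k y * u i * v j * w k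

/-- The sectional curvature of the plane spanned by the tangent vectors with coordinates `u`, `v`
(meaningful when these are linearly independent). -/
noncomputable def sectionalCurvature (x₀ : M) (y u v : EuclideanSpace ℝ (Fin n)) : ℝ :=
  metricForm n x₀ y (curvatureVec n x₀ y u v v) u /
    (metricForm n x₀ y u u * metricForm n x₀ y v v - metricForm n x₀ y u v ^ 2)

variable (M) in
/-- All sectional curvatures of `M` are at most `κ`. -/
def SectionalCurvatureLE (κ : ℝ) : Prop :=
  ∀ (x₀ : M), ∀ y ∈ (extChartAt (𝓡 n) x₀).target, ∀ u v : EuclideanSpace ℝ (Fin n),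
    LinearIndependent ℝ ![u, v] → sectionalCurvature n x₀ y u v ≤ κ

/-- `γ` restricted to `[a, b]` is a geodesic: it is smooth and satisfies the geodesic equation
`ẍᵏ + ∑ᵢⱼ Γᵏ_{ij} ẋⁱ ẋʲ = 0` in coordinates. -/
def IsGeodesicOn (γ : ℝ → M) (a b : ℝ) : Prop :=
  ContMDiffOn 𝓘(ℝ, ℝ) (𝓡 n) ∞ γ (Icc a b) ∧
  ∀ (x₀ : M), ∀ t ∈ Ioo a b, γ t ∈ (extChartAt (𝓡 n) x₀).source → ∀ k : Fin n,
    deriv (deriv fun s ↦ extChartAt (𝓡 n) x₀ (γ s) k) t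
      + ∑ i, ∑ j, christoffel n x₀ k i j (extChartAt (𝓡 n) x₀ (γ t))
        * deriv (fun s ↦ extChartAt (𝓡 n) x₀ (γ s) i) t
        * deriv (fun s ↦ extChartAt (𝓡 n) x₀ (γ s) j) t = 0

/-- The curve `γ` has unit speed on `[a, b]`. -/
def HasUnitVelocityOn (γ : ℝ → M) (a b : ℝ) : Prop :=
  ∀ t ∈ Icc a b, ‖mfderivWithin 𝓘(ℝ, ℝ) (𝓡 n) γ (Icc a b) t (1 : ℝ)‖ = 1

end Riemannian

/-- The curve `γ'` on `[a, b]` is an (orientation preserving, regular) reparametrization of the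
curve `γ` on `[a, b]`. -/
def IsReparametrizationOn {M : Type*} (γ' γ : ℝ → M) (a b : ℝ) : Prop :=
  ∃ τ : ℝ → ℝ, ContDiffOn ℝ ∞ τ (Icc a b) ∧ (∀ t ∈ Icc a b, 0 < derivWithin τ (Icc a b) t) ∧
    τ a = a ∧ τ b = b ∧ ∀ t ∈ Icc a b, γ' t = γ (τ t)

/-! ## Spherical slices -/

instance fact_finrank_euclideanSpace_three :
    Fact (Module.finrank ℝ (EuclideanSpace ℝ (Fin 3)) = 2 + 1) := ⟨by simp⟩

/-- The unit sphere in `ℝ³`. -/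
abbrev UnitSphere : Type := Metric.sphere (0 : EuclideanSpace ℝ (Fin 3)) 1

/-- The point of the unit sphere at distance `t` from the pole `(1, 0, 0)` on the meridian with
longitude `θ`. -/
noncomputable def meridian (θ t : ℝ) : UnitSphere :=
  ⟨!₂[Real.cos t, Real.sin t * Real.cos θ, Real.sin t * Real.sin θ], by
    rw [mem_sphere_zero_iff_norm, EuclideanSpace.norm_eq, Real.sqrt_eq_one]
    simp only [Fin.sum_univ_three, Real.norm_eq_abs, sq_abs]
    simp
    nlinarith [Real.sin_sq_add_cos_sq t, Real.sin_sq_add_cos_sq θ]⟩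

/-- The closed lune of angle `α` in the unit sphere: the region swept out by the meridians of
longitude between `0` and `α`. -/
def lune (α : ℝ) : Set UnitSphere :=
  {x | ∃ θ ∈ Icc 0 α, ∃ t ∈ Icc 0 Real.pi, x = meridian θ t}

/-- `γ` is a unit speed parametrization of a great circle. -/
def IsGreatCircle (γ : ℝ → UnitSphere) : Prop :=
  ∃ u w : EuclideanSpace ℝ (Fin 3), ‖u‖ = 1 ∧ ‖w‖ = 1 ∧ inner ℝ u w = 0 ∧
    ∀ t, (γ t : EuclideanSpace ℝ (Fin 3)) = Real.cos t • u + Real.sin t • w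

section Slice

variable (n : ℕ) {M : Type*} [TopologicalSpace M] [ChartedSpace (EuclideanSpace ℝ (Fin n)) M]
  [RiemannianBundle (fun x : M ↦ TangentSpace (𝓡 n) x)]

/-- `F` is a smooth isometric immersion of the region `D` of the round unit sphere into `M`. The
metric of the sphere is the one induced from `ℝ³`. -/
def IsIsometricImmersionOn (F : UnitSphere → M) (D : Set UnitSphere) : Prop :=
  ContMDiffOn (𝓡 2) (𝓡 n) ∞ F D ∧
  ∀ x ∈ D, ∀ u v : TangentSpace (𝓡 2) x,
    inner ℝ (mfderivWithin (𝓡 2) (𝓡 n) F D x u) (mfderivWithin (𝓡 2) (𝓡 n) F D x v)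
      = inner (E := EuclideanSpace ℝ (Fin 3)) ℝ
        (mfderiv (𝓡 2) 𝓘(ℝ, EuclideanSpace ℝ (Fin 3))
          (fun z : UnitSphere ↦ (z : EuclideanSpace ℝ (Fin 3))) x u)
        (mfderiv (𝓡 2) 𝓘(ℝ, EuclideanSpace ℝ (Fin 3))
          (fun z : UnitSphere ↦ (z : EuclideanSpace ℝ (Fin 3))) x v)

/-- `F` is totally geodesic on the region `D` of the unit sphere: it maps the geodesics of `D`,
which are the arcs of great circles in `D`, to geodesics of `M`. -/
def IsTotallyGeodesicOn (F : UnitSphere → M) (D : Set UnitSphere) : Prop :=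
  ∀ γ : ℝ → UnitSphere, IsGreatCircle γ → ∀ a b : ℝ, a < b → (∀ t ∈ Icc a b, γ t ∈ D) →
    IsGeodesicOn n (fun t ↦ F (γ t)) a b

/-- The curves `c` and `c'` on `[0, π]` span a totally geodesic spherical slice: there is a totally
geodesic isometric immersion of a lune in the unit sphere which maps one bounding meridian of the
lune to `c` and the other one, up to reparametrization, to `c'`. -/
def SpanTotallyGeodesicSphericalSlice (c c' : ℝ → M) : Prop :=
  ∃ α : ℝ, 0 < α ∧ α < Real.pi / 2 ∧ ∃ F : UnitSphere → M,
    IsIsometricImmersionOn n F (lune α) ∧ IsTotallyGeodesicOn n F (lune α) ∧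
    (∀ t ∈ Icc 0 Real.pi, F (meridian 0 t) = c t) ∧
    IsReparametrizationOn c' (fun t ↦ F (meridian α t)) 0 Real.pi

end Slice

/-!
The idea is that `c` is decomposed at its midpoint `m` into a ray from `p` and a ray from `q`, both
of length `π / 2`, and that the sum of the distances `ρ` and `ρ'` to `p` and `q`, measured in
normal coordinates, cannot fall below `π` near `m`.

*Normal coordinates.* Radial Jacobi fields satisfy the Rauch and Hessian comparison with the unit
sphere (`IsNormalMetric.sin_sq_mul_le`, `IsNormalMetric.radialDefect_nonneg`). Therefore `p` and `q`
have no conjugate points along `c` before distance `π` (`mem_normalDom`), both halves of `c` and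
the curves of the variation close to them can be studied in normal coordinates
(`IsGeodesicOn.exists_rays`, `exists_isRadialLift`), and by the Gauss lemma the length of such a
curve is at least its distance to the pole.

*Sum of the distances.* Let `f = -cos ρ - cos ρ'` along a unit speed geodesic which starts at `m`.
The Hessian comparison gives `f'' + f ≥ 0`. At `m` the function and its derivative vanish, since
the directions to `p` and `q` are opposite. Sturm comparison gives `f ≥ 0`, that is `ρ + ρ' ≥ π`
(`IsOpposite.pi_le_of_ray`). Hence a curve of length at most `π` close to `c` realizes the distance
to `p` in its first half and the distance to `q` in its second half. Up to parametrization it is a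
broken geodesic, whose parts meet at a point `x` with `ρ = ρ' = π / 2` (`exists_broken_geodesic`).
If `x = m`, then the curve is a reparametrization of `c`.

*Rigidity.* If `x ≠ m`, then equality holds in Sturm comparison along the segment from `m` to `x`.
The segment has `ρ = ρ' = π / 2` throughout, and the Hessian comparison is an equality along the
rays to it (`IsOpposite.rigid`). The radial Jacobi fields are then those of the unit sphere, and the
curvature bound forces the surfaces swept out by the rays to be totally geodesic: a plane of maximal
sectional curvature determines the curvature vector (`IsMetricOn.curv_eq_of_max`), so that the
second fundamental form, divided by `sin t`, is parallel along the rays, and it vanishes on the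
segment, which is a geodesic (`IsNormalMetric.spherical_of_jacobiDeriv`, `IsPole.exists_isSector`).
Since `ρ + ρ'` is minimal along the segment, the rays from `p` and `q` meet it in opposite
directions (`IsMidpoint.opposite`), and the two sectors form the image of a lune under the map
`sliceMap`.

Normal coordinates around a pole of the unit sphere make `sliceMap` explicit. It is an isometric and
totally geodesic immersion because the metric and the Christoffel symbols along a sector are known
(`IsSector.apply_fderiv`, `IsSector.accel_eq_zero`), and it is smooth across the equator because the
rays from `p` and `q` agree there as geodesics (`IsSlice.exists_overlap`). The differential along
the lune is well defined since the lune has unique derivatives (`uniqueMDiffWithinAt_lune`).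

The exponential map rests on a smooth local flow of smooth vector fields (`exists_contDiffOn_flow`),
which is obtained from the implicit function theorem in a space of continuous curves. The metric,
its Christoffel symbols and its curvature are treated without coordinates on open subsets of a
vector space; `christoffel_eq`, `curvatureVec_eq` and `classical_geodesic_iff` compare them with the
classical index formulas.
-/

set_option linter.unusedSectionVars false

/-! Shortcut instances, which spare long searches through iterated spaces of linear maps. -/

section Shortcuts

variable {E F : Type*} [NormedAddCommGroup E] [NormedSpace ℝ E] [NormedAddCommGroup F]
  [NormedSpace ℝ F]

noncomputable instance instNormedGroupClm₂ : NormedAddCommGroup (E →L[ℝ] E →L[ℝ] F) :=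
  ContinuousLinearMap.toNormedAddCommGroup
noncomputable instance instNormedSpaceClm₂ : NormedSpace ℝ (E →L[ℝ] E →L[ℝ] F) :=
  ContinuousLinearMap.toNormedSpace
noncomputable instance instSeminormedClm₂ : SeminormedAddCommGroup (E →L[ℝ] E →L[ℝ] F) :=
  ContinuousLinearMap.toSeminormedAddCommGroup
noncomputable instance instAddCommGroupClm₂ : AddCommGroup (E →L[ℝ] E →L[ℝ] F) :=
  ContinuousLinearMap.addCommGroup
noncomputable instance instAddCommMonoidClm₂ : AddCommMonoid (E →L[ℝ] E →L[ℝ] F) :=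
  ContinuousLinearMap.addCommMonoid
noncomputable instance instAddGroupClm₂ : AddGroup (E →L[ℝ] E →L[ℝ] F) :=
  ContinuousLinearMap.addCommGroup.toAddGroup
noncomputable instance instAddMonoidClm₂ : AddMonoid (E →L[ℝ] E →L[ℝ] F) :=
  ContinuousLinearMap.addCommMonoid.toAddMonoid
noncomputable instance instAddZeroClm₂ : AddZeroClass (E →L[ℝ] E →L[ℝ] F) :=
  ContinuousLinearMap.addCommMonoid.toAddMonoid.toAddZeroClass
noncomputable instance instModuleClm₂ : Module ℝ (E →L[ℝ] E →L[ℝ] F) :=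
  ContinuousLinearMap.module
noncomputable instance instConstSMulClm₂ : ContinuousConstSMul ℝ (E →L[ℝ] E →L[ℝ] F) :=
  ContinuousLinearMap.continuousConstSMul
noncomputable instance instNormedGroupClm₃ : NormedAddCommGroup (E →L[ℝ] E →L[ℝ] E →L[ℝ] F) :=
  ContinuousLinearMap.toNormedAddCommGroup
noncomputable instance instNormedSpaceClm₃ : NormedSpace ℝ (E →L[ℝ] E →L[ℝ] E →L[ℝ] F) :=
  ContinuousLinearMap.toNormedSpace
noncomputable instance instSeminormedClm₃ : SeminormedAddCommGroup (E →L[ℝ] E →L[ℝ] E →L[ℝ] F) :=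
  ContinuousLinearMap.toSeminormedAddCommGroup
noncomputable instance instAddCommGroupClm₃ : AddCommGroup (E →L[ℝ] E →L[ℝ] E →L[ℝ] F) :=
  ContinuousLinearMap.addCommGroup
noncomputable instance instAddCommMonoidClm₃ : AddCommMonoid (E →L[ℝ] E →L[ℝ] E →L[ℝ] F) :=
  ContinuousLinearMap.addCommMonoid
noncomputable instance instAddGroupClm₃ : AddGroup (E →L[ℝ] E →L[ℝ] E →L[ℝ] F) :=
  ContinuousLinearMap.addCommGroup.toAddGroup
noncomputable instance instAddMonoidClm₃ : AddMonoid (E →L[ℝ] E →L[ℝ] E →L[ℝ] F) :=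
  ContinuousLinearMap.addCommMonoid.toAddMonoid
noncomputable instance instAddZeroClm₃ : AddZeroClass (E →L[ℝ] E →L[ℝ] E →L[ℝ] F) :=
  ContinuousLinearMap.addCommMonoid.toAddMonoid.toAddZeroClass
noncomputable instance instModuleClm₃ : Module ℝ (E →L[ℝ] E →L[ℝ] E →L[ℝ] F) :=
  ContinuousLinearMap.module
noncomputable instance instConstSMulClm₃ : ContinuousConstSMul ℝ (E →L[ℝ] E →L[ℝ] E →L[ℝ] F) :=
  ContinuousLinearMap.continuousConstSMul
noncomputable instance instNormedGroupDualClm : NormedAddCommGroup ((E →L[ℝ] ℝ) →L[ℝ] F) :=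
  ContinuousLinearMap.toNormedAddCommGroup
noncomputable instance instNormedSpaceDualClm : NormedSpace ℝ ((E →L[ℝ] ℝ) →L[ℝ] F) :=
  ContinuousLinearMap.toNormedSpace
noncomputable instance instNormedGroupClm₂Clm₂ :
    NormedAddCommGroup ((E →L[ℝ] E →L[ℝ] ℝ) →L[ℝ] E →L[ℝ] F) :=
  ContinuousLinearMap.toNormedAddCommGroup
noncomputable instance instNormedSpaceClm₂Clm₂ :
    NormedSpace ℝ ((E →L[ℝ] E →L[ℝ] ℝ) →L[ℝ] E →L[ℝ] F) :=
  ContinuousLinearMap.toNormedSpace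

end Shortcuts

/-! ### Riemannian metrics on open subsets of a vector space -/

section LocalMetric

variable {E : Type*} [NormedAddCommGroup E] [NormedSpace ℝ E]

/-- `g` restricts to a smooth Riemannian metric on the open set `U` of the vector space `E`. -/
structure IsMetricOn (g : E → E →L[ℝ] E →L[ℝ] ℝ) (U : Set E) : Prop where
  isOpen : IsOpen U
  contDiffOn : ContDiffOn ℝ ∞ g U
  symm : ∀ y ∈ U, ∀ u v, g y u v = g y v u
  pos : ∀ y ∈ U, ∀ u, u ≠ 0 → 0 < g y u u

/-- The trilinear form `½ (∂ᵤ g(v, w) + ∂ᵥ g(u, w) - ∂_w g(u, v))`, which is `g(∇ᵤ v, w)` for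
constant fields. -/
noncomputable def koszulForm (g : E → E →L[ℝ] E →L[ℝ] ℝ) (y : E) : E →L[ℝ] E →L[ℝ] E →L[ℝ] ℝ :=
  (1 / 2 : ℝ) • (fderiv ℝ g y + (fderiv ℝ g y).flip
    - ((ContinuousLinearMap.flipₗᵢ ℝ E E ℝ).toContinuousLinearEquiv :
      (E →L[ℝ] E →L[ℝ] ℝ) →L[ℝ] (E →L[ℝ] E →L[ℝ] ℝ)) ∘L
      (fderiv ℝ g y).flip)

/-- The Christoffel symbol of the Levi-Civita connection of `g`, as a bilinear map. -/
noncomputable def chris (g : E → E →L[ℝ] E →L[ℝ] ℝ) (y : E) : E →L[ℝ] E →L[ℝ] E :=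
  (ContinuousLinearMap.compL ℝ E (E →L[ℝ] ℝ) E (ContinuousLinearMap.inverse (g y))) ∘L koszulForm g y

/-- The curvature vector `R(u, v)w` of `g`. -/
noncomputable def curv (g : E → E →L[ℝ] E →L[ℝ] ℝ) (y u v w : E) : E :=
  fderiv ℝ (chris g) y u v w - fderiv ℝ (chris g) y v u w
    + (chris g y u (chris g y v w) - chris g y v (chris g y u w))

/-- The covariant acceleration of the curve `x`. -/
noncomputable def accel (g : E → E →L[ℝ] E →L[ℝ] ℝ) (x : ℝ → E) (t : ℝ) : E :=
  deriv (deriv x) t + chris g (x t) (deriv x t) (deriv x t)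

/-- The sectional curvatures of `g` on `U` are at most `1`. The inequality is the one between
quadratic forms, which also makes sense for linearly dependent vectors. -/
def SecLEOne (g : E → E →L[ℝ] E →L[ℝ] ℝ) (U : Set E) : Prop :=
  ∀ y ∈ U, ∀ u v, g y (curv g y u v v) u ≤ g y u u * g y v v - g y u v ^ 2

theorem koszulForm_apply (g : E → E →L[ℝ] E →L[ℝ] ℝ) (y u v w : E) :
    koszulForm g y u v w =
      (1 / 2 : ℝ) * (fderiv ℝ g y u v w + fderiv ℝ g y v u w - fderiv ℝ g y w u v) := by
  simp [koszulForm]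

theorem chris_apply (g : E → E →L[ℝ] E →L[ℝ] ℝ) (y u v : E) :
    chris g y u v = ContinuousLinearMap.inverse (g y) (koszulForm g y u v) := by
  simp [chris]

theorem curv_swap (g : E → E →L[ℝ] E →L[ℝ] ℝ) (y u v w : E) :
    curv g y u v w = - curv g y v u w := by
  simp only [curv]; abel

namespace IsMetricOn

variable {g : E → E →L[ℝ] E →L[ℝ] ℝ} {U : Set E} (hg : IsMetricOn g U) {y : E} (hy : y ∈ U)
include hg hy

theorem mem_nhds : U ∈ nhds y := hg.isOpen.mem_nhds hy

theorem contDiffAt : ContDiffAt ℝ ∞ g y := hg.contDiffOn.contDiffAt (hg.mem_nhds hy)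

theorem differentiableAt : DifferentiableAt ℝ g y := (hg.contDiffAt hy).differentiableAt (by simp)

theorem nonneg (u : E) : 0 ≤ g y u u := by
  by_cases h : u = 0
  · simp [h]
  · exact (hg.pos y hy u h).le

theorem eq_zero_of_apply_self {u : E} (h : g y u u = 0) : u = 0 := by
  by_contra hu
  exact (hg.pos y hy u hu).ne' h

theorem ext_of_apply {u v : E} (h : ∀ w, g y u w = g y v w) : u = v := by
  have : g y (u - v) (u - v) = 0 := by simp [h]
  exact sub_eq_zero.1 (hg.eq_zero_of_apply_self hy this)

theorem injective : Function.Injective (g y) := fun u v h ↦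
  hg.ext_of_apply hy fun w ↦ by rw [h]

theorem fderiv_symm (u v w : E) : fderiv ℝ g y u v w = fderiv ℝ g y u w v := by
  have h1 : HasFDerivAt (fun z ↦ g z v w) (((fderiv ℝ g y).flip v).flip w) y := by
    have := ((hg.differentiableAt hy).hasFDerivAt.clm_apply (hasFDerivAt_const v y)).clm_apply
      (hasFDerivAt_const w y)
    refine this.congr_fderiv ?_
    ext; simp
  have h2 : HasFDerivAt (fun z ↦ g z w v) (((fderiv ℝ g y).flip w).flip v) y := by
    have := ((hg.differentiableAt hy).hasFDerivAt.clm_apply (hasFDerivAt_const w y)).clm_apply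
      (hasFDerivAt_const v y)
    refine this.congr_fderiv ?_
    ext; simp
  have h3 : (fun z ↦ g z v w) =ᶠ[nhds y] fun z ↦ g z w v := by
    filter_upwards [hg.mem_nhds hy] with z hz using hg.symm z hz v w
  have h4 := h1.unique (h2.congr_of_eventuallyEq h3)
  simpa using congrArg (fun L : E →L[ℝ] ℝ ↦ L u) h4

/-- The Cauchy–Schwarz inequality for `g`. -/
theorem cauchySchwarz (u v : E) : g y u v ^ 2 ≤ g y u u * g y v v := by
  by_cases h : v = 0
  · simp [h]
  have hv := hg.pos y hy v h
  have h1 := hg.nonneg hy (g y v v • u - g y u v • v)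
  have h2 := hg.symm y hy u v
  simp only [map_sub, map_smul, sub_apply, smul_apply, smul_eq_mul, ← h2] at h1
  have h3 : 0 ≤ g y v v * (g y u u * g y v v - g y u v ^ 2) := by nlinarith [h1]
  nlinarith [nonneg_of_mul_nonneg_right h3 hv]

variable [FiniteDimensional ℝ E]

theorem isInvertible : (g y).IsInvertible := by
  have hfr : Module.finrank ℝ E = Module.finrank ℝ (E →L[ℝ] ℝ) := by
    rw [← (LinearMap.toContinuousLinearMap (𝕜 := ℝ) (E := E) (F' := ℝ)).finrank_eq]
    exact (Subspace.dual_finrank_eq).symm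
  let e := LinearEquiv.ofInjectiveOfFinrankEq (g y : E →ₗ[ℝ] (E →L[ℝ] ℝ)) (hg.injective hy) hfr
  have : CompleteSpace E := FiniteDimensional.complete ℝ E
  exact ⟨e.toContinuousLinearEquiv, by ext; rfl⟩

theorem apply_chris (u v w : E) : g y (chris g y u v) w = koszulForm g y u v w := by
  obtain ⟨e, he⟩ := hg.isInvertible hy
  rw [chris_apply, ← he, ContinuousLinearMap.inverse_equiv]
  simp

theorem eq_chris_of_apply {u v z : E} (h : ∀ w, g y z w = koszulForm g y u v w) :
    z = chris g y u v :=
  hg.ext_of_apply hy fun w ↦ by rw [h, hg.apply_chris hy]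

theorem chris_symm (u v : E) : chris g y u v = chris g y v u := by
  refine hg.ext_of_apply hy fun w ↦ ?_
  rw [hg.apply_chris hy, hg.apply_chris hy, koszulForm_apply, koszulForm_apply,
    hg.fderiv_symm hy w u v]
  ring

/-- The Levi-Civita connection is compatible with the metric. -/
theorem fderiv_eq (u v w : E) :
    fderiv ℝ g y u v w = g y (chris g y u v) w + g y v (chris g y u w) := by
  rw [hg.symm y hy v, hg.apply_chris hy, hg.apply_chris hy, koszulForm_apply, koszulForm_apply,
    hg.fderiv_symm hy u v w, hg.fderiv_symm hy v u w, hg.fderiv_symm hy w u v]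
  ring

set_option maxHeartbeats 1000000 in
theorem contDiffAt_chris : ContDiffAt ℝ ∞ (chris g) y := by
  have : CompleteSpace E := FiniteDimensional.complete ℝ E
  have h1 : ContDiffAt ℝ ∞ (fderiv ℝ g) y :=
    (hg.contDiffAt hy).fderiv_right (m := ∞) (by norm_cast)
  have h2 : ContDiffAt ℝ ∞ (fun z ↦ (fderiv ℝ g z).flip) y :=
    (ContinuousLinearMap.flipₗᵢ ℝ E E (E →L[ℝ] ℝ)).contDiff.contDiffAt.comp y h1
  have h3 : ContDiffAt ℝ ∞ (koszulForm g) y := by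
    unfold koszulForm
    refine ContDiffAt.const_smul (1 / 2 : ℝ) ((h1.add h2).sub ?_)
    exact contDiffAt_const.clm_comp h2
  obtain ⟨e, he⟩ := hg.isInvertible hy
  have h4 : ContDiffAt ℝ ∞ (fun z ↦ ContinuousLinearMap.inverse (g z)) y := by
    have := contDiffAt_map_inverse (𝕜 := ℝ) (n := ∞) e
    rw [he] at this
    exact this.comp y (hg.contDiffAt hy)
  unfold chris
  have h5 : ContDiffAt ℝ ∞ (fun z ↦ ContinuousLinearMap.compL ℝ E (E →L[ℝ] ℝ) E
      (ContinuousLinearMap.inverse (g z))) y :=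
    (ContinuousLinearMap.compL ℝ E (E →L[ℝ] ℝ) E).contDiff.contDiffAt.comp y h4
  exact h5.clm_comp h3

theorem differentiableAt_chris : DifferentiableAt ℝ (chris g) y :=
  (hg.contDiffAt_chris hy).differentiableAt (by simp)

theorem fderiv_chris_symm (u v w : E) :
    fderiv ℝ (chris g) y u v w = fderiv ℝ (chris g) y u w v := by
  have key (v w : E) : HasFDerivAt (fun z ↦ chris g z v w) (((fderiv ℝ (chris g) y).flip v).flip w) y := by
    have := ((hg.differentiableAt_chris hy).hasFDerivAt.clm_apply (hasFDerivAt_const v y)).clm_apply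
      (hasFDerivAt_const w y)
    refine this.congr_fderiv ?_
    ext; simp
  have h3 : (fun z ↦ chris g z v w) =ᶠ[nhds y] fun z ↦ chris g z w v := by
    filter_upwards [hg.mem_nhds hy] with z hz using hg.chris_symm hz v w
  have h4 := (key v w).unique ((key w v).congr_of_eventuallyEq h3)
  simpa using congrArg (fun L : E →L[ℝ] E ↦ L u) h4

/-- Differentiation of the metric along a curve, in terms of covariant derivatives. -/
theorem hasDerivAt_apply {x X Y : ℝ → E} {x' X' Y' : E} {t : ℝ} (hxt : x t = y)
    (hx : HasDerivAt x x' t) (hX : HasDerivAt X X' t) (hY : HasDerivAt Y Y' t) :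
    HasDerivAt (fun t ↦ g (x t) (X t) (Y t))
      (g (x t) (X' + chris g (x t) x' (X t)) (Y t)
        + g (x t) (X t) (Y' + chris g (x t) x' (Y t))) t := by
  subst hxt
  have h1 := ((((hg.differentiableAt hy).hasFDerivAt.comp_hasDerivAt t hx).clm_apply hX).clm_apply hY)
  refine h1.congr_deriv ?_
  simp only [Function.comp, map_add, add_apply]
  rw [hg.fderiv_eq hy]
  ring

omit hg hy [FiniteDimensional ℝ E] in
theorem _root_.hasDerivAt_bilin {F : Type*} [NormedAddCommGroup F] [NormedSpace ℝ F]
    {B : E → E →L[ℝ] E →L[ℝ] F} {x X Y : ℝ → E} {x' X' Y' : E} {t : ℝ}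
    (hB : DifferentiableAt ℝ B (x t))
    (hx : HasDerivAt x x' t) (hX : HasDerivAt X X' t) (hY : HasDerivAt Y Y' t) :
    HasDerivAt (fun t ↦ B (x t) (X t) (Y t))
      (fderiv ℝ B (x t) x' (X t) (Y t) + B (x t) X' (Y t) + B (x t) (X t) Y') t := by
  have h1 := (((hB.hasFDerivAt.comp_hasDerivAt t hx).clm_apply hX).clm_apply hY)
  refine h1.congr_deriv ?_
  simp [Function.comp]

/-- The first Bianchi identity. -/
theorem bianchi (u v w : E) : curv g y u v w + curv g y v w u + curv g y w u v = 0 := by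
  simp only [curv]
  rw [hg.fderiv_chris_symm hy u v w, hg.fderiv_chris_symm hy v u w, hg.fderiv_chris_symm hy w u v,
    hg.chris_symm hy u v, hg.chris_symm hy w v, hg.chris_symm hy w u]
  abel

/-- `R(u, v)` is skew-adjoint. -/
theorem curv_skew (u v w z : E) : g y (curv g y u v w) z + g y w (curv g y u v z) = 0 := by
  -- Both mixed second derivatives of `g(w, z)` are computed from compatibility with the metric.
  have key (a b : E) : fderiv ℝ (fderiv ℝ g) y a b w z =
      g y (fderiv ℝ (chris g) y a b w + chris g y a (chris g y b w)) z
      + g y (chris g y b w) (chris g y a z)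
      + (g y (chris g y a w) (chris g y b z)
      + g y w (fderiv ℝ (chris g) y a b z + chris g y a (chris g y b z))) := by
    have hx : HasDerivAt (fun t : ℝ ↦ y + t • a) a 0 := by
      simpa using ((hasDerivAt_id (0 : ℝ)).smul_const a).const_add y
    have hx0 : y + (0 : ℝ) • a = y := by simp
    have hd : DifferentiableAt ℝ (fderiv ℝ g) y :=
      ((hg.contDiffAt hy).fderiv_right (m := 1) (by norm_cast)).differentiableAt (by simp)
    have h1 : HasDerivAt (fun t : ℝ ↦ fderiv ℝ g (y + t • a) b w z)
        (fderiv ℝ (fderiv ℝ g) y a b w z) 0 := by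
      have hd' : HasFDerivAt (fderiv ℝ g) (fderiv ℝ (fderiv ℝ g) y) (y + (0 : ℝ) • a) := by
        rw [hx0]; exact hd.hasFDerivAt
      have := (((hd'.comp_hasDerivAt (0 : ℝ) hx).clm_apply (hasDerivAt_const 0 b)).clm_apply
        (hasDerivAt_const 0 w)).clm_apply (hasDerivAt_const 0 z)
      refine this.congr_deriv ?_
      simp
    have hc (w : E) : HasDerivAt (fun t : ℝ ↦ chris g (y + t • a) b w)
        (fderiv ℝ (chris g) y a b w) 0 := by
      have hd' : DifferentiableAt ℝ (chris g) (y + (0 : ℝ) • a) := by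
        rw [hx0]; exact hg.differentiableAt_chris hy
      have := hasDerivAt_bilin hd' hx (hasDerivAt_const 0 b) (hasDerivAt_const 0 w)
      simpa using this
    have h2 := (hg.hasDerivAt_apply hy hx0 hx (hc w) (hasDerivAt_const 0 z)).add
      (hg.hasDerivAt_apply hy hx0 hx (hasDerivAt_const 0 w) (hc z))
    have h3 : (fun t : ℝ ↦ fderiv ℝ g (y + t • a) b w z) =ᶠ[nhds 0]
        fun t ↦ g (y + t • a) (chris g (y + t • a) b w) z
          + g (y + t • a) w (chris g (y + t • a) b z) := by
      have : ∀ᶠ t : ℝ in nhds 0, y + t • a ∈ U :=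
        hx.continuousAt.eventually (by beta_reduce; rw [hx0]; exact hg.mem_nhds hy)
      filter_upwards [this] with t ht using hg.fderiv_eq ht b w z
    have h4 := h1.unique (h2.congr_of_eventuallyEq h3)
    rw [h4]
    simp only [hx0, zero_add]
  have hs : fderiv ℝ (fderiv ℝ g) y u v = fderiv ℝ (fderiv ℝ g) y v u := by
    have : IsSymmSndFDerivAt ℝ g y := (hg.contDiffAt hy).isSymmSndFDerivAt (by simp; norm_cast)
    exact this u v
  have h1 := key u v
  rw [hs, key v u] at h1
  simp only [curv, map_sub, map_add, sub_apply, add_apply] at h1 ⊢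
  linarith

/-- The pair symmetry of the curvature tensor. -/
theorem curv_pair (u v w z : E) : g y (curv g y u v w) z = g y (curv g y w z u) v := by
  have sk (a b c d : E) : g y (curv g y a b c) d = - g y (curv g y a b d) c := by
    have := hg.curv_skew hy a b c d
    rw [hg.symm y hy c] at this
    linarith
  have sw (a b c d : E) : g y (curv g y a b c) d = - g y (curv g y b a c) d := by
    rw [curv_swap]; simp
  have bi (a b c d : E) : g y (curv g y a b c) d + g y (curv g y b c a) d
      + g y (curv g y c a b) d = 0 := by
    have := congrArg (fun z ↦ g y z d) (hg.bianchi hy a b c)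
    simpa using this
  have h1 := bi u v w z
  have h2 := bi v w z u
  have h3 := bi w z u v
  have h4 := bi z u v w
  linarith [sk u v w z, sk v w u z, sk w u v z, sk v w z u, sk w z v u, sk z v w u, sk w z u v,
    sk z u w v, sk u w z v, sk z u v w, sk u v z w, sk v z u w, sw u v w z, sw v w u z, sw w u v z,
    sw v w z u, sw w z v u, sw z v w u, sw w z u v,
    sw z u w v, sw u w z v, sw z u v w, sw u v z w, sw v z u w]

end IsMetricOn

end LocalMetric

/-! ### Local isometries -/

section Isometry

variable {E : Type*} [NormedAddCommGroup E] [NormedSpace ℝ E]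

/-- `ψ` is a smooth map on the open set `N` which pulls the metric `g` back to `g'`. -/
structure IsIsomOn (ψ : E → E) (g' g : E → E →L[ℝ] E →L[ℝ] ℝ) (N : Set E) : Prop where
  isOpen : IsOpen N
  contDiffOn : ContDiffOn ℝ ∞ ψ N
  apply : ∀ y ∈ N, ∀ u v, g' y u v = g (ψ y) (fderiv ℝ ψ y u) (fderiv ℝ ψ y v)

theorem hasDerivAt_line (y w : E) : HasDerivAt (fun t : ℝ ↦ y + t • w) w 0 := by
  simpa using ((hasDerivAt_id (0 : ℝ)).smul_const w).const_add y

theorem hasDerivAt_comp_line {F : Type*} [NormedAddCommGroup F] [NormedSpace ℝ F] {f : E → F}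
    {y : E} (hf : DifferentiableAt ℝ f y) (w : E) :
    HasDerivAt (fun t : ℝ ↦ f (y + t • w)) (fderiv ℝ f y w) 0 := by
  have h : HasFDerivAt f (fderiv ℝ f y) (y + (0 : ℝ) • w) := by simpa using hf.hasFDerivAt
  exact h.comp_hasDerivAt (0 : ℝ) (hasDerivAt_line y w)

theorem eventually_line {N : Set E} (hN : IsOpen N) {y : E} (hy : y ∈ N) (w : E) :
    ∀ᶠ t : ℝ in nhds 0, y + t • w ∈ N :=
  (hasDerivAt_line y w).continuousAt.eventually (by simpa using hN.mem_nhds hy)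

namespace IsIsomOn

variable {ψ : E → E} {g' g : E → E →L[ℝ] E →L[ℝ] ℝ} {N U : Set E} (h : IsIsomOn ψ g' g N)
  (hg' : IsMetricOn g' N) (hg : IsMetricOn g U) (hm : MapsTo ψ N U) {y : E} (hy : y ∈ N)
include h hy

theorem contDiffAt : ContDiffAt ℝ ∞ ψ y := h.contDiffOn.contDiffAt (h.isOpen.mem_nhds hy)

theorem contDiffAt_fderiv : ContDiffAt ℝ ∞ (fderiv ℝ ψ) y :=
  (h.contDiffAt hy).fderiv_right (m := ∞) (by norm_cast)

theorem contDiffAt_fderiv₂ : ContDiffAt ℝ ∞ (fderiv ℝ (fderiv ℝ ψ)) y :=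
  (h.contDiffAt_fderiv hy).fderiv_right (m := ∞) (by norm_cast)

theorem differentiableAt : DifferentiableAt ℝ ψ y := (h.contDiffAt hy).differentiableAt (by simp)

theorem fderiv₂_symm (u v : E) :
    fderiv ℝ (fderiv ℝ ψ) y u v = fderiv ℝ (fderiv ℝ ψ) y v u := by
  have : IsSymmSndFDerivAt ℝ ψ y := (h.contDiffAt hy).isSymmSndFDerivAt (by simp; norm_cast)
  exact this u v

theorem fderiv₃_symm (u v : E) :
    fderiv ℝ (fderiv ℝ (fderiv ℝ ψ)) y u v = fderiv ℝ (fderiv ℝ (fderiv ℝ ψ)) y v u := by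
  have : IsSymmSndFDerivAt ℝ (fderiv ℝ ψ) y :=
    (h.contDiffAt_fderiv hy).isSymmSndFDerivAt (by simp; norm_cast)
  exact this u v

theorem hasDerivAt_fderiv_line (u w : E) :
    HasDerivAt (fun t : ℝ ↦ fderiv ℝ ψ (y + t • w) u) (fderiv ℝ (fderiv ℝ ψ) y w u) 0 := by
  have := (hasDerivAt_comp_line ((h.contDiffAt_fderiv hy).differentiableAt (by simp)) w).clm_apply
    (hasDerivAt_const 0 u)
  simpa using this

include hg' in
theorem fderiv_injective : Function.Injective (fderiv ℝ ψ y) := by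
  refine (injective_iff_map_eq_zero _).2 fun u hu ↦ ?_
  have := h.apply y hy u u
  rw [hu] at this
  exact hg'.eq_zero_of_apply_self hy (by simpa using this)

variable [FiniteDimensional ℝ E]

include hg' in
theorem fderiv_surjective : Function.Surjective (fderiv ℝ ψ y) :=
  (LinearMap.injective_iff_surjective (f := (fderiv ℝ ψ y : E →ₗ[ℝ] E))).1
    (h.fderiv_injective hg' hy)

omit [FiniteDimensional ℝ E] in
include hg' hg hm in
theorem fderiv_metric (w u v : E) : fderiv ℝ g' y w u v =
    fderiv ℝ g (ψ y) (fderiv ℝ ψ y w) (fderiv ℝ ψ y u) (fderiv ℝ ψ y v)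
      + g (ψ y) (fderiv ℝ (fderiv ℝ ψ) y w u) (fderiv ℝ ψ y v)
      + g (ψ y) (fderiv ℝ ψ y u) (fderiv ℝ (fderiv ℝ ψ) y w v) := by
  have hd' : DifferentiableAt ℝ g' y := hg'.differentiableAt hy
  have h1 : HasDerivAt (fun t : ℝ ↦ g' (y + t • w) u v) (fderiv ℝ g' y w u v) 0 := by
    have := ((hasDerivAt_comp_line hd' w).clm_apply (hasDerivAt_const 0 u)).clm_apply
      (hasDerivAt_const 0 v)
    simpa using this
  have h0 : y + (0 : ℝ) • w = y := by simp
  have h2 := hasDerivAt_bilin (x := fun t : ℝ ↦ ψ (y + t • w)) (t := 0)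
    (by simpa using hg.differentiableAt (hm hy))
    (hasDerivAt_comp_line (h.differentiableAt hy) w) (h.hasDerivAt_fderiv_line hy u w)
    (h.hasDerivAt_fderiv_line hy v w)
  have h3 : (fun t : ℝ ↦ g' (y + t • w) u v) =ᶠ[nhds 0] fun t ↦
      g (ψ (y + t • w)) (fderiv ℝ ψ (y + t • w) u) (fderiv ℝ ψ (y + t • w) v) := by
    filter_upwards [eventually_line h.isOpen hy w] with t ht using h.apply _ ht u v
  have h4 := h1.unique (h2.congr_of_eventuallyEq h3)
  simpa [h0] using h4

include hg' hg hm

/-- The transformation law of the Christoffel symbols. -/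
theorem fderiv_chris (u v : E) : fderiv ℝ ψ y (chris g' y u v) =
    chris g (ψ y) (fderiv ℝ ψ y u) (fderiv ℝ ψ y v) + fderiv ℝ (fderiv ℝ ψ) y u v := by
  refine hg.ext_of_apply (hm hy) fun z ↦ ?_
  obtain ⟨w, rfl⟩ := h.fderiv_surjective hg' hy z
  rw [← h.apply y hy, hg'.apply_chris hy, koszulForm_apply, map_add,
    add_apply, hg.apply_chris (hm hy), koszulForm_apply]
  simp only [h.fderiv_metric hg' hg hm hy]
  rw [hg.symm _ (hm hy) (fderiv ℝ ψ y v), hg.symm _ (hm hy) (fderiv ℝ ψ y u)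
    (fderiv ℝ (fderiv ℝ ψ) y v w), hg.symm _ (hm hy) (fderiv ℝ ψ y u)
    (fderiv ℝ (fderiv ℝ ψ) y w v), h.fderiv₂_symm hy v u, h.fderiv₂_symm hy w u, h.fderiv₂_symm hy w v]
  ring

/-- Naturality of the curvature. -/
theorem fderiv_curv (u v w : E) : fderiv ℝ ψ y (curv g' y u v w) =
    curv g (ψ y) (fderiv ℝ ψ y u) (fderiv ℝ ψ y v) (fderiv ℝ ψ y w) := by
  have h0 (u : E) : y + (0 : ℝ) • u = y := by simp
  have key (u v w : E) :
      fderiv ℝ (fderiv ℝ ψ) y u (chris g' y v w) + fderiv ℝ ψ y (fderiv ℝ (chris g') y u v w) =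
        fderiv ℝ (chris g) (ψ y) (fderiv ℝ ψ y u) (fderiv ℝ ψ y v) (fderiv ℝ ψ y w)
        + chris g (ψ y) (fderiv ℝ (fderiv ℝ ψ) y u v) (fderiv ℝ ψ y w)
        + chris g (ψ y) (fderiv ℝ ψ y v) (fderiv ℝ (fderiv ℝ ψ) y u w)
        + fderiv ℝ (fderiv ℝ (fderiv ℝ ψ)) y u v w := by
    have a1 : HasDerivAt (fun t : ℝ ↦ chris g' (y + t • u) v w)
        (fderiv ℝ (chris g') y u v w) 0 := by
      have := ((hasDerivAt_comp_line (hg'.differentiableAt_chris hy) u).clm_apply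
        (hasDerivAt_const 0 v)).clm_apply (hasDerivAt_const 0 w)
      simpa using this
    have a2 := (hasDerivAt_comp_line ((h.contDiffAt_fderiv hy).differentiableAt (by simp))
      u).clm_apply a1
    have b1 := hasDerivAt_bilin (x := fun t : ℝ ↦ ψ (y + t • u)) (t := 0) (B := chris g)
      (by simpa using hg.differentiableAt_chris (hm hy))
      (hasDerivAt_comp_line (h.differentiableAt hy) u) (h.hasDerivAt_fderiv_line hy v u)
      (h.hasDerivAt_fderiv_line hy w u)
    have b2 : HasDerivAt (fun t : ℝ ↦ fderiv ℝ (fderiv ℝ ψ) (y + t • u) v w)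
        (fderiv ℝ (fderiv ℝ (fderiv ℝ ψ)) y u v w) 0 := by
      have := ((hasDerivAt_comp_line ((h.contDiffAt_fderiv₂ hy).differentiableAt (by simp))
        u).clm_apply (hasDerivAt_const 0 v)).clm_apply (hasDerivAt_const 0 w)
      simpa using this
    have h3 : (fun t : ℝ ↦ fderiv ℝ ψ (y + t • u) (chris g' (y + t • u) v w)) =ᶠ[nhds 0]
        (fun t ↦ chris g (ψ (y + t • u)) (fderiv ℝ ψ (y + t • u) v) (fderiv ℝ ψ (y + t • u) w))
        + fun t ↦ fderiv ℝ (fderiv ℝ ψ) (y + t • u) v w := by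
      filter_upwards [eventually_line h.isOpen hy u] with t ht
      exact h.fderiv_chris hg' hg hm ht v w
    have h4 := a2.unique ((b1.add b2).congr_of_eventuallyEq h3)
    simpa [h0] using h4
  have k1 := eq_sub_of_add_eq' (key u v w)
  have k2 := eq_sub_of_add_eq' (key v u w)
  simp only [curv, map_sub, map_add, h.fderiv_chris hg' hg hm hy, k1, k2]
  rw [h.fderiv₂_symm hy v u, h.fderiv₃_symm hy v u]
  abel

theorem apply_curv (u v w z : E) : g' y (curv g' y u v w) z =
    g (ψ y) (curv g (ψ y) (fderiv ℝ ψ y u) (fderiv ℝ ψ y v) (fderiv ℝ ψ y w)) (fderiv ℝ ψ y z) := by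
  rw [h.apply y hy, h.fderiv_curv hg' hg hm hy]

/-- Naturality of the covariant acceleration. -/
theorem accel_comp {x : ℝ → E} {t : ℝ} (hx : ContDiffAt ℝ 2 x t) (hxt : x t = y) :
    accel g (ψ ∘ x) t = fderiv ℝ ψ y (accel g' x t) := by
  subst hxt
  have hx1 : ∀ᶠ s in nhds t, DifferentiableAt ℝ x s :=
    (hx.eventually (by simp)).mono fun s hs ↦ hs.differentiableAt (by simp)
  have hxN : ∀ᶠ s in nhds t, x s ∈ N := hx.continuousAt.eventually (h.isOpen.mem_nhds hy)
  have hx2 : DifferentiableAt ℝ (deriv x) t := by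
    have : ContDiffAt ℝ 1 (deriv x) t := by
      have h1 : ContDiffAt ℝ 1 (fderiv ℝ x) t := hx.fderiv_right (m := 1) (by norm_num)
      exact h1.clm_apply contDiffAt_const
    exact this.differentiableAt (by simp)
  have e1 : deriv (ψ ∘ x) =ᶠ[nhds t] fun s ↦ fderiv ℝ ψ (x s) (deriv x s) := by
    filter_upwards [hx1, hxN] with s hs hsN
    exact ((h.differentiableAt hsN).hasFDerivAt.comp_hasDerivAt s hs.hasDerivAt).deriv
  have e2 : HasDerivAt (deriv (ψ ∘ x)) (fderiv ℝ (fderiv ℝ ψ) (x t) (deriv x t) (deriv x t)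
      + fderiv ℝ ψ (x t) (deriv (deriv x) t)) t := by
    refine HasDerivAt.congr_of_eventuallyEq ?_ e1
    exact (((h.contDiffAt_fderiv hy).differentiableAt (by simp)).hasFDerivAt.comp_hasDerivAt t
      hx1.self_of_nhds.hasDerivAt).clm_apply hx2.hasDerivAt
  simp only [accel]
  rw [e2.deriv, e1.self_of_nhds, map_add, h.fderiv_chris hg' hg hm hy]
  simp only [Function.comp]
  abel

omit hy in
theorem secLEOne (hs : SecLEOne g U) : SecLEOne g' N := by
  intro y hy u v
  rw [h.apply_curv hg' hg hm hy, h.apply y hy, h.apply y hy, h.apply y hy]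
  exact hs _ (hm hy) _ _

end IsIsomOn

end Isometry

/-! ### Smooth dependence of solutions of ordinary differential equations -/

section Flow

universe u

section Nemytskii

variable {K : Type*} [TopologicalSpace K] [CompactSpace K]
  {E F : Type u} [NormedAddCommGroup E] [NormedSpace ℝ E] [NormedAddCommGroup F] [NormedSpace ℝ F]

noncomputable instance instNormedGroupContinuousMapClm : NormedAddCommGroup C(K, E →L[ℝ] F) :=
  ContinuousMap.instNormedAddCommGroup
noncomputable instance instSeminormedGroupContinuousMapClm :
    SeminormedAddCommGroup C(K, E →L[ℝ] F) :=
  instNormedGroupContinuousMapClm.toSeminormedAddCommGroup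
noncomputable instance instPseudoMetricContinuousMapClm : PseudoMetricSpace C(K, E →L[ℝ] F) :=
  instNormedGroupContinuousMapClm.toPseudoMetricSpace
noncomputable instance instNormedSpaceContinuousMapClm : NormedSpace ℝ C(K, E →L[ℝ] F) :=
  ContinuousMap.normedSpace

/-- The pointwise application of a family of linear maps to a family of vectors. -/
noncomputable def pointwiseApply (K : Type*) [TopologicalSpace K] [CompactSpace K] (E F : Type u)
    [NormedAddCommGroup E] [NormedSpace ℝ E] [NormedAddCommGroup F] [NormedSpace ℝ F] :
    C(K, E →L[ℝ] F) →L[ℝ] C(K, E) →L[ℝ] C(K, F) :=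
  LinearMap.mkContinuous₂
    (LinearMap.mk₂ ℝ (fun (A : C(K, E →L[ℝ] F)) (β : C(K, E)) ↦
      (⟨fun k ↦ A k (β k), A.continuous.clm_apply β.continuous⟩ : C(K, F)))
      (fun _ _ _ ↦ by ext; simp) (fun _ _ _ ↦ by ext; simp)
      (fun _ _ _ ↦ by ext; simp) (fun _ _ _ ↦ by ext; simp)) 1
    (fun A β ↦ by
      rw [one_mul]
      refine (ContinuousMap.norm_le _ (by positivity)).2 fun k ↦ ?_
      exact (A k).le_of_opNorm_le_of_le (A.norm_coe_le_norm k) (β.norm_coe_le_norm k))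

/-- Composition with a `C¹` map is differentiable on spaces of continuous functions. -/
theorem hasFDerivAt_comp_continuousMap {f : E → F} {f' : E → E →L[ℝ] F}
    (hf : ∀ y, HasFDerivAt f (f' y) y) (hc : Continuous f) (hc' : Continuous f') (α : C(K, E)) :
    HasFDerivAt (fun α : C(K, E) ↦ (⟨f, hc⟩ : C(E, F)).comp α)
      (pointwiseApply K E F ((⟨f', hc'⟩ : C(E, E →L[ℝ] F)).comp α)) α := by
  rw [hasFDerivAt_iff_isLittleO_nhds_zero, Asymptotics.isLittleO_iff]
  intro ε hε
  have hcont : Continuous fun α : C(K, E) ↦ (⟨f', hc'⟩ : C(E, E →L[ℝ] F)).comp α :=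
    ContinuousMap.continuous_postcomp _
  obtain ⟨δ, hδ, hδ'⟩ := Metric.continuous_iff.1 hcont α ε hε
  filter_upwards [Metric.ball_mem_nhds (0 : C(K, E)) hδ] with β hβ
  refine (ContinuousMap.norm_le _ (by positivity)).2 fun k ↦ ?_
  have key : ∀ x ∈ segment ℝ (α k) (α k + β k), ‖f' x - f' (α k)‖ ≤ ε := by
    intro x hx
    rw [segment_eq_image'] at hx
    obtain ⟨s, hs, rfl⟩ := hx
    have h1 : dist (α + s • β) α < δ := by
      rw [dist_eq_norm, add_sub_cancel_left, norm_smul, Real.norm_eq_abs, abs_of_nonneg hs.1]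
      have : ‖β‖ < δ := by simpa using hβ
      nlinarith [norm_nonneg β, hs.2]
    have h2 := (ContinuousMap.dist_apply_le_dist k).trans (hδ' _ h1).le
    rw [dist_eq_norm] at h2
    simpa using h2
  have := (convex_segment (α k) (α k + β k)).norm_image_sub_le_of_norm_hasFDerivWithin_le'
    (fun x _ ↦ (hf x).hasFDerivWithinAt) key (left_mem_segment ℝ _ _) (right_mem_segment ℝ _ _)
  simp only [add_sub_cancel_left] at this
  refine this.trans ?_
  gcongr
  exact β.norm_coe_le_norm k

theorem contDiff_comp_continuousMap (n : ℕ) : ∀ {F : Type u} [NormedAddCommGroup F]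
    [NormedSpace ℝ F] {f : E → F} (hf : ContDiff ℝ n f),
    ContDiff ℝ n (fun α : C(K, E) ↦ (⟨f, hf.continuous⟩ : C(E, F)).comp α) := by
  induction n with
  | zero =>
    intro F _ _ f hf
    exact contDiff_zero.2 (ContinuousMap.continuous_postcomp _)
  | succ n ih =>
    intro F _ _ f hf
    have h1 : ContDiff ℝ n (fderiv ℝ f) := hf.fderiv_right (by norm_cast)
    have hd := hasFDerivAt_comp_continuousMap (K := K)
      (fun y ↦ (hf.differentiable (by simp) y).hasFDerivAt) hf.continuous h1.continuous
    push_cast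
    rw [contDiff_succ_iff_fderiv]
    refine ⟨fun α ↦ (hd α).differentiableAt, by simp, ?_⟩
    have : fderiv ℝ (fun α : C(K, E) ↦ (⟨f, hf.continuous⟩ : C(E, F)).comp α) =
        fun α ↦ pointwiseApply K E F ((⟨fderiv ℝ f, h1.continuous⟩ : C(E, E →L[ℝ] F)).comp α) :=
      funext fun α ↦ (hd α).fderiv
    rw [this]
    exact (pointwiseApply K E F).contDiff.comp (ih h1)

end Nemytskii

variable {E : Type u} [NormedAddCommGroup E] [NormedSpace ℝ E] [CompleteSpace E]

/-- The primitive vanishing at `0` of a continuous function on `[-1, 1]`. -/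
noncomputable def primitiveCLM (E : Type u) [NormedAddCommGroup E] [NormedSpace ℝ E]
    [CompleteSpace E] : C(Icc (-1 : ℝ) 1, E) →L[ℝ] C(Icc (-1 : ℝ) 1, E) :=
  LinearMap.mkContinuous
    { toFun := fun β ↦ ⟨fun s ↦ ∫ σ in (0 : ℝ)..s, β (projIcc (-1) 1 (by norm_num) σ), by
        have hc : Continuous fun σ : ℝ ↦ β (projIcc (-1) 1 (by norm_num) σ) :=
          β.continuous.comp continuous_projIcc
        exact (intervalIntegral.continuous_primitive
          (fun a b ↦ hc.intervalIntegrable a b) 0).comp continuous_subtype_val⟩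
      map_add' := fun β γ ↦ by
        ext s
        have hc (β : C(Icc (-1 : ℝ) 1, E)) :
            Continuous fun σ : ℝ ↦ β (projIcc (-1) 1 (by norm_num) σ) :=
          β.continuous.comp continuous_projIcc
        simp only [ContinuousMap.coe_mk, ContinuousMap.add_apply]
        exact intervalIntegral.integral_add ((hc β).intervalIntegrable _ _)
          ((hc γ).intervalIntegrable _ _)
      map_smul' := fun r β ↦ by
        ext s
        simp only [ContinuousMap.coe_mk, ContinuousMap.smul_apply, RingHom.id_apply]
        exact intervalIntegral.integral_smul r _ } 1
    (fun β ↦ by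
      rw [one_mul]
      refine (ContinuousMap.norm_le _ (by positivity)).2 fun s ↦ ?_
      have h1 := intervalIntegral.norm_integral_le_of_norm_le_const (a := (0 : ℝ)) (b := s)
        (f := fun σ ↦ β (projIcc (-1) 1 (by norm_num) σ)) (C := ‖β‖)
        (fun x _ ↦ β.norm_coe_le_norm _)
      refine h1.trans ?_
      have : |(s : ℝ) - 0| ≤ 1 := by rw [sub_zero]; exact abs_le.2 s.2
      exact mul_le_of_le_one_right (norm_nonneg _) this)

theorem primitiveCLM_apply (β : C(Icc (-1 : ℝ) 1, E)) (s : Icc (-1 : ℝ) 1) :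
    primitiveCLM E β s = ∫ σ in (0 : ℝ)..s, β (projIcc (-1) 1 (by norm_num) σ) := rfl

/-- Restriction of a curve on `[-1, 1]` to `[-s, s]`, rescaled to `[-1, 1]`. -/
noncomputable def rescale (s : Icc (-1 : ℝ) 1) (α : C(Icc (-1 : ℝ) 1, E)) : C(Icc (-1 : ℝ) 1, E) :=
  ⟨fun σ ↦ α ⟨s * σ, by
    have h1 := abs_le.2 s.2
    have h2 := abs_le.2 σ.2
    rw [mem_Icc, ← abs_le, abs_mul]
    exact mul_le_one₀ h1 (abs_nonneg _) h2⟩, by fun_prop⟩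

theorem primitiveCLM_rescale (s : Icc (-1 : ℝ) 1) (β : C(Icc (-1 : ℝ) 1, E)) :
    (s : ℝ) • primitiveCLM E (rescale s β) = rescale s (primitiveCLM E β) := by
  ext σ
  have h2 := abs_le.2 σ.2
  have h1 := abs_le.2 s.2
  simp only [ContinuousMap.smul_apply, primitiveCLM_apply, rescale, ContinuousMap.coe_mk]
  rw [← mul_zero (s : ℝ), ← intervalIntegral.smul_integral_comp_mul_left, mul_zero]
  congr 1
  refine intervalIntegral.integral_congr fun x hx ↦ ?_
  have hx1 : |x| ≤ 1 := by
    have := abs_sub_left_of_mem_uIcc hx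
    simp only [sub_zero] at this
    linarith
  have hsx : |(s : ℝ) * x| ≤ 1 := by
    rw [abs_mul]; exact mul_le_one₀ h1 (abs_nonneg _) hx1
  rw [projIcc_of_mem _ (abs_le.1 hx1), projIcc_of_mem _ (abs_le.1 hsx)]

/-- A smooth vector field has a local flow which is smooth jointly in the time and the initial
value. The flow is obtained from the implicit function theorem, applied to the integral equation
`α(σ) = x + τ ∫₀^σ f(α)` for curves `α` on `[-1, 1]`: the solution at `σ = 1` is the flow at
time `τ`. -/
theorem exists_contDiffOn_flow {f : E → E} (hf : ContDiff ℝ ∞ f) (x₀ : E) :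
    ∃ ε > 0, ∃ Φ : E × ℝ → E,
      ContDiffOn ℝ ∞ Φ (Metric.ball x₀ ε ×ˢ Ioo (-ε) ε) ∧
      ∀ x ∈ Metric.ball x₀ ε, Φ (x, 0) = x ∧
        ∀ t ∈ Ioo (-ε) ε, HasDerivAt (fun t ↦ Φ (x, t)) (f (Φ (x, t))) t := by
  set X := C(Icc (-1 : ℝ) 1, E) with hX
  let Nf : X → X := fun α ↦ (⟨f, hf.continuous⟩ : C(E, E)).comp α
  have hNf : ContDiff ℝ ∞ Nf := contDiff_infty.2 fun k ↦
    contDiff_comp_continuousMap k (hf.of_le (by exact_mod_cast le_top))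
  let G : (E × ℝ) × X → X := fun z ↦
    z.2 - ContinuousLinearMap.const ℝ (Icc (-1 : ℝ) 1) z.1.1 - z.1.2 • primitiveCLM E (Nf z.2)
  have hG : ContDiff ℝ ∞ G := by
    refine (contDiff_snd.sub ?_).sub ?_
    · have hconst := ContinuousLinearMap.contDiff (𝕜 := ℝ) (n := ∞) (E := E)
        (F := C(Icc (-1 : ℝ) 1, E)) (ContinuousLinearMap.const ℝ (Icc (-1 : ℝ) 1))
      exact hconst.comp (contDiff_fst.comp contDiff_fst)
    · exact (contDiff_snd.comp contDiff_fst).smul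
        ((primitiveCLM E).contDiff.comp (hNf.comp contDiff_snd))
  let α₀ : X := ContinuousLinearMap.const ℝ (Icc (-1 : ℝ) 1) x₀
  have hG0 : G ((x₀, 0), α₀) = 0 := by simp [G, α₀]
  -- The partial derivative in the curve is the identity at time `0`, hence invertible nearby.
  have hinv0 : (fderiv ℝ G ((x₀, 0), α₀) ∘L .inr ℝ (E × ℝ) X).IsInvertible := by
    have h1 : HasFDerivAt (fun α : X ↦ G ((x₀, 0), α))
        (fderiv ℝ G ((x₀, 0), α₀) ∘L .inr ℝ (E × ℝ) X) α₀ :=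
      ((hG.differentiable (by simp)) _).hasFDerivAt.comp α₀ (hasFDerivAt_prodMk_right _ _)
    have h2 : HasFDerivAt (fun α : X ↦ G ((x₀, 0), α)) (ContinuousLinearMap.id ℝ X) α₀ := by
      have : (fun α : X ↦ G ((x₀, 0), α)) = fun α ↦ α - α₀ := by
        ext α; simp [G, α₀]
      rw [this]
      exact (hasFDerivAt_id α₀).sub_const α₀
    rw [h1.unique h2]
    exact ⟨ContinuousLinearEquiv.refl ℝ X, rfl⟩
  have hinv : ∀ᶠ z in nhds ((x₀, (0 : ℝ)), α₀),
      (fderiv ℝ G z ∘L .inr ℝ (E × ℝ) X).IsInvertible := by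
    have hc : Continuous fun z ↦ fderiv ℝ G z ∘L .inr ℝ (E × ℝ) X :=
      (hG.continuous_fderiv (by simp)).clm_comp continuous_const
    obtain ⟨e, he⟩ := hinv0
    have h1 : {L : X →L[ℝ] X | L.IsInvertible} ∈
        nhds (fderiv ℝ G ((x₀, 0), α₀) ∘L .inr ℝ (E × ℝ) X) := by
      rw [← he]; exact ContinuousLinearEquiv.nhds e
    exact (hc.continuousAt (x := ((x₀, (0 : ℝ)), α₀))).eventually h1
  have cd (z) : ContDiffAt ℝ ∞ G z := hG.contDiffAt
  let A := (cd ((x₀, 0), α₀)).implicitFunction (by simp) hinv0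
  have hA0 : A (x₀, 0) = α₀ := (cd ((x₀, 0), α₀)).implicitFunction_apply_self (by simp) hinv0
  have hAc : ContinuousAt A (x₀, 0) :=
    ((cd ((x₀, 0), α₀)).contDiffAt_implicitFunction (by simp) hinv0).continuousAt
  -- Near `(x₀, 0)` the implicit function solves the equation, and its solutions are unique.
  have e1 : ∀ᶠ p in nhds (x₀, (0 : ℝ)), G (p, A p) = 0 := by
    have := (cd ((x₀, 0), α₀)).eventually_apply_implicitFunction (by simp) hinv0
    rwa [hG0] at this
  have e1' : ∀ᶠ p in nhds (x₀, (0 : ℝ)), ContinuousAt A p := by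
    have : ContDiffAt ℝ 1 A (x₀, 0) :=
      ((cd ((x₀, 0), α₀)).contDiffAt_implicitFunction (by simp) hinv0).of_le (by simp)
    filter_upwards [this.eventually (by simp)] with p hp using hp.continuousAt
  have e2 : ∀ᶠ v in nhds ((x₀, (0 : ℝ)), α₀), G v = 0 ↔ A v.1 = v.2 := by
    have := (cd ((x₀, 0), α₀)).eventually_apply_eq_iff_implicitFunction (by simp) hinv0
    rwa [hG0] at this
  have hpair : Filter.Tendsto (fun p ↦ (p, A p)) (nhds (x₀, (0 : ℝ)))
      (nhds ((x₀, (0 : ℝ)), α₀)) := by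
    have : ContinuousAt (fun p ↦ (p, A p)) (x₀, (0 : ℝ)) := continuousAt_id.prodMk hAc
    rw [← hA0]; exact this
  -- The implicit function theorem gives smoothness of `A` at `(x₀, 0)` only. At nearby points it is
  -- applied again; by uniqueness the implicit function obtained there is `A`.
  have e3 : ∀ᶠ p in nhds (x₀, (0 : ℝ)), ContDiffAt ℝ ∞ A p := by
    filter_upwards [e1.eventually_nhds, e1', hpair.eventually hinv] with p hp hpc hpi
    have hz : G (p, A p) = 0 := hp.self_of_nhds
    have h1 := (cd (p, A p)).contDiffAt_implicitFunction (by simp) hpi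
    refine h1.congr_of_eventuallyEq ?_
    have h2 := (cd (p, A p)).eventually_apply_eq_iff_implicitFunction (by simp) hpi
    rw [hz] at h2
    have h3 : ContinuousAt (fun q ↦ (q, A q)) p := continuousAt_id.prodMk hpc
    filter_upwards [hp, h3.eventually h2] with q hq hq2
    exact (hq2.1 hq).symm
  obtain ⟨r, hr, hr2⟩ := Metric.eventually_nhds_iff_ball.1 e2
  have e4 : ∀ᶠ p in nhds (x₀, (0 : ℝ)), ‖A p - α₀‖ < r := by
    have := hAc.eventually (Metric.ball_mem_nhds _ hr)
    rw [hA0] at this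
    filter_upwards [this] with p hp
    rw [← dist_eq_norm]; exact hp
  obtain ⟨ε', hε', hε2⟩ := Metric.eventually_nhds_iff_ball.1 (e1.and (e3.and e4))
  set ε := min ε' r with hε
  have hε0 : 0 < ε := lt_min hε' hr
  have hgood : ∀ x ∈ Metric.ball x₀ ε, ∀ t ∈ Ioo (-ε) ε,
      G ((x, t), A (x, t)) = 0 ∧ ContDiffAt ℝ ∞ A (x, t) ∧ ‖A (x, t) - α₀‖ < r := by
    intro x hx t ht
    refine hε2 _ ?_
    rw [← ball_prod_same]
    refine ⟨Metric.ball_subset_ball (min_le_left _ _) hx, ?_⟩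
    rw [Metric.mem_ball, Real.dist_eq, sub_zero]
    exact (abs_lt.2 ht).trans_le (min_le_left _ _)
  -- By uniqueness, the solutions for different times are restrictions of each other.
  have hscale : ∀ x ∈ Metric.ball x₀ ε, ∀ τ ∈ Ioo 0 ε, ∀ s : Icc (-1 : ℝ) 1,
      A (x, s * τ) = rescale s (A (x, τ)) := by
    intro x hx τ hτ s
    obtain ⟨h1, -, h3⟩ := hgood x hx τ ⟨by linarith [hτ.1], hτ.2⟩
    set α := A (x, τ)
    have hs := abs_le.2 s.2
    have hmem : ((x, (s : ℝ) * τ), rescale s α) ∈ Metric.ball ((x₀, (0 : ℝ)), α₀) r := by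
      rw [← ball_prod_same, ← ball_prod_same]
      refine ⟨⟨Metric.ball_subset_ball (min_le_right _ _) hx, ?_⟩, ?_⟩
      · rw [Metric.mem_ball, Real.dist_eq, sub_zero, abs_mul, abs_of_pos hτ.1]
        have : τ < r := hτ.2.trans_le (min_le_right _ _)
        nlinarith [hτ.1, abs_nonneg (s : ℝ)]
      · rw [Metric.mem_ball, dist_eq_norm]
        refine lt_of_le_of_lt ?_ h3
        refine (ContinuousMap.norm_le _ (norm_nonneg _)).2 fun σ ↦ ?_
        exact (α - α₀).norm_coe_le_norm _
    refine (hr2 _ hmem).1 ?_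
    have h4 : α - ContinuousLinearMap.const ℝ (Icc (-1 : ℝ) 1) x - τ • primitiveCLM E (Nf α) = 0 :=
      h1
    have h5 : rescale s α - ContinuousLinearMap.const ℝ (Icc (-1 : ℝ) 1) x
        - τ • rescale s (primitiveCLM E (Nf α)) = 0 := by
      ext σ
      exact congrArg (fun β : X ↦ rescale s β σ) h4
    rw [← primitiveCLM_rescale, smul_smul, mul_comm] at h5
    exact h5
  refine ⟨ε, hε0, fun p ↦ A p ⟨1, by norm_num⟩, ?_, fun x hx ↦ ⟨?_, fun t ht ↦ ?_⟩⟩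
  · rintro ⟨x, t⟩ ⟨hx, ht⟩
    exact ((ContinuousMap.evalCLM ℝ (⟨1, by norm_num⟩ : Icc (-1 : ℝ) 1)).contDiff.contDiffAt.comp _
      (hgood x hx t ht).2.1).contDiffWithinAt
  · have := (hgood x hx 0 ⟨by linarith, hε0⟩).1
    have h2 : A (x, 0) = ContinuousLinearMap.const ℝ (Icc (-1 : ℝ) 1) x := by
      simpa [G, sub_eq_zero] using this
    change A (x, 0) _ = x
    rw [h2]; rfl
  · obtain ⟨τ, hτ1, hτ2⟩ := exists_between (abs_lt.2 ht)
    have hτ0 : 0 < τ := (abs_nonneg t).trans_lt hτ1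
    set α := A (x, τ) with hα
    have hΦ : ∀ t' : ℝ, |t'| < τ → A (x, t') ⟨1, by norm_num⟩ =
        α (projIcc (-1) 1 (by norm_num) (t' / τ)) := by
      intro t' ht'
      have hm : t' / τ ∈ Icc (-1 : ℝ) 1 := by
        rw [mem_Icc, ← abs_le, abs_div, abs_of_pos hτ0]
        exact (div_le_one hτ0).2 ht'.le
      have := hscale x hx τ ⟨hτ0, hτ2⟩ ⟨t' / τ, hm⟩
      rw [div_mul_cancel₀ _ hτ0.ne'] at this
      rw [this, projIcc_of_mem _ hm]
      exact congrArg α (Subtype.ext (mul_one _))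
    have hα1 : ∀ s : Icc (-1 : ℝ) 1, α s = x + τ • primitiveCLM E (Nf α) s := by
      intro s
      have h1 : α - ContinuousLinearMap.const ℝ (Icc (-1 : ℝ) 1) x
          - τ • primitiveCLM E (Nf α) = 0 := (hgood x hx τ ⟨by linarith, hτ2⟩).1
      have h2 : α s - x - τ • primitiveCLM E (Nf α) s = 0 := congrArg (fun β : X ↦ β s) h1
      rw [sub_sub, sub_eq_zero] at h2
      exact h2
    have hcont : Continuous fun σ : ℝ ↦ Nf α (projIcc (-1) 1 (by norm_num) σ) :=
      (Nf α).continuous.comp continuous_projIcc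
    have hder : HasDerivAt (fun t' : ℝ ↦ x + τ • ∫ σ in (0 : ℝ)..(t' / τ),
        Nf α (projIcc (-1) 1 (by norm_num) σ))
        (τ • ((1 / τ) • Nf α (projIcc (-1) 1 (by norm_num) (t / τ)))) t := by
      refine HasDerivAt.const_add x (HasDerivAt.const_smul τ ?_)
      exact HasDerivAt.scomp t (intervalIntegral.integral_hasDerivAt_right
        (hcont.intervalIntegrable _ _) (hcont.stronglyMeasurableAtFilter _ _) hcont.continuousAt)
        ((hasDerivAt_id t).div_const τ)
    rw [smul_smul, mul_one_div_cancel hτ0.ne', one_smul] at hder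
    have hval : f (A (x, t) ⟨1, by norm_num⟩) = Nf α (projIcc (-1) 1 (by norm_num) (t / τ)) := by
      rw [hΦ t hτ1]; rfl
    change HasDerivAt (fun t' ↦ A (x, t') ⟨1, by norm_num⟩) (f (A (x, t) ⟨1, by norm_num⟩)) t
    rw [hval]
    refine hder.congr_of_eventuallyEq ?_
    have : ∀ᶠ t' in nhds t, |t'| < τ := continuous_abs.continuousAt.eventually (gt_mem_nhds hτ1)
    filter_upwards [this] with t' ht'
    have hm : t' / τ ∈ Icc (-1 : ℝ) 1 := by
      rw [mem_Icc, ← abs_le, abs_div, abs_of_pos hτ0]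
      exact (div_le_one hτ0).2 ht'.le
    rw [hΦ t' ht', hα1, primitiveCLM_apply, projIcc_of_mem _ hm]

end Flow

/-! ### Comparison in geodesic normal coordinates -/

section Normal

variable {E : Type*} [NormedAddCommGroup E] [NormedSpace ℝ E]

/-- The metric `g` on the star-shaped set `U` is written in normal coordinates: the rays from the
origin are geodesics. -/
structure IsNormalMetric (g : E → E →L[ℝ] E →L[ℝ] ℝ) (U : Set E) : Prop where
  metric : IsMetricOn g U
  zero_mem : (0 : E) ∈ U
  star : ∀ y ∈ U, ∀ r ∈ Icc (0 : ℝ) 1, r • y ∈ U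
  radial : ∀ y ∈ U, chris g y y y = 0

/-- The covariant derivative at time `t` of the radial Jacobi field `t ↦ tX` along the ray
`t ↦ tw`. -/
noncomputable def jacobiDeriv (g : E → E →L[ℝ] E →L[ℝ] ℝ) (w X : E) (t : ℝ) : E :=
  X + chris g (t • w) w (t • X)

/-- The quantity `g(J', J) - cot t g(J, J)` for the radial Jacobi field `J = tX` along `t ↦ tw`. It
vanishes identically on the unit sphere. -/
noncomputable def radialDefect (g : E → E →L[ℝ] E →L[ℝ] ℝ) (w X : E) (t : ℝ) : ℝ :=
  g (t • w) (jacobiDeriv g w X t) (t • X)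
    - Real.cos t / Real.sin t * g (t • w) (t • X) (t • X)

theorem hasDerivAt_smul_const' (w : E) (t : ℝ) : HasDerivAt (fun t : ℝ ↦ t • w) w t := by
  simpa using (hasDerivAt_id t).smul_const w

namespace IsMetricOn

variable [FiniteDimensional ℝ E] {g : E → E →L[ℝ] E →L[ℝ] ℝ} {U : Set E} (hg : IsMetricOn g U)
include hg

/-- If a plane realizes the maximal sectional curvature `1`, then the curvature operator of one of
its vectors acts on the plane as on a space of constant curvature `1`. The reason is that the
quadratic form `Z ↦ |Z|²|J|² - g(Z, J)² - g(R(Z, J)J, Z)` attains its minimum `0` at `w`. -/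
theorem curv_eq_of_max (hs : SecLEOne g U) {y : E} (hy : y ∈ U) {J w : E}
    (h : g y (curv g y J w w) J = g y J J * g y w w - g y J w ^ 2) :
    curv g y w J J = g y J J • w - g y w J • J := by
  have sk (a b c d : E) : g y (curv g y a b c) d = - g y (curv g y a b d) c := by
    have := hg.curv_skew hy a b c d
    rw [hg.symm y hy c] at this
    linarith
  have sw (a b c d : E) : g y (curv g y a b c) d = - g y (curv g y b a c) d := by
    rw [curv_swap]; simp
  have hw : g y (curv g y w J J) w = g y w w * g y J J - g y w J ^ 2 := by
    rw [sw, sk, neg_neg, h, hg.symm y hy J w]; ring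
  have hadd (Z Z' : E) : curv g y (Z + Z') J J = curv g y Z J J + curv g y Z' J J := by
    simp only [curv, map_add, add_apply]; abel
  have hsmul (r : ℝ) (Z : E) : curv g y (r • Z) J J = r • curv g y Z J J := by
    simp only [curv, map_smul, smul_apply, smul_add, smul_sub]
  refine hg.ext_of_apply hy fun Z ↦ ?_
  have hZ : g y (curv g y Z J J) w = g y (curv g y w J J) Z := by
    rw [hg.curv_pair hy, sw, sk]; ring
  -- The quadratic form is nonnegative along `r ↦ w + r Z` and vanishes at `r = 0`, hence its linear
  -- coefficient vanishes.
  have key (r : ℝ) : 0 ≤ r * (2 * (g y w Z * g y J J - g y w J * g y Z J - g y (curv g y w J J) Z))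
      + r ^ 2 * (g y Z Z * g y J J - g y Z J ^ 2 - g y (curv g y Z J J) Z) := by
    have h1 := hs y hy (w + r • Z) J
    rw [hadd, hsmul] at h1
    simp only [map_add, map_smul, add_apply, smul_apply, smul_eq_mul] at h1
    rw [hw, hZ, hg.symm y hy Z w] at h1
    nlinarith [h1]
  set b := 2 * (g y w Z * g y J J - g y w J * g y Z J - g y (curv g y w J J) Z) with hb
  set c := g y Z Z * g y J J - g y Z J ^ 2 - g y (curv g y Z J J) Z with hc
  have hb0 : b = 0 := by
    have hc1 : 0 < 1 + |c| := by positivity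
    -- With this value of `r`, a nonzero `b` would make the expression negative.
    have h1 := key (-b / (1 + |c|))
    have h2 : -b / (1 + |c|) * b + (-b / (1 + |c|)) ^ 2 * c
        = b ^ 2 / (1 + |c|) ^ 2 * (c - (1 + |c|)) := by
      field_simp
      ring
    rw [h2] at h1
    have h3 : c - (1 + |c|) < 0 := by linarith [le_abs_self c]
    by_contra hne
    have h4 : 0 < b ^ 2 / (1 + |c|) ^ 2 := by positivity
    nlinarith
  rw [hg.symm y hy Z J] at hb
  simp only [map_sub, map_smul, sub_apply, smul_apply, smul_eq_mul]
  linarith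

end IsMetricOn

namespace IsNormalMetric

variable [FiniteDimensional ℝ E] {g : E → E →L[ℝ] E →L[ℝ] ℝ} {U : Set E} (h : IsNormalMetric g U)
include h

theorem radial_smul {w : E} {t : ℝ} (ht : t • w ∈ U) : chris g (t • w) w w = 0 := by
  -- For `t = 0` this follows by continuity.
  have hne {t : ℝ} (ht0 : t ≠ 0) (ht : t • w ∈ U) : chris g (t • w) w w = 0 := by
    have := h.radial _ ht
    simp only [map_smul, smul_apply, smul_smul] at this
    exact (smul_eq_zero.1 this).resolve_left (mul_ne_zero ht0 ht0)
  by_cases ht0 : t = 0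
  · subst ht0
    have hc : ContinuousAt (fun s : ℝ ↦ chris g (s • w) w w) 0 := by
      have h1 : ContinuousAt (chris g) ((0 : ℝ) • w) :=
        (h.metric.differentiableAt_chris ht).continuousAt
      have h2 : ContinuousAt (fun s : ℝ ↦ chris g (s • w)) 0 :=
        ContinuousAt.comp (f := fun s : ℝ ↦ s • w) h1 (hasDerivAt_smul_const' w 0).continuousAt
      exact (h2.clm_apply continuousAt_const).clm_apply continuousAt_const
    have h3 : ∀ᶠ s : ℝ in nhdsWithin 0 {0}ᶜ, chris g (s • w) w w = 0 := by
      have : ∀ᶠ s : ℝ in nhds 0, s • w ∈ U :=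
        (hasDerivAt_smul_const' w 0).continuousAt.eventually (h.metric.mem_nhds ht)
      filter_upwards [this.filter_mono nhdsWithin_le_nhds, self_mem_nhdsWithin] with s hs hs0
      exact hne hs0 hs
    exact tendsto_nhds_unique (hc.tendsto.mono_left nhdsWithin_le_nhds)
      (tendsto_const_nhds.congr' (h3.mono fun s hs ↦ hs.symm))
  · exact hne ht0 ht

/-- Rays have constant speed. -/
theorem apply_self {y : E} (hy : y ∈ U) : g y y y = g 0 y y := by
  have hd (t : ℝ) (ht : t ∈ Icc (0 : ℝ) 1) : HasDerivAt (fun t : ℝ ↦ g (t • y) y y) 0 t := by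
    have := h.metric.hasDerivAt_apply (h.star y hy t ht) rfl (hasDerivAt_smul_const' y t)
      (hasDerivAt_const t y) (hasDerivAt_const t y)
    simpa [h.radial_smul (h.star y hy t ht)] using this
  have := constant_of_has_deriv_right_zero (f := fun t : ℝ ↦ g (t • y) y y) (a := 0) (b := 1)
    (fun t ht ↦ (hd t ht).continuousAt.continuousWithinAt)
    (fun t ht ↦ (hd t (Ico_subset_Icc_self ht)).hasDerivWithinAt) 1 (by simp)
  simpa using this

theorem apply_jacobi {y : E} (hy : y ∈ U) (X : E) :
    g y (X + chris g y X y) y = g 0 X y := by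
  have hm := h.metric
  have hl := hasDerivAt_line y X
  have h0 : y + (0 : ℝ) • X = y := by simp
  have d1 := hm.hasDerivAt_apply hy h0 hl hl hl
  have d2 : HasDerivAt (fun t : ℝ ↦ g 0 (y + t • X) (y + t • X)) (g 0 X y + g 0 y X) 0 := by
    have := ((hasDerivAt_const (0 : ℝ) (g 0)).clm_apply hl).clm_apply hl
    simpa using this
  have h3 : (fun t : ℝ ↦ g (y + t • X) (y + t • X) (y + t • X)) =ᶠ[nhds 0]
      fun t ↦ g 0 (y + t • X) (y + t • X) := by
    filter_upwards [eventually_line hm.isOpen hy X] with t ht using h.apply_self ht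
  have h4 := d1.unique (d2.congr_of_eventuallyEq h3)
  rw [h0] at h4
  rw [hm.symm y hy y, hm.symm 0 h.zero_mem y X] at h4
  linarith

/-- The Gauss lemma. -/
theorem gauss {y : E} (hy : y ∈ U) (X : E) : g y y X = g 0 y X := by
  have hm := h.metric
  have hd (t : ℝ) (ht : t ∈ Icc (0 : ℝ) 1) :
      HasDerivAt (fun t : ℝ ↦ g (t • y) (t • X) y - t * g 0 X y) 0 t := by
    have hU := h.star y hy t ht
    have d1 := hm.hasDerivAt_apply hU rfl (hasDerivAt_smul_const' y t)
      (hasDerivAt_smul_const' X t) (hasDerivAt_const t y)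
    have d2 := d1.sub ((hasDerivAt_id t).mul_const (g 0 X y))
    refine d2.congr_deriv ?_
    rw [h.radial_smul hU, zero_add, map_zero, add_zero, one_mul]
    by_cases ht0 : t = 0
    · subst ht0; simp
    have h1 := h.apply_jacobi hU X
    have h2 : chris g (t • y) X (t • y) = chris g (t • y) y (t • X) := by
      rw [map_smul, map_smul, hm.chris_symm hU]
    rw [h2, ContinuousLinearMap.map_smul (g (t • y) (X + chris g (t • y) y (t • X))),
      ContinuousLinearMap.map_smul (g 0 X), smul_eq_mul, smul_eq_mul] at h1
    rw [mul_left_cancel₀ ht0 h1, sub_self]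
  have := constant_of_has_deriv_right_zero
    (f := fun t : ℝ ↦ g (t • y) (t • X) y - t * g 0 X y) (a := 0) (b := 1)
    (fun t ht ↦ (hd t ht).continuousAt.continuousWithinAt)
    (fun t ht ↦ (hd t (Ico_subset_Icc_self ht)).hasDerivWithinAt) 1 (by simp)
  simp only [one_smul, one_mul, zero_smul, map_zero, zero_apply, zero_mul, sub_zero] at this
  rw [hm.symm y hy, hm.symm 0 h.zero_mem y X]
  linarith

theorem gauss_smul {w X : E} {t : ℝ} (ht : t • w ∈ U) : g (t • w) w X = g 0 w X := by
  by_cases ht0 : t = 0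
  · simp [ht0]
  · have := h.gauss ht X
    rw [map_smul, map_smul, smul_apply, smul_apply, smul_eq_mul, smul_eq_mul] at this
    exact mul_left_cancel₀ ht0 this

/-- The Jacobi equation for radial Jacobi fields. -/
theorem hasDerivAt_jacobiDeriv {w : E} {t : ℝ} (ht : t • w ∈ U) (X : E) :
    HasDerivAt (jacobiDeriv g w X)
      (curv g (t • w) w (t • X) w - chris g (t • w) w (jacobiDeriv g w X t)) t := by
  have hm := h.metric
  have d1 := (hasDerivAt_bilin (hm.differentiableAt_chris ht) (hasDerivAt_smul_const' w t)
    (hasDerivAt_const t w) (hasDerivAt_smul_const' X t)).const_add X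
  refine d1.congr_deriv ?_
  -- Differentiating `Γ_y(y, y) = 0` in the direction `tX`.
  have key : fderiv ℝ (chris g) (t • w) (t • X) w w = - (2 : ℝ) • chris g (t • w) X w := by
    by_cases ht0 : t = 0
    · subst ht0
      have d : HasDerivAt (fun s : ℝ ↦ chris g ((0 : E) + s • (w + X)) (w + X) (w + X))
          (fderiv ℝ (chris g) 0 (w + X) (w + X) (w + X)) 0 := by
        have := ((hasDerivAt_comp_line (hm.differentiableAt_chris h.zero_mem) (w + X)).clm_apply
          (hasDerivAt_const 0 (w + X))).clm_apply (hasDerivAt_const 0 (w + X))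
        simpa using this
      have e (X Y : E) : chris g 0 X Y = 0 := by
        have e1 (X : E) : chris g 0 X X = 0 := by
          simpa using h.radial_smul (w := X) (t := 0) (by simpa using h.zero_mem)
        have := e1 (X + Y)
        simp only [map_add, add_apply, e1, zero_add, add_zero, hm.chris_symm h.zero_mem Y X] at this
        have h2 : (2 : ℝ) • chris g 0 X Y = 0 := by rw [two_smul]; exact this
        exact (smul_eq_zero.1 h2).resolve_left (by norm_num)
      simp [e]
    have d1 := hasDerivAt_bilin (t := 0) (x := fun s : ℝ ↦ t • w + s • X) (B := chris g)
      (by simpa using hm.differentiableAt_chris ht)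
      (hasDerivAt_line (t • w) X) (hasDerivAt_line (t • w) X) (hasDerivAt_line (t • w) X)
    have d2 : (fun s : ℝ ↦ chris g (t • w + s • X) (t • w + s • X) (t • w + s • X)) =ᶠ[nhds 0]
        fun _ ↦ (0 : E) := by
      filter_upwards [eventually_line hm.isOpen ht X] with s hs using h.radial _ hs
    have d3 := d1.unique ((hasDerivAt_const (0 : ℝ) (0 : E)).congr_of_eventuallyEq d2)
    simp only [zero_smul, add_zero, map_smul, smul_apply] at d3
    rw [hm.chris_symm ht w X] at d3
    rw [map_smul, smul_apply, smul_apply]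
    have d4 : t • (t • fderiv ℝ (chris g) (t • w) X w w + (2 : ℝ) • chris g (t • w) X w) = 0 := by
      rw [← d3]; module
    have d5 := (smul_eq_zero.1 d4).resolve_left ht0
    rw [neg_smul]
    exact eq_neg_of_add_eq_zero_left d5
  simp only [curv, jacobiDeriv, key, h.radial_smul ht, map_add, map_zero, sub_zero, add_zero,
    map_zero, hm.chris_symm ht X w, zero_apply]
  rw [hm.chris_symm ht (t • X) w, hm.fderiv_chris_symm ht w w (t • X)]
  module

section Comparison

variable {w X : E} (hw : g 0 w w = 1) (hX : g 0 w X = 0)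

theorem hasDerivAt_apply_radial {t : ℝ} (ht : t • w ∈ U) (X : E) :
    HasDerivAt (fun t ↦ g (t • w) (t • X) (t • X))
      (2 * g (t • w) (jacobiDeriv g w X t) (t • X)) t := by
  have := h.metric.hasDerivAt_apply ht rfl (hasDerivAt_smul_const' w t)
    (hasDerivAt_smul_const' X t) (hasDerivAt_smul_const' X t)
  refine this.congr_deriv ?_
  rw [h.metric.symm _ ht (t • X)]
  simp only [jacobiDeriv]
  ring

theorem hasDerivAt_jacobiDeriv_apply {t : ℝ} (ht : t • w ∈ U) (X : E) :
    HasDerivAt (fun t ↦ g (t • w) (jacobiDeriv g w X t) (t • X))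
      (g (t • w) (jacobiDeriv g w X t) (jacobiDeriv g w X t)
        - g (t • w) (curv g (t • w) (t • X) w w) (t • X)) t := by
  have := h.metric.hasDerivAt_apply ht rfl (hasDerivAt_smul_const' w t)
    (h.hasDerivAt_jacobiDeriv ht X) (hasDerivAt_smul_const' X t)
  refine this.congr_deriv ?_
  rw [sub_add_cancel, curv_swap g _ w, map_neg, neg_apply]
  simp only [jacobiDeriv]
  ring

/-- The derivative of the radial defect is the sum of the square of the length of `J' - cot t J` and
of a curvature term, both of which are nonnegative. -/
theorem hasDerivAt_radialDefect {t : ℝ} (ht : t • w ∈ U) (hs : Real.sin t ≠ 0) (X : E) :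
    HasDerivAt (radialDefect g w X)
      (g (t • w) (jacobiDeriv g w X t - (Real.cos t / Real.sin t) • t • X)
          (jacobiDeriv g w X t - (Real.cos t / Real.sin t) • t • X)
        + (g (t • w) (t • X) (t • X) - g (t • w) (curv g (t • w) (t • X) w w) (t • X))) t := by
  have d1 := (h.hasDerivAt_jacobiDeriv_apply ht X).sub
    (((Real.hasDerivAt_cos t).div (Real.hasDerivAt_sin t) hs).mul (h.hasDerivAt_apply_radial ht X))
  refine d1.congr_deriv ?_
  simp only [map_sub, map_smul, sub_apply, smul_apply, smul_eq_mul]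
  rw [h.metric.symm _ ht X (jacobiDeriv g w X t)]
  simp only [Pi.div_apply]
  field_simp
  ring

include hw hX in
theorem curv_radial_le (hs : SecLEOne g U) {t : ℝ} (ht : t • w ∈ U) :
    g (t • w) (curv g (t • w) (t • X) w w) (t • X) ≤ g (t • w) (t • X) (t • X) := by
  have h1 := hs _ ht (t • X) w
  have h2 : g (t • w) w w = 1 := by rw [h.gauss_smul ht, hw]
  have h3 : g (t • w) (t • X) w = 0 := by
    rw [h.metric.symm _ ht, map_smul, h.gauss_smul ht, hX, smul_zero]
  rw [h2, h3] at h1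
  linarith

theorem continuousOn_radialDefect {T : ℝ} (hT : T < Real.pi) (hTU : ∀ t ∈ Icc 0 T, t • w ∈ U)
    (X : E) : ContinuousOn (radialDefect g w X) (Icc 0 T) := by
  -- Written with `sinc`, the defect is visibly continuous at `0`.
  have h1 : radialDefect g w X = fun t ↦ t * (g (t • w) (jacobiDeriv g w X t) X
      - Real.cos t * (Real.sinc t)⁻¹ * g (t • w) X X) := by
    ext t
    by_cases ht0 : t = 0
    · simp [radialDefect, ht0]
    · rw [Real.sinc_of_ne_zero ht0]
      simp only [radialDefect, map_smul, smul_apply, smul_eq_mul]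
      rw [inv_div]
      ring
  rw [h1]
  intro t ht
  have hU := hTU t ht
  have hd : ContinuousAt (fun t : ℝ ↦ g (t • w)) t :=
    ContinuousAt.comp (f := fun t : ℝ ↦ t • w) (h.metric.differentiableAt hU).continuousAt
      (hasDerivAt_smul_const' w t).continuousAt
  have hsinc : Real.sinc t ≠ 0 := by
    by_cases ht0 : t = 0
    · simp [ht0]
    · rw [Real.sinc_of_ne_zero ht0]
      have := Real.sin_pos_of_pos_of_lt_pi (lt_of_le_of_ne ht.1 (Ne.symm ht0)) (ht.2.trans_lt hT)
      exact div_ne_zero this.ne' ht0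
  refine ContinuousAt.continuousWithinAt (continuousAt_id.mul (ContinuousAt.sub ?_ ?_))
  · exact (hd.clm_apply (h.hasDerivAt_jacobiDeriv hU X).continuousAt).clm_apply continuousAt_const
  · exact (Real.continuous_cos.continuousAt.mul
      (Real.continuous_sinc.continuousAt.inv₀ hsinc)).mul
      ((hd.clm_apply continuousAt_const).clm_apply continuousAt_const)

variable (hs : SecLEOne g U) {T : ℝ} (hT : T < Real.pi) (hTU : ∀ t ∈ Icc 0 T, t • w ∈ U)
include hw hX hs hT hTU

theorem monotoneOn_radialDefect : MonotoneOn (radialDefect g w X) (Icc 0 T) := by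
  refine monotoneOn_of_deriv_nonneg (convex_Icc 0 T) (h.continuousOn_radialDefect hT hTU X) ?_ ?_
  all_goals
    intro t ht
    rw [interior_Icc] at ht
    have hsin := (Real.sin_pos_of_pos_of_lt_pi ht.1 (ht.2.trans hT)).ne'
    have hU := hTU t (Ioo_subset_Icc_self ht)
    have := h.hasDerivAt_radialDefect hU hsin X
  · exact this.differentiableAt.differentiableWithinAt
  · rw [this.deriv]
    linarith [h.curv_radial_le hw hX hs hU, h.metric.nonneg hU
      (jacobiDeriv g w X t - (Real.cos t / Real.sin t) • t • X)]

/-- The Hessian comparison: `g(J', J) ≥ cot t g(J, J)`. -/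
theorem radialDefect_nonneg {t : ℝ} (ht : t ∈ Icc 0 T) : 0 ≤ radialDefect g w X t := by
  have := h.monotoneOn_radialDefect hw hX hs hT hTU (left_mem_Icc.2 (ht.1.trans ht.2)) ht ht.1
  simpa [radialDefect] using this

omit hs hw hX in
/-- The quotient `g(J, J) / sin² t` for the radial Jacobi field `J = tX` is increasing. It is written
with `sinc` because the factor `t²` cancels, which makes it continuous at `0`. -/
theorem hasDerivAt_ratio {t : ℝ} (ht : t ∈ Ioo 0 T) (X : E) :
    HasDerivAt (fun t ↦ g (t • w) X X * ((Real.sinc t)⁻¹) ^ 2)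
      (2 * radialDefect g w X t / Real.sin t ^ 2) t := by
  have hsin := (Real.sin_pos_of_pos_of_lt_pi ht.1 (ht.2.trans hT)).ne'
  have hU := hTU t (Ioo_subset_Icc_self ht)
  have h1 : (fun t ↦ g (t • w) X X * ((Real.sinc t)⁻¹) ^ 2) =ᶠ[nhds t]
      fun t ↦ g (t • w) (t • X) (t • X) / Real.sin t ^ 2 := by
    filter_upwards [isOpen_Ioi.mem_nhds ht.1] with s hs
    have hs0 : s ≠ 0 := ne_of_gt hs
    rw [Real.sinc_of_ne_zero hs0]
    simp only [map_smul, smul_apply, smul_eq_mul]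
    rw [inv_div, div_pow]
    ring
  have d := (h.hasDerivAt_apply_radial hU X).div ((Real.hasDerivAt_sin t).pow 2)
    (pow_ne_zero 2 hsin)
  refine (d.congr_deriv ?_).congr_of_eventuallyEq h1
  simp only [radialDefect, Pi.pow_apply]
  field_simp
  push_cast
  ring

omit [FiniteDimensional ℝ E] hs hw hX in
theorem continuousOn_ratio (X : E) :
    ContinuousOn (fun t ↦ g (t • w) X X * ((Real.sinc t)⁻¹) ^ 2) (Icc 0 T) := by
  intro t ht
  have hU := hTU t ht
  have hd : ContinuousAt (fun t : ℝ ↦ g (t • w)) t :=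
    ContinuousAt.comp (f := fun t : ℝ ↦ t • w) (h.metric.differentiableAt hU).continuousAt
      (hasDerivAt_smul_const' w t).continuousAt
  have hsinc : Real.sinc t ≠ 0 := by
    by_cases ht0 : t = 0
    · simp [ht0]
    · rw [Real.sinc_of_ne_zero ht0]
      have := Real.sin_pos_of_pos_of_lt_pi (lt_of_le_of_ne ht.1 (Ne.symm ht0)) (ht.2.trans_lt hT)
      exact div_ne_zero this.ne' ht0
  exact (((hd.clm_apply continuousAt_const).clm_apply continuousAt_const).mul
    ((Real.continuous_sinc.continuousAt.inv₀ hsinc).pow 2)).continuousWithinAt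

/-- The Rauch comparison: radial Jacobi fields are at least as long as on the unit sphere. -/
theorem sin_sq_mul_le {t : ℝ} (ht : t ∈ Icc 0 T) :
    Real.sin t ^ 2 * g 0 X X ≤ g (t • w) (t • X) (t • X) := by
  have hmono : MonotoneOn (fun t ↦ g (t • w) X X * ((Real.sinc t)⁻¹) ^ 2) (Icc 0 T) := by
    refine monotoneOn_of_deriv_nonneg (convex_Icc 0 T) (h.continuousOn_ratio hT hTU X) ?_ ?_
    all_goals
      intro t ht
      rw [interior_Icc] at ht
      have := h.hasDerivAt_ratio hT hTU ht X
    · exact this.differentiableAt.differentiableWithinAt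
    · rw [this.deriv]
      have := h.radialDefect_nonneg hw hX hs hT hTU (Ioo_subset_Icc_self ht)
      positivity
  have h1 := hmono (left_mem_Icc.2 (ht.1.trans ht.2)) ht ht.1
  simp only [zero_smul, Real.sinc_zero, inv_one, one_pow, mul_one] at h1
  by_cases ht0 : t = 0
  · simp [ht0]
  rw [Real.sinc_of_ne_zero ht0, inv_div, div_pow] at h1
  have hsin := Real.sin_pos_of_pos_of_lt_pi (lt_of_le_of_ne ht.1 (Ne.symm ht0)) (ht.2.trans_lt hT)
  simp only [map_smul, smul_apply, smul_eq_mul]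
  calc Real.sin t ^ 2 * g 0 X X ≤ Real.sin t ^ 2 * (g (t • w) X X * (t ^ 2 / Real.sin t ^ 2)) := by
        gcongr
    _ = _ := by field_simp

/-- Equality in the Hessian comparison forces the radial Jacobi field to be a spherical one. -/
theorem jacobiDeriv_eq_of_radialDefect_eq_zero (hT0 : 0 < T) (hz : radialDefect g w X T = 0) :
    (∀ t ∈ Ioc 0 T, jacobiDeriv g w X t = (Real.cos t / Real.sin t) • t • X) ∧
    ∀ t ∈ Icc 0 T, g (t • w) (t • X) (t • X) = Real.sin t ^ 2 * g 0 X X := by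
  have hzero : ∀ t ∈ Icc 0 T, radialDefect g w X t = 0 := fun t ht ↦ le_antisymm
    (hz ▸ h.monotoneOn_radialDefect hw hX hs hT hTU ht (right_mem_Icc.2 hT0.le) ht.2)
    (h.radialDefect_nonneg hw hX hs hT hTU ht)
  -- The defect is monotone and nonnegative, hence it vanishes identically, and so does its
  -- derivative.
  have hopen : ∀ t ∈ Ioo 0 T, jacobiDeriv g w X t = (Real.cos t / Real.sin t) • t • X := by
    intro t ht
    have hsin := (Real.sin_pos_of_pos_of_lt_pi ht.1 (ht.2.trans hT)).ne'
    have hU := hTU t (Ioo_subset_Icc_self ht)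
    have d1 := h.hasDerivAt_radialDefect hU hsin X
    have d2 : radialDefect g w X =ᶠ[nhds t] fun _ ↦ 0 := by
      filter_upwards [isOpen_Ioo.mem_nhds ht] with s hs using hzero s (Ioo_subset_Icc_self hs)
    have d3 := d1.unique ((hasDerivAt_const t (0 : ℝ)).congr_of_eventuallyEq d2)
    have d4 := h.metric.nonneg hU (jacobiDeriv g w X t - (Real.cos t / Real.sin t) • t • X)
    have d5 := h.curv_radial_le hw hX hs hU
    exact sub_eq_zero.1 (h.metric.eq_zero_of_apply_self hU (by linarith))
  constructor
  · intro t ht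
    rcases ht.2.lt_or_eq with hlt | rfl
    · exact hopen t ⟨ht.1, hlt⟩
    have hsin := (Real.sin_pos_of_pos_of_lt_pi ht.1 hT).ne'
    have c1 : ContinuousAt (jacobiDeriv g w X) t :=
      (h.hasDerivAt_jacobiDeriv (hTU t (Ioc_subset_Icc_self ht)) X).continuousAt
    have c2 : ContinuousAt (fun t ↦ (Real.cos t / Real.sin t) • t • X) t :=
      (Real.continuous_cos.continuousAt.div Real.continuous_sin.continuousAt hsin).smul
        (hasDerivAt_smul_const' X t).continuousAt
    have hev : ∀ᶠ s in nhdsWithin t (Iio t),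
        jacobiDeriv g w X s = (Real.cos s / Real.sin s) • s • X := by
      filter_upwards [Ioo_mem_nhdsLT ht.1] with s hs using hopen s hs
    exact tendsto_nhds_unique (c1.tendsto.mono_left nhdsWithin_le_nhds)
      ((c2.tendsto.mono_left nhdsWithin_le_nhds).congr' (hev.mono fun s hs ↦ hs.symm))
  · intro t ht
    have hconst : ∀ t ∈ Icc 0 T, g (t • w) X X * ((Real.sinc t)⁻¹) ^ 2 = g 0 X X := by
      intro t ht
      rcases ht.1.eq_or_lt with rfl | ht0
      · simp
      by_contra hne
      obtain ⟨ξ, hξ, hξ'⟩ := exists_hasDerivAt_eq_slope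
        (fun t ↦ g (t • w) X X * ((Real.sinc t)⁻¹) ^ 2) _ ht0
        ((h.continuousOn_ratio hT hTU X).mono (Icc_subset_Icc le_rfl ht.2))
        (fun s hs ↦ h.hasDerivAt_ratio hT hTU ⟨hs.1, hs.2.trans_le ht.2⟩ X)
      rw [hzero ξ ⟨hξ.1.le, hξ.2.le.trans ht.2⟩] at hξ'
      simp only [mul_zero, zero_div, zero_smul, Real.sinc_zero, inv_one, one_pow, mul_one,
        sub_zero] at hξ'
      have := (div_eq_zero_iff.1 hξ'.symm).resolve_right ht0.ne'
      exact hne (by linarith)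
    have h1 := hconst t ht
    by_cases ht0 : t = 0
    · simp [ht0]
    rw [Real.sinc_of_ne_zero ht0, inv_div, div_pow] at h1
    have hsin := Real.sin_pos_of_pos_of_lt_pi (lt_of_le_of_ne ht.1 (Ne.symm ht0)) (ht.2.trans_lt hT)
    simp only [map_smul, smul_apply, smul_eq_mul]
    rw [← h1]
    field_simp

end Comparison

end IsNormalMetric

end Normal

section Normal

variable {E : Type*} [NormedAddCommGroup E] [NormedSpace ℝ E]

/-- The distance to the origin in normal coordinates. -/
noncomputable def radius (g : E → E →L[ℝ] E →L[ℝ] ℝ) (y : E) : ℝ := √(g 0 y y)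

namespace IsNormalMetric

variable [FiniteDimensional ℝ E] {g : E → E →L[ℝ] E →L[ℝ] ℝ} {U : Set E} (h : IsNormalMetric g U)
include h

omit [FiniteDimensional ℝ E] in
theorem radius_pos {y : E} (hy : y ≠ 0) : 0 < radius g y :=
  Real.sqrt_pos.2 (h.metric.pos 0 h.zero_mem y hy)

omit [FiniteDimensional ℝ E] in
theorem radius_sq (y : E) : radius g y ^ 2 = g 0 y y :=
  Real.sq_sqrt (h.metric.nonneg h.zero_mem y)

omit [FiniteDimensional ℝ E] h in
theorem radius_smul {w : E} (hw : g 0 w w = 1) {t : ℝ} (ht : 0 ≤ t) : radius g (t • w) = t := by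
  simp only [radius, map_smul, smul_apply, smul_eq_mul, hw, mul_one]
  exact Real.sqrt_mul_self ht

omit [FiniteDimensional ℝ E] in
theorem hasDerivAt_radius {y : ℝ → E} {y' : E} {s : ℝ} (hy : HasDerivAt y y' s) (hne : y s ≠ 0) :
    HasDerivAt (fun s ↦ radius g (y s)) (g 0 (y s) y' / radius g (y s)) s := by
  have h1 : HasDerivAt (fun s ↦ g 0 (y s) (y s)) (g 0 y' (y s) + g 0 (y s) y') s := by
    have := ((hasDerivAt_const s (g 0)).clm_apply hy).clm_apply hy
    simpa using this
  have h2 := h1.sqrt (h.metric.pos 0 h.zero_mem _ hne).ne'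
  refine h2.congr_deriv ?_
  rw [h.metric.symm 0 h.zero_mem y']
  simp only [radius]
  field_simp
  ring

omit [FiniteDimensional ℝ E] in
theorem hasDerivAt_cos_radius {y : ℝ → E} {y' : E} {s : ℝ} (hy : HasDerivAt y y' s)
    (hne : y s ≠ 0) : HasDerivAt (fun s ↦ Real.cos (radius g (y s)))
      (-(Real.sin (radius g (y s)) / radius g (y s)) * g 0 (y s) y') s := by
  refine (h.hasDerivAt_radius hy hne).cos.congr_deriv ?_
  ring

/-- The second derivative of the cosine of the distance to the origin along a unit speed
geodesic: compared with the unit sphere, the error is the radial defect of the component of the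
velocity orthogonal to the ray. -/
theorem hasDerivAt_deriv_cos_radius {y : ℝ → E} {s : ℝ} (hy : ContDiffAt ℝ 2 y s) (hU : y s ∈ U)
    (hne : y s ≠ 0) (hacc : accel g y s = 0) (hunit : g (y s) (deriv y s) (deriv y s) = 1)
    (hsin : Real.sin (radius g (y s)) ≠ 0) :
    HasDerivAt (fun s ↦ -(Real.sin (radius g (y s)) / radius g (y s)) * g 0 (y s) (deriv y s))
      (-Real.cos (radius g (y s)) - Real.sin (radius g (y s)) *
        radialDefect g ((radius g (y s))⁻¹ • y s)
          ((radius g (y s))⁻¹ • (deriv y s - (g 0 (y s) (deriv y s) / radius g (y s) ^ 2) • y s))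
          (radius g (y s))) s := by
  have hm := h.metric
  have hy1 : HasDerivAt y (deriv y s) s := (hy.differentiableAt (by simp)).hasDerivAt
  have hy2 : HasDerivAt (deriv y) (deriv (deriv y) s) s := by
    have h1 : ContDiffAt ℝ 1 (fderiv ℝ y) s := hy.fderiv_right (m := 1) (by norm_num)
    have h2 : ContDiffAt ℝ 1 (deriv y) s := h1.clm_apply contDiffAt_const
    exact (h2.differentiableAt (by simp)).hasDerivAt
  set r := radius g (y s) with hr
  have hr0 : 0 < r := h.radius_pos hne
  have hrr : r ^ 2 = g 0 (y s) (y s) := h.radius_sq _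
  set y' := deriv y s with hy'
  set a := g 0 (y s) y' with ha
  -- the component of the velocity orthogonal to the ray
  set J := y' - (a / r ^ 2) • y s with hJ
  have hrw : r • r⁻¹ • y s = y s := smul_inv_smul₀ hr0.ne' _
  have hrX : r • r⁻¹ • J = J := smul_inv_smul₀ hr0.ne' _
  have hga : g (y s) (y s) y' = a := h.gauss hU y'
  have hgr : g (y s) (y s) (y s) = r ^ 2 := by rw [h.apply_self hU, hrr]
  have hgJ : g (y s) (y s) J = 0 := by
    simp only [hJ, map_sub, map_smul, smul_eq_mul, hga, hgr]
    field_simp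
    ring
  have hJJ : g (y s) J J = 1 - a ^ 2 / r ^ 2 := by
    simp only [hJ, map_sub, map_smul, sub_apply, smul_apply, smul_eq_mul]
    rw [hunit, hm.symm _ hU y' (y s), hga, hgr]
    field_simp
    ring
  set D := jacobiDeriv g (r⁻¹ • y s) (r⁻¹ • J) r with hD
  have hDJ : r • D = J + chris g (y s) J (y s) := by
    simp only [hD, jacobiDeriv, hrw, hrX, smul_add, map_smul, smul_apply]
    rw [smul_inv_smul₀ hr0.ne', hm.chris_symm hU]
  have hDy : g (y s) D (y s) = 0 := by
    have h1 : r * g (y s) D (y s) = 0 := by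
      have : g (y s) (r • D) (y s) = 0 := by
        rw [hDJ, h.apply_jacobi hU, hm.symm 0 h.zero_mem, ← h.gauss hU, hgJ]
      simpa using this
    exact (mul_eq_zero.1 h1).resolve_left hr0.ne'
  have hdef : radialDefect g (r⁻¹ • y s) (r⁻¹ • J) r =
      g (y s) D J - Real.cos r / Real.sin r * (1 - a ^ 2 / r ^ 2) := by
    simp only [radialDefect, hrw, hrX, hJJ, hD]
  -- By the Gauss lemma `g 0` may be replaced by `g` at the point itself, which is then differentiated
  -- covariantly.
  have hd : HasDerivAt (fun s ↦ g 0 (y s) (deriv y s)) (a ^ 2 / r ^ 2 + r * g (y s) D J) s := by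
    have d1 := hm.hasDerivAt_apply hU rfl hy1 hy1 hy2
    have h0 : deriv (deriv y) s + chris g (y s) y' y' = 0 := hacc
    rw [h0, map_zero, add_zero] at d1
    have e1 : y' + chris g (y s) y' (y s) = (a / r ^ 2) • y s + r • D := by
      have : y' = J + (a / r ^ 2) • y s := by rw [hJ]; abel
      rw [hDJ]
      conv_lhs => rw [this]
      rw [map_add, map_smul, add_apply, smul_apply, h.radial _ hU]
      module
    rw [e1] at d1
    have e2 : g (y s) ((a / r ^ 2) • y s + r • D) y' = a ^ 2 / r ^ 2 + r * g (y s) D J := by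
      have : y' = J + (a / r ^ 2) • y s := by rw [hJ]; abel
      rw [map_add, add_apply, map_smul, map_smul, smul_apply, smul_apply, hga]
      conv_lhs => rw [this]
      rw [map_add, map_smul, hDy]
      simp only [smul_eq_mul]
      ring
    rw [e2] at d1
    refine d1.congr_of_eventuallyEq ?_
    filter_upwards [hy1.continuousAt.eventually (hm.mem_nhds hU)] with x hx
    exact (h.gauss hx _).symm
  have hρ := h.hasDerivAt_radius hy1 hne
  have d := ((hρ.sin.div hρ hr0.ne').neg).mul hd
  refine d.congr_deriv ?_
  rw [hdef]
  simp only [← hr, ← ha, ← hy', Pi.div_apply, Pi.neg_apply]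
  field_simp
  ring

/-- Rigidity of a family of rays whose radial Jacobi fields are spherical: the surface
`(s, t) ↦ t v(s)` is totally geodesic as soon as its circle of radius `T` is a geodesic up to a
radial term. Indeed the field `A = ∇ₛ∂ₛ + sin t cos t ∂ₜ` satisfies `∇ₜ A = cot t A`, so that
`|A| / sin t` is constant. -/
theorem spherical_of_jacobiDeriv (hs : SecLEOne g U) {v : ℝ → E} {s₀ T : ℝ}
    (hv : ContDiffAt ℝ 2 v s₀) (hT0 : 0 < T) (hT : T < Real.pi)
    (hTU : ∀ t ∈ Icc 0 T, t • v s₀ ∈ U)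
    (hJ : ∀ t ∈ Ioc 0 T, ∀ᶠ s in nhds s₀,
      jacobiDeriv g (v s) (deriv v s) t = (Real.cos t / Real.sin t) • t • deriv v s)
    (hw : g 0 (v s₀) (v s₀) = 1) (hX : g 0 (v s₀) (deriv v s₀) = 0)
    (hn : ∀ t ∈ Icc 0 T,
      g (t • v s₀) (t • deriv v s₀) (t • deriv v s₀) = Real.sin t ^ 2)
    (hend : T • deriv (deriv v) s₀ + chris g (T • v s₀) (T • deriv v s₀) (T • deriv v s₀)
      + (Real.sin T * Real.cos T) • v s₀ = 0) :
    (∀ t ∈ Ioc 0 T, t • deriv (deriv v) s₀ + chris g (t • v s₀) (t • deriv v s₀) (t • deriv v s₀)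
      + (Real.sin t * Real.cos t) • v s₀ = 0) ∧ deriv (deriv v) s₀ = - v s₀ := by
  have hm := h.metric
  have hv1 : HasDerivAt v (deriv v s₀) s₀ := (hv.differentiableAt (by simp)).hasDerivAt
  have hv2 : HasDerivAt (deriv v) (deriv (deriv v) s₀) s₀ := by
    have h1 : ContDiffAt ℝ 1 (fderiv ℝ v) s₀ := hv.fderiv_right (m := 1) (by norm_num)
    have h2 : ContDiffAt ℝ 1 (deriv v) s₀ := h1.clm_apply contDiffAt_const
    exact (h2.differentiableAt (by simp)).hasDerivAt
  set w := v s₀ with hwdef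
  set X := deriv v s₀ with hXdef
  set Z := deriv (deriv v) s₀ with hZdef
  let A : ℝ → E := fun t ↦ t • Z + chris g (t • w) (t • X) (t • X)
    + (Real.sin t * Real.cos t) • w
  have hJ0 (t : ℝ) (ht : t ∈ Ioc 0 T) : chris g (t • w) w (t • X) =
      (Real.cos t / Real.sin t) • t • X - X := by
    have := (hJ t ht).self_of_nhds
    simp only [jacobiDeriv, ← hwdef, ← hXdef] at this
    rw [← this]; abel
  -- The radial planes realize the maximal curvature, by the Jacobi equation.
  have hcurv (t : ℝ) (ht : t ∈ Ioo 0 T) :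
      curv g (t • w) w (t • X) (t • X) = (Real.sin t ^ 2) • w := by
    have hsin := (Real.sin_pos_of_pos_of_lt_pi ht.1 (ht.2.trans hT)).ne'
    have hU := hTU t (Ioo_subset_Icc_self ht)
    have hRw : curv g (t • w) w (t • X) w = -(t • X) := by
      have d1 := h.hasDerivAt_jacobiDeriv hU X
      have d2 : HasDerivAt (fun t : ℝ ↦ (Real.cos t / Real.sin t) • t • X) _ t :=
        ((Real.hasDerivAt_cos t).div (Real.hasDerivAt_sin t) hsin).smul
          (hasDerivAt_smul_const' X t)
      have d3 : jacobiDeriv g w X =ᶠ[nhds t] fun t : ℝ ↦ (Real.cos t / Real.sin t) • t • X := by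
        filter_upwards [isOpen_Ioo.mem_nhds ht] with s hs
        exact (hJ s (Ioo_subset_Ioc_self hs)).self_of_nhds
      have d4 := d1.unique (d2.congr_of_eventuallyEq d3)
      rw [d3.self_of_nhds, map_smul, hJ0 t (Ioo_subset_Ioc_self ht)] at d4
      rw [sub_eq_iff_eq_add.1 d4]
      simp only [Pi.div_apply, smul_sub, smul_smul]
      have e : -Real.sin t * Real.sin t - Real.cos t * Real.cos t = -1 := by
        linarith [Real.sin_sq_add_cos_sq t, sq (Real.sin t), sq (Real.cos t)]
      rw [e]
      have e2 : Real.cos t / Real.sin t * (Real.cos t / Real.sin t * t)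
          = t / Real.sin t ^ 2 - t := by
        rw [eq_sub_iff_add_eq]
        field_simp
        linear_combination t * Real.sin_sq_add_cos_sq t
      rw [e2, sub_smul, ← neg_smul]
      match_scalars
      ring
    have hgw : g (t • w) w w = 1 := by rw [h.gauss_smul hU, hw]
    have hgX : g (t • w) w (t • X) = 0 := by
      rw [map_smul, h.gauss_smul hU, hX, smul_zero]
    have := hm.curv_eq_of_max hs hU (J := t • X) (w := w) (by
      rw [curv_swap, hRw, neg_neg, hgw, hm.symm _ hU (t • X) w, hgX]
      ring)
    rw [this, hgX, hn t (Ioo_subset_Icc_self ht), zero_smul, sub_zero]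
  -- the differential equation `∇ₜ A = cot t A`
  have hA (t : ℝ) (ht : t ∈ Ioo 0 T) : ∃ A' : E, HasDerivAt A A' t ∧
      A' + chris g (t • w) w (A t) = (Real.cos t / Real.sin t) • A t := by
    have hsin := (Real.sin_pos_of_pos_of_lt_pi ht.1 (ht.2.trans hT)).ne'
    have hU := hTU t (Ioo_subset_Icc_self ht)
    have d1 : HasDerivAt A (Z + (fderiv ℝ (chris g) (t • w) w (t • X) (t • X)
        + chris g (t • w) X (t • X) + chris g (t • w) (t • X) X)
        + (Real.cos t * Real.cos t + Real.sin t * -Real.sin t) • w) t :=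
      ((hasDerivAt_smul_const' Z t).add (hasDerivAt_bilin (hm.differentiableAt_chris hU)
        (hasDerivAt_smul_const' w t) (hasDerivAt_smul_const' X t)
        (hasDerivAt_smul_const' X t))).add
        (((Real.hasDerivAt_sin t).mul (Real.hasDerivAt_cos t)).smul_const w)
    refine ⟨_, d1, ?_⟩
    -- The identity `J' = cot t J`, differentiated with respect to the parameter of the family.
    have e1 : Z + (fderiv ℝ (chris g) (t • w) (t • X) w (t • X) + chris g (t • w) X (t • X)
        + chris g (t • w) w (t • Z)) = (Real.cos t / Real.sin t) • t • Z := by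
      have d2 : HasDerivAt (fun s ↦ jacobiDeriv g (v s) (deriv v s) t) _ s₀ :=
        hv2.add (hasDerivAt_bilin (x := fun s ↦ t • v s) (X := v) (Y := fun s ↦ t • deriv v s)
          (hm.differentiableAt_chris hU) (hv1.const_smul t) hv1 (hv2.const_smul t))
      have d3 : HasDerivAt (fun s ↦ (Real.cos t / Real.sin t) • t • deriv v s) _ s₀ :=
        (hv2.const_smul t).const_smul (Real.cos t / Real.sin t)
      exact d2.unique (d3.congr_of_eventuallyEq (hJ t (Ioo_subset_Ioc_self ht)))
    have e2 := hcurv t ht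
    have e3 := hJ0 t (Ioo_subset_Ioc_self ht)
    simp only [curv] at e2
    rw [e3, map_sub, map_smul (chris g (t • w) (t • X)) (Real.cos t / Real.sin t)] at e2
    have e4 : fderiv ℝ (chris g) (t • w) w (t • X) (t • X) = (Real.sin t ^ 2) • w
        + fderiv ℝ (chris g) (t • w) (t • X) w (t • X)
        - (chris g (t • w) w (chris g (t • w) (t • X) (t • X))
          - ((Real.cos t / Real.sin t) • chris g (t • w) (t • X) (t • X)
            - chris g (t • w) (t • X) X)) := by
      rw [← e2]; abel
    have e5 : fderiv ℝ (chris g) (t • w) (t • X) w (t • X) = (Real.cos t / Real.sin t) • t • Z - Z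
        - chris g (t • w) X (t • X) - chris g (t • w) w (t • Z) := by
      rw [← e1]; abel
    simp only [A, map_add, map_smul (chris g (t • w) w) (Real.sin t * Real.cos t),
      h.radial_smul hU, smul_zero, add_zero]
    rw [e4, e5, hm.chris_symm hU (t • X) X]
    have e6 : (Real.cos t / Real.sin t) • (Real.sin t * Real.cos t) • w
        = (Real.cos t * Real.cos t) • w := by
      rw [smul_smul]; congr 1; field_simp
    rw [smul_add, smul_add, e6]
    module
  have hAc (t : ℝ) (ht : t ∈ Icc 0 T) : ContinuousAt A t := by
    have hU := hTU t ht
    have c1 : ContinuousAt (fun t : ℝ ↦ t • X) t := (hasDerivAt_smul_const' X t).continuousAt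
    have c2 : ContinuousAt (fun t : ℝ ↦ chris g (t • w)) t :=
      ContinuousAt.comp (f := fun t : ℝ ↦ t • w) (hm.differentiableAt_chris hU).continuousAt
        (hasDerivAt_smul_const' w t).continuousAt
    exact ((hasDerivAt_smul_const' Z t).continuousAt.add ((c2.clm_apply c1).clm_apply c1)).add
      ((Real.continuous_sin.mul Real.continuous_cos).continuousAt.smul continuousAt_const)
  have hA0 : ∀ t ∈ Ioc 0 T, A t = 0 := by
    intro t ht
    rcases ht.2.eq_or_lt with rfl | htT
    · exact hend
    have hd (x : ℝ) (hx : x ∈ Ioo t T) :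
        HasDerivAt (fun t ↦ g (t • w) (A t) (A t) / Real.sin t ^ 2) 0 x := by
      have hx' : x ∈ Ioo 0 T := ⟨ht.1.trans hx.1, hx.2⟩
      have hsin := (Real.sin_pos_of_pos_of_lt_pi hx'.1 (hx'.2.trans hT)).ne'
      obtain ⟨A', hA', hA''⟩ := hA x hx'
      have d1 := hm.hasDerivAt_apply (hTU x (Ioo_subset_Icc_self hx')) rfl
        (hasDerivAt_smul_const' w x) hA' hA'
      rw [hA''] at d1
      refine (d1.div ((Real.hasDerivAt_sin x).pow 2) (pow_ne_zero 2 hsin)).congr_deriv ?_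
      simp only [map_smul, smul_apply, smul_eq_mul, Pi.pow_apply]
      field_simp
      push_cast
      ring
    have hc : ContinuousOn (fun t ↦ g (t • w) (A t) (A t) / Real.sin t ^ 2) (Icc t T) := by
      intro x hx
      have hx' : x ∈ Icc 0 T := ⟨ht.1.le.trans hx.1, hx.2⟩
      have hsin := (Real.sin_pos_of_pos_of_lt_pi (ht.1.trans_le hx.1) (hx.2.trans_lt hT)).ne'
      have c2 : ContinuousAt (fun t : ℝ ↦ g (t • w)) x :=
        ContinuousAt.comp (f := fun t : ℝ ↦ t • w) (hm.differentiableAt (hTU x hx')).continuousAt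
          (hasDerivAt_smul_const' w x).continuousAt
      exact (((c2.clm_apply (hAc x hx')).clm_apply (hAc x hx')).div
        (Real.continuous_sin.continuousAt.pow 2) (pow_ne_zero 2 hsin)).continuousWithinAt
    obtain ⟨ξ, hξ, hξ'⟩ := exists_hasDerivAt_eq_slope _ _ htT hc hd
    have hAT : A T = 0 := hend
    have h1 := (div_eq_zero_iff.1 hξ'.symm).resolve_right (sub_ne_zero.2 htT.ne')
    rw [hAT, map_zero, zero_div, zero_sub, neg_eq_zero] at h1
    have hsin := (Real.sin_pos_of_pos_of_lt_pi ht.1 (htT.trans hT)).ne'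
    have h2 := (div_eq_zero_iff.1 h1).resolve_right (pow_ne_zero 2 hsin)
    exact hm.eq_zero_of_apply_self (hTU t (Ioc_subset_Icc_self ht)) h2
  refine ⟨hA0, ?_⟩
  -- The second claim is the limit of `A t / t` as `t` tends to `0`.
  have hlim : ContinuousAt (fun t : ℝ ↦ Z + t • chris g (t • w) X X
      + (Real.sinc t * Real.cos t) • w) 0 := by
    have hU := hTU 0 (left_mem_Icc.2 hT0.le)
    have c2 : ContinuousAt (fun t : ℝ ↦ chris g (t • w)) 0 :=
      ContinuousAt.comp (f := fun t : ℝ ↦ t • w) (hm.differentiableAt_chris hU).continuousAt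
        (hasDerivAt_smul_const' w 0).continuousAt
    exact (continuousAt_const.add (continuousAt_id.smul
      ((c2.clm_apply continuousAt_const).clm_apply continuousAt_const))).add
      ((Real.continuous_sinc.mul Real.continuous_cos).continuousAt.smul continuousAt_const)
  have hev : ∀ᶠ t in nhdsWithin (0 : ℝ) (Ioi 0), Z + t • chris g (t • w) X X
      + (Real.sinc t * Real.cos t) • w = 0 := by
    filter_upwards [Ioo_mem_nhdsGT hT0] with t ht
    have h1 := hA0 t (Ioo_subset_Ioc_self ht)
    have ht0 : t ≠ 0 := ht.1.ne'
    have h2 : t • (Z + t • chris g (t • w) X X + (Real.sinc t * Real.cos t) • w) = 0 := by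
      rw [← h1, Real.sinc_of_ne_zero ht0]
      simp only [A, map_smul, smul_apply, smul_add, smul_smul]
      congr 2
      field_simp
    exact (smul_eq_zero.1 h2).resolve_left ht0
  have h3 := tendsto_nhds_unique (hlim.tendsto.mono_left nhdsWithin_le_nhds)
    (tendsto_const_nhds.congr' (hev.mono fun s hs ↦ hs.symm))
  simp only [zero_smul, add_zero, Real.sinc_zero, Real.cos_zero, mul_one, one_smul] at h3
  exact eq_neg_of_add_eq_zero_left h3

end IsNormalMetric

end Normal

/-! ### Parametrizations of a Riemannian manifold -/

section Param

variable {n : ℕ} {M : Type*} [TopologicalSpace M] [ChartedSpace (EuclideanSpace ℝ (Fin n)) M]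

/-- The differential of a map from `ℝⁿ` to `M`. Tangent spaces of `M` are identified with `ℝⁿ`. -/
noncomputable def tang (Φ : EuclideanSpace ℝ (Fin n) → M) (y : EuclideanSpace ℝ (Fin n)) :
    EuclideanSpace ℝ (Fin n) →L[ℝ] EuclideanSpace ℝ (Fin n) :=
  mfderiv 𝓘(ℝ, EuclideanSpace ℝ (Fin n)) (𝓡 n) Φ y

variable (n) in
/-- The velocity of a curve in `M`. -/
noncomputable def vel (γ : ℝ → M) (t : ℝ) : EuclideanSpace ℝ (Fin n) :=
  mfderiv 𝓘(ℝ, ℝ) (𝓡 n) γ t (1 : ℝ)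

/-- A local parametrization of `M`: a smooth map with injective differential. -/
structure IsParam (Φ : EuclideanSpace ℝ (Fin n) → M) (U : Set (EuclideanSpace ℝ (Fin n))) :
    Prop where
  isOpen : IsOpen U
  contMDiffOn : ContMDiffOn 𝓘(ℝ, EuclideanSpace ℝ (Fin n)) (𝓡 n) ∞ Φ U
  injective : ∀ y ∈ U, Function.Injective (tang Φ y)

theorem vel_comp {Φ : EuclideanSpace ℝ (Fin n) → M} {x : ℝ → EuclideanSpace ℝ (Fin n)}
    {x' : EuclideanSpace ℝ (Fin n)} {t : ℝ}
    (hΦ : MDifferentiableAt 𝓘(ℝ, EuclideanSpace ℝ (Fin n)) (𝓡 n) Φ (x t))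
    (hx : HasDerivAt x x' t) :
    vel n (fun s ↦ Φ (x s)) t = tang Φ (x t) x' := by
  have h2 : HasMFDerivAt 𝓘(ℝ, ℝ) 𝓘(ℝ, EuclideanSpace ℝ (Fin n)) x t
      (ContinuousLinearMap.toSpanSingleton ℝ x') := hx.hasFDerivAt.hasMFDerivAt
  have h3 := (hΦ.hasMFDerivAt.comp t h2).mfderiv
  unfold vel
  have h4 := congrArg (fun L ↦ (L (1 : ℝ) : EuclideanSpace ℝ (Fin n))) h3
  refine h4.trans ?_
  change tang Φ (x t) ((1 : ℝ) • x') = _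
  rw [one_smul]

theorem vel_congr {γ γ' : ℝ → M} {t : ℝ} (h : γ =ᶠ[nhds t] γ') : vel n γ t = vel n γ' t := by
  unfold vel
  have := h.mfderiv_eq (I := 𝓘(ℝ, ℝ)) (I' := 𝓡 n)
  exact congrArg (fun L : ℝ →L[ℝ] EuclideanSpace ℝ (Fin n) ↦ L 1) this

theorem vel_comp_real {γ : ℝ → M} {τ : ℝ → ℝ} {τ' t : ℝ}
    (hγ : MDifferentiableAt 𝓘(ℝ, ℝ) (𝓡 n) γ (τ t)) (hτ : HasDerivAt τ τ' t) :
    vel n (fun s ↦ γ (τ s)) t = τ' • vel n γ (τ t) := by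
  have h2 : HasMFDerivAt 𝓘(ℝ, ℝ) 𝓘(ℝ, ℝ) τ t
      (ContinuousLinearMap.toSpanSingleton ℝ τ') := hτ.hasFDerivAt.hasMFDerivAt
  have h3 := (hγ.hasMFDerivAt.comp t h2).mfderiv
  unfold vel
  have h4 := congrArg (fun L ↦ (L (1 : ℝ) : EuclideanSpace ℝ (Fin n))) h3
  refine h4.trans ?_
  have key (L : ℝ →L[ℝ] EuclideanSpace ℝ (Fin n)) (r : ℝ) : L ((1 : ℝ) • r) = r • L 1 := by
    rw [← L.map_smul]; simp
  exact key _ _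

variable [IsManifold (𝓡 n) ∞ M]

namespace IsParam

variable {Φ : EuclideanSpace ℝ (Fin n) → M} {U : Set (EuclideanSpace ℝ (Fin n))}
  (h : IsParam Φ U) {y : EuclideanSpace ℝ (Fin n)} (hy : y ∈ U)
include h

omit [IsManifold (𝓡 n) ∞ M] in
theorem mono {V : Set (EuclideanSpace ℝ (Fin n))} (hV : IsOpen V) (hVU : V ⊆ U) : IsParam Φ V :=
  ⟨hV, h.contMDiffOn.mono hVU, fun y hy ↦ h.injective y (hVU hy)⟩

include hy

omit [IsManifold (𝓡 n) ∞ M] in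
theorem contMDiffAt : ContMDiffAt 𝓘(ℝ, EuclideanSpace ℝ (Fin n)) (𝓡 n) ∞ Φ y :=
  h.contMDiffOn.contMDiffAt (h.isOpen.mem_nhds hy)

omit [IsManifold (𝓡 n) ∞ M] in
theorem mdifferentiableAt : MDifferentiableAt 𝓘(ℝ, EuclideanSpace ℝ (Fin n)) (𝓡 n) Φ y :=
  (h.contMDiffAt hy).mdifferentiableAt (by simp)

/-- The coordinate expression of a parametrization in a chart of `M` is smooth. -/
theorem contDiffAt_chart {x₀ : M} (hx : Φ y ∈ (extChartAt (𝓡 n) x₀).source) :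
    ContDiffAt ℝ ∞ (fun z ↦ extChartAt (𝓡 n) x₀ (Φ z)) y := by
  have h1 : ContMDiffAt (𝓡 n) 𝓘(ℝ, EuclideanSpace ℝ (Fin n)) ∞ (extChartAt (𝓡 n) x₀) (Φ y) :=
    contMDiffAt_extChartAt' (by simpa using hx)
  exact contMDiffAt_iff_contDiffAt.1 (h1.comp y (h.contMDiffAt hy))

end IsParam

theorem isParam_chart (x₀ : M) :
    IsParam (extChartAt (𝓡 n) x₀).symm (extChartAt (𝓡 n) x₀).target where
  isOpen := isOpen_extChartAt_target x₀
  contMDiffOn := contMDiffOn_extChartAt_symm x₀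
  injective y hy := by
    have := isInvertible_mfderivWithin_extChartAt_symm (I := 𝓡 n) hy
    have hr : range (𝓡 n) = univ := by simp
    rw [hr, mfderivWithin_univ] at this
    obtain ⟨e, he⟩ := this
    unfold tang
    rw [← he]
    exact e.injective

section Metric

variable [RiemannianBundle (fun x : M ↦ TangentSpace (𝓡 n) x)]

/-- The inner product of the tangent space at `m`. -/
noncomputable def ip (m : M) (u v : EuclideanSpace ℝ (Fin n)) : ℝ :=
  inner ℝ (show TangentSpace (𝓡 n) m from u) (show TangentSpace (𝓡 n) m from v)

omit [IsManifold (𝓡 n) ∞ M] in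
theorem ip_symm (m : M) (u v : EuclideanSpace ℝ (Fin n)) : ip m u v = ip m v u :=
  real_inner_comm _ _

omit [IsManifold (𝓡 n) ∞ M] in
theorem ip_pos (m : M) {u : EuclideanSpace ℝ (Fin n)} (hu : u ≠ 0) : 0 < ip m u u :=
  real_inner_self_pos.2 hu

omit [IsManifold (𝓡 n) ∞ M] in
theorem ip_add (m : M) (u u' v : EuclideanSpace ℝ (Fin n)) :
    ip m (u + u') v = ip m u v + ip m u' v := by
  exact inner_add_left (𝕜 := ℝ) (E := TangentSpace (𝓡 n) m) _ _ _

omit [IsManifold (𝓡 n) ∞ M] in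
theorem ip_smul (m : M) (r : ℝ) (u v : EuclideanSpace ℝ (Fin n)) :
    ip m (r • u) v = r * ip m u v := by
  exact real_inner_smul_left (F := TangentSpace (𝓡 n) m) _ _ _

/-- The metric of `M`, pulled back by a map `Φ` from `ℝⁿ`. -/
noncomputable def pullMetric (Φ : EuclideanSpace ℝ (Fin n) → M) (y : EuclideanSpace ℝ (Fin n)) :
    EuclideanSpace ℝ (Fin n) →L[ℝ] EuclideanSpace ℝ (Fin n) →L[ℝ] ℝ :=
  LinearMap.toContinuousLinearMap
    ((LinearMap.toContinuousLinearMap : (EuclideanSpace ℝ (Fin n) →ₗ[ℝ] ℝ) ≃ₗ[ℝ] _).toLinearMap ∘ₗ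
      LinearMap.mk₂ ℝ (fun u v ↦ ip (Φ y) (tang Φ y u) (tang Φ y v))
        (fun u u' v ↦ by rw [map_add, ip_add])
        (fun r u v ↦ by rw [map_smul, ip_smul, smul_eq_mul])
        (fun u v v' ↦ by rw [map_add, ip_symm, ip_add, ip_symm _ _ (tang Φ y u),
          ip_symm _ (tang Φ y v') (tang Φ y u)])
        (fun r u v ↦ by rw [map_smul, ip_symm, ip_smul, ip_symm, smul_eq_mul]))

omit [IsManifold (𝓡 n) ∞ M] in
theorem pullMetric_apply (Φ : EuclideanSpace ℝ (Fin n) → M) (y u v : EuclideanSpace ℝ (Fin n)) :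
    pullMetric Φ y u v = ip (Φ y) (tang Φ y u) (tang Φ y v) := rfl

variable [IsContMDiffRiemannianBundle (𝓡 n) ∞ (EuclideanSpace ℝ (Fin n))
      (fun x : M ↦ TangentSpace (𝓡 n) x)]

theorem contDiffOn_pullMetric {Φ : EuclideanSpace ℝ (Fin n) → M}
    {U : Set (EuclideanSpace ℝ (Fin n))} (hU : IsOpen U)
    (h : ContMDiffOn 𝓘(ℝ, EuclideanSpace ℝ (Fin n)) (𝓡 n) ∞ Φ U) :
    ContDiffOn ℝ ∞ (pullMetric Φ) U := by
  rw [contDiffOn_clm_apply]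
  intro u
  rw [contDiffOn_clm_apply]
  intro v y hy
  refine ContDiffAt.contDiffWithinAt ?_
  rw [← contMDiffAt_iff_contDiffAt]
  have key (u : EuclideanSpace ℝ (Fin n)) : ContMDiffAt 𝓘(ℝ, EuclideanSpace ℝ (Fin n))
      ((𝓡 n).prod 𝓘(ℝ, EuclideanSpace ℝ (Fin n))) ∞
      (fun y ↦ (TotalSpace.mk (Φ y) (tang Φ y u) : TangentBundle (𝓡 n) M)) y := by
    have h1 := (h.contMDiffOn_tangentMapWithin (m := ∞) (by simp)
      hU.uniqueMDiffOn)
    have h2 : ContMDiff 𝓘(ℝ, EuclideanSpace ℝ (Fin n))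
        (𝓘(ℝ, EuclideanSpace ℝ (Fin n)).prod 𝓘(ℝ, EuclideanSpace ℝ (Fin n))) ∞
        (fun y ↦ (TotalSpace.mk y u :
          TangentBundle 𝓘(ℝ, EuclideanSpace ℝ (Fin n)) (EuclideanSpace ℝ (Fin n)))) := by
      intro y
      rw [contMDiffAt_totalSpace]
      refine ⟨contMDiffAt_id, ?_⟩
      simp
      exact contMDiffAt_const
    have h3 := h1.comp h2.contMDiffOn (s := U) (fun y hy ↦ hy)
    refine (h3.contMDiffAt (hU.mem_nhds hy)).congr_of_eventuallyEq ?_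
    filter_upwards [hU.mem_nhds hy] with z hz
    simp only [Function.comp, tangentMapWithin, tang]
    rw [mfderivWithin_of_isOpen hU hz]
    rfl
  exact (key u).inner_bundle (key v)

theorem IsParam.isMetricOn {Φ : EuclideanSpace ℝ (Fin n) → M}
    {U : Set (EuclideanSpace ℝ (Fin n))} (h : IsParam Φ U) : IsMetricOn (pullMetric Φ) U where
  isOpen := h.isOpen
  contDiffOn := contDiffOn_pullMetric h.isOpen h.contMDiffOn
  symm y _ u v := by rw [pullMetric_apply, pullMetric_apply, ip_symm]
  pos y hy u hu := ip_pos _ fun h0 ↦ hu (h.injective y hy (by rw [h0, map_zero]))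

end Metric

end Param

section Param

variable {n : ℕ} {M : Type*} [TopologicalSpace M] [ChartedSpace (EuclideanSpace ℝ (Fin n)) M]

theorem tang_comp {Φ : EuclideanSpace ℝ (Fin n) → M}
    {ψ : EuclideanSpace ℝ (Fin n) → EuclideanSpace ℝ (Fin n)} {y : EuclideanSpace ℝ (Fin n)}
    (hΦ : MDifferentiableAt 𝓘(ℝ, EuclideanSpace ℝ (Fin n)) (𝓡 n) Φ (ψ y))
    (hψ : DifferentiableAt ℝ ψ y) (u : EuclideanSpace ℝ (Fin n)) :
    tang (fun z ↦ Φ (ψ z)) y u = tang Φ (ψ y) (fderiv ℝ ψ y u) := by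
  have h3 := (hΦ.hasMFDerivAt.comp y hψ.hasFDerivAt.hasMFDerivAt).mfderiv
  exact congrArg (fun L : EuclideanSpace ℝ (Fin n) →L[ℝ] EuclideanSpace ℝ (Fin n) ↦ L u) h3

theorem tang_congr {Φ Φ' : EuclideanSpace ℝ (Fin n) → M} {y : EuclideanSpace ℝ (Fin n)}
    (h : Φ =ᶠ[nhds y] Φ') : tang Φ y = tang Φ' y :=
  h.mfderiv_eq (I := 𝓘(ℝ, EuclideanSpace ℝ (Fin n))) (I' := 𝓡 n)

theorem contMDiffAt_comp_real {Φ : EuclideanSpace ℝ (Fin n) → M}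
    {x : ℝ → EuclideanSpace ℝ (Fin n)} {t : ℝ}
    (hΦ : ContMDiffAt 𝓘(ℝ, EuclideanSpace ℝ (Fin n)) (𝓡 n) ∞ Φ (x t))
    (hx : ContDiffAt ℝ ∞ x t) : ContMDiffAt 𝓘(ℝ, ℝ) (𝓡 n) ∞ (fun s ↦ Φ (x s)) t :=
  hΦ.comp t hx.contMDiffAt

variable [IsManifold (𝓡 n) ∞ M]

theorem contDiffAt_chart_comp {γ : ℝ → M} {t : ℝ} (hγ : ContMDiffAt 𝓘(ℝ, ℝ) (𝓡 n) ∞ γ t)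
    {x₀ : M} (hx : γ t ∈ (extChartAt (𝓡 n) x₀).source) :
    ContDiffAt ℝ ∞ (fun s ↦ extChartAt (𝓡 n) x₀ (γ s)) t := by
  have h1 : ContMDiffAt (𝓡 n) 𝓘(ℝ, EuclideanSpace ℝ (Fin n)) ∞ (extChartAt (𝓡 n) x₀) (γ t) :=
    contMDiffAt_extChartAt' (by simpa using hx)
  exact contMDiffAt_iff_contDiffAt.1 (h1.comp t hγ)

theorem eventually_mem_chart {X : Type*} [TopologicalSpace X] {γ : X → M} {t : X}
    (hγ : ContinuousAt γ t) {x₀ : M}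
    (hx : γ t ∈ (extChartAt (𝓡 n) x₀).source) :
    ∀ᶠ s in nhds t, γ s ∈ (extChartAt (𝓡 n) x₀).source :=
  hγ.eventually ((isOpen_extChartAt_source x₀).mem_nhds hx)

theorem eventually_chart_symm {X : Type*} [TopologicalSpace X] {γ : X → M} {t : X}
    (hγ : ContinuousAt γ t) {x₀ : M}
    (hx : γ t ∈ (extChartAt (𝓡 n) x₀).source) :
    γ =ᶠ[nhds t] fun s ↦ (extChartAt (𝓡 n) x₀).symm (extChartAt (𝓡 n) x₀ (γ s)) := by
  filter_upwards [eventually_mem_chart hγ hx] with s hs using ((extChartAt _ x₀).left_inv hs).symm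

theorem IsParam.tang_chart {Φ : EuclideanSpace ℝ (Fin n) → M}
    {U : Set (EuclideanSpace ℝ (Fin n))} (h : IsParam Φ U) {y : EuclideanSpace ℝ (Fin n)}
    (hy : y ∈ U) {x₀ : M} (hx : Φ y ∈ (extChartAt (𝓡 n) x₀).source)
    (u : EuclideanSpace ℝ (Fin n)) :
    tang (extChartAt (𝓡 n) x₀).symm (extChartAt (𝓡 n) x₀ (Φ y))
      (fderiv ℝ (fun z ↦ extChartAt (𝓡 n) x₀ (Φ z)) y u) = tang Φ y u := by
  rw [← tang_comp (ψ := fun z ↦ extChartAt (𝓡 n) x₀ (Φ z))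
    ((isParam_chart x₀).mdifferentiableAt ((extChartAt (𝓡 n) x₀).map_source hx))
    ((h.contDiffAt_chart hy hx).differentiableAt (by simp)),
    ← tang_congr (eventually_chart_symm (h.contMDiffAt hy).continuousAt hx)]

/-- The differential of a parametrization in a chart, as an isomorphism. -/
theorem IsParam.exists_equiv_fderiv_chart {Φ : EuclideanSpace ℝ (Fin n) → M}
    {U : Set (EuclideanSpace ℝ (Fin n))} (h : IsParam Φ U) {y : EuclideanSpace ℝ (Fin n)}
    (hy : y ∈ U) {x₀ : M} (hx : Φ y ∈ (extChartAt (𝓡 n) x₀).source) :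
    ∃ L : EuclideanSpace ℝ (Fin n) ≃L[ℝ] EuclideanSpace ℝ (Fin n),
      HasFDerivAt (fun z ↦ extChartAt (𝓡 n) x₀ (Φ z))
        (L : EuclideanSpace ℝ (Fin n) →L[ℝ] EuclideanSpace ℝ (Fin n)) y := by
  have hc := h.contDiffAt_chart hy hx
  have hinj : Function.Injective (fderiv ℝ (fun z ↦ extChartAt (𝓡 n) x₀ (Φ z)) y) := by
    refine (injective_iff_map_eq_zero _).2 fun u hu ↦ ?_
    have := h.tang_chart hy hx u
    rw [hu, map_zero] at this
    exact (injective_iff_map_eq_zero _).1 (h.injective y hy) u this.symm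
  let L : EuclideanSpace ℝ (Fin n) ≃L[ℝ] EuclideanSpace ℝ (Fin n) :=
    (LinearEquiv.ofInjectiveEndo (fderiv ℝ (fun z ↦ extChartAt (𝓡 n) x₀ (Φ z)) y :
      EuclideanSpace ℝ (Fin n) →ₗ[ℝ] EuclideanSpace ℝ (Fin n)) hinj).toContinuousLinearEquiv
  exact ⟨L, (hc.differentiableAt (by simp)).hasFDerivAt⟩

/-- A parametrization is a local diffeomorphism in charts. -/
theorem IsParam.exists_localInverse {Φ : EuclideanSpace ℝ (Fin n) → M}
    {U : Set (EuclideanSpace ℝ (Fin n))} (h : IsParam Φ U) {y : EuclideanSpace ℝ (Fin n)}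
    (hy : y ∈ U) : ∃ e : OpenPartialHomeomorph (EuclideanSpace ℝ (Fin n)) (EuclideanSpace ℝ (Fin n)),
      y ∈ e.source ∧ e.source ⊆ U ∧ (∀ z ∈ e.source, Φ z ∈ (extChartAt (𝓡 n) (Φ y)).source) ∧
      (∀ z ∈ e.source, e z = extChartAt (𝓡 n) (Φ y) (Φ z)) ∧ ContDiffOn ℝ ∞ e.symm e.target := by
  set f := fun z ↦ extChartAt (𝓡 n) (Φ y) (Φ z) with hf
  have hx : Φ y ∈ (extChartAt (𝓡 n) (Φ y)).source := mem_extChartAt_source _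
  have hc : ContDiffAt ℝ ∞ f y := h.contDiffAt_chart hy hx
  obtain ⟨L, hL⟩ := h.exists_equiv_fderiv_chart hy hx
  let e := hc.toOpenPartialHomeomorph f hL (by simp)
  have hye : y ∈ e.source := hc.mem_toOpenPartialHomeomorph_source hL (by simp)
  obtain ⟨W, hWs, hWo, hyW⟩ := mem_nhds_iff.1 (Filter.inter_mem (h.isOpen.mem_nhds hy)
    (eventually_mem_chart (h.contMDiffAt hy).continuousAt hx))
  refine ⟨e.restrOpen W hWo, ⟨hye, hyW⟩, fun z hz ↦ (hWs hz.2).1, fun z hz ↦ (hWs hz.2).2,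
    fun z hz ↦ rfl, fun z hz ↦ ContDiffAt.contDiffWithinAt ?_⟩
  have hz' := (e.restrOpen W hWo).map_target hz
  have hzW := hWs hz'.2
  obtain ⟨L', hL'⟩ := h.exists_equiv_fderiv_chart hzW.1 hzW.2
  exact (e.restrOpen W hWo).contDiffAt_symm hz hL' (h.contDiffAt_chart hzW.1 hzW.2)

/-- Two parametrizations are related by a local diffeomorphism where their images meet. -/
theorem IsParam.exists_transition {Φ Φ' : EuclideanSpace ℝ (Fin n) → M}
    {U U' : Set (EuclideanSpace ℝ (Fin n))} (h : IsParam Φ U) (h' : IsParam Φ' U')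
    {y y' : EuclideanSpace ℝ (Fin n)} (hy : y ∈ U) (hy' : y' ∈ U') (hyy : Φ y = Φ' y') :
    ∃ (ψ : EuclideanSpace ℝ (Fin n) → EuclideanSpace ℝ (Fin n))
      (N : Set (EuclideanSpace ℝ (Fin n))), IsOpen N ∧ y ∈ N ∧ N ⊆ U ∧ ContDiffOn ℝ ∞ ψ N ∧
      MapsTo ψ N U' ∧ ψ y = y' ∧ ∀ z ∈ N, Φ' (ψ z) = Φ z := by
  obtain ⟨e, h1, h2, h3, h4, h5⟩ := h'.exists_localInverse hy'
  have hx : Φ y ∈ (extChartAt (𝓡 n) (Φ' y')).source := hyy ▸ mem_extChartAt_source _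
  have hf := h.contDiffAt_chart hy hx
  have hey : e y' = extChartAt (𝓡 n) (Φ' y') (Φ y) := by rw [h4 _ h1, hyy]
  have hev : ∀ᶠ z in nhds y, (z ∈ U ∧ Φ z ∈ (extChartAt (𝓡 n) (Φ' y')).source) ∧
      extChartAt (𝓡 n) (Φ' y') (Φ z) ∈ e.target := by
    refine Filter.Eventually.and (Filter.Eventually.and (h.isOpen.mem_nhds hy)
      (eventually_mem_chart (h.contMDiffAt hy).continuousAt hx)) ?_
    refine hf.continuousAt.eventually (e.open_target.mem_nhds ?_)
    beta_reduce
    rw [← hey]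
    exact e.map_source h1
  obtain ⟨W, hWs, hWo, hyW⟩ := mem_nhds_iff.1 hev
  refine ⟨fun z ↦ e.symm (extChartAt (𝓡 n) (Φ' y') (Φ z)), W, hWo, hyW,
    fun z hz ↦ (hWs hz).1.1, ?_, fun z hz ↦ h2 (e.map_target (hWs hz).2), ?_, ?_⟩
  · intro z hz
    obtain ⟨⟨a, b⟩, c⟩ := hWs hz
    exact ((h5.contDiffAt (e.open_target.mem_nhds c)).comp z
      (h.contDiffAt_chart a b)).contDiffWithinAt
  · simp only [← hey]
    exact e.left_inv h1
  · intro z hz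
    obtain ⟨⟨a, b⟩, c⟩ := hWs hz
    have h6 := h4 _ (e.map_target c)
    rw [e.right_inv c] at h6
    exact ((extChartAt (𝓡 n) (Φ' y')).injOn (h3 _ (e.map_target c)) b h6.symm)

section Metric

variable [RiemannianBundle (fun x : M ↦ TangentSpace (𝓡 n) x)]

theorem IsParam.isIsomOn {Φ Φ' : EuclideanSpace ℝ (Fin n) → M}
    {U' N : Set (EuclideanSpace ℝ (Fin n))} (h' : IsParam Φ' U')
    {ψ : EuclideanSpace ℝ (Fin n) → EuclideanSpace ℝ (Fin n)} (hN : IsOpen N)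
    (hψ : ContDiffOn ℝ ∞ ψ N) (hm : MapsTo ψ N U') (hc : ∀ z ∈ N, Φ' (ψ z) = Φ z) :
    IsIsomOn ψ (pullMetric Φ) (pullMetric Φ') N where
  isOpen := hN
  contDiffOn := hψ
  apply y hy u v := by
    have h1 : Φ =ᶠ[nhds y] fun z ↦ Φ' (ψ z) := by
      filter_upwards [hN.mem_nhds hy] with z hz using (hc z hz).symm
    have hd := (hψ.contDiffAt (hN.mem_nhds hy)).differentiableAt (by simp)
    rw [pullMetric_apply, pullMetric_apply, hc y hy, tang_congr h1,
      tang_comp (h'.mdifferentiableAt (hm hy)) hd, tang_comp (h'.mdifferentiableAt (hm hy)) hd]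

variable [IsContMDiffRiemannianBundle (𝓡 n) ∞ (EuclideanSpace ℝ (Fin n))
      (fun x : M ↦ TangentSpace (𝓡 n) x)]

/-- The coordinate expression of a parametrization in a chart is a local isometry. -/
theorem IsParam.isIsomOn_chart {Φ : EuclideanSpace ℝ (Fin n) → M}
    {U : Set (EuclideanSpace ℝ (Fin n))} (h : IsParam Φ U) (x₀ : M) :
    IsIsomOn (fun z ↦ extChartAt (𝓡 n) x₀ (Φ z)) (pullMetric Φ)
      (pullMetric (extChartAt (𝓡 n) x₀).symm) (U ∩ Φ ⁻¹' (extChartAt (𝓡 n) x₀).source) := by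
  refine (isParam_chart x₀).isIsomOn ?_ (fun z hz ↦ ?_) (fun z hz ↦ ?_) (fun z hz ↦ ?_)
  · exact h.contMDiffOn.continuousOn.isOpen_inter_preimage h.isOpen (isOpen_extChartAt_source x₀)
  · exact (h.contDiffAt_chart hz.1 hz.2).contDiffWithinAt
  · exact (extChartAt (𝓡 n) x₀).map_source hz.2
  · exact (extChartAt (𝓡 n) x₀).left_inv hz.2

variable (n) in
/-- The curve `γ` is smooth at `t` and its covariant acceleration vanishes there. -/
def GeoAt (γ : ℝ → M) (t : ℝ) : Prop :=
  ContMDiffAt 𝓘(ℝ, ℝ) (𝓡 n) ∞ γ t ∧ ∀ x₀ : M, γ t ∈ (extChartAt (𝓡 n) x₀).source →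
    accel (pullMetric (extChartAt (𝓡 n) x₀).symm) (fun s ↦ extChartAt (𝓡 n) x₀ (γ s)) t = 0

theorem accel_congr {E : Type*} [NormedAddCommGroup E] [NormedSpace ℝ E]
    (g : E → E →L[ℝ] E →L[ℝ] ℝ) {x x' : ℝ → E} {t : ℝ} (h : x =ᶠ[nhds t] x') :
    accel g x t = accel g x' t := by
  simp only [accel, h.deriv.deriv_eq, h.deriv_eq, h.self_of_nhds]

theorem GeoAt.congr {γ γ' : ℝ → M} {t : ℝ} (hγ : GeoAt n γ t) (h : γ =ᶠ[nhds t] γ') :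
    GeoAt n γ' t := by
  refine ⟨hγ.1.congr_of_eventuallyEq h.symm, fun x₀ hx ↦ ?_⟩
  rw [← h.self_of_nhds] at hx
  rw [← hγ.2 x₀ hx]
  refine accel_congr _ ?_
  filter_upwards [h] with s hs
  rw [hs]

/-- The geodesic equation may be checked in any parametrization. -/
theorem IsParam.geoAt_iff {Φ : EuclideanSpace ℝ (Fin n) → M}
    {U : Set (EuclideanSpace ℝ (Fin n))} (h : IsParam Φ U) {x : ℝ → EuclideanSpace ℝ (Fin n)}
    {t : ℝ} (hx : ContDiffAt ℝ ∞ x t) (hU : x t ∈ U) :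
    GeoAt n (fun s ↦ Φ (x s)) t ↔ accel (pullMetric Φ) x t = 0 := by
  have key (x₀ : M) (hx₀ : Φ (x t) ∈ (extChartAt (𝓡 n) x₀).source) :
      accel (pullMetric (extChartAt (𝓡 n) x₀).symm) (fun s ↦ extChartAt (𝓡 n) x₀ (Φ (x s))) t = 0 ↔
      accel (pullMetric Φ) x t = 0 := by
    have hi := h.isIsomOn_chart x₀
    have hg' := h.isMetricOn
    have hg'' : IsMetricOn (pullMetric Φ) (U ∩ Φ ⁻¹' (extChartAt (𝓡 n) x₀).source) :=
      ⟨hi.isOpen, hg'.contDiffOn.mono inter_subset_left, fun y hy ↦ hg'.symm y hy.1,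
        fun y hy ↦ hg'.pos y hy.1⟩
    have := hi.accel_comp hg'' (isParam_chart x₀).isMetricOn
      (fun z hz ↦ (extChartAt (𝓡 n) x₀).map_source hz.2) ⟨hU, hx₀⟩
      (hx.of_le (by norm_cast)) rfl
    simp only [Function.comp_def] at this
    rw [this]
    constructor
    · intro h0
      exact (injective_iff_map_eq_zero _).1 (hi.fderiv_injective hg'' ⟨hU, hx₀⟩) _ h0
    · intro h0
      rw [h0, map_zero]
  constructor
  · intro hγ
    exact (key _ (mem_extChartAt_source _)).1 (hγ.2 _ (mem_extChartAt_source _))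
  · intro h0
    exact ⟨contMDiffAt_comp_real (h.contMDiffAt hU) hx, fun x₀ hx₀ ↦ (key x₀ hx₀).2 h0⟩

theorem geoAt_of_chart {γ : ℝ → M} {t : ℝ} (hγ : ContMDiffAt 𝓘(ℝ, ℝ) (𝓡 n) ∞ γ t) {x₀ : M}
    (hx : γ t ∈ (extChartAt (𝓡 n) x₀).source)
    (h0 : accel (pullMetric (extChartAt (𝓡 n) x₀).symm) (fun s ↦ extChartAt (𝓡 n) x₀ (γ s)) t = 0) :
    GeoAt n γ t := by
  refine (((isParam_chart x₀).geoAt_iff (contDiffAt_chart_comp hγ hx)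
    ((extChartAt (𝓡 n) x₀).map_source hx)).2 h0).congr ?_
  exact (eventually_chart_symm hγ.continuousAt hx).symm

end Metric
end Param

/-! ### Classical tensor calculus in charts -/

section Classical

variable {n : ℕ} {M : Type*} [TopologicalSpace M] [ChartedSpace (EuclideanSpace ℝ (Fin n)) M]
  [IsManifold (𝓡 n) ∞ M] [RiemannianBundle (fun x : M ↦ TangentSpace (𝓡 n) x)]

theorem euclidean_eq_sum (u : EuclideanSpace ℝ (Fin n)) :
    u = ∑ i, u i • EuclideanSpace.single i (1 : ℝ) := by
  have := (EuclideanSpace.basisFun (Fin n) ℝ).sum_repr u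
  simpa using this.symm

theorem metricCoeff_eq (x₀ : M) (y : EuclideanSpace ℝ (Fin n)) (i j : Fin n) :
    metricCoeff n x₀ y i j = pullMetric (extChartAt (𝓡 n) x₀).symm y
      (EuclideanSpace.single i (1 : ℝ)) (EuclideanSpace.single j (1 : ℝ)) := rfl

theorem metricForm_eq (x₀ : M) (y u v : EuclideanSpace ℝ (Fin n)) :
    metricForm n x₀ y u v = pullMetric (extChartAt (𝓡 n) x₀).symm y u v := by
  conv_rhs => rw [euclidean_eq_sum u, euclidean_eq_sum v]
  simp only [metricForm, metricCoeff_eq, map_sum, sum_apply, map_smul,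
    smul_apply, smul_eq_mul, Finset.mul_sum]
  rw [Finset.sum_comm]
  refine Finset.sum_congr rfl fun i _ ↦ Finset.sum_congr rfl fun j _ ↦ ?_
  ring

variable [IsContMDiffRiemannianBundle (𝓡 n) ∞ (EuclideanSpace ℝ (Fin n))
      (fun x : M ↦ TangentSpace (𝓡 n) x)]

theorem partialDeriv_metricCoeff (x₀ : M) {y : EuclideanSpace ℝ (Fin n)}
    (hy : y ∈ (extChartAt (𝓡 n) x₀).target) (i j l : Fin n) :
    partialDeriv n i (fun z ↦ metricCoeff n x₀ z j l) y =
      fderiv ℝ (pullMetric (extChartAt (𝓡 n) x₀).symm) y (EuclideanSpace.single i (1 : ℝ))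
        (EuclideanSpace.single j (1 : ℝ)) (EuclideanSpace.single l (1 : ℝ)) := by
  have h := (((isParam_chart x₀).isMetricOn.differentiableAt hy).hasFDerivAt.clm_apply
    (hasFDerivAt_const (EuclideanSpace.single j (1 : ℝ)) y)).clm_apply
    (hasFDerivAt_const (EuclideanSpace.single l (1 : ℝ)) y)
  simp only [partialDeriv, metricCoeff_eq]
  rw [h.fderiv]
  simp

theorem isUnit_det_metricCoeff (x₀ : M) {y : EuclideanSpace ℝ (Fin n)}
    (hy : y ∈ (extChartAt (𝓡 n) x₀).target) : IsUnit (metricCoeff n x₀ y).det := by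
  rw [← Matrix.isUnit_iff_isUnit_det, ← Matrix.mulVec_injective_iff_isUnit]
  refine (injective_iff_map_eq_zero (Matrix.mulVecLin (metricCoeff n x₀ y))).2 fun u hu ↦ ?_
  have h1 : pullMetric (extChartAt (𝓡 n) x₀).symm y (WithLp.toLp 2 u) (WithLp.toLp 2 u) = 0 := by
    rw [← metricForm_eq]
    simp only [metricForm]
    refine Finset.sum_eq_zero fun i _ ↦ ?_
    have h2 : ∑ j, metricCoeff n x₀ y i j * u j = 0 := congrFun hu i
    have h3 : ∑ j, metricCoeff n x₀ y i j * u i * u j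
        = u i * ∑ j, metricCoeff n x₀ y i j * u j := by
      rw [Finset.mul_sum]
      exact Finset.sum_congr rfl fun j _ ↦ by ring
    exact h3.trans (by rw [h2, mul_zero])
  have h4 := (isParam_chart x₀).isMetricOn.eq_zero_of_apply_self hy h1
  exact congrArg WithLp.ofLp h4

theorem christoffel_eq (x₀ : M) {y : EuclideanSpace ℝ (Fin n)}
    (hy : y ∈ (extChartAt (𝓡 n) x₀).target) (k i j : Fin n) :
    christoffel n x₀ k i j y = chris (pullMetric (extChartAt (𝓡 n) x₀).symm) y
      (EuclideanSpace.single i (1 : ℝ)) (EuclideanSpace.single j (1 : ℝ)) k := by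
  have hg := (isParam_chart (n := n) x₀).isMetricOn
  set g := pullMetric (extChartAt (𝓡 n) x₀).symm with hgdef
  let b : Fin n → ℝ := fun l ↦ koszulForm g y (EuclideanSpace.single i (1 : ℝ))
    (EuclideanSpace.single j (1 : ℝ)) (EuclideanSpace.single l (1 : ℝ))
  have h1 (k : Fin n) : christoffel n x₀ k i j y =
      Matrix.mulVec (metricCoeff n x₀ y)⁻¹ b k := by
    simp only [christoffel, partialDeriv_metricCoeff x₀ hy, Matrix.mulVec, dotProduct, b,
      koszulForm_apply, ← hgdef, Finset.mul_sum]
    refine Finset.sum_congr rfl fun l _ ↦ ?_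
    ring
  have h2 : (WithLp.toLp 2 (Matrix.mulVec (metricCoeff n x₀ y)⁻¹ b) : EuclideanSpace ℝ (Fin n)) =
      chris g y (EuclideanSpace.single i (1 : ℝ)) (EuclideanSpace.single j (1 : ℝ)) := by
    refine hg.eq_chris_of_apply hy fun w ↦ ?_
    rw [hg.symm y hy]
    conv_lhs => rw [euclidean_eq_sum w]
    conv_rhs => rw [euclidean_eq_sum w]
    simp only [map_sum, sum_apply, map_smul, smul_apply, smul_eq_mul]
    refine Finset.sum_congr rfl fun l _ ↦ ?_
    congr 1
    have h3 : Matrix.mulVec (metricCoeff n x₀ y) (Matrix.mulVec (metricCoeff n x₀ y)⁻¹ b) = b := by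
      rw [Matrix.mulVec_mulVec, Matrix.mul_nonsing_inv _ (isUnit_det_metricCoeff x₀ hy),
        Matrix.one_mulVec]
    have h4 := congrFun h3 l
    refine Eq.trans ?_ h4
    rw [← metricForm_eq]
    simp only [metricForm, Matrix.mulVec, dotProduct]
    rw [Finset.sum_eq_single l]
    · simp
    · intro m _ hm
      simp [hm]
    · simp
  rw [h1, ← h2]

theorem sum_chris (x₀ : M) {y : EuclideanSpace ℝ (Fin n)}
    (hy : y ∈ (extChartAt (𝓡 n) x₀).target) (k : Fin n) (u v : EuclideanSpace ℝ (Fin n)) :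
    ∑ i, ∑ j, christoffel n x₀ k i j y * u i * v j =
      chris (pullMetric (extChartAt (𝓡 n) x₀).symm) y u v k := by
  conv_rhs => rw [euclidean_eq_sum u, euclidean_eq_sum v]
  simp only [map_sum, sum_apply, map_smul, smul_apply]
  simp only [WithLp.ofLp_sum, Finset.sum_apply, PiLp.smul_apply, smul_eq_mul, christoffel_eq x₀ hy,
    Finset.mul_sum]
  rw [Finset.sum_comm]
  refine Finset.sum_congr rfl fun i _ ↦ Finset.sum_congr rfl fun j _ ↦ ?_
  ring

theorem curvatureCoeff_eq (x₀ : M) {y : EuclideanSpace ℝ (Fin n)}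
    (hy : y ∈ (extChartAt (𝓡 n) x₀).target) (l i j k : Fin n) :
    curvatureCoeff n x₀ l i j k y = curv (pullMetric (extChartAt (𝓡 n) x₀).symm) y
      (EuclideanSpace.single i (1 : ℝ)) (EuclideanSpace.single j (1 : ℝ))
      (EuclideanSpace.single k (1 : ℝ)) l := by
  have hg := (isParam_chart (n := n) x₀).isMetricOn
  set g := pullMetric (extChartAt (𝓡 n) x₀).symm with hgdef
  have h1 (i j k : Fin n) : partialDeriv n i (christoffel n x₀ l j k) y =
      fderiv ℝ (chris g) y (EuclideanSpace.single i (1 : ℝ)) (EuclideanSpace.single j (1 : ℝ))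
      (EuclideanSpace.single k (1 : ℝ)) l := by
    have d1 := ((hg.differentiableAt_chris hy).hasFDerivAt.clm_apply
      (hasFDerivAt_const (EuclideanSpace.single j (1 : ℝ)) y)).clm_apply
      (hasFDerivAt_const (EuclideanSpace.single k (1 : ℝ)) y)
    have d2 := (EuclideanSpace.proj (𝕜 := ℝ) l).hasFDerivAt.comp y d1
    have d3 : christoffel n x₀ l j k =ᶠ[nhds y] fun z ↦ chris g z
        (EuclideanSpace.single j (1 : ℝ)) (EuclideanSpace.single k (1 : ℝ)) l := by
      filter_upwards [hg.mem_nhds hy] with z hz using christoffel_eq x₀ hz l j k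
    simp only [partialDeriv]
    rw [d3.fderiv_eq]
    have d4 : HasFDerivAt (fun z ↦ chris g z
        (EuclideanSpace.single j (1 : ℝ)) (EuclideanSpace.single k (1 : ℝ)) l) _ y := d2
    rw [d4.fderiv]
    simp
  have h2 (i j k : Fin n) : ∑ m, christoffel n x₀ m j k y * christoffel n x₀ l i m y =
      chris g y (EuclideanSpace.single i (1 : ℝ)) (chris g y (EuclideanSpace.single j (1 : ℝ))
        (EuclideanSpace.single k (1 : ℝ))) l := by
    conv_rhs => rw [euclidean_eq_sum (chris g y (EuclideanSpace.single j (1 : ℝ))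
      (EuclideanSpace.single k (1 : ℝ)))]
    simp only [map_sum, map_smul, WithLp.ofLp_sum, Finset.sum_apply, PiLp.smul_apply, smul_eq_mul,
      christoffel_eq x₀ hy, ← hgdef]
  simp only [curvatureCoeff, h1, Finset.sum_sub_distrib, h2, curv]
  simp

theorem curvatureVec_eq (x₀ : M) {y : EuclideanSpace ℝ (Fin n)}
    (hy : y ∈ (extChartAt (𝓡 n) x₀).target) (u v w : EuclideanSpace ℝ (Fin n)) :
    curvatureVec n x₀ y u v w = curv (pullMetric (extChartAt (𝓡 n) x₀).symm) y u v w := by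
  set g := pullMetric (extChartAt (𝓡 n) x₀).symm with hgdef
  have a1 {ι : Type} (s : Finset ι) (c : ι → ℝ) (f : ι → EuclideanSpace ℝ (Fin n))
      (v w : EuclideanSpace ℝ (Fin n)) :
      curv g y (∑ i ∈ s, c i • f i) v w = ∑ i ∈ s, c i • curv g y (f i) v w := by
    simp only [curv, map_sum, map_smul, sum_apply, smul_apply,
      ← Finset.sum_sub_distrib, ← Finset.sum_add_distrib, ← smul_sub, ← smul_add]
  have a2 {ι : Type} (s : Finset ι) (c : ι → ℝ) (f : ι → EuclideanSpace ℝ (Fin n))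
      (u w : EuclideanSpace ℝ (Fin n)) :
      curv g y u (∑ i ∈ s, c i • f i) w = ∑ i ∈ s, c i • curv g y u (f i) w := by
    simp only [curv, map_sum, map_smul, sum_apply, smul_apply,
      ← Finset.sum_sub_distrib, ← Finset.sum_add_distrib, ← smul_sub, ← smul_add]
  have a3 {ι : Type} (s : Finset ι) (c : ι → ℝ) (f : ι → EuclideanSpace ℝ (Fin n))
      (u v : EuclideanSpace ℝ (Fin n)) :
      curv g y u v (∑ i ∈ s, c i • f i) = ∑ i ∈ s, c i • curv g y u v (f i) := by
    simp only [curv, map_sum, map_smul,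
      ← Finset.sum_sub_distrib, ← Finset.sum_add_distrib, ← smul_sub, ← smul_add]
  conv_rhs => rw [euclidean_eq_sum u, euclidean_eq_sum v, euclidean_eq_sum w]
  ext l
  simp only [a1, a2, a3, WithLp.ofLp_sum, Finset.sum_apply, PiLp.smul_apply, smul_eq_mul,
    curvatureVec, curvatureCoeff_eq x₀ hy, ← hgdef, Finset.mul_sum]
  refine Finset.sum_congr rfl fun i _ ↦ Finset.sum_congr rfl fun j _ ↦
    Finset.sum_congr rfl fun k _ ↦ ?_
  ring

/-- The curvature bound in a chart, as an inequality for all pairs of vectors. -/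
theorem secLEOne_chart (hsec : SectionalCurvatureLE n M 1) (x₀ : M) :
    SecLEOne (pullMetric (extChartAt (𝓡 n) x₀).symm) (extChartAt (𝓡 n) x₀).target := by
  intro y hy u v
  have hg := (isParam_chart (n := n) x₀).isMetricOn
  set g := pullMetric (extChartAt (𝓡 n) x₀).symm with hgdef
  have hCS := hg.cauchySchwarz hy u v
  by_cases hli : LinearIndependent ℝ ![u, v]
  · have h1 := hsec x₀ y hy u v hli
    simp only [sectionalCurvature, metricForm_eq, curvatureVec_eq x₀ hy, ← hgdef] at h1
    have hv : v ≠ 0 := hli.ne_zero 1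
    have hD : 0 < g y u u * g y v v - g y u v ^ 2 := by
      have hw : g y v v • u - g y u v • v ≠ 0 := by
        intro h0
        have := (LinearIndependent.pair_iff.1 hli (g y v v) (-g y u v)
          (by rw [neg_smul, ← sub_eq_add_neg, h0])).1
        exact (hg.pos y hy v hv).ne' this
      have h2 := hg.pos y hy _ hw
      have h3 := hg.symm y hy u v
      simp only [map_sub, map_smul, sub_apply, smul_apply, smul_eq_mul, ← h3] at h2
      have h4 : 0 < g y v v * (g y u u * g y v v - g y u v ^ 2) := by nlinarith [h2]
      exact pos_of_mul_pos_right h4 (hg.pos y hy v hv).le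
    exact (div_le_one hD).1 h1
  · rw [LinearIndependent.pair_iff] at hli
    push Not at hli
    -- For linearly dependent vectors the curvature term vanishes.
    obtain ⟨s, t, hst, hne⟩ := hli
    have h0 : g y (curv g y u v v) u = 0 := by
      by_cases hs : s = 0
      · have ht := hne hs
        rw [hs, zero_smul, zero_add] at hst
        have hv0 := (smul_eq_zero.1 hst).resolve_left ht
        simp [curv, hv0]
      · have hu : u = (-(s⁻¹ * t)) • v := by
          have h5 : s • u = -(t • v) := eq_neg_of_add_eq_zero_left hst
          have h6 : u = s⁻¹ • s • u := (inv_smul_smul₀ hs u).symm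
          rw [h6, h5, neg_smul, smul_neg, smul_smul]
        have : curv g y u v v = 0 := by
          rw [hu]
          simp [curv]
        rw [this, map_zero, zero_apply]
    rw [h0]
    linarith

/-- The curvature bound in an arbitrary parametrization. -/
theorem IsParam.secLEOne (hsec : SectionalCurvatureLE n M 1) {Φ : EuclideanSpace ℝ (Fin n) → M}
    {U : Set (EuclideanSpace ℝ (Fin n))} (h : IsParam Φ U) : SecLEOne (pullMetric Φ) U := by
  intro y hy u v
  have hi := h.isIsomOn_chart (Φ y)
  have hg' : IsMetricOn (pullMetric Φ) (U ∩ Φ ⁻¹' (extChartAt (𝓡 n) (Φ y)).source) :=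
    ⟨hi.isOpen, h.isMetricOn.contDiffOn.mono inter_subset_left,
      fun y hy ↦ h.isMetricOn.symm y hy.1, fun y hy ↦ h.isMetricOn.pos y hy.1⟩
  exact hi.secLEOne hg' (isParam_chart (Φ y)).isMetricOn
    (fun z hz ↦ (extChartAt (𝓡 n) (Φ y)).map_source hz.2) (secLEOne_chart hsec (Φ y))
    y ⟨hy, mem_extChartAt_source _⟩ u v

/-- The geodesic equation in its classical form. -/
theorem classical_geodesic_iff (x₀ : M) {γ : ℝ → M} {t : ℝ}
    (hγ : ContMDiffAt 𝓘(ℝ, ℝ) (𝓡 n) ∞ γ t) (hx : γ t ∈ (extChartAt (𝓡 n) x₀).source) :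
    (∀ k : Fin n, deriv (deriv fun s ↦ extChartAt (𝓡 n) x₀ (γ s) k) t
      + ∑ i, ∑ j, christoffel n x₀ k i j (extChartAt (𝓡 n) x₀ (γ t))
        * deriv (fun s ↦ extChartAt (𝓡 n) x₀ (γ s) i) t
        * deriv (fun s ↦ extChartAt (𝓡 n) x₀ (γ s) j) t = 0) ↔
      accel (pullMetric (extChartAt (𝓡 n) x₀).symm) (fun s ↦ extChartAt (𝓡 n) x₀ (γ s)) t = 0 := by
  have hc := contDiffAt_chart_comp hγ hx
  set x := fun s ↦ extChartAt (𝓡 n) x₀ (γ s) with hxdef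
  have proj {f : ℝ → EuclideanSpace ℝ (Fin n)} {s : ℝ} (hf : DifferentiableAt ℝ f s) (k : Fin n) :
      deriv (fun s ↦ f s k) s = deriv f s k :=
    ((EuclideanSpace.proj (𝕜 := ℝ) k).hasFDerivAt.comp_hasDerivAt s hf.hasDerivAt).deriv
  have hev : ∀ᶠ s in nhds t, DifferentiableAt ℝ x s := by
    have : ContDiffAt ℝ 1 x t := hc.of_le (by norm_cast)
    filter_upwards [this.eventually (by simp)] with s hs using hs.differentiableAt (by simp)
  have hd2 : DifferentiableAt ℝ (deriv x) t := by
    have h1 : ContDiffAt ℝ 1 (fderiv ℝ x) t := hc.fderiv_right (m := 1) (by norm_cast)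
    have h2 : ContDiffAt ℝ 1 (deriv x) t := h1.clm_apply contDiffAt_const
    exact h2.differentiableAt (by simp)
  have h2 (k : Fin n) : deriv (deriv fun s ↦ x s k) t = deriv (deriv x) t k := by
    have : deriv (fun s ↦ x s k) =ᶠ[nhds t] fun s ↦ deriv x s k := by
      filter_upwards [hev] with s hs using proj hs k
    rw [this.deriv_eq, proj hd2]
  have hy := (extChartAt (𝓡 n) x₀).map_source hx
  have h3 : ∀ k, (deriv (deriv fun s ↦ x s k) t
      + ∑ i, ∑ j, christoffel n x₀ k i j (extChartAt (𝓡 n) x₀ (γ t))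
        * deriv (fun s ↦ x s i) t * deriv (fun s ↦ x s j) t) =
      accel (pullMetric (extChartAt (𝓡 n) x₀).symm) x t k := by
    intro k
    simp only [h2, proj hev.self_of_nhds, accel, PiLp.add_apply]
    rw [sum_chris x₀ hy]
  constructor
  · intro h
    ext k
    rw [← h3]
    exact h k
  · intro h k
    exact (h3 k).trans (by rw [h]; rfl)

theorem IsGeodesicOn.geoAt {γ : ℝ → M} {a b : ℝ} (h : IsGeodesicOn n γ a b) {t : ℝ}
    (ht : t ∈ Ioo a b) : GeoAt n γ t := by
  have h1 : ContMDiffAt 𝓘(ℝ, ℝ) (𝓡 n) ∞ γ t := h.1.contMDiffAt (Icc_mem_nhds ht.1 ht.2)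
  exact ⟨h1, fun x₀ hx ↦ (classical_geodesic_iff x₀ h1 hx).1 (h.2 x₀ t ht hx)⟩

theorem isGeodesicOn_of_geoAt {γ : ℝ → M} {a b : ℝ}
    (h : ContMDiffOn 𝓘(ℝ, ℝ) (𝓡 n) ∞ γ (Icc a b)) (hγ : ∀ t ∈ Ioo a b, GeoAt n γ t) :
    IsGeodesicOn n γ a b :=
  ⟨h, fun x₀ t ht hx ↦ (classical_geodesic_iff x₀ (hγ t ht).1 hx).2 ((hγ t ht).2 x₀ hx)⟩

end Classical

/-! ### Geodesics: uniqueness, gluing and the local flow -/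

section LocalGeodesics

variable {E : Type*} [NormedAddCommGroup E] [NormedSpace ℝ E] [FiniteDimensional ℝ E]
  {g : E → E →L[ℝ] E →L[ℝ] ℝ} {U : Set E}

theorem hasDerivAt_deriv_of_contDiffAt {F : Type*} [NormedAddCommGroup F] [NormedSpace ℝ F]
    {x : ℝ → F} {t : ℝ} (hx : ContDiffAt ℝ 2 x t) :
    HasDerivAt x (deriv x t) t ∧ HasDerivAt (deriv x) (deriv (deriv x) t) t := by
  have h1 : ContDiffAt ℝ 1 (fderiv ℝ x) t := hx.fderiv_right (m := 1) (by norm_num)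
  have h2 : ContDiffAt ℝ 1 (deriv x) t := h1.clm_apply contDiffAt_const
  exact ⟨(hx.differentiableAt (by simp)).hasDerivAt, (h2.differentiableAt (by simp)).hasDerivAt⟩

theorem IsMetricOn.contDiffAt_spray (hg : IsMetricOn g U) {z : E × E} (hz : z.1 ∈ U) :
    ContDiffAt ℝ ∞ (fun z : E × E ↦ (z.2, -chris g z.1 z.2 z.2)) z := by
  have h1 : ContDiffAt ℝ ∞ (fun z : E × E ↦ chris g z.1) z :=
    (hg.contDiffAt_chris hz).comp z contDiffAt_fst
  exact contDiffAt_snd.prodMk ((h1.clm_apply contDiffAt_snd).clm_apply contDiffAt_snd).neg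

theorem IsMetricOn.geodesic_unique (hg : IsMetricOn g U) {x y : ℝ → E} {t : ℝ}
    (hx : ∀ᶠ s in nhds t, ContDiffAt ℝ 2 x s ∧ accel g x s = 0)
    (hy : ∀ᶠ s in nhds t, ContDiffAt ℝ 2 y s ∧ accel g y s = 0)
    (hU : x t ∈ U) (h0 : x t = y t) (h1 : deriv x t = deriv y t) : x =ᶠ[nhds t] y := by
  obtain ⟨K, S, hS, hK⟩ := ((hg.contDiffAt_spray (z := (x t, deriv x t)) hU).of_le
    (m := 1) (by norm_cast)).exists_lipschitzOnWith
  have key {x : ℝ → E} (hx : ∀ᶠ s in nhds t, ContDiffAt ℝ 2 x s ∧ accel g x s = 0)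
      (hS : S ∈ nhds (x t, deriv x t)) : ∀ᶠ s in nhds t,
      HasDerivAt (fun s ↦ (x s, deriv x s)) (deriv x s, -chris g (x s) (deriv x s) (deriv x s)) s ∧
      (x s, deriv x s) ∈ S := by
    have h2 := hasDerivAt_deriv_of_contDiffAt hx.self_of_nhds.1
    have hc : ContinuousAt (fun s ↦ (x s, deriv x s)) t :=
      h2.1.continuousAt.prodMk h2.2.continuousAt
    filter_upwards [hx, hc.eventually hS] with s hs hs'
    have h3 := hasDerivAt_deriv_of_contDiffAt hs.1
    refine ⟨?_, hs'⟩
    have h4 : deriv (deriv x) s = -chris g (x s) (deriv x s) (deriv x s) :=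
      eq_neg_of_add_eq_zero_left hs.2
    rw [← h4]
    exact h3.1.prodMk h3.2
  have h5 := ODE_solution_unique_of_eventually (t₀ := t)
    (v := fun _ (z : E × E) ↦ (z.2, -chris g z.1 z.2 z.2)) (s := fun _ ↦ S) (K := K)
    (f := fun s ↦ (x s, deriv x s)) (g := fun s ↦ (y s, deriv y s))
    (Filter.Eventually.of_forall fun _ ↦ hK) (key hx hS) (key hy (by rw [← h0, ← h1]; exact hS))
    (by rw [h0, h1])
  filter_upwards [h5] with s hs using congrArg Prod.fst hs

/-- The geodesic flow of a metric near a given initial position and velocity. -/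
theorem IsMetricOn.exists_geodesic_flow (hg : IsMetricOn g U) {x₀ : E} (hx : x₀ ∈ U) (v₀ : E) :
    ∃ ε > 0, ∃ X : (E × E) × ℝ → E,
      ContDiffOn ℝ ∞ X (Metric.ball (x₀, v₀) ε ×ˢ Ioo (-ε) ε) ∧
      ∀ z ∈ Metric.ball (x₀, v₀) ε, X (z, 0) = z.1 ∧ deriv (fun s ↦ X (z, s)) 0 = z.2 ∧
        ∀ t ∈ Ioo (-ε) ε, X (z, t) ∈ U ∧ ContDiffAt ℝ ∞ (fun s ↦ X (z, s)) t ∧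
          accel g (fun s ↦ X (z, s)) t = 0 := by
  obtain ⟨r, hr, hrU⟩ := Metric.isOpen_iff.1 hg.isOpen x₀ hx
  -- The cutoff makes the geodesic spray globally defined. It equals one near the initial position,
  -- so that the solutions of the modified equation are geodesics for small times.
  let χ : ContDiffBump x₀ := ⟨r / 3, r / 2, by positivity, by linarith⟩
  have hχU : tsupport χ ⊆ U := by
    rw [χ.tsupport_eq]
    exact (Metric.closedBall_subset_ball (by change r / 2 < r; linarith)).trans hrU
  let f : E × E → E × E := fun z ↦ χ z.1 • (z.2, -chris g z.1 z.2 z.2)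
  have hf : ContDiff ℝ ∞ f := by
    refine contDiff_iff_contDiffAt.2 fun z ↦ ?_
    by_cases hz : z ∈ tsupport f
    swap
    · exact contDiffAt_const.congr_of_eventuallyEq (notMem_tsupport_iff_eventuallyEq.1 hz)
    have h1 : z.1 ∈ tsupport χ := by
      have h2 : Function.support f ⊆ Prod.fst ⁻¹' tsupport χ := fun w hw ↦ by
        refine subset_tsupport _ ?_
        intro h0
        exact hw (by simp only [f, h0, zero_smul])
      exact closure_minimal h2 ((isClosed_tsupport _).preimage continuous_fst) hz
    exact (χ.contDiff.contDiffAt.comp z contDiffAt_fst).smul (hg.contDiffAt_spray (hχU h1))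
  obtain ⟨ε, hε, Φ, hΦ, hΦ'⟩ := exists_contDiffOn_flow hf (x₀, v₀)
  have hopen : IsOpen (Metric.ball (x₀, v₀) ε ×ˢ Ioo (-ε) ε) := Metric.isOpen_ball.prod isOpen_Ioo
  have hmem : ((x₀, v₀), (0 : ℝ)) ∈ Metric.ball (x₀, v₀) ε ×ˢ Ioo (-ε) ε :=
    ⟨Metric.mem_ball_self hε, by simp [hε]⟩
  have hev : ∀ᶠ q in nhds (((x₀, v₀), (0 : ℝ)) : (E × E) × ℝ), (Φ q).1 ∈ Metric.ball x₀ (r / 3) := by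
    have hc : ContinuousAt (fun q ↦ (Φ q).1) (((x₀, v₀), (0 : ℝ)) : (E × E) × ℝ) :=
      (hΦ.contDiffAt (hopen.mem_nhds hmem)).continuousAt.fst
    refine hc.eventually ?_
    simp only [(hΦ' _ hmem.1).1]
    exact Metric.ball_mem_nhds _ (by positivity)
  obtain ⟨δ, hδ, hball⟩ := Metric.eventually_nhds_iff_ball.1 hev
  refine ⟨min ε δ, lt_min hε hδ, fun q ↦ (Φ q).1, ?_, ?_⟩
  · refine contDiff_fst.comp_contDiffOn (hΦ.mono (prod_mono ?_ ?_))
    · exact Metric.ball_subset_ball (min_le_left _ _)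
    · exact Ioo_subset_Ioo (neg_le_neg (min_le_left _ _)) (min_le_left _ _)
  intro z hz
  have hzε : z ∈ Metric.ball (x₀, v₀) ε := Metric.ball_subset_ball (min_le_left _ _) hz
  have hd (t : ℝ) (ht : t ∈ Ioo (-min ε δ) (min ε δ)) : (Φ (z, t)).1 ∈ Metric.ball x₀ (r / 3) ∧
      HasDerivAt (fun s ↦ (Φ (z, s)).1) (Φ (z, t)).2 t ∧
      HasDerivAt (fun s ↦ (Φ (z, s)).2)
        (-chris g (Φ (z, t)).1 (Φ (z, t)).2 (Φ (z, t)).2) t := by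
    have h1 : (Φ (z, t)).1 ∈ Metric.ball x₀ (r / 3) := by
      refine hball _ ?_
      rw [← ball_prod_same]
      refine ⟨Metric.ball_subset_ball (min_le_right _ _) hz, ?_⟩
      rw [Metric.mem_ball, Real.dist_eq, sub_zero, abs_lt]
      exact ⟨(neg_le_neg (min_le_right _ _)).trans_lt ht.1, ht.2.trans_le (min_le_right _ _)⟩
    have h2 := (hΦ' z hzε).2 t
      ⟨(neg_le_neg (min_le_left _ _)).trans_lt ht.1, ht.2.trans_le (min_le_left _ _)⟩
    have h3 : χ (Φ (z, t)).1 = 1 := χ.one_of_mem_closedBall (Metric.ball_subset_closedBall h1)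
    simp only [f, h3, one_smul] at h2
    exact ⟨h1, h2.fst, h2.snd⟩
  have h0 : (0 : ℝ) ∈ Ioo (-min ε δ) (min ε δ) := by
    have := lt_min hε hδ
    exact ⟨by linarith, this⟩
  refine ⟨by simp only [(hΦ' z hzε).1], ?_, fun t ht ↦ ⟨?_, ?_, ?_⟩⟩
  · rw [(hd 0 h0).2.1.deriv, (hΦ' z hzε).1]
  · exact hrU (Metric.ball_subset_ball (by linarith) (hd t ht).1)
  · have h1 : ContDiffAt ℝ ∞ Φ (z, t) := hΦ.contDiffAt (hopen.mem_nhds ⟨hzε,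
      (neg_le_neg (min_le_left _ _)).trans_lt ht.1, ht.2.trans_le (min_le_left _ _)⟩)
    exact contDiffAt_fst.comp t (h1.comp t (contDiffAt_const.prodMk contDiffAt_id))
  · have h1 : deriv (fun s ↦ (Φ (z, s)).1) =ᶠ[nhds t] fun s ↦ (Φ (z, s)).2 := by
      filter_upwards [isOpen_Ioo.mem_nhds ht] with s hs using (hd s hs).2.1.deriv
    simp only [accel]
    rw [h1.deriv_eq, (hd t ht).2.2.deriv, (hd t ht).2.1.deriv, neg_add_cancel]

theorem accel_comp_affine {x : ℝ → E} {a b t : ℝ} (hx : ∀ᶠ s in nhds (a * t + b),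
    ContDiffAt ℝ 2 x s) : accel g (fun s ↦ x (a * s + b)) t = a ^ 2 • accel g x (a * t + b) := by
  have hl (s : ℝ) : HasDerivAt (fun s ↦ a * s + b) a s := by
    simpa using ((hasDerivAt_id s).const_mul a).add_const b
  have h1 : deriv (fun s ↦ x (a * s + b)) =ᶠ[nhds t] fun s ↦ a • deriv x (a * s + b) := by
    filter_upwards [(hl t).continuousAt.eventually hx] with s hs
    exact ((hasDerivAt_deriv_of_contDiffAt hs).1.scomp s (hl s)).deriv
  have h2 : HasDerivAt (fun s ↦ a • deriv x (a * s + b)) (a • a • deriv (deriv x) (a * t + b)) t :=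
    ((hasDerivAt_deriv_of_contDiffAt hx.self_of_nhds).2.scomp t (hl t)).const_smul a
  simp only [accel]
  rw [h1.deriv_eq, h2.deriv, h1.self_of_nhds]
  simp only [map_smul, smul_apply, smul_add, smul_smul, sq]

end LocalGeodesics

section Geodesics

variable {n : ℕ} {M : Type*} [TopologicalSpace M] [ChartedSpace (EuclideanSpace ℝ (Fin n)) M]
  [IsManifold (𝓡 n) ∞ M] [RiemannianBundle (fun x : M ↦ TangentSpace (𝓡 n) x)]
  [IsContMDiffRiemannianBundle (𝓡 n) ∞ (EuclideanSpace ℝ (Fin n))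
      (fun x : M ↦ TangentSpace (𝓡 n) x)]

/-- The velocity in terms of the derivative in a chart. -/
theorem vel_eq_tang {γ : ℝ → M} {t : ℝ} (hγ : ContMDiffAt 𝓘(ℝ, ℝ) (𝓡 n) ∞ γ t) {x₀ : M}
    (hx : γ t ∈ (extChartAt (𝓡 n) x₀).source) :
    vel n γ t = tang (extChartAt (𝓡 n) x₀).symm (extChartAt (𝓡 n) x₀ (γ t))
      (deriv (fun s ↦ extChartAt (𝓡 n) x₀ (γ s)) t) := by
  rw [vel_congr (eventually_chart_symm hγ.continuousAt hx)]
  exact vel_comp (x := fun s ↦ extChartAt (𝓡 n) x₀ (γ s))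
    ((isParam_chart x₀).mdifferentiableAt ((extChartAt (𝓡 n) x₀).map_source hx))
    ((contDiffAt_chart_comp hγ hx).differentiableAt (by simp)).hasDerivAt

theorem deriv_chart_eq_of_vel_eq {γ γ' : ℝ → M} {t : ℝ} (hγ : ContMDiffAt 𝓘(ℝ, ℝ) (𝓡 n) ∞ γ t)
    (hγ' : ContMDiffAt 𝓘(ℝ, ℝ) (𝓡 n) ∞ γ' t) (h0 : γ t = γ' t) (h1 : vel n γ t = vel n γ' t)
    {x₀ : M} (hx : γ t ∈ (extChartAt (𝓡 n) x₀).source) :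
    deriv (fun s ↦ extChartAt (𝓡 n) x₀ (γ s)) t = deriv (fun s ↦ extChartAt (𝓡 n) x₀ (γ' s)) t := by
  rw [vel_eq_tang hγ hx, vel_eq_tang hγ' (h0 ▸ hx), h0] at h1
  exact (isParam_chart x₀).injective _ ((extChartAt (𝓡 n) x₀).map_source (h0 ▸ hx)) h1

theorem GeoAt.eventually_chart {γ : ℝ → M} {t : ℝ} (h : ∀ᶠ s in nhds t, GeoAt n γ s) {x₀ : M}
    (hx : γ t ∈ (extChartAt (𝓡 n) x₀).source) : ∀ᶠ s in nhds t,
    ContDiffAt ℝ 2 (fun s ↦ extChartAt (𝓡 n) x₀ (γ s)) s ∧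
    accel (pullMetric (extChartAt (𝓡 n) x₀).symm) (fun s ↦ extChartAt (𝓡 n) x₀ (γ s)) s = 0 := by
  filter_upwards [h, eventually_mem_chart h.self_of_nhds.1.continuousAt hx] with s hs hs'
  exact ⟨(contDiffAt_chart_comp hs.1 hs').of_le (by norm_cast), hs.2 x₀ hs'⟩

theorem geo_eventuallyEq_of_chart {γ γ' : ℝ → M} {t : ℝ} (h : ∀ᶠ s in nhds t, GeoAt n γ s)
    (h' : ∀ᶠ s in nhds t, GeoAt n γ' s) (h0 : γ t = γ' t)
    (h1 : deriv (fun s ↦ extChartAt (𝓡 n) (γ t) (γ s)) t =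
      deriv (fun s ↦ extChartAt (𝓡 n) (γ t) (γ' s)) t) : γ =ᶠ[nhds t] γ' := by
  have hx : γ t ∈ (extChartAt (𝓡 n) (γ t)).source := mem_extChartAt_source _
  have hx' : γ' t ∈ (extChartAt (𝓡 n) (γ t)).source := h0 ▸ hx
  have h2 := (isParam_chart (n := n) (γ t)).isMetricOn.geodesic_unique
    (GeoAt.eventually_chart h hx) (GeoAt.eventually_chart h' hx')
    ((extChartAt (𝓡 n) (γ t)).map_source hx) (by rw [h0]) h1
  filter_upwards [h2, eventually_mem_chart h.self_of_nhds.1.continuousAt hx,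
    eventually_mem_chart h'.self_of_nhds.1.continuousAt hx'] with s hs a b
  exact (extChartAt (𝓡 n) (γ t)).injOn a b hs

theorem geo_eventuallyEq {γ γ' : ℝ → M} {t : ℝ} (h : ∀ᶠ s in nhds t, GeoAt n γ s)
    (h' : ∀ᶠ s in nhds t, GeoAt n γ' s) (h0 : γ t = γ' t) (h1 : vel n γ t = vel n γ' t) :
    γ =ᶠ[nhds t] γ' :=
  geo_eventuallyEq_of_chart h h' h0
    (deriv_chart_eq_of_vel_eq h.self_of_nhds.1 h'.self_of_nhds.1 h0 h1 (mem_extChartAt_source _))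

/-- Uniqueness of geodesics with given initial position and velocity. -/
theorem geo_eqOn [T2Space M] {γ γ' : ℝ → M} {I : Set ℝ} (hI : IsOpen I) (hI' : IsPreconnected I)
    (h : ∀ t ∈ I, GeoAt n γ t) (h' : ∀ t ∈ I, GeoAt n γ' t) {t₀ : ℝ} (ht₀ : t₀ ∈ I)
    (h0 : γ t₀ = γ' t₀) (h1 : vel n γ t₀ = vel n γ' t₀) : EqOn γ γ' I := by
  have ev {γ : ℝ → M} (h : ∀ t ∈ I, GeoAt n γ t) {t : ℝ} (ht : t ∈ I) :
      ∀ᶠ s in nhds t, GeoAt n γ s := by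
    filter_upwards [hI.mem_nhds ht] with s hs using h s hs
  have hsub : I ⊆ {t | γ =ᶠ[nhds t] γ'} := by
    refine hI'.subset_of_closure_inter_subset isOpen_setOfPred_eventually_nhds
      ⟨t₀, ht₀, geo_eventuallyEq (ev h ht₀) (ev h' ht₀) h0 h1⟩ ?_
    rintro t ⟨htc, ht⟩
    have hfr : ∃ᶠ s in nhds t, γ =ᶠ[nhds s] γ' := mem_closure_iff_frequently.1 htc
    have e0 : γ t = γ' t := tendsto_nhds_unique_of_frequently_eq (h t ht).1.continuousAt
      (h' t ht).1.continuousAt (hfr.mono fun s hs ↦ hs.self_of_nhds)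
    refine geo_eventuallyEq_of_chart (ev h ht) (ev h' ht) e0 ?_
    have hx : γ t ∈ (extChartAt (𝓡 n) (γ t)).source := mem_extChartAt_source _
    have hx' : γ' t ∈ (extChartAt (𝓡 n) (γ t)).source := e0 ▸ hx
    refine tendsto_nhds_unique_of_frequently_eq
      (hasDerivAt_deriv_of_contDiffAt (GeoAt.eventually_chart (ev h ht) hx).self_of_nhds.1
        ).2.continuousAt
      (hasDerivAt_deriv_of_contDiffAt (GeoAt.eventually_chart (ev h' ht) hx').self_of_nhds.1
        ).2.continuousAt (hfr.mono fun s hs ↦ ?_)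
    refine Filter.EventuallyEq.deriv_eq ?_
    filter_upwards [hs] with r hr
    rw [hr]
  exact fun t ht ↦ (hsub ht).self_of_nhds

theorem geo_glue {γ γ' : ℝ → M} {a b c d t₀ : ℝ} (h : ∀ t ∈ Ioo a b, GeoAt n γ t)
    (h' : ∀ t ∈ Ioo c d, GeoAt n γ' t) (hab : t₀ ∈ Ioo a b) (hcd : t₀ ∈ Ioo c d)
    (h0 : γ t₀ = γ' t₀) (h1 : vel n γ t₀ = vel n γ' t₀) :
    ∀ t ∈ Ioo a d, GeoAt n (fun t ↦ if t < t₀ then γ t else γ' t) t := by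
  intro t ht
  rcases lt_trichotomy t t₀ with htt | rfl | htt
  · refine (h t ⟨ht.1, htt.trans hab.2⟩).congr ?_
    filter_upwards [Iio_mem_nhds htt] with s hs
    rw [if_pos (mem_Iio.1 hs)]
  · refine (h t hab).congr ?_
    have := geo_eventuallyEq (Filter.eventually_of_mem (isOpen_Ioo.mem_nhds hab) h)
      (Filter.eventually_of_mem (isOpen_Ioo.mem_nhds hcd) h') h0 h1
    filter_upwards [this] with s hs
    rw [hs, ite_self]
  · refine (h' t ⟨hcd.1.trans htt, ht.2⟩).congr ?_
    filter_upwards [Ioi_mem_nhds htt] with s hs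
    rw [if_neg (not_lt.2 (le_of_lt hs))]

theorem GeoAt.comp_affine {γ : ℝ → M} {a b t : ℝ}
    (h : GeoAt n γ (a * t + b)) : GeoAt n (fun s ↦ γ (a * s + b)) t := by
  have hl : ContDiffAt ℝ ∞ (fun s ↦ a * s + b) t :=
    (contDiffAt_const.mul contDiffAt_id).add contDiffAt_const
  refine ⟨h.1.comp t hl.contMDiffAt, fun x₀ hx ↦ ?_⟩
  have h1 : ContDiffAt ℝ 2 (fun s ↦ extChartAt (𝓡 n) x₀ (γ s)) (a * t + b) :=
    (contDiffAt_chart_comp h.1 hx).of_le (by norm_cast)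
  have := accel_comp_affine (g := pullMetric (extChartAt (𝓡 n) x₀).symm)
    (x := fun s ↦ extChartAt (𝓡 n) x₀ (γ s)) (h1.eventually (by simp))
  rw [this, h.2 x₀ hx, smul_zero]

theorem vel_comp_affine {γ : ℝ → M} {a b t : ℝ} (h : GeoAt n γ (a * t + b)) :
    vel n (fun s ↦ γ (a * s + b)) t = a • vel n γ (a * t + b) := by
  have hl : HasDerivAt (fun s ↦ a * s + b) a t := by
    simpa using ((hasDerivAt_id t).const_mul a).add_const b
  exact vel_comp_real (τ := fun s ↦ a * s + b) (h.1.mdifferentiableAt (by simp)) hl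

end Geodesics

/-! ### The exponential map -/

section Exp

variable {n : ℕ} {M : Type*} [TopologicalSpace M] [ChartedSpace (EuclideanSpace ℝ (Fin n)) M]
  [IsManifold (𝓡 n) ∞ M] [RiemannianBundle (fun x : M ↦ TangentSpace (𝓡 n) x)]
  [IsContMDiffRiemannianBundle (𝓡 n) ∞ (EuclideanSpace ℝ (Fin n))
      (fun x : M ↦ TangentSpace (𝓡 n) x)]

/-- The curve `γ` is a geodesic on the open interval `I` which starts at time `0` at `p` with
velocity `w`. -/
structure IsGeoFrom (p : M) (w : EuclideanSpace ℝ (Fin n)) (γ : ℝ → M) (I : Set ℝ) : Prop where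
  isOpen : IsOpen I
  convex : Convex ℝ I
  zero_mem : 0 ∈ I
  geo : ∀ t ∈ I, GeoAt n γ t
  zero : γ 0 = p
  vel : vel n γ 0 = w

/-- The domain of the exponential map at `p`. -/
def expDom (p : M) : Set (EuclideanSpace ℝ (Fin n)) :=
  {w | ∃ γ I, IsGeoFrom p w γ I ∧ 1 ∈ I}

open Classical in
/-- The exponential map at `p`, with the value `p` outside of its domain. -/
noncomputable def rexp (p : M) (w : EuclideanSpace ℝ (Fin n)) : M :=
  if h : w ∈ expDom p then h.choose 1 else p

variable {p : M} {w : EuclideanSpace ℝ (Fin n)} {γ : ℝ → M} {I : Set ℝ}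

theorem IsGeoFrom.comp_mul (h : IsGeoFrom p w γ I) (r : ℝ) :
    IsGeoFrom p (r • w) (fun t ↦ γ (r * t)) {t | r * t ∈ I} where
  isOpen := h.isOpen.preimage (continuous_const.mul continuous_id)
  convex := h.convex.is_linear_preimage (f := fun t : ℝ ↦ r * t)
    ⟨fun x y ↦ mul_add r x y, fun c x ↦ by simp only [smul_eq_mul]; ring⟩
  zero_mem := by simpa using h.zero_mem
  geo t ht := by
    have : GeoAt n γ (r * t + 0) := by simpa using h.geo _ ht
    simpa using this.comp_affine
  zero := by simpa using h.zero
  vel := by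
    have h0 : GeoAt n γ (r * 0 + 0) := by simpa using h.geo _ h.zero_mem
    have := vel_comp_affine h0
    simpa [h.vel] using this

theorem IsGeoFrom.eqOn [T2Space M] (h : IsGeoFrom p w γ I) {γ' : ℝ → M} {J : Set ℝ}
    (h' : IsGeoFrom p w γ' J) : EqOn γ γ' (I ∩ J) :=
  geo_eqOn (h.isOpen.inter h'.isOpen) (h.convex.inter h'.convex).isPreconnected
    (fun t ht ↦ h.geo t ht.1) (fun t ht ↦ h'.geo t ht.2) ⟨h.zero_mem, h'.zero_mem⟩
    (h.zero.trans h'.zero.symm) (h.vel.trans h'.vel.symm)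

theorem IsGeoFrom.rexp_one [T2Space M] (h : IsGeoFrom p w γ I) (h1 : 1 ∈ I) : rexp p w = γ 1 := by
  have hw : w ∈ expDom p := ⟨γ, I, h, h1⟩
  obtain ⟨J, hJ, hJ1⟩ := hw.choose_spec
  rw [rexp, dif_pos hw]
  exact hJ.eqOn h ⟨hJ1, h1⟩

theorem IsGeoFrom.smul_mem (h : IsGeoFrom p w γ I) {t : ℝ} (ht : t ∈ I) : t • w ∈ expDom p :=
  ⟨_, _, h.comp_mul t, by simpa using ht⟩

theorem IsGeoFrom.rexp_smul [T2Space M] (h : IsGeoFrom p w γ I) {t : ℝ} (ht : t ∈ I) :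
    rexp p (t • w) = γ t := by
  rw [(h.comp_mul t).rexp_one (by simpa using ht), mul_one]

/-- The rays `t ↦ exp(tw)` are geodesics. -/
theorem IsGeoFrom.ray [T2Space M] (h : IsGeoFrom p w γ I) :
    IsGeoFrom p w (fun t ↦ rexp p (t • w)) I := by
  have hev {t : ℝ} (ht : t ∈ I) : γ =ᶠ[nhds t] fun t ↦ rexp p (t • w) := by
    filter_upwards [h.isOpen.mem_nhds ht] with s hs using (h.rexp_smul hs).symm
  exact ⟨h.isOpen, h.convex, h.zero_mem, fun t ht ↦ (h.geo t ht).congr (hev ht),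
    (h.rexp_smul h.zero_mem).trans h.zero, (vel_congr (hev h.zero_mem)).symm.trans h.vel⟩

variable (p) in
theorem isGeoFrom_const : IsGeoFrom (n := n) p 0 (fun _ ↦ p) univ := by
  refine ⟨isOpen_univ, convex_univ, mem_univ _, fun t _ ↦ ?_, rfl, ?_⟩
  · refine geoAt_of_chart contMDiffAt_const (mem_extChartAt_source p) ?_
    simp [accel]
  · simp only [vel, mfderiv_const]
    rfl

theorem zero_mem_expDom : (0 : EuclideanSpace ℝ (Fin n)) ∈ expDom p :=
  ⟨_, _, isGeoFrom_const p, mem_univ _⟩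

theorem rexp_zero [T2Space M] : rexp p (0 : EuclideanSpace ℝ (Fin n)) = p :=
  (isGeoFrom_const p).rexp_one (mem_univ _)

/-- The geodesics which are close to a given one at a given time form a smooth family. -/
theorem exists_geodesic_flow (m₀ : M) (x₀ v₀ : EuclideanSpace ℝ (Fin n))
    (hx₀ : x₀ ∈ (extChartAt (𝓡 n) m₀).target) :
    ∃ ε > 0, ∃ Y : (EuclideanSpace ℝ (Fin n) × EuclideanSpace ℝ (Fin n)) × ℝ → M,
      ContMDiffOn 𝓘(ℝ, (EuclideanSpace ℝ (Fin n) × EuclideanSpace ℝ (Fin n)) × ℝ) (𝓡 n) ∞ Y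
        (Metric.ball (x₀, v₀) ε ×ˢ Ioo (-ε) ε) ∧
      ∀ z ∈ Metric.ball (x₀, v₀) ε, z.1 ∈ (extChartAt (𝓡 n) m₀).target ∧
        Y (z, 0) = (extChartAt (𝓡 n) m₀).symm z.1 ∧
        vel n (fun s ↦ Y (z, s)) 0 = tang (extChartAt (𝓡 n) m₀).symm z.1 z.2 ∧
        ∀ t ∈ Ioo (-ε) ε, GeoAt n (fun s ↦ Y (z, s)) t := by
  have hP := isParam_chart (n := n) m₀
  obtain ⟨ε, hε, X, hX, hX'⟩ := hP.isMetricOn.exists_geodesic_flow hx₀ v₀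
  have h0 : (0 : ℝ) ∈ Ioo (-ε) ε := ⟨by linarith, hε⟩
  refine ⟨ε, hε, fun q ↦ (extChartAt (𝓡 n) m₀).symm (X q), ?_, fun z hz ↦ ?_⟩
  · exact hP.contMDiffOn.comp hX.contMDiffOn fun q hq ↦ ((hX' q.1 hq.1).2.2 q.2 hq.2).1
  obtain ⟨a, b, c⟩ := hX' z hz
  refine ⟨a ▸ (c 0 h0).1, by simp only [a], ?_, fun t ht ↦ ?_⟩
  · have := vel_comp (x := fun s ↦ X (z, s)) (hP.mdifferentiableAt (c 0 h0).1)
      ((c 0 h0).2.1.differentiableAt (by simp)).hasDerivAt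
    rw [b] at this
    rw [this, a]
  · exact (hP.geoAt_iff (c t ht).2.1 (c t ht).1).2 (c t ht).2.2

variable [T2Space M]

/-- The exponential map is defined and smooth near the origin. -/
theorem eventually_rexp_zero (p : M) : ∀ᶠ w in nhds (0 : EuclideanSpace ℝ (Fin n)),
    w ∈ expDom p ∧ ContMDiffAt 𝓘(ℝ, EuclideanSpace ℝ (Fin n)) (𝓡 n) ∞ (rexp p) w := by
  set x₀ := extChartAt (𝓡 n) p p with hx₀
  have hx : x₀ ∈ (extChartAt (𝓡 n) p).target := mem_extChartAt_target p
  obtain ⟨ε, hε, Y, hY, hY'⟩ := exists_geodesic_flow p x₀ (0 : EuclideanSpace ℝ (Fin n)) hx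
  -- The flow is defined for times up to `ε` and small initial velocities. Hence the time is fixed to
  -- be `ε / 2` and the velocity is scaled by `2 / ε`.
  let L : EuclideanSpace ℝ (Fin n) ≃L[ℝ] EuclideanSpace ℝ (Fin n) :=
    (LinearEquiv.ofInjectiveEndo (tang (extChartAt (𝓡 n) p).symm x₀ :
      EuclideanSpace ℝ (Fin n) →ₗ[ℝ] EuclideanSpace ℝ (Fin n))
      ((isParam_chart p).injective x₀ hx)).toContinuousLinearEquiv
  have hL (v : EuclideanSpace ℝ (Fin n)) : L v = tang (extChartAt (𝓡 n) p).symm x₀ v := rfl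
  let f : EuclideanSpace ℝ (Fin n) →
      (EuclideanSpace ℝ (Fin n) × EuclideanSpace ℝ (Fin n)) × ℝ :=
    fun w ↦ ((x₀, (2 / ε) • L.symm w), ε / 2)
  have hf : ContDiff ℝ ∞ f :=
    (contDiff_const.prodMk (L.symm.contDiff.const_smul _)).prodMk contDiff_const
  have hopen : IsOpen (Metric.ball (x₀, (0 : EuclideanSpace ℝ (Fin n))) ε ×ˢ Ioo (-ε) ε) :=
    Metric.isOpen_ball.prod isOpen_Ioo
  have hev : ∀ᶠ w in nhds (0 : EuclideanSpace ℝ (Fin n)),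
      f w ∈ Metric.ball (x₀, (0 : EuclideanSpace ℝ (Fin n))) ε ×ˢ Ioo (-ε) ε := by
    refine hf.continuous.continuousAt.eventually (hopen.mem_nhds ?_)
    simp only [f, map_zero, smul_zero]
    exact ⟨Metric.mem_ball_self hε, by constructor <;> linarith⟩
  have key (w : EuclideanSpace ℝ (Fin n))
      (hw : f w ∈ Metric.ball (x₀, (0 : EuclideanSpace ℝ (Fin n))) ε ×ˢ Ioo (-ε) ε) :
      w ∈ expDom p ∧ rexp p w = Y (f w) := by
    obtain ⟨-, a, b, c⟩ := hY' _ hw.1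
    have hG : IsGeoFrom p ((2 / ε) • w) (fun s ↦ Y ((f w).1, s)) (Ioo (-ε) ε) := by
      refine ⟨isOpen_Ioo, convex_Ioo _ _, ⟨by linarith, hε⟩, c, ?_, ?_⟩
      · rw [a]
        exact extChartAt_to_inv p
      · rw [b]
        simp only [f, ← hL, map_smul, L.apply_symm_apply]
    have hw' : w = (ε / 2) • (2 / ε) • w := by
      rw [smul_smul, show ε / 2 * (2 / ε) = 1 by field_simp, one_smul]
    constructor
    · rw [hw']; exact hG.smul_mem hw.2
    · conv_lhs => rw [hw']
      exact hG.rexp_smul hw.2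
  filter_upwards [hev, hev.eventually_nhds] with w hw hw'
  refine ⟨(key w hw).1, ?_⟩
  have h1 : ContMDiffAt 𝓘(ℝ, EuclideanSpace ℝ (Fin n)) (𝓡 n) ∞ (fun w ↦ Y (f w)) w :=
    (hY.contMDiffAt (hopen.mem_nhds hw)).comp w hf.contDiffAt.contMDiffAt
  refine h1.congr_of_eventuallyEq ?_
  filter_upwards [hw'] with v hv using (key v hv).2

/-- The exponential map is smooth on its domain, which is open. Smoothness propagates along a
geodesic by composing with the local geodesic flow. -/
theorem eventually_rexp (hw : w ∈ expDom p) : ∀ᶠ w' in nhds w,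
    w' ∈ expDom p ∧ ContMDiffAt 𝓘(ℝ, EuclideanSpace ℝ (Fin n)) (𝓡 n) ∞ (rexp p) w' := by
  obtain ⟨γ₀, I, hγ₀, hI⟩ := hw
  let good : EuclideanSpace ℝ (Fin n) → Prop := fun w ↦
    w ∈ expDom p ∧ ContMDiffAt 𝓘(ℝ, EuclideanSpace ℝ (Fin n)) (𝓡 n) ∞ (rexp p) w
  let B : Set ℝ := {t | ¬ ∀ᶠ w' in nhds (t • w), good w'}
  have hBc : IsClosed B := by
    rw [← isOpen_compl_iff]
    have : Bᶜ = (fun t : ℝ ↦ t • w) ⁻¹' {z | ∀ᶠ w' in nhds z, good w'} := by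
      ext t; simp [B]
    rw [this]
    exact isOpen_setOfPred_eventually_nhds.preimage (continuous_id.smul continuous_const)
  by_contra hcon
  have h1B : (1 : ℝ) ∈ Icc (0 : ℝ) 1 ∩ B := ⟨by simp, by
    simp only [B, mem_ofPred_eq, one_smul]
    exact hcon⟩
  -- The first time at which the assertion fails along the ray through `w`.
  obtain ⟨T, ⟨hT, hTB⟩, hTmin⟩ := (isCompact_Icc.inter_right hBc).exists_isLeast ⟨1, h1B⟩
  refine hTB ?_
  have hT0 : 0 < T := by
    rcases hT.1.eq_or_lt with h | h
    · exfalso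
      refine hTB ?_
      rw [← h, zero_smul]
      exact eventually_rexp_zero p
    · exact h
  have hlt (t : ℝ) (h0 : 0 ≤ t) (ht : t < T) : ∀ᶠ w' in nhds (t • w), good w' := by
    by_contra h
    exact absurd (hTmin ⟨⟨h0, (ht.trans_le hT.2).le⟩, h⟩) (not_le.2 ht)
  have hR := hγ₀.ray
  have hIcc : Icc (0 : ℝ) 1 ⊆ I := hγ₀.convex.ordConnected.out hγ₀.zero_mem hI
  have hTI : T ∈ I := hIcc hT
  set m := rexp p (T • w) with hm
  have hx : rexp p (T • w) ∈ (extChartAt (𝓡 n) m).source := mem_extChartAt_source _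
  let x : ℝ → EuclideanSpace ℝ (Fin n) := fun t ↦ extChartAt (𝓡 n) m (rexp p (t • w))
  obtain ⟨ε, hε, Y, hY, hY'⟩ := exists_geodesic_flow m (x T) (deriv x T)
    ((extChartAt (𝓡 n) m).map_source hx)
  have hopen : IsOpen (Metric.ball (x T, deriv x T) ε ×ˢ Ioo (-ε) ε) :=
    Metric.isOpen_ball.prod isOpen_Ioo
  -- A time `t₁ < T` at which the geodesic is already covered by the flow around time `T`.
  have hev : ∀ᶠ t in nhds T, rexp p (t • w) ∈ (extChartAt (𝓡 n) m).source ∧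
      (x t, deriv x t) ∈ Metric.ball (x T, deriv x T) ε ∧ t ∈ Ioo 0 (T + ε) ∧ T - ε < t := by
    have h2 := (contDiffAt_chart_comp (hR.geo T hTI).1 hx).of_le (m := 2) (by norm_cast)
    have h3 := hasDerivAt_deriv_of_contDiffAt h2
    refine (eventually_mem_chart (hR.geo T hTI).1.continuousAt hx).and (Filter.Eventually.and ?_ ?_)
    · exact (h3.1.continuousAt.prodMk h3.2.continuousAt).eventually
        (Metric.ball_mem_nhds _ hε)
    · exact Filter.Eventually.and (Ioo_mem_nhds hT0 (by linarith)) (Ioi_mem_nhds (by linarith))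
  obtain ⟨t₁, ⟨hs1, hb1, ht1, hTt1⟩, htT⟩ :=
    ((hev.filter_mono nhdsWithin_le_nhds).and (self_mem_nhdsWithin (s := Iio T))).exists
  have htT : t₁ < T := htT
  have hg1 := hlt t₁ ht1.1.le htT
  have ht10 : t₁ ≠ 0 := ht1.1.ne'
  -- Position and velocity at time `t₁` of the geodesic that reaches `exp z` at time `t₁` depend
  -- smoothly on `z`, and the flow continues this geodesic up to time `T`.
  let R : EuclideanSpace ℝ (Fin n) → EuclideanSpace ℝ (Fin n) :=
    fun z ↦ extChartAt (𝓡 n) m (rexp p z)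
  have hRc : ∀ᶠ z in nhds (t₁ • w), good z ∧ rexp p z ∈ (extChartAt (𝓡 n) m).source ∧
      ContDiffAt ℝ ∞ R z := by
    filter_upwards [hg1, eventually_mem_chart hg1.self_of_nhds.2.continuousAt hs1] with z hz hz'
    have h1 : ContMDiffAt (𝓡 n) 𝓘(ℝ, EuclideanSpace ℝ (Fin n)) ∞ (extChartAt (𝓡 n) m) (rexp p z) :=
      contMDiffAt_extChartAt' (by simpa using hz')
    exact ⟨hz, hz', contMDiffAt_iff_contDiffAt.1 (h1.comp z hz.2)⟩
  let f : EuclideanSpace ℝ (Fin n) →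
      (EuclideanSpace ℝ (Fin n) × EuclideanSpace ℝ (Fin n)) × ℝ :=
    fun z ↦ ((R z, fderiv ℝ R z (t₁⁻¹ • z)), T - t₁)
  have hfc (z : EuclideanSpace ℝ (Fin n)) (hz : ContDiffAt ℝ ∞ R z) : ContDiffAt ℝ ∞ f z :=
    (hz.prodMk ((hz.fderiv_right (m := ∞) (by norm_cast)).clm_apply
      (contDiffAt_id.const_smul t₁⁻¹))).prodMk contDiffAt_const
  have hf1 : f (t₁ • w) ∈ Metric.ball (x T, deriv x T) ε ×ˢ Ioo (-ε) ε := by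
    refine ⟨?_, by constructor <;> linarith⟩
    have h3 : HasDerivAt x (fderiv ℝ R (t₁ • w) w) t₁ := by
      have h4 := (hRc.self_of_nhds.2.2.differentiableAt (by simp)).hasFDerivAt
      exact h4.comp_hasDerivAt t₁ (hasDerivAt_smul_const' w t₁)
    simp only [f, inv_smul_smul₀ ht10]
    rw [← h3.deriv]
    exact hb1
  have hev2 : ∀ᶠ z in nhds (t₁ • w), (good z ∧ rexp p z ∈ (extChartAt (𝓡 n) m).source ∧
      ContDiffAt ℝ ∞ R z) ∧ f z ∈ Metric.ball (x T, deriv x T) ε ×ˢ Ioo (-ε) ε :=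
    hRc.and ((hfc _ hRc.self_of_nhds.2.2).continuousAt.eventually (hopen.mem_nhds hf1))
  have key (z : EuclideanSpace ℝ (Fin n)) (hz : (good z ∧
      rexp p z ∈ (extChartAt (𝓡 n) m).source ∧ ContDiffAt ℝ ∞ R z) ∧
      f z ∈ Metric.ball (x T, deriv x T) ε ×ˢ Ioo (-ε) ε) :
      (T / t₁) • z ∈ expDom p ∧ rexp p ((T / t₁) • z) = Y (f z) := by
    obtain ⟨⟨⟨hzd, hzs⟩, hzc, hzR⟩, hzf⟩ := hz
    obtain ⟨γ', J, hγ', hJ⟩ := hzd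
    set u := t₁⁻¹ • z with hu
    have hzu : t₁ • u = z := smul_inv_smul₀ ht10 z
    have hJ' := (hγ'.comp_mul t₁⁻¹).ray
    set J' := {t | t₁⁻¹ * t ∈ J} with hJ'def
    have ht1J : t₁ ∈ J' := by simpa [hJ'def, inv_mul_cancel₀ ht10] using hJ
    obtain ⟨a, ha, hab⟩ := Metric.isOpen_iff.1 hJ'.isOpen 0 hJ'.zero_mem
    obtain ⟨b, hb, hbb⟩ := Metric.isOpen_iff.1 hJ'.isOpen t₁ ht1J
    have hsub : Ioo (-(a / 2)) (t₁ + b / 2) ⊆ J' := by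
      refine Ioo_subset_Icc_self.trans (hJ'.convex.ordConnected.out (hab ?_) (hbb ?_))
      · rw [Metric.mem_ball, Real.dist_eq, sub_zero, abs_neg, abs_of_pos] <;> linarith
      · rw [Metric.mem_ball, Real.dist_eq, add_sub_cancel_left, abs_of_pos] <;> linarith
    obtain ⟨a1, a2, a3, a4⟩ := hY' _ hzf.1
    let σ : ℝ → M := fun t ↦ Y ((f z).1, t - t₁)
    have hσ (t : ℝ) (ht : t ∈ Ioo (t₁ - ε) (t₁ + ε)) : GeoAt n σ t := by
      have h4 : GeoAt n (fun s ↦ Y ((f z).1, s)) (1 * t + -t₁) :=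
        a4 _ ⟨by linarith [ht.1], by linarith [ht.2]⟩
      simpa [σ, sub_eq_add_neg] using h4.comp_affine
    have hσv : vel n σ t₁ = tang (extChartAt (𝓡 n) m).symm (R z) (fderiv ℝ R z u) := by
      have h4 : GeoAt n (fun s ↦ Y ((f z).1, s)) (1 * t₁ + -t₁) :=
        a4 _ ⟨by linarith, by linarith⟩
      have h5 := vel_comp_affine h4
      simp only [one_mul, ← sub_eq_add_neg, one_smul, sub_self] at h5
      rw [a3] at h5
      exact h5
    have hrv : vel n (fun t ↦ rexp p (t • u)) t₁ =
        tang (extChartAt (𝓡 n) m).symm (R z) (fderiv ℝ R z u) := by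
      rw [vel_eq_tang (hJ'.geo t₁ ht1J).1 (x₀ := m) (by rw [hzu]; exact hzc), hzu]
      congr 1
      have h6 : HasFDerivAt R (fderiv ℝ R z) (t₁ • u) := by
        rw [hzu]; exact (hzR.differentiableAt (by simp)).hasFDerivAt
      exact (h6.comp_hasDerivAt t₁ (hasDerivAt_smul_const' u t₁)).deriv
    have hσ0 : σ t₁ = rexp p (t₁ • u) := by
      simp only [σ, sub_self]
      rw [a2, hzu]
      exact (extChartAt (𝓡 n) m).left_inv hzc
    have hglue := geo_glue (γ := fun t ↦ rexp p (t • u)) (γ' := σ) (t₀ := t₁)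
      (fun t ht ↦ hJ'.geo t (hsub ht)) hσ ⟨by linarith [ht1.1], by linarith⟩
      ⟨by linarith, by linarith⟩ hσ0.symm (hrv.trans hσv.symm)
    have hG : IsGeoFrom p u (fun t ↦ if t < t₁ then rexp p (t • u) else σ t)
        (Ioo (-(a / 2)) (t₁ + ε)) := by
      refine ⟨isOpen_Ioo, convex_Ioo _ _, ⟨by linarith, by linarith [ht1.1]⟩, hglue, ?_, ?_⟩
      · rw [if_pos ht1.1]; exact hJ'.zero
      · refine Eq.trans (vel_congr ?_) hJ'.vel
        filter_upwards [Iio_mem_nhds ht1.1] with s hs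
        rw [if_pos (mem_Iio.1 hs)]
    have hTz : (T / t₁) • z = T • u := by rw [hu, smul_smul, div_eq_mul_inv]
    have hTm : T ∈ Ioo (-(a / 2)) (t₁ + ε) := ⟨by linarith, by linarith⟩
    rw [hTz]
    refine ⟨hG.smul_mem hTm, ?_⟩
    rw [hG.rexp_smul hTm, if_neg (not_lt.2 htT.le)]
  have hscale : ContinuousAt (fun z : EuclideanSpace ℝ (Fin n) ↦ (t₁ / T) • z) (T • w) :=
    (continuous_const_smul (t₁ / T)).continuousAt
  have hpt : (t₁ / T) • T • w = t₁ • w := by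
    rw [smul_smul, div_mul_cancel₀ _ hT0.ne']
  have hev3 := hscale.eventually (by beta_reduce; rw [hpt]; exact hev2)
  have hback (z : EuclideanSpace ℝ (Fin n)) : (T / t₁) • (t₁ / T) • z = z := by
    rw [smul_smul, show T / t₁ * (t₁ / T) = 1 by field_simp, one_smul]
  filter_upwards [hev3, hev3.eventually_nhds] with z hz hz'
  have hk := key _ hz
  rw [hback] at hk
  refine ⟨hk.1, ?_⟩
  have h1 : ContMDiffAt 𝓘(ℝ, EuclideanSpace ℝ (Fin n)) (𝓡 n) ∞
      (fun z ↦ Y (f ((t₁ / T) • z))) z := by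
    have h2 : ContDiffAt ℝ ∞ (fun z ↦ f ((t₁ / T) • z)) z :=
      (hfc _ hz.1.2.2).comp z (contDiff_id.const_smul _).contDiffAt
    exact (hY.contMDiffAt (hopen.mem_nhds hz.2)).comp z h2.contMDiffAt
  refine h1.congr_of_eventuallyEq ?_
  filter_upwards [hz'] with v hv
  have := (key _ hv).2
  rwa [hback] at this

theorem isOpen_expDom : IsOpen (expDom (n := n) p) :=
  isOpen_iff_mem_nhds.2 fun _ hw ↦ (eventually_rexp hw).mono fun _ h ↦ h.1

theorem contMDiffAt_rexp (hw : w ∈ expDom p) :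
    ContMDiffAt 𝓘(ℝ, EuclideanSpace ℝ (Fin n)) (𝓡 n) ∞ (rexp p) w :=
  (eventually_rexp hw).self_of_nhds.2

theorem geoAt_ray {t : ℝ} (ht0 : t ∈ Icc (0 : ℝ) 1) (hw : w ∈ expDom p) :
    GeoAt n (fun t ↦ rexp p (t • w)) t := by
  obtain ⟨γ, I, h, h1⟩ := hw
  exact h.ray.geo t (h.convex.ordConnected.out h.zero_mem h1 ht0)

/-- The differential of the exponential map at the origin is the identity. -/
theorem tang_rexp_zero (w : EuclideanSpace ℝ (Fin n)) : tang (rexp p) 0 w = w := by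
  have h1 : ∀ᶠ t : ℝ in nhds 0, t • w ∈ expDom p :=
    (hasDerivAt_smul_const' w 0).continuousAt.eventually
      (by simpa using isOpen_expDom.mem_nhds zero_mem_expDom)
  obtain ⟨δ, hδ, hball⟩ := Metric.eventually_nhds_iff_ball.1 h1
  have hd : (δ / 2) • w ∈ expDom p := hball _ (by
    rw [Metric.mem_ball, Real.dist_eq, sub_zero, abs_of_pos] <;> linarith)
  obtain ⟨γ, I, h, -⟩ := hd
  have h2 := (h.comp_mul (δ / 2)⁻¹).ray
  rw [inv_smul_smul₀ (by positivity)] at h2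
  have h3 := vel_comp (n := n) (Φ := rexp p) (x := fun t : ℝ ↦ t • w) (t := 0)
    (by simpa using (contMDiffAt_rexp zero_mem_expDom).mdifferentiableAt (by simp))
    (hasDerivAt_smul_const' w 0)
  rw [h2.vel, zero_smul] at h3
  exact h3.symm

end Exp

/-! ### Normal coordinates and the absence of conjugate points -/

section NormalCoordinates

variable {n : ℕ} {M : Type*} [TopologicalSpace M] [ChartedSpace (EuclideanSpace ℝ (Fin n)) M]
  [IsManifold (𝓡 n) ∞ M] [RiemannianBundle (fun x : M ↦ TangentSpace (𝓡 n) x)]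
  [IsContMDiffRiemannianBundle (𝓡 n) ∞ (EuclideanSpace ℝ (Fin n))
      (fun x : M ↦ TangentSpace (𝓡 n) x)]

/-- The tangent vectors `w` at `p` such that the exponential map is defined and regular on the
segment from `0` to `w`. -/
def normalDom (p : M) : Set (EuclideanSpace ℝ (Fin n)) :=
  {w | ∀ r ∈ Icc (0 : ℝ) 1, r • w ∈ expDom p ∧ Function.Injective (tang (rexp p) (r • w))}

variable [T2Space M] {p : M} {w : EuclideanSpace ℝ (Fin n)}

/-- In charts the differential of the exponential map is continuous, and injective endomorphisms form
an open set. -/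
theorem isOpen_regular (p : M) : IsOpen {w : EuclideanSpace ℝ (Fin n) |
    w ∈ expDom p ∧ Function.Injective (tang (rexp p) w)} := by
  refine isOpen_iff_mem_nhds.2 fun w hw ↦ ?_
  set m := rexp p w
  have hx : rexp p w ∈ (extChartAt (𝓡 n) m).source := mem_extChartAt_source _
  have hreg (z : EuclideanSpace ℝ (Fin n)) (hz : z ∈ expDom p)
      (hs : rexp p z ∈ (extChartAt (𝓡 n) m).source) :
      ContDiffAt ℝ ∞ (fun z ↦ extChartAt (𝓡 n) m (rexp p z)) z ∧
      ∀ u, tang (rexp p) z u = tang (extChartAt (𝓡 n) m).symm (extChartAt (𝓡 n) m (rexp p z))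
        (fderiv ℝ (fun z ↦ extChartAt (𝓡 n) m (rexp p z)) z u) := by
    have h1 : ContMDiffAt (𝓡 n) 𝓘(ℝ, EuclideanSpace ℝ (Fin n)) ∞ (extChartAt (𝓡 n) m)
        (rexp p z) := contMDiffAt_extChartAt' (by simpa using hs)
    have h2 : ContDiffAt ℝ ∞ (fun z ↦ extChartAt (𝓡 n) m (rexp p z)) z :=
      contMDiffAt_iff_contDiffAt.1 (h1.comp z (contMDiffAt_rexp hz))
    refine ⟨h2, fun u ↦ ?_⟩
    rw [← tang_comp (ψ := fun z ↦ extChartAt (𝓡 n) m (rexp p z))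
      ((isParam_chart m).mdifferentiableAt ((extChartAt (𝓡 n) m).map_source hs))
      (h2.differentiableAt (by simp)),
      ← tang_congr (eventually_chart_symm (contMDiffAt_rexp hz).continuousAt hs)]
  obtain ⟨hc, ht⟩ := hreg w hw.1 hx
  have hinj : Function.Injective (fderiv ℝ (fun z ↦ extChartAt (𝓡 n) m (rexp p z)) w) := by
    intro a b hab
    refine hw.2 ?_
    rw [ht, ht, hab]
  let L : EuclideanSpace ℝ (Fin n) ≃L[ℝ] EuclideanSpace ℝ (Fin n) :=
    (LinearEquiv.ofInjectiveEndo (fderiv ℝ (fun z ↦ extChartAt (𝓡 n) m (rexp p z)) w :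
      EuclideanSpace ℝ (Fin n) →ₗ[ℝ] EuclideanSpace ℝ (Fin n)) hinj).toContinuousLinearEquiv
  have hL : (L : EuclideanSpace ℝ (Fin n) →L[ℝ] EuclideanSpace ℝ (Fin n)) =
    fderiv ℝ (fun z ↦ extChartAt (𝓡 n) m (rexp p z)) w := rfl
  have hev := ((hc.fderiv_right (m := 0) (by norm_cast)).continuousAt).eventually
    (hL ▸ ContinuousLinearEquiv.nhds L)
  filter_upwards [isOpen_expDom.mem_nhds hw.1,
    eventually_mem_chart (contMDiffAt_rexp hw.1).continuousAt hx, hev] with z h1 h2 h3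
  refine ⟨h1, fun a b hab ↦ ?_⟩
  obtain ⟨e, he⟩ := h3
  rw [(hreg z h1 h2).2, (hreg z h1 h2).2] at hab
  have := (isParam_chart m).injective _ ((extChartAt (𝓡 n) m).map_source h2) hab
  rw [← he] at this
  exact e.injective this

theorem isOpen_normalDom (p : M) : IsOpen (normalDom (n := n) p) := by
  refine isOpen_iff_mem_nhds.2 fun w hw ↦ ?_
  have := isCompact_Icc.eventually_forall_of_forall_eventually (x₀ := w) (K := Icc (0 : ℝ) 1)
    (P := fun w r ↦ r • w ∈ expDom p ∧ Function.Injective (tang (rexp p) (r • w)))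
    (fun r hr ↦ ?_)
  · exact this
  · have hc : ContinuousAt (fun q : EuclideanSpace ℝ (Fin n) × ℝ ↦ q.2 • q.1) (w, r) :=
      (continuous_snd.smul continuous_fst).continuousAt
    exact hc.eventually ((isOpen_regular p).mem_nhds (hw r hr))

theorem normalDom_subset : normalDom (n := n) p ⊆ expDom p := fun w hw ↦ by
  simpa using (hw 1 (by simp)).1

theorem isParam_rexp (p : M) : IsParam (n := n) (rexp p) (normalDom p) where
  isOpen := isOpen_normalDom p
  contMDiffOn w hw := (contMDiffAt_rexp (normalDom_subset hw)).contMDiffWithinAt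
  injective w hw := by simpa using (hw 1 (by simp)).2

theorem pullMetric_rexp_zero (u v : EuclideanSpace ℝ (Fin n)) :
    pullMetric (rexp p) 0 u v = ip p u v := by
  rw [pullMetric_apply, tang_rexp_zero, tang_rexp_zero, rexp_zero]

theorem isNormalMetric_rexp (p : M) :
    IsNormalMetric (pullMetric (rexp p)) (normalDom (n := n) p) where
  metric := (isParam_rexp p).isMetricOn
  zero_mem r _ := by
    rw [smul_zero]
    refine ⟨zero_mem_expDom, fun u v huv ↦ ?_⟩
    rwa [tang_rexp_zero, tang_rexp_zero] at huv
  star y hy r hr s hs := by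
    rw [smul_smul]
    exact hy (s * r) ⟨mul_nonneg hs.1 hr.1, mul_le_one₀ hs.2 hr.1 hr.2⟩
  radial y hy := by
    have h1 := geoAt_ray (t := 1) (by simp) (normalDom_subset hy)
    have h2 := ((isParam_rexp p).geoAt_iff (x := fun t : ℝ ↦ t • y) (t := 1)
      (contDiffAt_id.smul contDiffAt_const) (by simpa using hy)).1 h1
    have h3 : deriv (fun t : ℝ ↦ t • y) = fun _ ↦ y := by
      ext1 t
      exact (hasDerivAt_smul_const' y t).deriv
    simpa [accel, h3] using h2

/-- There are no conjugate points before distance `π`. -/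
theorem mem_normalDom (hsec : SectionalCurvatureLE n M 1) (hw : ip p w w = 1) {T : ℝ}
    (hT0 : 0 ≤ T) (hT : T < Real.pi) (hdom : ∀ t ∈ Icc 0 T, t • w ∈ expDom p) :
    T • w ∈ normalDom p := by
  set g := pullMetric (rexp (n := n) p) with hg
  have hN := isNormalMetric_rexp (n := n) p
  have hs := (isParam_rexp (n := n) p).secLEOne hsec
  let B : Set ℝ := {t | t • w ∉ normalDom p}
  have hBc : IsClosed B := ((isOpen_normalDom p).preimage
    (continuous_id.smul continuous_const : Continuous fun t : ℝ ↦ t • w)).isClosed_compl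
  by_contra hcon
  -- The first time at which the ray leaves the domain.
  obtain ⟨t, ⟨ht, htB⟩, htmin⟩ := (isCompact_Icc.inter_right hBc).exists_isLeast
    ⟨T, right_mem_Icc.2 hT0, hcon⟩
  have hlt (r : ℝ) (h0 : 0 ≤ r) (hr : r < t) : r • w ∈ normalDom p := by
    by_contra h
    exact absurd (htmin ⟨⟨h0, hr.le.trans ht.2⟩, h⟩) (not_le.2 hr)
  have ht0 : 0 < t := by
    rcases ht.1.eq_or_lt with h | h
    · exact absurd hN.zero_mem (by rw [← zero_smul ℝ w, h]; exact htB)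
    · exact h
  refine htB fun r hr ↦ ?_
  rcases hr.2.lt_or_eq with h1 | rfl
  · rw [smul_smul]
    have := hlt (r * t) (mul_nonneg hr.1 ht0.le) (by nlinarith)
    simpa using this 1 (by simp)
  rw [one_smul]
  refine ⟨hdom t ht, (injective_iff_map_eq_zero _).2 fun X hX ↦ ?_⟩
  -- Before time `t` the length of `rX` is bounded from below by the Rauch estimate, applied to the
  -- part `Y` of `X` orthogonal to `w`. The bound persists at time `t`, so `X` cannot be in the
  -- kernel of the differential.
  set a := ip p w X with ha
  set Y := X - a • w with hY
  have hw0 : g 0 w w = 1 := by rw [hg, pullMetric_rexp_zero, hw]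
  have hwY : g 0 w Y = 0 := by
    rw [hY, map_sub, map_smul, hw0, hg, pullMetric_rexp_zero, ← ha]
    simp
  have hest : ∀ r ∈ Ico 0 t, r ^ 2 * a ^ 2 + Real.sin r ^ 2 * g 0 Y Y
      ≤ r ^ 2 * g (r • w) X X := by
    intro r hr
    have hrU : ∀ s ∈ Icc 0 r, s • w ∈ normalDom p := fun s hs ↦ hlt s hs.1 (hs.2.trans_lt hr.2)
    have hU := hrU r (right_mem_Icc.2 hr.1)
    have h1 := hN.sin_sq_mul_le hw0 hwY hs (hr.2.trans_le ht.2 |>.trans hT) hrU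
      (right_mem_Icc.2 hr.1)
    have h2 : g (r • w) w w = 1 := by rw [hN.gauss_smul hU, hw0]
    have h3 : g (r • w) w Y = 0 := by rw [hN.gauss_smul hU, hwY]
    have h4 : g (r • w) Y w = 0 := by rw [hN.metric.symm _ hU, h3]
    have hXY : X = a • w + Y := by rw [hY]; abel
    rw [hXY]
    simp only [map_smul, smul_apply, smul_eq_mul] at h1
    simp only [map_add, add_apply, map_smul, smul_apply, smul_eq_mul, h2, h3, h4]
    nlinarith [h1]
  have hcont : ContinuousAt (fun r : ℝ ↦ r ^ 2 * g (r • w) X X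
      - (r ^ 2 * a ^ 2 + Real.sin r ^ 2 * g 0 Y Y)) t := by
    have c1 : ContinuousAt (fun r : ℝ ↦ g (r • w)) t := by
      have h5 := (contDiffOn_pullMetric (n := n) (Φ := rexp p) isOpen_expDom
        (fun z hz ↦ (contMDiffAt_rexp hz).contMDiffWithinAt)).contDiffAt
        (isOpen_expDom.mem_nhds (hdom t ht))
      exact ContinuousAt.comp (f := fun r : ℝ ↦ r • w) h5.continuousAt
        (hasDerivAt_smul_const' w t).continuousAt
    exact ((continuousAt_id.pow 2).mul ((c1.clm_apply continuousAt_const).clm_apply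
      continuousAt_const)).sub (((continuousAt_id.pow 2).mul continuousAt_const).add
      ((Real.continuous_sin.continuousAt.pow 2).mul continuousAt_const))
  have hlim := ge_of_tendsto (hcont.tendsto.mono_left (nhdsWithin_le_nhds (s := Iio t)))
    (b := 0) (by
      filter_upwards [Ico_mem_nhdsLT ht0] with r hr using sub_nonneg.2 (hest r hr))
  have hgX : g (t • w) X X = 0 := by
    have : g (t • w) X X = ip (rexp p (t • w)) (tang (rexp p) (t • w) X)
      (tang (rexp p) (t • w) X) := rfl
    rw [this, hX, ← zero_smul ℝ (0 : EuclideanSpace ℝ (Fin n)), ip_smul, zero_mul]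
  rw [hgX, mul_zero] at hlim
  have hsin : 0 < Real.sin t ^ 2 :=
    pow_pos (Real.sin_pos_of_pos_of_lt_pi ht0 (ht.2.trans_lt hT)) 2
  have hYY := hN.metric.nonneg hN.zero_mem Y
  have ht2 : 0 < t ^ 2 := by positivity
  have hp1 : 0 ≤ t ^ 2 * a ^ 2 := by positivity
  have hp2 : 0 ≤ Real.sin t ^ 2 * g 0 Y Y := mul_nonneg hsin.le hYY
  have e1 : a ^ 2 = 0 :=
    (mul_eq_zero.1 (show t ^ 2 * a ^ 2 = 0 by linarith)).resolve_left ht2.ne'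
  have e2 : g 0 Y Y = 0 :=
    (mul_eq_zero.1 (show Real.sin t ^ 2 * g 0 Y Y = 0 by linarith)).resolve_left hsin.ne'
  have e3 := hN.metric.eq_zero_of_apply_self hN.zero_mem e2
  have e4 : a = 0 := by simpa using e1
  rw [e4, zero_smul, sub_zero] at hY
  rw [← hY, e3]

end NormalCoordinates

section Extension

variable {n : ℕ} {M : Type*} [TopologicalSpace M] [ChartedSpace (EuclideanSpace ℝ (Fin n)) M]
  [IsManifold (𝓡 n) ∞ M] [RiemannianBundle (fun x : M ↦ TangentSpace (𝓡 n) x)]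
  [IsContMDiffRiemannianBundle (𝓡 n) ∞ (EuclideanSpace ℝ (Fin n))
      (fun x : M ↦ TangentSpace (𝓡 n) x)] [T2Space M]

/-- A geodesic on a closed interval extends slightly beyond its starting point. -/
theorem IsGeodesicOn.exists_extension {c : ℝ → M} {b : ℝ} (hb : 0 < b)
    (hc : IsGeodesicOn n c 0 b) : ∃ γ η, 0 < η ∧
      IsGeoFrom (n := n) (c 0) (vel n γ 0) γ (Ioo (-η) b) ∧ EqOn γ c (Ico 0 b) := by
  have h0 : (0 : ℝ) ∈ Icc 0 b := left_mem_Icc.2 hb.le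
  have hx : c 0 ∈ (extChartAt (𝓡 n) (c 0)).source := mem_extChartAt_source _
  have hcc : ContinuousWithinAt c (Icc 0 b) 0 := (hc.1 0 h0).continuousWithinAt
  obtain ⟨d, hd, hdc⟩ : ∃ d, 0 < d ∧ d < b ∧
      ∀ t ∈ Icc 0 d, c t ∈ (extChartAt (𝓡 n) (c 0)).source := by
    have h1 := hcc.preimage_mem_nhdsWithin ((isOpen_extChartAt_source (c 0)).mem_nhds hx)
    rw [nhdsWithin_Icc_eq_nhdsGE hb, mem_nhdsGE_iff_exists_Icc_subset] at h1
    obtain ⟨u, hu, hu'⟩ := h1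
    exact ⟨min u (b / 2), lt_min hu (by linarith), (min_le_right _ _).trans_lt (by linarith),
      fun t ht ↦ hu' ⟨ht.1, ht.2.trans (min_le_left _ _)⟩⟩
  obtain ⟨hdb, hdc⟩ := hdc
  set x : ℝ → EuclideanSpace ℝ (Fin n) := fun t ↦ extChartAt (𝓡 n) (c 0) (c t) with hxdef
  have hxs : ContDiffOn ℝ ∞ x (Icc 0 d) := by
    have h1 : ContMDiffOn (𝓡 n) 𝓘(ℝ, EuclideanSpace ℝ (Fin n)) ∞ (extChartAt (𝓡 n) (c 0))
      (extChartAt (𝓡 n) (c 0)).source := by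
        rw [extChartAt_source]; exact contMDiffOn_extChartAt
    exact contMDiffOn_iff_contDiffOn.1 (h1.comp (hc.1.mono (Icc_subset_Icc_right hdb.le)) hdc)
  have hderiv : ContinuousWithinAt (derivWithin x (Icc 0 d)) (Icc 0 d) 0 :=
    (hxs.continuousOn_derivWithin (uniqueDiffOn_Icc hd) (by simp)) 0 (left_mem_Icc.2 hd.le)
  -- The geodesic equation holds only for positive times. The geodesic `σ` of the flow with the
  -- position and velocity of `c` at a small time `t₁ > 0` is defined around time `0`, and it agrees
  -- with `c` by uniqueness.
  obtain ⟨ε, hε, Y, hY, hY'⟩ := exists_geodesic_flow (c 0) (x 0) (derivWithin x (Icc 0 d) 0)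
    ((extChartAt (𝓡 n) (c 0)).map_source hx)
  have hev : ∀ᶠ t in nhdsWithin 0 (Ioi 0), (x t, derivWithin x (Icc 0 d) t) ∈
      Metric.ball (x 0, derivWithin x (Icc 0 d) 0) ε ∧ t ∈ Ioo 0 (min d (ε / 2)) := by
    have h1 : Filter.Tendsto (fun t ↦ (x t, derivWithin x (Icc 0 d) t)) (nhdsWithin 0 (Icc 0 d))
        (nhds (x 0, derivWithin x (Icc 0 d) 0)) :=
      ((hxs.continuousOn 0 (left_mem_Icc.2 hd.le)).prodMk hderiv)
    rw [nhdsWithin_Icc_eq_nhdsGE hd] at h1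
    have h2 := h1.mono_left (nhdsWithin_mono 0 Ioi_subset_Ici_self)
    exact (h2.eventually (Metric.ball_mem_nhds _ hε)).and
      (Ioo_mem_nhdsGT (lt_min hd (by linarith)))
  obtain ⟨t₁, hb1, ht1, ht1'⟩ := hev.exists
  have ht1d : t₁ < d := ht1'.trans_le (min_le_left _ _)
  have ht1ε : t₁ < ε / 2 := ht1'.trans_le (min_le_right _ _)
  have hsrc := hdc t₁ ⟨ht1.le, ht1d.le⟩
  rw [derivWithin_of_mem_nhds (Icc_mem_nhds ht1 ht1d)] at hb1
  have hgc (t : ℝ) (ht : t ∈ Ioo 0 b) : GeoAt n c t := hc.geoAt ht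
  obtain ⟨a1, a2, a3, a4⟩ := hY' _ hb1
  let σ : ℝ → M := fun t ↦ Y ((x t₁, deriv x t₁), t - t₁)
  have hσ (t : ℝ) (ht : t ∈ Ioo (t₁ - ε) (t₁ + ε)) : GeoAt n σ t := by
    have h4 : GeoAt n (fun s ↦ Y ((x t₁, deriv x t₁), s)) (1 * t + -t₁) :=
      a4 _ ⟨by linarith [ht.1], by linarith [ht.2]⟩
    simpa [σ, sub_eq_add_neg] using h4.comp_affine
  have hσ1 : σ t₁ = c t₁ := by
    simp only [σ, sub_self]
    rw [a2]
    exact (extChartAt (𝓡 n) (c 0)).left_inv hsrc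
  have hσv : vel n σ t₁ = vel n c t₁ := by
    have h4 : GeoAt n (fun s ↦ Y ((x t₁, deriv x t₁), s)) (1 * t₁ + -t₁) :=
      a4 _ ⟨by linarith, by linarith⟩
    have h5 := vel_comp_affine h4
    simp only [one_mul, ← sub_eq_add_neg, one_smul, sub_self] at h5
    rw [a3] at h5
    rw [vel_eq_tang (hgc t₁ ⟨ht1, ht1d.trans hdb⟩).1 hsrc]
    exact h5
  have heq : EqOn σ c (Ioo 0 (min (t₁ + ε) b)) := by
    refine geo_eqOn isOpen_Ioo isPreconnected_Ioo (fun t ht ↦ hσ t ⟨by linarith [ht.1],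
      ht.2.trans_le (min_le_left _ _)⟩) (fun t ht ↦ hgc t ⟨ht.1, ht.2.trans_le (min_le_right _ _)⟩)
      (t₀ := t₁) ⟨ht1, lt_min (by linarith) (ht1d.trans hdb)⟩ hσ1 hσv
  have hσ0 : σ 0 = c 0 := by
    have l1 : Filter.Tendsto σ (nhdsWithin 0 (Ioi 0)) (nhds (σ 0)) :=
      (hσ 0 ⟨by linarith, by linarith⟩).1.continuousAt.tendsto.mono_left nhdsWithin_le_nhds
    have l2 : Filter.Tendsto c (nhdsWithin 0 (Ioi 0)) (nhds (c 0)) := by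
      have := hcc
      rw [ContinuousWithinAt, nhdsWithin_Icc_eq_nhdsGE hb] at this
      exact this.mono_left (nhdsWithin_mono 0 Ioi_subset_Ici_self)
    refine tendsto_nhds_unique l1 (l2.congr' ?_)
    filter_upwards [Ioo_mem_nhdsGT (show (0 : ℝ) < min (t₁ + ε) b from
      lt_min (by linarith) hb)] with t ht using (heq ht).symm
  refine ⟨fun t ↦ if t < t₁ then σ t else c t, ε - t₁, by linarith, ⟨isOpen_Ioo, convex_Ioo _ _,
    ⟨by linarith, hb⟩, ?_, ?_, rfl⟩, ?_⟩
  · rw [neg_sub]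
    exact geo_glue hσ hgc ⟨by linarith, by linarith⟩ ⟨ht1, ht1d.trans hdb⟩ hσ1 hσv
  · rw [if_pos ht1, hσ0]
  · intro t ht
    by_cases h : t < t₁
    · simp only [if_pos h]
      rcases ht.1.eq_or_lt with h' | h'
      · rw [← h', hσ0]
      · exact heq ⟨h', lt_min (by linarith) ht.2⟩
    · simp only [if_neg h]

/-- The speed is continuous along geodesics, which determines the initial speed of a geodesic given
on a closed interval. -/
theorem continuousAt_speed {γ : ℝ → M} {t : ℝ} (h : ∀ᶠ s in nhds t, GeoAt n γ s) :
    ContinuousAt (fun s ↦ ip (γ s) (vel n γ s) (vel n γ s)) t := by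
  have hx : γ t ∈ (extChartAt (𝓡 n) (γ t)).source := mem_extChartAt_source _
  set φ := extChartAt (𝓡 n) (γ t)
  have h1 := GeoAt.eventually_chart h hx
  have hd := hasDerivAt_deriv_of_contDiffAt h1.self_of_nhds.1
  have hc : ContinuousAt (fun s ↦ pullMetric φ.symm (φ (γ s)) (deriv (fun s ↦ φ (γ s)) s)
      (deriv (fun s ↦ φ (γ s)) s)) t := by
    have c1 : ContinuousAt (fun s ↦ pullMetric φ.symm (φ (γ s))) t :=
      ContinuousAt.comp (f := fun s ↦ φ (γ s)) ((isParam_chart (n := n) (γ t)).isMetricOn.contDiffAt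
        (φ.map_source hx)).continuousAt hd.1.continuousAt
    exact (c1.clm_apply hd.2.continuousAt).clm_apply hd.2.continuousAt
  refine hc.congr ?_
  filter_upwards [h, eventually_mem_chart h.self_of_nhds.1.continuousAt hx] with s hs hs'
  rw [pullMetric_apply, φ.left_inv hs', vel_eq_tang hs.1 hs']

theorem HasUnitVelocityOn.ip_vel {c : ℝ → M} {a b t : ℝ} (hc : HasUnitVelocityOn n c a b)
    (ht : t ∈ Ioo a b) : ip (c t) (vel n c t) (vel n c t) = 1 := by
  have h1 := hc t (Ioo_subset_Icc_self ht)
  rw [mfderivWithin_of_mem_nhds (Icc_mem_nhds ht.1 ht.2)] at h1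
  have h2 : ip (c t) (vel n c t) (vel n c t) = ‖mfderiv 𝓘(ℝ, ℝ) (𝓡 n) c t (1 : ℝ)‖ ^ 2 :=
    real_inner_self_eq_norm_sq _
  rw [h2, h1, one_pow]

/-- A unit speed geodesic of length `π` is, except for its end, a ray in normal coordinates around
its starting point. -/
theorem IsGeodesicOn.exists_ray (hsec : SectionalCurvatureLE n M 1) {c : ℝ → M}
    (hc : IsGeodesicOn n c 0 Real.pi)
    (hc1 : ∀ t ∈ Ioo 0 Real.pi, ip (c t) (vel n c t) (vel n c t) = 1) :
    ∃ v : EuclideanSpace ℝ (Fin n), ip (c 0) v v = 1 ∧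
      ∀ t ∈ Ico 0 Real.pi, t • v ∈ normalDom (c 0) ∧ rexp (c 0) (t • v) = c t := by
  obtain ⟨γ, η, hη, hγ, heq⟩ := hc.exists_extension Real.pi_pos
  have hmem (t : ℝ) (ht : t ∈ Ico 0 Real.pi) : t ∈ Ioo (-η) Real.pi := ⟨by linarith [ht.1], ht.2⟩
  have hunit : ip (c 0) (vel n γ 0) (vel n γ 0) = 1 := by
    have h1 := continuousAt_speed (Filter.eventually_of_mem
      (isOpen_Ioo.mem_nhds hγ.zero_mem) hγ.geo)
    have h2 := h1.tendsto.mono_left (nhdsWithin_le_nhds (s := Ioi 0))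
    have h3 : γ 0 = c 0 := hγ.zero
    rw [h3] at h2
    refine tendsto_nhds_unique h2 (tendsto_const_nhds.congr' ?_)
    filter_upwards [Ioo_mem_nhdsGT Real.pi_pos] with t ht
    have h4 : γ =ᶠ[nhds t] c := by
      filter_upwards [isOpen_Ioo.mem_nhds ht] with s hs using heq (Ioo_subset_Ico_self hs)
    rw [vel_congr h4, h4.self_of_nhds, hc1 t ht]
  refine ⟨vel n γ 0, hunit, fun t ht ↦ ⟨?_, ?_⟩⟩
  · exact mem_normalDom hsec hunit ht.1 ht.2 fun s hs ↦
      hγ.smul_mem (hmem s ⟨hs.1, hs.2.trans_lt ht.2⟩)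
  · rw [hγ.rexp_smul (hmem t ht), heq ht]

end Extension

/-! ### Sturm comparison with the equation `f'' + f = 0` -/

section Sturm

variable {F : Type*} [NormedAddCommGroup F] [NormedSpace ℝ F]

/-- The derivative of the auxiliary function `t ↦ cos(s - t) f(t) + sin(s - t) f'(t)`, which takes
the value `f(s)` at `t = s`. -/
theorem hasDerivAt_sturm {f f' : ℝ → F} {h : F} {s t : ℝ} (hf : HasDerivAt f (f' t) t)
    (hf' : HasDerivAt f' (h - f t) t) :
    HasDerivAt (fun t ↦ Real.cos (s - t) • f t + Real.sin (s - t) • f' t)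
      (Real.sin (s - t) • h) t := by
  have h1 : HasDerivAt (fun t ↦ s - t) (-1) t := by simpa using (hasDerivAt_id t).const_sub s
  refine ((h1.cos.smul hf).add (h1.sin.smul hf')).congr_deriv ?_
  module

theorem eq_of_hasDerivAt_zero {f : ℝ → F} {a b : ℝ} (hab : a < b) (hf : ContinuousOn f (Icc a b))
    (hd : ∀ t ∈ Ioo a b, HasDerivAt f 0 t) : f a = f b := by
  have h1 : ∀ t ∈ Ioo a b, f b = f t := fun t ht ↦
    constant_of_has_deriv_right_zero (hf.mono (Icc_subset_Icc_left ht.1.le))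
      (fun x hx ↦ (hd x ⟨ht.1.trans_le hx.1, hx.2⟩).hasDerivWithinAt) b (right_mem_Icc.2 ht.2.le)
  have h2 : Filter.Tendsto f (nhdsWithin a (Ioi a)) (nhds (f a)) := by
    have := hf a (left_mem_Icc.2 hab.le)
    rw [ContinuousWithinAt, nhdsWithin_Icc_eq_nhdsGE hab] at this
    exact this.mono_left (nhdsWithin_mono a Ioi_subset_Ici_self)
  refine tendsto_nhds_unique h2 (tendsto_const_nhds.congr' ?_)
  filter_upwards [Ioo_mem_nhdsGT hab] with t ht using h1 t ht

theorem eq_cos_add_sin {f f' : ℝ → F} {s : ℝ} (hs : 0 < s)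
    (hfc : ContinuousOn f (Icc 0 s)) (hfc' : ContinuousOn f' (Icc 0 s))
    (hf : ∀ t ∈ Ioo 0 s, HasDerivAt f (f' t) t)
    (hf' : ∀ t ∈ Ioo 0 s, HasDerivAt f' (-f t) t) :
    f s = Real.cos s • f 0 + Real.sin s • f' 0 := by
  have hc : ContinuousOn (fun t ↦ Real.cos (s - t) • f t + Real.sin (s - t) • f' t) (Icc 0 s) :=
    ((Real.continuous_cos.comp (continuous_const.sub continuous_id)).continuousOn.smul hfc).add
      ((Real.continuous_sin.comp (continuous_const.sub continuous_id)).continuousOn.smul hfc')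
  have hd (t : ℝ) (ht : t ∈ Ioo 0 s) := hasDerivAt_sturm (s := s) (h := (0 : F)) (hf t ht)
    (by simpa using hf' t ht)
  have := eq_of_hasDerivAt_zero hs hc (fun t ht ↦ by simpa using hd t ht)
  simpa using this.symm

theorem monotoneOn_sturm {f f' h : ℝ → ℝ} {s : ℝ} (hπ : s ≤ Real.pi)
    (hf : ∀ t ∈ Icc 0 s, HasDerivAt f (f' t) t)
    (hf' : ∀ t ∈ Icc 0 s, HasDerivAt f' (h t - f t) t) (hh : ∀ t ∈ Icc 0 s, 0 ≤ h t) :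
    MonotoneOn (fun t ↦ Real.cos (s - t) • f t + Real.sin (s - t) • f' t) (Icc 0 s) := by
  refine monotoneOn_of_deriv_nonneg (convex_Icc 0 s)
    (fun t ht ↦ (hasDerivAt_sturm (hf t ht) (hf' t ht)).continuousAt.continuousWithinAt) ?_ ?_
  all_goals
    intro t ht
    rw [interior_Icc] at ht
    have hd := hasDerivAt_sturm (s := s) (hf t (Ioo_subset_Icc_self ht))
      (hf' t (Ioo_subset_Icc_self ht))
  · exact hd.differentiableAt.differentiableWithinAt
  · rw [hd.deriv]
    exact mul_nonneg (Real.sin_nonneg_of_nonneg_of_le_pi (by linarith [ht.2])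
      (by linarith [ht.1])) (hh t (Ioo_subset_Icc_self ht))

theorem sturm_le {f f' h : ℝ → ℝ} {s : ℝ} (hs : 0 ≤ s) (hπ : s ≤ Real.pi)
    (hf : ∀ t ∈ Icc 0 s, HasDerivAt f (f' t) t)
    (hf' : ∀ t ∈ Icc 0 s, HasDerivAt f' (h t - f t) t) (hh : ∀ t ∈ Icc 0 s, 0 ≤ h t) :
    Real.cos s * f 0 + Real.sin s * f' 0 ≤ f s := by
  have hm := monotoneOn_sturm hπ hf hf' hh
  have := hm (left_mem_Icc.2 hs) (right_mem_Icc.2 hs) hs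
  simpa using this

theorem sturm_eq {f f' h : ℝ → ℝ} {s : ℝ} (hπ : s < Real.pi)
    (hf : ∀ t ∈ Icc 0 s, HasDerivAt f (f' t) t)
    (hf' : ∀ t ∈ Icc 0 s, HasDerivAt f' (h t - f t) t) (hh : ∀ t ∈ Icc 0 s, 0 ≤ h t)
    (heq : f s = Real.cos s * f 0 + Real.sin s * f' 0) : ∀ t ∈ Ico 0 s, h t = 0 := by
  intro t ht
  have hs : 0 ≤ s := ht.1.trans ht.2.le
  have hm := monotoneOn_sturm hπ.le hf hf' hh
  have hconst : ∀ r ∈ Icc 0 s, Real.cos (s - r) • f r + Real.sin (s - r) • f' r = f s := by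
    intro r hr
    have h1 := hm (left_mem_Icc.2 hs) hr hr.1
    have h2 := hm hr (right_mem_Icc.2 hs) hr.2
    simp only [sub_zero, smul_eq_mul, ← heq, sub_self, Real.cos_zero, Real.sin_zero] at h1 h2 ⊢
    linarith
  have hd := (hasDerivAt_sturm (s := s) (hf t (Ico_subset_Icc_self ht))
    (hf' t (Ico_subset_Icc_self ht))).hasDerivWithinAt (s := Icc t s)
  have hd' : HasDerivWithinAt (fun t ↦ Real.cos (s - t) • f t + Real.sin (s - t) • f' t) 0
      (Icc t s) t :=
    (hasDerivWithinAt_const t (Icc t s) (f s)).congr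
      (fun r hr ↦ hconst r ⟨ht.1.trans hr.1, hr.2⟩) (hconst t (Ico_subset_Icc_self ht))
  have h0 := (uniqueDiffOn_Icc ht.2 t (left_mem_Icc.2 ht.2.le)).eq_deriv _ hd hd'
  exact (mul_eq_zero.1 h0).resolve_left
    (Real.sin_pos_of_pos_of_lt_pi (by linarith [ht.2]) (by linarith [ht.1])).ne'

end Sturm

/-! ### The distance to a pole along geodesics -/

section Pole

variable {E : Type*} [NormedAddCommGroup E] [NormedSpace ℝ E]

/-- The isometry `ψ` identifies the domain `N` of normal coordinates around some point with an open
subset of the domain `U` of normal coordinates around another point, the pole. The points of `N`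
have distance less than `π` to the pole and are different from it. -/
structure IsPole (g g₀ : E → E →L[ℝ] E →L[ℝ] ℝ) (U N : Set E) (ψ : E → E) : Prop where
  normal : IsNormalMetric g U
  sec : SecLEOne g U
  center : IsNormalMetric g₀ N
  isom : IsIsomOn ψ g₀ g N
  mapsTo : MapsTo ψ N U
  radius_mem : ∀ x ∈ N, radius g (ψ x) ∈ Ioo 0 Real.pi

/-- The quantity `sin ρ * h` for the distance `ρ` to the pole along a geodesic `y`, where `h` is the
radial defect of the component of the velocity orthogonal to the ray. -/
noncomputable def sturmDefect (g : E → E →L[ℝ] E →L[ℝ] ℝ) (y : ℝ → E) (s : ℝ) : ℝ :=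
  Real.sin (radius g (y s)) * radialDefect g ((radius g (y s))⁻¹ • y s)
    ((radius g (y s))⁻¹ • (deriv y s - (g 0 (y s) (deriv y s) / radius g (y s) ^ 2) • y s))
    (radius g (y s))

namespace IsPole

variable [FiniteDimensional ℝ E] {g g₀ : E → E →L[ℝ] E →L[ℝ] ℝ} {U N : Set E} {ψ : E → E}
  (P : IsPole g g₀ U N ψ) {e : E} (he : g₀ 0 e e = 1) {s : ℝ} (hs : s • e ∈ N)
include P hs

theorem hasDerivAt_ray : HasDerivAt (fun s : ℝ ↦ ψ (s • e)) (fderiv ℝ ψ (s • e) e) s := by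
  have h1 := (P.isom.differentiableAt hs).hasFDerivAt
  exact h1.comp_hasDerivAt s (hasDerivAt_smul_const' e s)

theorem contDiffAt_ray : ContDiffAt ℝ ∞ (fun s : ℝ ↦ ψ (s • e)) s :=
  (P.isom.contDiffAt hs).comp s (contDiffAt_id.smul contDiffAt_const)

theorem accel_ray : accel g (fun s : ℝ ↦ ψ (s • e)) s = 0 := by
  have h1 := P.isom.accel_comp P.center.metric P.normal.metric P.mapsTo hs
    (x := fun s : ℝ ↦ s • e) (t := s) (contDiffAt_id.smul contDiffAt_const) rfl
  have h2 : deriv (fun t : ℝ ↦ t • e) = fun _ ↦ e := by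
    ext1 t
    exact (hasDerivAt_smul_const' e t).deriv
  have h3 : accel g₀ (fun s : ℝ ↦ s • e) s = 0 := by
    simp only [accel, h2, deriv_const, P.center.radial_smul hs, add_zero]
  rw [h3, map_zero] at h1
  exact h1

include he in
theorem apply_deriv_ray : g (ψ (s • e)) (deriv (fun s : ℝ ↦ ψ (s • e)) s)
    (deriv (fun s : ℝ ↦ ψ (s • e)) s) = 1 := by
  rw [(P.hasDerivAt_ray hs).deriv, ← P.isom.apply _ hs, P.center.gauss_smul hs, he]

theorem ne_zero_of_mem {x : E} (hx : x ∈ N) : ψ x ≠ 0 := by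
  intro h0
  have := (P.radius_mem x hx).1
  rw [h0] at this
  simp [radius] at this

theorem hasDerivAt_cos_ray : HasDerivAt (fun s : ℝ ↦ -Real.cos (radius g (ψ (s • e))))
    (Real.sin (radius g (ψ (s • e))) / radius g (ψ (s • e)) *
      g 0 (ψ (s • e)) (deriv (fun s : ℝ ↦ ψ (s • e)) s)) s := by
  have h1 := (P.normal.hasDerivAt_cos_radius (P.hasDerivAt_ray hs)
    (P.ne_zero_of_mem hs hs)).neg
  refine h1.congr_deriv ?_
  rw [(P.hasDerivAt_ray hs).deriv]
  ring

include he in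
theorem hasDerivAt_deriv_cos_ray : HasDerivAt (fun s : ℝ ↦
    Real.sin (radius g (ψ (s • e))) / radius g (ψ (s • e)) *
      g 0 (ψ (s • e)) (deriv (fun s : ℝ ↦ ψ (s • e)) s))
    (sturmDefect g (fun s ↦ ψ (s • e)) s - -Real.cos (radius g (ψ (s • e)))) s := by
  have hr := P.radius_mem _ hs
  have h1 := (P.normal.hasDerivAt_deriv_cos_radius (y := fun s : ℝ ↦ ψ (s • e))
    ((P.contDiffAt_ray hs).of_le (by norm_cast)) (P.mapsTo hs) (P.ne_zero_of_mem hs hs)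
    (P.accel_ray hs) (P.apply_deriv_ray he hs) (Real.sin_pos_of_pos_of_lt_pi hr.1 hr.2).ne').neg
  have h2 := h1.congr_deriv (g' := sturmDefect g (fun s ↦ ψ (s • e)) s
    - -Real.cos (radius g (ψ (s • e)))) (by simp only [sturmDefect]; ring)
  refine h2.congr_of_eventuallyEq (Filter.Eventually.of_forall fun t ↦ ?_)
  simp only [Pi.neg_apply]
  ring

theorem smul_mem {t : ℝ} (ht : t ∈ Icc 0 (radius g (ψ (s • e)))) :
    t • (radius g (ψ (s • e)))⁻¹ • ψ (s • e) ∈ U := by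
  rw [smul_smul]
  have hr := (P.radius_mem _ hs).1
  exact P.normal.star _ (P.mapsTo hs) _ ⟨mul_nonneg ht.1 (inv_nonneg.2 hr.le), by
    rw [← div_eq_mul_inv, div_le_one hr]; exact ht.2⟩

theorem unit_radial :
    g 0 ((radius g (ψ (s • e)))⁻¹ • ψ (s • e)) ((radius g (ψ (s • e)))⁻¹ • ψ (s • e)) = 1 := by
  have hr := (P.radius_mem _ hs).1
  simp only [map_smul, smul_apply, smul_eq_mul, ← P.normal.radius_sq (ψ (s • e))]
  field_simp

theorem sturmDefect_nonneg : 0 ≤ sturmDefect g (fun s : ℝ ↦ ψ (s • e)) s := by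
  have hr := P.radius_mem _ hs
  refine mul_nonneg (Real.sin_pos_of_pos_of_lt_pi hr.1 hr.2).le ?_
  refine P.normal.radialDefect_nonneg (P.unit_radial hs) ?_ P.sec hr.2
    (fun t ht ↦ P.smul_mem hs ht) ⟨hr.1.le, le_rfl⟩
  have h1 := P.normal.radius_sq (ψ (s • e))
  have h2 : radius g (ψ (s • e)) ≠ 0 := hr.1.ne'
  simp only [map_smul, map_sub, smul_apply, smul_eq_mul, ← h1]
  field_simp
  ring

omit he hs in
theorem ray_mem {s ℓ : ℝ} (hℓ : ℓ • e ∈ N) (hs : s ∈ Icc 0 ℓ) : s • e ∈ N := by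
  rcases eq_or_ne ℓ 0 with h | h
  · have : s = ℓ := le_antisymm hs.2 (h ▸ hs.1)
    rwa [this]
  · have := P.center.star _ hℓ (s / ℓ) ⟨div_nonneg hs.1 (hs.1.trans hs.2),
      div_le_one_of_le₀ hs.2 (hs.1.trans hs.2)⟩
    rwa [smul_smul, div_mul_cancel₀ _ h] at this

end IsPole

section TwoPoles

variable [FiniteDimensional ℝ E] {g g' g₀ : E → E →L[ℝ] E →L[ℝ] ℝ} {U U' N : Set E} {ψ ψ' : E → E}

/-- Two poles which lie opposite to each other with respect to the center. -/
structure IsOpposite (g g' g₀ : E → E →L[ℝ] E →L[ℝ] ℝ) (U U' N : Set E) (ψ ψ' : E → E) : Prop where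
  left : IsPole g g₀ U N ψ
  right : IsPole g' g₀ U' N ψ'
  radius_left : radius g (ψ 0) = Real.pi / 2
  radius_right : radius g' (ψ' 0) = Real.pi / 2
  opposite : ∀ e, g 0 (ψ 0) (fderiv ℝ ψ 0 e) + g' 0 (ψ' 0) (fderiv ℝ ψ' 0 e) = 0

namespace IsOpposite

variable (h : IsOpposite g g' g₀ U U' N ψ ψ') {e : E} (he : g₀ 0 e e = 1) {ℓ : ℝ} (hℓ : ℓ • e ∈ N)
include h

theorem symm : IsOpposite g' g g₀ U' U N ψ' ψ :=
  ⟨h.right, h.left, h.radius_right, h.radius_left, fun e ↦ by rw [add_comm, h.opposite]⟩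

theorem deriv_zero (e : E) : Real.sin (radius g (ψ ((0 : ℝ) • e))) / radius g (ψ ((0 : ℝ) • e)) *
      g 0 (ψ ((0 : ℝ) • e)) (deriv (fun s : ℝ ↦ ψ (s • e)) 0)
    + Real.sin (radius g' (ψ' ((0 : ℝ) • e))) / radius g' (ψ' ((0 : ℝ) • e)) *
      g' 0 (ψ' ((0 : ℝ) • e)) (deriv (fun s : ℝ ↦ ψ' (s • e)) 0) = 0 := by
  have h0 : (0 : ℝ) • e ∈ N := by rw [zero_smul]; exact h.left.center.zero_mem
  rw [(h.left.hasDerivAt_ray h0).deriv, (h.right.hasDerivAt_ray h0).deriv]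
  simp only [zero_smul, h.radius_left, h.radius_right]
  rw [← mul_add, h.opposite, mul_zero]

include he hℓ

/-- The sum of the distances to the two poles is at least `π`, because the function
`-cos ρ - cos ρ'` satisfies `f'' + f ≥ 0` along the rays and vanishes to first order at the
center. -/
theorem pi_le_of_ray (hℓ0 : 0 ≤ ℓ) (hℓπ : ℓ ≤ Real.pi) :
    Real.pi ≤ radius g (ψ (ℓ • e)) + radius g' (ψ' (ℓ • e)) := by
  have hN (t : ℝ) (ht : t ∈ Icc 0 ℓ) := h.left.ray_mem hℓ ht
  have h1 := sturm_le hℓ0 hℓπ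
    (fun t ht ↦ (h.left.hasDerivAt_cos_ray (hN t ht)).add (h.right.hasDerivAt_cos_ray (hN t ht)))
    (fun t ht ↦ ((h.left.hasDerivAt_deriv_cos_ray he (hN t ht)).add
      (h.right.hasDerivAt_deriv_cos_ray he (hN t ht))).congr_deriv
      (g' := (sturmDefect g (fun s ↦ ψ (s • e)) t + sturmDefect g' (fun s ↦ ψ' (s • e)) t) - _)
      (by simp only [Pi.add_apply]; ring))
    (fun t ht ↦ add_nonneg (h.left.sturmDefect_nonneg (hN t ht))
      (h.right.sturmDefect_nonneg (hN t ht)))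
  simp only [Pi.add_apply, h.deriv_zero] at h1
  simp only [zero_smul, h.radius_left, h.radius_right, Real.cos_pi_div_two] at h1
  have hr := h.left.radius_mem _ hℓ
  have hr' := h.right.radius_mem _ hℓ
  by_contra hlt
  push Not at hlt
  have h2 := Real.cos_lt_cos_of_nonneg_of_le_pi hr.1.le (by linarith [hr'.1])
    (show radius g (ψ (ℓ • e)) < Real.pi - radius g' (ψ' (ℓ • e)) by linarith)
  rw [Real.cos_pi_sub] at h2
  linarith

/-- If the sum of the distances to the poles is minimal at a point of the equator, then the
segment from the center to this point lies on the equator. -/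
theorem rigid (hℓ0 : 0 < ℓ) (hℓπ : ℓ < Real.pi) (hr : radius g (ψ (ℓ • e)) = Real.pi / 2)
    (hr' : radius g' (ψ' (ℓ • e)) = Real.pi / 2) :
    (∀ s ∈ Icc 0 ℓ, radius g (ψ (s • e)) = Real.pi / 2) ∧
      ∀ s ∈ Ico 0 ℓ, sturmDefect g (fun s ↦ ψ (s • e)) s = 0 := by
  have hN (t : ℝ) (ht : t ∈ Icc 0 ℓ) := h.left.ray_mem hℓ ht
  have h1 := sturm_eq hℓπ
    (fun t ht ↦ (h.left.hasDerivAt_cos_ray (hN t ht)).add (h.right.hasDerivAt_cos_ray (hN t ht)))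
    (fun t ht ↦ ((h.left.hasDerivAt_deriv_cos_ray he (hN t ht)).add
      (h.right.hasDerivAt_deriv_cos_ray he (hN t ht))).congr_deriv
      (g' := (sturmDefect g (fun s ↦ ψ (s • e)) t + sturmDefect g' (fun s ↦ ψ' (s • e)) t) - _)
      (by simp only [Pi.add_apply]; ring))
    (fun t ht ↦ add_nonneg (h.left.sturmDefect_nonneg (hN t ht))
      (h.right.sturmDefect_nonneg (hN t ht)))
    (by
      simp only [Pi.add_apply, h.deriv_zero]
      simp only [zero_smul, h.radius_left, h.radius_right, Real.cos_pi_div_two, hr, hr']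
      simp)
  -- The sum of the defects vanishes, hence both of them do, as they are nonnegative.
  have hdef : ∀ s ∈ Ico 0 ℓ, sturmDefect g (fun s ↦ ψ (s • e)) s = 0 := by
    intro t ht
    have h2 := h.left.sturmDefect_nonneg (hN t (Ico_subset_Icc_self ht))
    have h3 := h.right.sturmDefect_nonneg (hN t (Ico_subset_Icc_self ht))
    linarith [h1 t ht]
  -- Hence `-cos ρ` solves `f'' + f = 0` with `f(0) = 0`, so it equals `D sin`; it vanishes at
  -- `ℓ < π`, so `D = 0`.
  have hsol (s : ℝ) (hs : s ∈ Ioc 0 ℓ) := eq_cos_add_sin hs.1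
    (fun t ht ↦ (h.left.hasDerivAt_cos_ray (hN t ⟨ht.1, ht.2.trans hs.2⟩)
      ).continuousAt.continuousWithinAt)
    (fun t ht ↦ (h.left.hasDerivAt_deriv_cos_ray he (hN t ⟨ht.1, ht.2.trans hs.2⟩)
      ).continuousAt.continuousWithinAt)
    (fun t ht ↦ h.left.hasDerivAt_cos_ray (hN t ⟨ht.1.le, ht.2.le.trans hs.2⟩))
    (fun t ht ↦ (h.left.hasDerivAt_deriv_cos_ray he (hN t ⟨ht.1.le, ht.2.le.trans hs.2⟩)
      ).congr_deriv (by rw [hdef t ⟨ht.1.le, ht.2.trans_le hs.2⟩, zero_sub]))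
  set D := Real.sin (radius g (ψ ((0 : ℝ) • e))) / radius g (ψ ((0 : ℝ) • e)) *
      g 0 (ψ ((0 : ℝ) • e)) (deriv (fun s : ℝ ↦ ψ (s • e)) 0) with hD
  have hD0 : D = 0 := by
    have h4 := hsol ℓ ⟨hℓ0, le_rfl⟩
    simp only [zero_smul, h.radius_left, hr, Real.cos_pi_div_two, neg_zero, smul_eq_mul, mul_zero,
      zero_add] at h4
    exact (mul_eq_zero.1 h4.symm).resolve_left (Real.sin_pos_of_pos_of_lt_pi hℓ0 hℓπ).ne'
  refine ⟨fun s hs ↦ ?_, hdef⟩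
  rcases hs.1.eq_or_lt with h0 | h0
  · rw [← h0, zero_smul, h.radius_left]
  · have h4 := hsol s ⟨h0, hs.2⟩
    rw [hD0] at h4
    simp only [zero_smul, h.radius_left, Real.cos_pi_div_two, neg_zero, smul_zero,
      zero_add] at h4
    have h5 := h.left.radius_mem _ (hN s hs)
    refine Real.injOn_cos (Ioo_subset_Icc_self h5) ⟨by positivity, by linarith [Real.pi_pos]⟩ ?_
    rw [Real.cos_pi_div_two]
    linarith

end IsOpposite

end TwoPoles

end Pole

/-! ### Spherical sectors -/

section Sector

variable {E : Type*} [NormedAddCommGroup E] [NormedSpace ℝ E]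

/-- The vector at angle `θ` from `v` in the plane of `v` and `e`. -/
noncomputable def rot (v e : E) (θ : ℝ) : E := Real.cos θ • v + Real.sin θ • e

/-- The derivative of `rot`. -/
noncomputable def rot' (v e : E) (θ : ℝ) : E := -Real.sin θ • v + Real.cos θ • e

theorem hasDerivAt_rot (v e : E) (θ : ℝ) : HasDerivAt (rot v e) (rot' v e θ) θ :=
  ((Real.hasDerivAt_cos θ).smul_const v).add ((Real.hasDerivAt_sin θ).smul_const e)

theorem hasDerivAt_rot' (v e : E) (θ : ℝ) : HasDerivAt (rot' v e) (-rot v e θ) θ := by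
  refine (((Real.hasDerivAt_sin θ).neg.smul_const v).add
    ((Real.hasDerivAt_cos θ).smul_const e)).congr_deriv ?_
  simp only [rot]
  module

theorem contDiff_rot (v e : E) : ContDiff ℝ ∞ (rot v e) :=
  (Real.contDiff_cos.smul contDiff_const).add (Real.contDiff_sin.smul contDiff_const)

theorem continuous_rot (v e : E) : Continuous (rot v e) := (contDiff_rot v e).continuous

theorem continuous_rot' (v e : E) : Continuous (rot' v e) :=
  continuous_iff_continuousAt.2 fun θ ↦ (hasDerivAt_rot' v e θ).continuousAt

@[simp] theorem rot_zero (v e : E) : rot v e 0 = v := by simp [rot]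

@[simp] theorem rot'_zero (v e : E) : rot' v e 0 = e := by simp [rot']

/-- The sector of angle `α` and radius `π / 2` spanned by the orthonormal vectors `v`, `e` is, in
the normal coordinates of the metric `g`, a totally geodesic sector of the unit sphere. The field
`conn` describes the covariant derivative of `∂_θ` along the rays, the field `second` the second
fundamental form in the direction of `∂_θ`. -/
structure IsSector (g : E → E →L[ℝ] E →L[ℝ] ℝ) (U : Set E) (v e : E) (α : ℝ) : Prop where
  mem : ∀ θ ∈ Icc 0 α, ∀ t ∈ Icc 0 (Real.pi / 2), t • rot v e θ ∈ U
  unit_left : g 0 v v = 1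
  orth : g 0 v e = 0
  unit_right : g 0 e e = 1
  jacobi : ∀ θ ∈ Icc 0 α, ∀ t ∈ Ioc 0 (Real.pi / 2),
    g (t • rot v e θ) (t • rot' v e θ) (t • rot' v e θ) = Real.sin t ^ 2
  conn : ∀ θ ∈ Icc 0 α, ∀ t ∈ Ioc 0 (Real.pi / 2),
    jacobiDeriv g (rot v e θ) (rot' v e θ) t = (Real.cos t / Real.sin t) • t • rot' v e θ
  second : ∀ θ ∈ Icc 0 α, ∀ t ∈ Ioc 0 (Real.pi / 2), t • -rot v e θ
    + chris g (t • rot v e θ) (t • rot' v e θ) (t • rot' v e θ)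
    + (Real.sin t * Real.cos t) • rot v e θ = 0

theorem eqOn_Icc_of_Ioo {F : Type*} [TopologicalSpace F] [T2Space F] {f h : ℝ → F} {a b : ℝ}
    (hab : a < b) (hf : ContinuousOn f (Icc a b)) (hh : ContinuousOn h (Icc a b))
    (heq : ∀ t ∈ Ioo a b, f t = h t) : ∀ t ∈ Icc a b, f t = h t :=
  Set.EqOn.of_subset_closure (s := Ioo a b) heq hf hh Ioo_subset_Icc_self
    (by rw [closure_Ioo hab.ne])

variable [FiniteDimensional ℝ E] {g g₀ : E → E →L[ℝ] E →L[ℝ] ℝ} {U N : Set E} {ψ : E → E}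

/-- Rays to a segment on the equator along which the comparison is an equality sweep out a
spherical sector. -/
theorem IsPole.exists_isSector (P : IsPole g g₀ U N ψ) {e : E} (he : g₀ 0 e e = 1) {ℓ : ℝ}
    (hℓ0 : 0 < ℓ) (hℓ : ℓ • e ∈ N) (hr : ∀ s ∈ Icc 0 ℓ, radius g (ψ (s • e)) = Real.pi / 2)
    (hd : ∀ s ∈ Ico 0 ℓ, sturmDefect g (fun s ↦ ψ (s • e)) s = 0) :
    ∃ v e', IsSector g U v e' ℓ ∧ ∀ s ∈ Icc 0 ℓ, ψ (s • e) = (Real.pi / 2) • rot v e' s := by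
  have hN (t : ℝ) (ht : t ∈ Icc 0 ℓ) := P.ray_mem hℓ ht
  have hπ : 0 < Real.pi / 2 := by positivity
  have hππ : Real.pi / 2 < Real.pi := by linarith
  set c := (Real.pi / 2)⁻¹ with hc
  have hcT : Real.pi / 2 * c = 1 := mul_inv_cancel₀ hπ.ne'
  set y : ℝ → E := fun s ↦ ψ (s • e) with hy
  -- The unit directions of the rays to the points of the segment.
  set W : ℝ → E := fun s ↦ c • y s with hW
  have hWy (s : ℝ) : (Real.pi / 2) • W s = y s := by
    simp only [hW, smul_smul, hcT, one_smul]
  have hdW : deriv W = fun s ↦ c • deriv y s := by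
    ext1 s
    exact deriv_fun_const_smul_field c y
  have hWy' (s : ℝ) : (Real.pi / 2) • deriv W s = deriv y s := by
    simp only [hdW, smul_smul, hcT, one_smul]
  have hWc (s : ℝ) (hs : s ∈ Icc 0 ℓ) : ContDiffAt ℝ ∞ W s :=
    (P.contDiffAt_ray (hN s hs)).const_smul c
  have hWd (s : ℝ) (hs : s ∈ Icc 0 ℓ) :=
    hasDerivAt_deriv_of_contDiffAt ((hWc s hs).of_le (m := 2) (by norm_cast))
  have hyU (s : ℝ) (hs : s ∈ Icc 0 ℓ) : y s ∈ U := P.mapsTo (hN s hs)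
  have hmem (s : ℝ) (hs : s ∈ Icc 0 ℓ) (t : ℝ) (ht : t ∈ Icc 0 (Real.pi / 2)) : t • W s ∈ U := by
    have := P.smul_mem (hN s hs) (t := t) (by rw [hr s hs]; exact ht)
    rwa [hr s hs] at this
  have hunit (s : ℝ) (hs : s ∈ Icc 0 ℓ) : g 0 (W s) (W s) = 1 := by
    have := P.unit_radial (hN s hs)
    rwa [hr s hs] at this
  -- Identities which involve the derivative of the distance are available on the open interval only;
  -- at the end they are extended to the closed interval by continuity.
  have horthy (s : ℝ) (hs : s ∈ Ioo 0 ℓ) : g 0 (y s) (deriv y s) = 0 := by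
    have hs' := Ioo_subset_Icc_self hs
    have h1 := P.normal.hasDerivAt_radius (P.hasDerivAt_ray (hN s hs'))
      (P.ne_zero_of_mem (hN s hs') (hN s hs'))
    have h2 : (fun s ↦ radius g (ψ (s • e))) =ᶠ[nhds s] fun _ ↦ Real.pi / 2 := by
      filter_upwards [isOpen_Ioo.mem_nhds hs] with r hr' using hr r (Ioo_subset_Icc_self hr')
    have h3 := h1.unique ((hasDerivAt_const s (Real.pi / 2)).congr_of_eventuallyEq h2)
    rw [hr s hs'] at h3
    have h4 := (div_eq_zero_iff.1 h3).resolve_right hπ.ne'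
    rwa [← (P.hasDerivAt_ray (hN s hs')).deriv] at h4
  have horth (s : ℝ) (hs : s ∈ Ioo 0 ℓ) : g 0 (W s) (deriv W s) = 0 := by
    rw [congrFun hdW s]
    change g 0 (c • y s) (c • deriv y s) = 0
    simp only [map_smul, smul_apply, horthy s hs, smul_zero]
  have hTU (s : ℝ) (hs : s ∈ Icc 0 ℓ) := hmem s hs
  have hjac (s : ℝ) (hs : s ∈ Ioo 0 ℓ) := P.normal.jacobiDeriv_eq_of_radialDefect_eq_zero
    (hunit s (Ioo_subset_Icc_self hs)) (horth s hs) P.sec hππ (hTU s (Ioo_subset_Icc_self hs)) hπ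
    (by
      have h1 := hd s (Ioo_subset_Ico_self hs)
      have h2 : radius g (y s) = Real.pi / 2 := hr s (Ioo_subset_Icc_self hs)
      have h3 := horthy s hs
      simp only [sturmDefect, h2, Real.sin_pi_div_two, one_mul, h3, zero_div, zero_smul,
        sub_zero] at h1
      rw [congrFun hdW s]
      exact h1)
  have hunit' (s : ℝ) (hs : s ∈ Ioo 0 ℓ) : g 0 (deriv W s) (deriv W s) = 1 := by
    have h1 := (hjac s hs).2 _ (right_mem_Icc.2 hπ.le)
    rw [hWy, hWy', Real.sin_pi_div_two, one_pow, one_mul,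
      P.apply_deriv_ray he (hN s (Ioo_subset_Icc_self hs))] at h1
    exact h1.symm
  have hsph (s : ℝ) (hs : s ∈ Ioo 0 ℓ) := P.normal.spherical_of_jacobiDeriv P.sec (s₀ := s)
    ((hWc s (Ioo_subset_Icc_self hs)).of_le (by norm_cast)) hπ hππ (hTU s (Ioo_subset_Icc_self hs))
    (fun t ht ↦ by
      filter_upwards [isOpen_Ioo.mem_nhds hs] with r hr' using (hjac r hr').1 t ht)
    (hunit s (Ioo_subset_Icc_self hs)) (horth s hs)
    (fun t ht ↦ by rw [(hjac s hs).2 t ht, hunit' s hs, mul_one])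
    (by
      have h1 := P.accel_ray (hN s (Ioo_subset_Icc_self hs))
      have h2 : deriv (deriv W) s = c • deriv (deriv y) s := by
        rw [hdW]; exact deriv_fun_const_smul_field c (deriv y)
      rw [hWy, hWy', h2, smul_smul, hcT, one_smul, Real.cos_pi_div_two, mul_zero, zero_smul,
        add_zero]
      exact h1)
  -- The directions satisfy `W'' + W = 0`.
  have hWrot (s : ℝ) (hs : s ∈ Icc 0 ℓ) : W s = rot (W 0) (deriv W 0) s := by
    rcases hs.1.eq_or_lt with h | h
    · rw [← h, rot_zero]
    · exact eq_cos_add_sin h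
        (fun t ht ↦ (hWd t ⟨ht.1, ht.2.trans hs.2⟩).1.continuousAt.continuousWithinAt)
        (fun t ht ↦ (hWd t ⟨ht.1, ht.2.trans hs.2⟩).2.continuousAt.continuousWithinAt)
        (fun t ht ↦ (hWd t ⟨ht.1.le, ht.2.le.trans hs.2⟩).1)
        (fun t ht ↦ (hWd t ⟨ht.1.le, ht.2.le.trans hs.2⟩).2.congr_deriv
          (hsph t ⟨ht.1, ht.2.trans_le hs.2⟩).2)
  have hWrot' (s : ℝ) (hs : s ∈ Ioo 0 ℓ) : deriv W s = rot' (W 0) (deriv W 0) s := by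
    have h1 : W =ᶠ[nhds s] rot (W 0) (deriv W 0) := by
      filter_upwards [isOpen_Ioo.mem_nhds hs] with r hr' using hWrot r (Ioo_subset_Icc_self hr')
    rw [h1.deriv_eq, (hasDerivAt_rot _ _ s).deriv]
  set v := W 0
  set e' := deriv W 0
  have hmem' : ∀ θ ∈ Icc 0 ℓ, ∀ t ∈ Icc 0 (Real.pi / 2), t • rot v e' θ ∈ U := fun θ hθ t ht ↦ by
    rw [← hWrot θ hθ]; exact hmem θ hθ t ht
  have h0 : (0 : ℝ) ∈ Icc 0 ℓ := left_mem_Icc.2 hℓ0.le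
  have cr := (continuous_rot v e').continuousOn (s := Icc 0 ℓ)
  have cr' := (continuous_rot' v e').continuousOn (s := Icc 0 ℓ)
  have cg (t : ℝ) (ht : t ∈ Ioc 0 (Real.pi / 2)) :
      ContinuousOn (fun θ ↦ g (t • rot v e' θ)) (Icc 0 ℓ) :=
    P.normal.metric.contDiffOn.continuousOn.comp (cr.const_smul t)
      fun θ hθ ↦ hmem' θ hθ t (Ioc_subset_Icc_self ht)
  have cchris (t : ℝ) (ht : t ∈ Ioc 0 (Real.pi / 2)) :
      ContinuousOn (fun θ ↦ chris g (t • rot v e' θ)) (Icc 0 ℓ) := by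
    have h1 : ContinuousOn (chris g) U := fun z hz ↦
      (P.normal.metric.contDiffAt_chris hz).continuousAt.continuousWithinAt
    exact h1.comp (cr.const_smul t) fun θ hθ ↦ hmem' θ hθ t (Ioc_subset_Icc_self ht)
  refine ⟨v, e', ⟨hmem', hunit 0 h0, ?_, ?_, fun θ hθ t ht ↦ ?_, fun θ hθ t ht ↦ ?_,
    fun θ hθ t ht ↦ ?_⟩, fun s hs ↦ ?_⟩
  · have := eqOn_Icc_of_Ioo hℓ0 (f := fun θ ↦ g 0 (rot v e' θ) (rot' v e' θ)) (h := fun _ ↦ 0)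
      ((continuousOn_const.clm_apply cr).clm_apply cr') continuousOn_const (fun t ht ↦ by
        rw [← hWrot t (Ioo_subset_Icc_self ht), ← hWrot' t ht]; exact horth t ht) 0 h0
    simpa using this
  · have := eqOn_Icc_of_Ioo hℓ0 (f := fun θ ↦ g 0 (rot' v e' θ) (rot' v e' θ)) (h := fun _ ↦ 1)
      ((continuousOn_const.clm_apply cr').clm_apply cr') continuousOn_const (fun t ht ↦ by
        rw [← hWrot' t ht]; exact hunit' t ht) 0 h0
    simpa using this
  · refine eqOn_Icc_of_Ioo hℓ0
      (f := fun θ ↦ g (t • rot v e' θ) (t • rot' v e' θ) (t • rot' v e' θ))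
      (h := fun _ ↦ Real.sin t ^ 2)
      (((cg t ht).clm_apply (cr'.const_smul t)).clm_apply (cr'.const_smul t)) continuousOn_const
      (fun θ hθ ↦ ?_) θ hθ
    rw [← hWrot θ (Ioo_subset_Icc_self hθ), ← hWrot' θ hθ,
      (hjac θ hθ).2 t (Ioc_subset_Icc_self ht), hunit' θ hθ, mul_one]
  · refine eqOn_Icc_of_Ioo hℓ0
      (f := fun θ ↦ jacobiDeriv g (rot v e' θ) (rot' v e' θ) t)
      (h := fun θ ↦ (Real.cos t / Real.sin t) • t • rot' v e' θ)
      (cr'.add (((cchris t ht).clm_apply cr).clm_apply (cr'.const_smul t)))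
      ((cr'.const_smul t).const_smul _) (fun θ hθ ↦ ?_) θ hθ
    rw [← hWrot θ (Ioo_subset_Icc_self hθ), ← hWrot' θ hθ, (hjac θ hθ).1 t ht]
  · refine eqOn_Icc_of_Ioo hℓ0
      (f := fun θ ↦ t • -rot v e' θ + chris g (t • rot v e' θ) (t • rot' v e' θ) (t • rot' v e' θ)
        + (Real.sin t * Real.cos t) • rot v e' θ) (h := fun _ ↦ 0)
      (((cr.neg.const_smul t).add (((cchris t ht).clm_apply (cr'.const_smul t)).clm_apply
        (cr'.const_smul t))).add (cr.const_smul _))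
      continuousOn_const (fun θ hθ ↦ ?_) θ hθ
    rw [← hWrot θ (Ioo_subset_Icc_self hθ), ← hWrot' θ hθ, ← (hsph θ hθ).2]
    exact (hsph θ hθ).1 t ht
  · rw [← hWrot s hs, hWy]

end Sector

/-! ### Lifting variations to normal coordinates -/

section Lift

/-- A tube lemma at the parameter `0` for relative neighborhoods in a product of intervals. -/
theorem exists_forall_of_eventually_nhdsWithin {P : ℝ × ℝ → Prop} {a b δ : ℝ} (hab : a ≤ b)
    (hδ : 0 < δ)
    (h : ∀ t ∈ Icc a b, ∀ᶠ z in nhdsWithin (0, t) (Ioo (-δ) δ ×ˢ Icc a b), P z) :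
    ∃ ε, 0 < ε ∧ ε ≤ δ ∧ ∀ σ ∈ Ioo (-ε) ε, ∀ t ∈ Icc a b, P (σ, t) := by
  have hev := isCompact_Icc.eventually_forall_of_forall_eventually (x₀ := (0 : ℝ)) (K := Icc a b)
    (P := fun σ t ↦ P (σ, projIcc a b hab t)) (fun t ht ↦ by
      have hc : Continuous fun z : ℝ × ℝ ↦ (z.1, (projIcc a b hab z.2 : ℝ)) :=
        continuous_fst.prodMk (continuous_subtype_val.comp (continuous_projIcc.comp continuous_snd))
      have h0 : ((0 : ℝ), (projIcc a b hab t : ℝ)) = (0, t) := by rw [projIcc_of_mem hab ht]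
      have ht' : Filter.Tendsto (fun z : ℝ × ℝ ↦ (z.1, (projIcc a b hab z.2 : ℝ))) (nhds (0, t))
          (nhdsWithin (0, t) (Ioo (-δ) δ ×ˢ Icc a b)) := by
        refine tendsto_nhdsWithin_iff.2 ⟨?_, ?_⟩
        · have := hc.tendsto (0, t)
          rwa [h0] at this
        · have : ∀ᶠ z : ℝ × ℝ in nhds (0, t), z.1 ∈ Ioo (-δ) δ :=
            continuous_fst.continuousAt.eventually
              (isOpen_Ioo.mem_nhds ⟨neg_lt_zero.2 hδ, hδ⟩)
          filter_upwards [this] with z hz using ⟨hz, (projIcc a b hab z.2).2⟩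
      exact ht'.eventually (h t ht))
  obtain ⟨r, hr, hball⟩ := Metric.eventually_nhds_iff_ball.1 hev
  refine ⟨min r δ, lt_min hr hδ, min_le_right _ _, fun σ hσ t ht ↦ ?_⟩
  have h1 := hball σ (by
    rw [Metric.mem_ball, Real.dist_eq, sub_zero, abs_lt]
    exact ⟨by linarith [hσ.1, min_le_left r δ], hσ.2.trans_le (min_le_left _ _)⟩) t ht
  rwa [projIcc_of_mem hab ht] at h1

variable {n : ℕ} {M : Type*} [TopologicalSpace M] [ChartedSpace (EuclideanSpace ℝ (Fin n)) M]
  [IsManifold (𝓡 n) ∞ M]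

/-- A smooth map lifts locally through a parametrization. -/
theorem IsParam.exists_local_lift {Φ : EuclideanSpace ℝ (Fin n) → M}
    {U : Set (EuclideanSpace ℝ (Fin n))} (h : IsParam Φ U) {V : ℝ × ℝ → M} {S : Set (ℝ × ℝ)}
    {z : ℝ × ℝ} (hV : ContMDiffWithinAt 𝓘(ℝ, ℝ × ℝ) (𝓡 n) ∞ V S z)
    {w : EuclideanSpace ℝ (Fin n)} (hw : w ∈ U) (hz : Φ w = V z) :
    ∃ f : ℝ × ℝ → EuclideanSpace ℝ (Fin n), ContDiffWithinAt ℝ ∞ f S z ∧ f z = w ∧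
      ∀ᶠ z' in nhdsWithin z S, Φ (f z') = V z' := by
  obtain ⟨e, h1, h2, h3, h4, h5⟩ := h.exists_localInverse hw
  set φ := extChartAt (𝓡 n) (Φ w) with hφ
  have hx : V z ∈ φ.source := hz ▸ mem_extChartAt_source _
  have h6 : ContMDiffAt (𝓡 n) 𝓘(ℝ, EuclideanSpace ℝ (Fin n)) ∞ φ (V z) :=
    contMDiffAt_extChartAt' (by simpa [hφ] using hx)
  have h7 : ContDiffWithinAt ℝ ∞ (fun z ↦ φ (V z)) S z :=
    contMDiffWithinAt_iff_contDiffWithinAt.1 (h6.comp_contMDiffWithinAt z hV)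
  have h8 : e w = φ (V z) := by rw [h4 w h1, hz]
  have h9 : φ (V z) ∈ e.target := h8 ▸ e.map_source h1
  refine ⟨fun z ↦ e.symm (φ (V z)),
    (h5.contDiffAt (e.open_target.mem_nhds h9)).comp_contDiffWithinAt z h7, ?_, ?_⟩
  · simp only [← h8]
    exact e.left_inv h1
  · filter_upwards [h7.continuousWithinAt.preimage_mem_nhdsWithin (e.open_target.mem_nhds h9),
      hV.continuousWithinAt.preimage_mem_nhdsWithin
        ((isOpen_extChartAt_source (Φ w)).mem_nhds hx)] with z' h10 h11
    have h12 := h4 _ (e.map_target h10)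
    rw [e.right_inv h10] at h12
    exact φ.injOn (h3 _ (e.map_target h10)) h11 h12.symm

variable [T2Space M]

/-- A variation of a curve which lies in a parametrized region lifts to a variation of the
coordinate curve. The lift is unique within an open set `O` on which the parametrization is
injective for each time. -/
theorem IsParam.exists_lift {Φ : EuclideanSpace ℝ (Fin n) → M}
    {U : Set (EuclideanSpace ℝ (Fin n))} (h : IsParam Φ U) {a b δ : ℝ} (hab : a ≤ b) (hδ : 0 < δ)
    {x : ℝ → EuclideanSpace ℝ (Fin n)} (hx : ContinuousOn x (Icc a b))
    (hxU : ∀ t ∈ Icc a b, x t ∈ U) {V : ℝ × ℝ → M}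
    (hV : ContMDiffOn 𝓘(ℝ, ℝ × ℝ) (𝓡 n) ∞ V (Ioo (-δ) δ ×ˢ Icc a b))
    (hV0 : ∀ t ∈ Icc a b, V (0, t) = Φ (x t)) :
    ∃ O : Set (ℝ × EuclideanSpace ℝ (Fin n)), IsOpen O ∧ InjOn (fun q ↦ (q.1, Φ q.2)) O ∧
      (∀ q ∈ O, q.2 ∈ U) ∧ (∀ t ∈ Icc a b, (t, x t) ∈ O) ∧
      ∃ ε, 0 < ε ∧ ε ≤ δ ∧ ∃ Y : ℝ × ℝ → EuclideanSpace ℝ (Fin n),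
        ContDiffOn ℝ ∞ Y (Ioo (-ε) ε ×ˢ Icc a b) ∧
        ∀ σ ∈ Ioo (-ε) ε, ∀ t ∈ Icc a b, (t, Y (σ, t)) ∈ O ∧ Φ (Y (σ, t)) = V (σ, t) := by
  set f : ℝ × EuclideanSpace ℝ (Fin n) → ℝ × M := fun q ↦ (q.1, Φ q.2) with hf
  set K := (fun t ↦ (t, x t)) '' Icc a b with hK
  have hKU : ∀ q ∈ K, q.2 ∈ U := by
    rintro - ⟨t, ht, rfl⟩
    exact hxU t ht
  have hKc : IsCompact K := isCompact_Icc.image_of_continuousOn (continuousOn_id.prodMk hx)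
  have hinj : InjOn f K := by
    rintro - ⟨t, ht, rfl⟩ - ⟨s, hs, rfl⟩ hts
    have : t = s := congrArg Prod.fst hts
    rw [this]
  -- The map `f` is injective on the compact graph `K` and locally injective near it, hence it is
  -- injective on a neighborhood of `K`.
  obtain ⟨O₁, hO₁, hO₁i⟩ := hinj.exists_mem_nhdsSet hKc
    (fun q hq ↦ continuousAt_fst.prodMk
      ((h.contMDiffAt (hKU q hq)).continuousAt.comp continuousAt_snd))
    (fun q hq ↦ by
      obtain ⟨e, h1, h2, h3, h4, h5⟩ := h.exists_localInverse (hKU q hq)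
      refine ⟨univ ×ˢ e.source, prod_mem_nhds Filter.univ_mem (e.open_source.mem_nhds h1), ?_⟩
      rintro ⟨t, y⟩ ⟨-, hy⟩ ⟨s, z⟩ ⟨-, hz⟩ hyz
      have h6 : Φ y = Φ z := congrArg Prod.snd hyz
      have h7 : e y = e z := by rw [h4 y hy, h4 z hz, h6]
      have h8 : t = s := congrArg Prod.fst hyz
      exact Prod.ext h8 (e.injOn hy hz h7))
  obtain ⟨O₂, hO₂, hKO₂, hO₂₁⟩ := mem_nhdsSet_iff_exists.1 hO₁
  set O := O₂ ∩ Prod.snd ⁻¹' U with hO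
  have hOo : IsOpen O := hO₂.inter (h.isOpen.preimage continuous_snd)
  have hOi : InjOn f O := hO₁i.mono fun q hq ↦ hO₂₁ hq.1
  have hxO : ∀ t ∈ Icc a b, (t, x t) ∈ O := fun t ht ↦ ⟨hKO₂ ⟨t, ht, rfl⟩, hxU t ht⟩
  set S := Ioo (-δ) δ ×ˢ Icc a b with hS
  have hloc (z : ℝ × ℝ) (hz : z ∈ S) (w : EuclideanSpace ℝ (Fin n)) (hw : (z.2, w) ∈ O)
      (hwz : Φ w = V z) : ∃ u : ℝ × ℝ → EuclideanSpace ℝ (Fin n), ContDiffWithinAt ℝ ∞ u S z ∧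
        ∀ᶠ z' in nhdsWithin z S, (z'.2, u z') ∈ O ∧ Φ (u z') = V z' := by
    obtain ⟨u, h1, h2, h3⟩ := h.exists_local_lift (hV z hz) hw.2 hwz
    refine ⟨u, h1, Filter.Eventually.and ?_ h3⟩
    have h4 : ContinuousWithinAt (fun z ↦ (z.2, u z)) S z :=
      continuousWithinAt_snd.prodMk h1.continuousWithinAt
    exact h4.preimage_mem_nhdsWithin (hOo.mem_nhds (by rw [h2]; exact hw))
  obtain ⟨ε, hε, hεδ, hgood⟩ := exists_forall_of_eventually_nhdsWithin hab hδ
    (P := fun z ↦ ∃ w, (z.2, w) ∈ O ∧ Φ w = V z) (fun t ht ↦ by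
      obtain ⟨u, -, h2⟩ := hloc (0, t) ⟨⟨neg_lt_zero.2 hδ, hδ⟩, ht⟩ (x t) (hxO t ht)
        (hV0 t ht).symm
      filter_upwards [h2] with z hz using ⟨u z, hz⟩)
  -- The lift is chosen pointwise. By uniqueness in `O` it agrees with the smooth local lifts.
  classical
  set Y : ℝ × ℝ → EuclideanSpace ℝ (Fin n) := fun z ↦
    if hz : ∃ w, (z.2, w) ∈ O ∧ Φ w = V z then hz.choose else 0 with hY
  have hYs (z : ℝ × ℝ) (hz : ∃ w, (z.2, w) ∈ O ∧ Φ w = V z) : (z.2, Y z) ∈ O ∧ Φ (Y z) = V z := by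
    simp only [hY, dif_pos hz]
    exact hz.choose_spec
  refine ⟨O, hOo, hOi, fun q hq ↦ hq.2, hxO, ε, hε, hεδ, Y, ?_, fun σ hσ t ht ↦
    hYs (σ, t) (hgood σ hσ t ht)⟩
  rintro z ⟨hz1, hz2⟩
  have hsub : Ioo (-ε) ε ×ˢ Icc a b ⊆ S :=
    prod_mono (Ioo_subset_Ioo (neg_le_neg hεδ) hεδ) subset_rfl
  have hYz := hYs z (hgood z.1 hz1 z.2 hz2)
  obtain ⟨u, h1, h2⟩ := hloc z (hsub ⟨hz1, hz2⟩) (Y z) hYz.1 hYz.2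
  have h3 : ∀ᶠ z' in nhdsWithin z S, Y z' = u z' := by
    filter_upwards [h2] with z' hz'
    have h4 := hYs z' ⟨u z', hz'⟩
    exact congrArg Prod.snd (hOi h4.1 hz'.1 (Prod.ext rfl (h4.2.trans hz'.2.symm)))
  exact (h1.congr_of_eventuallyEq h3 (h3.self_of_nhdsWithin (hsub ⟨hz1, hz2⟩))).mono hsub

end Lift

/-! ### The length of curves in normal coordinates -/

section Length

variable {E : Type*} [NormedAddCommGroup E] [NormedSpace ℝ E] [FiniteDimensional ℝ E]
  {g : E → E →L[ℝ] E →L[ℝ] ℝ} {U : Set E} {y y' : ℝ → E} {T : ℝ}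

/-- A curve in normal coordinates which starts at the origin and whose coordinate velocity has a
positive component in a fixed direction. -/
structure IsRadialCurve (g : E → E →L[ℝ] E →L[ℝ] ℝ) (U : Set E) (y y' : ℝ → E) (T : ℝ) : Prop where
  normal : IsNormalMetric g U
  mem : ∀ t ∈ Icc 0 T, y t ∈ U
  zero : y 0 = 0
  deriv : ∀ t ∈ Icc 0 T, HasDerivWithinAt y (y' t) (Icc 0 T) t
  cont : ContinuousOn y' (Icc 0 T)
  pos : ∃ v, ∀ t ∈ Icc 0 T, 0 < g 0 (y' t) v

namespace IsRadialCurve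

variable (h : IsRadialCurve g U y y' T)
include h

theorem mono {t : ℝ} (ht : t ≤ T) : IsRadialCurve g U y y' t where
  normal := h.normal
  mem s hs := h.mem s ⟨hs.1, hs.2.trans ht⟩
  zero := h.zero
  deriv s hs := (h.deriv s ⟨hs.1, hs.2.trans ht⟩).mono (Icc_subset_Icc_right ht)
  cont := h.cont.mono (Icc_subset_Icc_right ht)
  pos := h.pos.imp fun _ hv s hs ↦ hv s ⟨hs.1, hs.2.trans ht⟩

theorem continuousOn : ContinuousOn y (Icc 0 T) := fun t ht ↦ (h.deriv t ht).continuousWithinAt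

theorem hasDerivAt {t : ℝ} (ht : t ∈ Ioo 0 T) : HasDerivAt y (y' t) t :=
  (h.deriv t (Ioo_subset_Icc_self ht)).hasDerivAt (Icc_mem_nhds ht.1 ht.2)

theorem apply_pos {v : E} (hv : ∀ t ∈ Icc 0 T, 0 < g 0 (y' t) v) {t : ℝ} (ht : t ∈ Ioc 0 T) :
    0 < g 0 (y t) v := by
  have h1 : StrictMonoOn (fun t ↦ g 0 (y t) v) (Icc 0 T) := by
    refine strictMonoOn_of_deriv_pos (convex_Icc 0 T)
      ((continuousOn_const.clm_apply h.continuousOn).clm_apply continuousOn_const) fun s hs ↦ ?_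
    rw [interior_Icc] at hs
    have := ((hasDerivAt_const s (g 0)).clm_apply (h.hasDerivAt hs)).clm_apply (hasDerivAt_const s v)
    rw [this.deriv]
    simpa using hv s (Ioo_subset_Icc_self hs)
  have h2 := h1 (left_mem_Icc.2 (ht.1.le.trans ht.2)) (Ioc_subset_Icc_self ht) ht.1
  simpa [h.zero] using h2

theorem ne_zero {t : ℝ} (ht : t ∈ Ioc 0 T) : y t ≠ 0 := by
  obtain ⟨v, hv⟩ := h.pos
  intro h0
  have := h.apply_pos hv ht
  simp [h0] at this

theorem continuousOn_radius : ContinuousOn (fun t ↦ radius g (y t)) (Icc 0 T) :=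
  ((continuousOn_const.clm_apply h.continuousOn).clm_apply h.continuousOn).sqrt

/-- The speed of the curve is continuous. -/
theorem continuousOn_speed : ContinuousOn (fun t ↦ √(g (y t) (y' t) (y' t))) (Icc 0 T) := by
  have h1 : ContinuousOn (fun t ↦ g (y t)) (Icc 0 T) :=
    h.normal.metric.contDiffOn.continuousOn.comp h.continuousOn h.mem
  exact ((h1.clm_apply h.cont).clm_apply h.cont).sqrt

theorem hasDerivAt_radius {t : ℝ} (ht : t ∈ Ioo 0 T) : HasDerivAt (fun t ↦ radius g (y t))
    (g (y t) (y t) (y' t) / radius g (y t)) t := by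
  rw [h.normal.gauss (h.mem t (Ioo_subset_Icc_self ht))]
  exact h.normal.hasDerivAt_radius (h.hasDerivAt ht) (h.ne_zero (Ioo_subset_Ioc_self ht))

theorem deriv_radius_le {t : ℝ} (ht : t ∈ Ioo 0 T) :
    g (y t) (y t) (y' t) / radius g (y t) ≤ √(g (y t) (y' t) (y' t)) := by
  have hU := h.mem t (Ioo_subset_Icc_self ht)
  have hr := h.normal.radius_pos (h.ne_zero (Ioo_subset_Ioc_self ht))
  rw [div_le_iff₀ hr]
  have hcs := h.normal.metric.cauchySchwarz hU (y t) (y' t)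
  rw [h.normal.apply_self hU, ← h.normal.radius_sq] at hcs
  refine abs_le_of_sq_le_sq' ?_ (by positivity) |>.2
  rw [mul_pow, Real.sq_sqrt (h.normal.metric.nonneg hU _)]
  linarith

theorem hasDerivAt_integral_speed {t : ℝ} (ht : t ∈ Ioo 0 T) :
    HasDerivAt (fun t ↦ ∫ s in (0 : ℝ)..t, √(g (y s) (y' s) (y' s)))
      (√(g (y t) (y' t) (y' t))) t := by
  have hc := h.continuousOn_speed
  refine intervalIntegral.integral_hasDerivAt_right ?_ ?_ (hc.continuousAt (Icc_mem_nhds ht.1 ht.2))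
  · refine ContinuousOn.intervalIntegrable ?_
    rw [uIcc_of_le ht.1.le]
    exact hc.mono (Icc_subset_Icc_right ht.2.le)
  · exact ContinuousOn.stronglyMeasurableAtFilter isOpen_Ioo (hc.mono Ioo_subset_Icc_self) t ht

theorem radius_le_integral (hT : 0 ≤ T) :
    radius g (y T) ≤ ∫ s in (0 : ℝ)..T, √(g (y s) (y' s) (y' s)) := by
  have := intervalIntegral.sub_le_integral_of_hasDeriv_right_of_le hT h.continuousOn_radius
    (fun t ht ↦ (h.hasDerivAt_radius ht).hasDerivWithinAt)
    (h.continuousOn_speed.integrableOn_Icc) (fun t ht ↦ h.deriv_radius_le ht)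
  simpa [h.zero, radius] using this

/-- A curve which realizes the distance to the origin is a reparametrized ray. -/
theorem exists_ray (hT : 0 < T)
    (hle : ∫ s in (0 : ℝ)..T, √(g (y s) (y' s) (y' s)) ≤ radius g (y T)) :
    ∃ v, g 0 v v = 1 ∧ ∀ t ∈ Icc 0 T, y t = radius g (y t) • v := by
  set S := fun s ↦ √(g (y s) (y' s) (y' s)) with hS
  -- The excess of length over distance is increasing, zero at the start, and at most zero at the end.
  set f : ℝ → ℝ := fun t ↦ (∫ s in (0 : ℝ)..t, S s) - radius g (y t) with hf
  have hfd (t : ℝ) (ht : t ∈ Ioo 0 T) : HasDerivAt f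
      (S t - g (y t) (y t) (y' t) / radius g (y t)) t :=
    (h.hasDerivAt_integral_speed ht).sub (h.hasDerivAt_radius ht)
  have hint : MeasureTheory.IntegrableOn S (uIcc 0 T) := by
    rw [uIcc_of_le hT.le]
    exact h.continuousOn_speed.integrableOn_Icc
  have hfc : ContinuousOn f (Icc 0 T) := by
    have := intervalIntegral.continuousOn_primitive_interval hint
    rw [uIcc_of_le hT.le] at this
    exact this.sub h.continuousOn_radius
  have hmono : MonotoneOn f (Icc 0 T) := by
    refine monotoneOn_of_deriv_nonneg (convex_Icc 0 T) hfc ?_ ?_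
    all_goals
      intro t ht
      rw [interior_Icc] at ht
    · exact (hfd t ht).differentiableAt.differentiableWithinAt
    · rw [(hfd t ht).deriv]
      exact sub_nonneg.2 (h.deriv_radius_le ht)
  have hf0 (t : ℝ) (ht : t ∈ Icc 0 T) : f t = 0 := by
    have h1 := hmono (left_mem_Icc.2 hT.le) ht ht.1
    have h2 := hmono ht (right_mem_Icc.2 hT.le) ht.2
    have h3 : f 0 = 0 := by simp [hf, h.zero, radius]
    have h4 : f T ≤ 0 := sub_nonpos.2 hle
    linarith
  have hSr (t : ℝ) (ht : t ∈ Ioo 0 T) : S t = g (y t) (y t) (y' t) / radius g (y t) := by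
    have h1 : f =ᶠ[nhds t] fun _ ↦ 0 := by
      filter_upwards [isOpen_Ioo.mem_nhds ht] with s hs using hf0 s (Ioo_subset_Icc_self hs)
    have := (hfd t ht).unique ((hasDerivAt_const t (0 : ℝ)).congr_of_eventuallyEq h1)
    linarith
  -- equality in the Cauchy-Schwarz inequality
  have hdir (t : ℝ) (ht : t ∈ Ioo 0 T) :
      y' t = (g (y t) (y t) (y' t) / radius g (y t) ^ 2) • y t := by
    have hU := h.mem t (Ioo_subset_Icc_self ht)
    have hr := (h.normal.radius_pos (h.ne_zero (Ioo_subset_Ioc_self ht))).ne'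
    have h1 : g (y t) (y' t) (y' t) = (g (y t) (y t) (y' t) / radius g (y t)) ^ 2 := by
      rw [← hSr t ht, hS]
      exact (Real.sq_sqrt (h.normal.metric.nonneg hU _)).symm
    rw [← sub_eq_zero]
    refine h.normal.metric.eq_zero_of_apply_self hU ?_
    have h2 := h.normal.apply_self hU
    rw [← h.normal.radius_sq] at h2
    have h3 := h.normal.metric.symm _ hU (y' t) (y t)
    simp only [map_sub, map_smul, sub_apply, smul_apply, smul_eq_mul, h1, h2, h3]
    field_simp
    ring
  have hconst (t : ℝ) (ht : t ∈ Ioc 0 T) :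
      (radius g (y t))⁻¹ • y t = (radius g (y T))⁻¹ • y T := by
    rcases ht.2.eq_or_lt with rfl | htT
    · rfl
    refine eq_of_hasDerivAt_zero (f := fun t ↦ (radius g (y t))⁻¹ • y t) htT ?_ fun s hs ↦ ?_
    · have hsub : Icc t T ⊆ Icc 0 T := Icc_subset_Icc_left ht.1.le
      exact ((h.continuousOn_radius.mono hsub).inv₀ fun s hs ↦
        (h.normal.radius_pos (h.ne_zero ⟨ht.1.trans_le hs.1, hs.2⟩)).ne').smul
          (h.continuousOn.mono hsub)
    · have hs' : s ∈ Ioo 0 T := ⟨ht.1.trans hs.1, hs.2⟩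
      have hr := (h.normal.radius_pos (h.ne_zero (Ioo_subset_Ioc_self hs'))).ne'
      have hd := h.hasDerivAt hs'
      rw [hdir s hs'] at hd
      refine (((h.hasDerivAt_radius hs').inv hr).smul hd).congr_deriv ?_
      rw [smul_smul, ← add_smul]
      convert zero_smul ℝ (y s) using 2
      simp only [Pi.inv_apply]
      field_simp
      ring
  have hrT := (h.normal.radius_pos (h.ne_zero (right_mem_Ioc.2 hT))).ne'
  refine ⟨(radius g (y T))⁻¹ • y T, ?_, fun t ht ↦ ?_⟩
  · simp only [map_smul, smul_apply, smul_eq_mul, ← h.normal.radius_sq]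
    field_simp
  · rcases ht.1.eq_or_lt with rfl | h0
    · simp [h.zero, radius]
    · rw [← hconst t ⟨h0, ht.2⟩, smul_inv_smul₀
        (h.normal.radius_pos (h.ne_zero ⟨h0, ht.2⟩)).ne']

/-- Along a reparametrized ray the distance to the origin is strictly increasing. -/
theorem radius_ray {v : E} (hv1 : g 0 v v = 1) (hv : ∀ t ∈ Icc 0 T, y t = radius g (y t) • v)
    (hT : 0 < T) :
    (∀ t ∈ Icc 0 T, radius g (y t) = g 0 (y t) v) ∧ ∀ t ∈ Icc 0 T, 0 < g 0 (y' t) v := by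
  have hr : ∀ t ∈ Icc 0 T, radius g (y t) = g 0 (y t) v := fun t ht ↦ by
    conv_rhs => rw [hv t ht]
    simp [hv1]
  refine ⟨hr, fun t ht ↦ ?_⟩
  obtain ⟨v₀, hv₀⟩ := h.pos
  have hdw : HasDerivWithinAt y (g 0 (y' t) v • v) (Icc 0 T) t := by
    have h1 := ((hasDerivWithinAt_const t (Icc 0 T) (g 0)).clm_apply (h.deriv t ht)).clm_apply
      (hasDerivWithinAt_const t (Icc 0 T) v)
    have h2 := h1.smul_const v
    simp only [zero_apply, zero_add, map_zero, add_zero] at h2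
    exact h2.congr (fun s hs ↦ by rw [← hr s hs, ← hv s hs]) (by rw [← hr t ht, ← hv t ht])
  have h3 := ((uniqueDiffOn_Icc hT) t ht).eq_deriv _ (h.deriv t ht) hdw
  have h4 := hv₀ t ht
  have h5 := h.apply_pos hv₀ (right_mem_Ioc.2 hT)
  have hTm : T ∈ Icc 0 T := right_mem_Icc.2 hT.le
  rw [hv T hTm] at h5
  rw [h3] at h4
  simp only [map_smul, smul_apply, smul_eq_mul] at h4 h5
  have h6 : 0 < g 0 v v₀ := pos_of_mul_pos_right h5 (Real.sqrt_nonneg _)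
  exact pos_of_mul_pos_left h4 h6.le

end IsRadialCurve

end Length

section PathLength

variable {n : ℕ} {M : Type*} [TopologicalSpace M] [ChartedSpace (EuclideanSpace ℝ (Fin n)) M]
  [IsManifold (𝓡 n) ∞ M] [RiemannianBundle (fun x : M ↦ TangentSpace (𝓡 n) x)]
  [IsContMDiffRiemannianBundle (𝓡 n) ∞ (EuclideanSpace ℝ (Fin n))
      (fun x : M ↦ TangentSpace (𝓡 n) x)]

theorem IsRadialCurve.pathELength_eq {Φ : EuclideanSpace ℝ (Fin n) → M}
    {U : Set (EuclideanSpace ℝ (Fin n))} (hΦ : IsParam Φ U) {y y' : ℝ → EuclideanSpace ℝ (Fin n)}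
    {T : ℝ} (h : IsRadialCurve (pullMetric Φ) U y y' T) (hT : 0 ≤ T) :
    pathELength (𝓡 n) (fun t ↦ Φ (y t)) 0 T =
      ENNReal.ofReal (∫ s in (0 : ℝ)..T, √(pullMetric Φ (y s) (y' s) (y' s))) := by
  rw [pathELength_eq_lintegral_mfderiv_Ioo, intervalIntegral.integral_of_le hT,
    MeasureTheory.integral_Ioc_eq_integral_Ioo,
    MeasureTheory.ofReal_integral_eq_lintegral_ofReal
      (h.continuousOn_speed.integrableOn_Icc.mono_set Ioo_subset_Icc_self)
      (Filter.Eventually.of_forall fun t ↦ Real.sqrt_nonneg _)]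
  refine MeasureTheory.setLIntegral_congr_fun measurableSet_Ioo fun t ht ↦ ?_
  have h1 : vel n (fun t ↦ Φ (y t)) t = tang Φ (y t) (y' t) :=
    vel_comp (hΦ.mdifferentiableAt (h.mem t (Ioo_subset_Icc_self ht))) (h.hasDerivAt ht)
  have h2 : ‖(mfderiv 𝓘(ℝ, ℝ) (𝓡 n) (fun t ↦ Φ (y t)) t (1 : ℝ))‖ =
      √(ip (Φ (y t)) (vel n (fun t ↦ Φ (y t)) t) (vel n (fun t ↦ Φ (y t)) t)) := by
    rw [norm_eq_sqrt_real_inner]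
    rfl
  rw [h1, ← pullMetric_apply] at h2
  beta_reduce
  rw [← ofReal_norm]
  exact congrArg ENNReal.ofReal h2

end PathLength

/-! ### Variations of a geodesic with fixed starting point -/

section Variation

variable {n : ℕ} {M : Type*} [TopologicalSpace M] [ChartedSpace (EuclideanSpace ℝ (Fin n)) M]
  [IsManifold (𝓡 n) ∞ M] [RiemannianBundle (fun x : M ↦ TangentSpace (𝓡 n) x)]
  [IsContMDiffRiemannianBundle (𝓡 n) ∞ (EuclideanSpace ℝ (Fin n))
      (fun x : M ↦ TangentSpace (𝓡 n) x)]

/-- The variation `V` with fixed starting point `p` of the geodesic `t ↦ exp(t v₀)` is, for times in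
`[0, T]` and parameters in `(-ε, ε)`, the image of the variation `Y` in normal coordinates around
`p`. For each time the exponential map is injective on the corresponding slice of the open
set `O`. -/
structure IsRadialLift (V : ℝ → ℝ → M) (p : M) (v₀ : EuclideanSpace ℝ (Fin n)) (T ε : ℝ)
    (O : Set (ℝ × EuclideanSpace ℝ (Fin n))) (Y : ℝ × ℝ → EuclideanSpace ℝ (Fin n)) : Prop where
  unit : ip p v₀ v₀ = 1
  isOpen : IsOpen O
  injOn : InjOn (fun q ↦ (q.1, rexp p q.2)) O
  mem_dom : ∀ q ∈ O, q.2 ∈ normalDom p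
  ray_mem : ∀ t ∈ Icc 0 T, (t, t • v₀) ∈ O
  contDiffOn : ContDiffOn ℝ ∞ Y (Ioo (-ε) ε ×ˢ Icc 0 T)
  mem : ∀ σ ∈ Ioo (-ε) ε, ∀ t ∈ Icc 0 T, (t, Y (σ, t)) ∈ O
  lift : ∀ σ ∈ Ioo (-ε) ε, ∀ t ∈ Icc 0 T, rexp p (Y (σ, t)) = V σ t
  center : ∀ t ∈ Icc 0 T, Y (0, t) = t • v₀
  radial : ∀ σ ∈ Ioo (-ε) ε, ∃ y', IsRadialCurve (pullMetric (rexp p)) (normalDom p)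
    (fun t ↦ Y (σ, t)) y' T

theorem IsRadialLift.mono {V : ℝ → ℝ → M} {p : M} {v₀ : EuclideanSpace ℝ (Fin n)} {T ε ε' : ℝ}
    {O : Set (ℝ × EuclideanSpace ℝ (Fin n))} {Y : ℝ × ℝ → EuclideanSpace ℝ (Fin n)}
    (L : IsRadialLift V p v₀ T ε O Y) (h : ε' ≤ ε) : IsRadialLift V p v₀ T ε' O Y where
  unit := L.unit
  isOpen := L.isOpen
  injOn := L.injOn
  mem_dom := L.mem_dom
  ray_mem := L.ray_mem
  contDiffOn := L.contDiffOn.mono (prod_mono (Ioo_subset_Ioo (neg_le_neg h) h) subset_rfl)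
  mem σ hσ := L.mem σ (Ioo_subset_Ioo (neg_le_neg h) h hσ)
  lift σ hσ := L.lift σ (Ioo_subset_Ioo (neg_le_neg h) h hσ)
  center := L.center
  radial σ hσ := L.radial σ (Ioo_subset_Ioo (neg_le_neg h) h hσ)

variable [T2Space M]

/-- A variation of a ray without conjugate points, with fixed starting point, lifts to normal
coordinates. -/
theorem exists_isRadialLift {p : M} {v₀ : EuclideanSpace ℝ (Fin n)} (hv : ip p v₀ v₀ = 1) {T δ : ℝ}
    (hT : 0 < T) (hδ : 0 < δ) (hmem : ∀ t ∈ Icc 0 T, t • v₀ ∈ normalDom p) {V : ℝ → ℝ → M}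
    (hV : ContMDiffOn 𝓘(ℝ, ℝ × ℝ) (𝓡 n) ∞ (fun x : ℝ × ℝ ↦ V x.1 x.2) (Ioo (-δ) δ ×ˢ Icc 0 T))
    (hV0 : ∀ t ∈ Icc 0 T, V 0 t = rexp p (t • v₀)) (hVp : ∀ s ∈ Ioo (-δ) δ, V s 0 = p) :
    ∃ O ε Y, 0 < ε ∧ ε ≤ δ ∧ IsRadialLift V p v₀ T ε O Y := by
  obtain ⟨O, hO, hOi, hOU, hxO, ε, hε, hεδ, Y, hY, hYO⟩ := (isParam_rexp p).exists_lift hT.le hδ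
    (x := fun t ↦ t • v₀) (continuous_id.smul continuous_const).continuousOn hmem hV hV0
  have h0ε : (0 : ℝ) ∈ Ioo (-ε) ε := ⟨neg_lt_zero.2 hε, hε⟩
  have h0T : (0 : ℝ) ∈ Icc 0 T := left_mem_Icc.2 hT.le
  have huniq {t : ℝ} {y z : EuclideanSpace ℝ (Fin n)} (hy : (t, y) ∈ O) (hz : (t, z) ∈ O)
      (hyz : rexp p y = rexp p z) : y = z :=
    congrArg Prod.snd (hOi hy hz (Prod.ext rfl hyz))
  have hcenter : ∀ t ∈ Icc 0 T, Y (0, t) = t • v₀ := fun t ht ↦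
    huniq (hYO 0 h0ε t ht).1 (hxO t ht) ((hYO 0 h0ε t ht).2.trans (hV0 t ht))
  set S := Ioo (-ε) ε ×ˢ Icc 0 T with hS
  have hSu : UniqueDiffOn ℝ S := isOpen_Ioo.uniqueDiffOn.prod (uniqueDiffOn_Icc hT)
  set Y' : ℝ × ℝ → EuclideanSpace ℝ (Fin n) := fun z ↦ fderivWithin ℝ Y S z (0, 1) with hY'
  have hY'c : ContinuousOn Y' S :=
    (hY.continuousOn_fderivWithin hSu (by simp)).clm_apply continuousOn_const
  have hd (σ : ℝ) (hσ : σ ∈ Ioo (-ε) ε) (t : ℝ) (ht : t ∈ Icc 0 T) :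
      HasDerivWithinAt (fun t ↦ Y (σ, t)) (Y' (σ, t)) (Icc 0 T) t := by
    have h1 := ((hY (σ, t) ⟨hσ, ht⟩).differentiableWithinAt (by simp)).hasFDerivWithinAt
    have h2 : HasDerivWithinAt (fun t ↦ (σ, t)) ((0 : ℝ), (1 : ℝ)) (Icc 0 T) t :=
      (hasDerivWithinAt_const t _ σ).prodMk (hasDerivWithinAt_id t _)
    exact h1.comp_hasDerivWithinAt t h2 fun s hs ↦ ⟨hσ, hs⟩
  have hY'0 : ∀ t ∈ Icc 0 T, Y' (0, t) = v₀ := fun t ht ↦ by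
    have h1 := hd 0 h0ε t ht
    have h2 : HasDerivWithinAt (fun t ↦ Y (0, t)) v₀ (Icc 0 T) t :=
      (hasDerivAt_smul_const' v₀ t).hasDerivWithinAt.congr hcenter (hcenter t ht)
    exact ((uniqueDiffOn_Icc hT) t ht).eq_deriv _ h1 h2
  -- For small parameters the coordinate velocity stays in the half space around `v₀`.
  obtain ⟨ε', hε', hεε', hpos⟩ := exists_forall_of_eventually_nhdsWithin hT.le hε
    (P := fun z ↦ 0 < pullMetric (rexp p) 0 (Y' z) v₀) (fun t ht ↦ by
      have h1 : ContinuousOn (fun z ↦ pullMetric (rexp p) 0 (Y' z) v₀) S :=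
        (continuousOn_const.clm_apply hY'c).clm_apply continuousOn_const
      refine (h1 (0, t) ⟨h0ε, ht⟩).eventually (lt_mem_nhds ?_)
      change 0 < pullMetric (rexp p) 0 (Y' (0, t)) v₀
      rw [hY'0 t ht, pullMetric_rexp_zero, hv]
      exact one_pos)
  have hsub : Ioo (-ε') ε' ⊆ Ioo (-ε) ε := Ioo_subset_Ioo (neg_le_neg hεε') hεε'
  refine ⟨O, ε', Y, hε', hεε'.trans hεδ, ⟨hv, hO, hOi, hOU, hxO, hY.mono
    (prod_mono hsub subset_rfl), fun σ hσ t ht ↦ (hYO σ (hsub hσ) t ht).1,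
    fun σ hσ t ht ↦ (hYO σ (hsub hσ) t ht).2, hcenter, fun σ hσ ↦ ⟨fun t ↦ Y' (σ, t), ?_⟩⟩⟩
  refine ⟨isNormalMetric_rexp p, fun t ht ↦ hOU _ (hYO σ (hsub hσ) t ht).1, ?_, hd σ (hsub hσ), ?_,
    v₀, hpos σ hσ⟩
  · have h1 := hYO σ (hsub hσ) 0 h0T
    have h2 := hxO 0 h0T
    rw [zero_smul] at h2
    refine huniq h1.1 h2 ?_
    rw [h1.2, rexp_zero]
    exact hVp σ (Ioo_subset_Ioo (neg_le_neg hεδ) hεδ (hsub hσ))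
  · exact hY'c.comp (continuousOn_const.prodMk continuousOn_id) fun t ht ↦ ⟨hsub hσ, ht⟩

namespace IsRadialLift

variable {V : ℝ → ℝ → M} {p : M} {v₀ : EuclideanSpace ℝ (Fin n)} {T ε : ℝ}
    {O : Set (ℝ × EuclideanSpace ℝ (Fin n))} {Y : ℝ × ℝ → EuclideanSpace ℝ (Fin n)}
    (L : IsRadialLift V p v₀ T ε O Y) {σ t : ℝ} (hσ : σ ∈ Ioo (-ε) ε)
include L

omit [T2Space M] in
theorem eq_of_rexp_eq {y z : EuclideanSpace ℝ (Fin n)} (hy : (t, y) ∈ O) (hz : (t, z) ∈ O)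
    (hyz : rexp p y = rexp p z) : y = z :=
  congrArg Prod.snd (L.injOn hy hz (Prod.ext rfl hyz))

include hσ

theorem contDiffOn_slice : ContDiffOn ℝ ∞ (fun t ↦ Y (σ, t)) (Icc 0 T) :=
  L.contDiffOn.comp (contDiffOn_const.prodMk contDiffOn_id) fun _ ht ↦ ⟨hσ, ht⟩

theorem radius_le_pathELength (ht : t ∈ Icc 0 T) :
    ENNReal.ofReal (radius (pullMetric (rexp p)) (Y (σ, t))) ≤ pathELength (𝓡 n) (V σ) 0 t := by
  obtain ⟨y', hy'⟩ := L.radial σ hσ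
  have h1 : EqOn (V σ) (fun t ↦ rexp p (Y (σ, t))) (Icc 0 t) := fun s hs ↦
    (L.lift σ hσ s ⟨hs.1, hs.2.trans ht.2⟩).symm
  rw [pathELength_congr h1, (hy'.mono ht.2).pathELength_eq (isParam_rexp p) ht.1]
  exact ENNReal.ofReal_le_ofReal ((hy'.mono ht.2).radius_le_integral ht.1)

/-- If the curve realizes the distance to `p` then it is a reparametrized ray. -/
theorem exists_ray (ht0 : 0 < t) (htT : t ≤ T) (hle : pathELength (𝓡 n) (V σ) 0 t ≤
      ENNReal.ofReal (radius (pullMetric (rexp p)) (Y (σ, t)))) :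
    ∃ v, ip p v v = 1 ∧
      (∀ s ∈ Icc 0 t, Y (σ, s) = radius (pullMetric (rexp p)) (Y (σ, s)) • v) ∧
      ContDiffOn ℝ ∞ (fun s ↦ radius (pullMetric (rexp p)) (Y (σ, s))) (Icc 0 t) ∧
      ∀ s ∈ Icc 0 t, ∃ r > 0, HasDerivWithinAt
        (fun s ↦ radius (pullMetric (rexp p)) (Y (σ, s))) r (Icc 0 t) s := by
  obtain ⟨y', hy'⟩ := L.radial σ hσ
  have hy := hy'.mono htT
  have h1 : EqOn (V σ) (fun t ↦ rexp p (Y (σ, t))) (Icc 0 t) := fun s hs ↦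
    (L.lift σ hσ s ⟨hs.1, hs.2.trans htT⟩).symm
  rw [pathELength_congr h1, hy.pathELength_eq (isParam_rexp p) ht0.le,
    ENNReal.ofReal_le_ofReal_iff (show 0 ≤ radius (pullMetric (rexp p)) (Y (σ, t)) from
      Real.sqrt_nonneg _)] at hle
  obtain ⟨v, hv, hray⟩ := hy.exists_ray ht0 hle
  obtain ⟨hr, hpos⟩ := hy.radius_ray hv hray ht0
  refine ⟨v, by rwa [pullMetric_rexp_zero] at hv, hray, ?_, fun s hs ↦ ⟨_, hpos s hs, ?_⟩⟩
  · have h2 := ((L.contDiffOn_slice hσ).mono (Icc_subset_Icc_right htT))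
    exact ((contDiffOn_const.clm_apply h2).clm_apply contDiffOn_const).congr hr
  · have h3 := ((hasDerivWithinAt_const s (Icc 0 t) (pullMetric (rexp p)
      (0 : EuclideanSpace ℝ (Fin n)))).clm_apply (hy.deriv s hs)).clm_apply
      (hasDerivWithinAt_const s (Icc 0 t) v)
    simp only [zero_apply, zero_add, map_zero, add_zero] at h3
    exact h3.congr hr (hr s hs)

end IsRadialLift

end Variation

/-! ### The midpoint of a geodesic of length `π` -/

section Midpoint

variable {n : ℕ} {M : Type*} [TopologicalSpace M] [ChartedSpace (EuclideanSpace ℝ (Fin n)) M]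
  [IsManifold (𝓡 n) ∞ M] [RiemannianBundle (fun x : M ↦ TangentSpace (𝓡 n) x)]
  [IsContMDiffRiemannianBundle (𝓡 n) ∞ (EuclideanSpace ℝ (Fin n))
      (fun x : M ↦ TangentSpace (𝓡 n) x)]

/-- The neighborhood `N` of the origin in normal coordinates around `m` is related by `ψ` and `ψ'`
to normal coordinates around `p` and `q`; the point `m` is the midpoint of a geodesic of length `π`
from `p` to `q`. -/
structure IsMidpoint (p q m : M) (N : Set (EuclideanSpace ℝ (Fin n)))
    (ψ ψ' : EuclideanSpace ℝ (Fin n) → EuclideanSpace ℝ (Fin n)) : Prop where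
  opp : IsOpposite (pullMetric (rexp p)) (pullMetric (rexp q)) (pullMetric (rexp m)) (normalDom p)
    (normalDom q) N ψ ψ'
  subset : N ⊆ normalDom m
  left : ∀ x ∈ N, rexp p (ψ x) = rexp m x
  right : ∀ x ∈ N, rexp q (ψ' x) = rexp m x
  small : ∀ x ∈ N, radius (pullMetric (rexp m)) x < Real.pi / 2

variable [T2Space M]

/-- The product of the radial vector with the differential of a transition map between normal
coordinates, expressed in `M`. -/
theorem apply_fderiv_transition {p m : M} {N : Set (EuclideanSpace ℝ (Fin n))} (hN : IsOpen N)
    {ψ : EuclideanSpace ℝ (Fin n) → EuclideanSpace ℝ (Fin n)}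
    (hψ : ContDiffOn ℝ ∞ ψ N) (hmaps : MapsTo ψ N (normalDom p))
    (hc : ∀ x ∈ N, rexp p (ψ x) = rexp m x) {x : EuclideanSpace ℝ (Fin n)} (hx : x ∈ N)
    (u : EuclideanSpace ℝ (Fin n)) :
    pullMetric (rexp p) 0 (ψ x) (fderiv ℝ ψ x u) =
      ip (rexp m x) (tang (rexp p) (ψ x) (ψ x)) (tang (rexp m) x u) := by
  have h1 : rexp m =ᶠ[nhds x] fun z ↦ rexp p (ψ z) := by
    filter_upwards [hN.mem_nhds hx] with z hz using (hc z hz).symm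
  rw [tang_congr h1, tang_comp ((isParam_rexp p).mdifferentiableAt (hmaps hx))
    ((hψ.contDiffAt (hN.mem_nhds hx)).differentiableAt (by simp)), ← hc x hx, ← pullMetric_apply,
    (isNormalMetric_rexp p).gauss (hmaps hx)]

/-- If the rays with directions `v` and `w` meet at time `π / 2` in `m` with opposite velocities, then
`m` is the midpoint of a geodesic of length `π`. -/
theorem exists_isMidpoint (hsec : SectionalCurvatureLE n M 1) {p q m : M}
    {v w : EuclideanSpace ℝ (Fin n)} (hv : ip p v v = 1) (hw : ip q w w = 1)
    (hvd : (Real.pi / 2) • v ∈ normalDom p) (hwd : (Real.pi / 2) • w ∈ normalDom q)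
    (hvm : rexp p ((Real.pi / 2) • v) = m) (hwm : rexp q ((Real.pi / 2) • w) = m)
    (hvw : tang (rexp p) ((Real.pi / 2) • v) v + tang (rexp q) ((Real.pi / 2) • w) w = 0) :
    ∃ N ψ ψ', IsMidpoint p q m N ψ ψ' ∧ ψ 0 = (Real.pi / 2) • v ∧ ψ' 0 = (Real.pi / 2) • w := by
  have hm0 : (0 : EuclideanSpace ℝ (Fin n)) ∈ normalDom m := (isNormalMetric_rexp m).zero_mem
  have hπ : (0 : ℝ) < Real.pi / 2 := by positivity
  have key {p : M} {v : EuclideanSpace ℝ (Fin n)} (hv : ip p v v = 1)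
      (hvd : (Real.pi / 2) • v ∈ normalDom p) (hvm : rexp p ((Real.pi / 2) • v) = m) :
      ∃ ψ : EuclideanSpace ℝ (Fin n) → EuclideanSpace ℝ (Fin n), ∃ r > 0,
        ψ 0 = (Real.pi / 2) • v ∧ ∀ x ∈ Metric.ball 0 r,
        ContDiffAt ℝ ∞ ψ x ∧ x ∈ normalDom m ∧ ψ x ∈ normalDom p ∧ rexp p (ψ x) = rexp m x ∧
        radius (pullMetric (rexp p)) (ψ x) ∈ Ioo 0 Real.pi := by
    obtain ⟨ψ, N, hN, h0N, hNm, hψ, hmaps, hψ0, hc⟩ := (isParam_rexp m).exists_transition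
      (isParam_rexp p) hm0 hvd (by rw [rexp_zero, hvm])
    have hcr : ContinuousAt (fun x ↦ radius (pullMetric (rexp p)) (ψ x)) 0 := by
      have := (hψ.contDiffAt (hN.mem_nhds h0N)).continuousAt
      exact ((continuousAt_const.clm_apply this).clm_apply this).sqrt
    have hr0 : radius (pullMetric (rexp p)) (ψ 0) = Real.pi / 2 := by
      rw [hψ0, IsNormalMetric.radius_smul (by rw [pullMetric_rexp_zero, hv]) hπ.le]
    have hev : ∀ᶠ x in nhds (0 : EuclideanSpace ℝ (Fin n)), x ∈ N ∧
        radius (pullMetric (rexp p)) (ψ x) ∈ Ioo 0 Real.pi := by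
      refine Filter.Eventually.and (hN.mem_nhds h0N) (hcr.eventually (isOpen_Ioo.mem_nhds ?_))
      beta_reduce
      rw [hr0]
      exact ⟨hπ, by linarith⟩
    obtain ⟨r, hr, hball⟩ := Metric.eventually_nhds_iff_ball.1 hev
    exact ⟨ψ, r, hr, hψ0, fun x hx ↦ ⟨hψ.contDiffAt (hN.mem_nhds (hball x hx).1),
      hNm (hball x hx).1, hmaps (hball x hx).1, hc x (hball x hx).1, (hball x hx).2⟩⟩
  obtain ⟨ψ, r, hr, hψ0, hψ⟩ := key hv hvd hvm
  obtain ⟨ψ', r', hr', hψ'0, hψ'⟩ := key hw hwd hwm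
  have hev : ∀ᶠ x in nhds (0 : EuclideanSpace ℝ (Fin n)),
      radius (pullMetric (rexp m)) x < Real.pi / 2 := by
    have hc : ContinuousAt (radius (pullMetric (rexp (n := n) m))) 0 :=
      ((continuousAt_const.clm_apply continuousAt_id).clm_apply continuousAt_id).sqrt
    refine hc.eventually (gt_mem_nhds ?_)
    simp [radius, hπ]
  obtain ⟨r'', hr'', hsmall⟩ := Metric.eventually_nhds_iff_ball.1 hev
  set R := min r (min r' r'') with hR
  have hR0 : 0 < R := lt_min hr (lt_min hr' hr'')
  set N := Metric.ball (0 : EuclideanSpace ℝ (Fin n)) R with hN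
  have hN1 : N ⊆ Metric.ball 0 r := Metric.ball_subset_ball (min_le_left _ _)
  have hN2 : N ⊆ Metric.ball 0 r' :=
    Metric.ball_subset_ball ((min_le_right _ _).trans (min_le_left _ _))
  have hN3 : N ⊆ Metric.ball 0 r'' :=
    Metric.ball_subset_ball ((min_le_right _ _).trans (min_le_right _ _))
  have h0N : (0 : EuclideanSpace ℝ (Fin n)) ∈ N := Metric.mem_ball_self hR0
  have hNo : IsOpen N := Metric.isOpen_ball
  have hNm : N ⊆ normalDom m := fun x hx ↦ (hψ x (hN1 hx)).2.1
  have hψc : ContDiffOn ℝ ∞ ψ N := fun x hx ↦ (hψ x (hN1 hx)).1.contDiffWithinAt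
  have hψ'c : ContDiffOn ℝ ∞ ψ' N := fun x hx ↦ (hψ' x (hN2 hx)).1.contDiffWithinAt
  have hmaps : MapsTo ψ N (normalDom p) := fun x hx ↦ (hψ x (hN1 hx)).2.2.1
  have hmaps' : MapsTo ψ' N (normalDom q) := fun x hx ↦ (hψ' x (hN2 hx)).2.2.1
  have hc : ∀ x ∈ N, rexp p (ψ x) = rexp m x := fun x hx ↦ (hψ x (hN1 hx)).2.2.2.1
  have hc' : ∀ x ∈ N, rexp q (ψ' x) = rexp m x := fun x hx ↦ (hψ' x (hN2 hx)).2.2.2.1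
  have hcenter : IsNormalMetric (pullMetric (rexp m)) N := by
    have h := isNormalMetric_rexp (n := n) m
    refine ⟨((isParam_rexp m).mono hNo hNm).isMetricOn, h0N, fun y hy s hs ↦ ?_,
      fun y hy ↦ h.radial y (hNm hy)⟩
    exact (convex_ball (0 : EuclideanSpace ℝ (Fin n)) R).smul_mem_of_zero_mem h0N hy hs
  refine ⟨N, ψ, ψ', ⟨⟨⟨isNormalMetric_rexp p, (isParam_rexp p).secLEOne hsec, hcenter,
    (isParam_rexp p).isIsomOn hNo hψc hmaps hc, hmaps, fun x hx ↦ (hψ x (hN1 hx)).2.2.2.2⟩,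
    ⟨isNormalMetric_rexp q, (isParam_rexp q).secLEOne hsec, hcenter,
    (isParam_rexp q).isIsomOn hNo hψ'c hmaps' hc', hmaps', fun x hx ↦ (hψ' x (hN2 hx)).2.2.2.2⟩,
    ?_, ?_, fun u ↦ ?_⟩, hNm, hc, hc', fun x hx ↦ hsmall x (hN3 hx)⟩, hψ0, hψ'0⟩
  · rw [hψ0, IsNormalMetric.radius_smul (by rw [pullMetric_rexp_zero, hv]) hπ.le]
  · rw [hψ'0, IsNormalMetric.radius_smul (by rw [pullMetric_rexp_zero, hw]) hπ.le]
  · rw [apply_fderiv_transition hNo hψc hmaps hc h0N,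
      apply_fderiv_transition hNo hψ'c hmaps' hc' h0N, hψ0, hψ'0, map_smul, map_smul,
      ← ip_add, ← smul_add, hvw, smul_zero]
    have := ip_smul (rexp m (0 : EuclideanSpace ℝ (Fin n))) 0 0 (tang (rexp m) 0 u)
    simpa using this

namespace IsMidpoint

variable {p q m : M} {N : Set (EuclideanSpace ℝ (Fin n))}
    {ψ ψ' : EuclideanSpace ℝ (Fin n) → EuclideanSpace ℝ (Fin n)} (h : IsMidpoint p q m N ψ ψ')
include h

theorem exists_smul {x : EuclideanSpace ℝ (Fin n)} (hx : x ∈ N) (hne : x ≠ 0) :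
    ∃ ℓ e, 0 < ℓ ∧ ℓ < Real.pi / 2 ∧ pullMetric (rexp m) 0 e e = 1 ∧ x = ℓ • e := by
  have hr := h.opp.left.center.radius_pos hne
  refine ⟨radius (pullMetric (rexp m)) x, (radius (pullMetric (rexp m)) x)⁻¹ • x, hr, h.small x hx,
    ?_, (smul_inv_smul₀ hr.ne' x).symm⟩
  simp only [map_smul, smul_apply, smul_eq_mul, ← h.opp.left.center.radius_sq x]
  field_simp

/-- Near the midpoint the sum of the distances to `p` and `q` is at least `π`. -/
theorem pi_le {x : EuclideanSpace ℝ (Fin n)} (hx : x ∈ N) : Real.pi ≤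
    radius (pullMetric (rexp p)) (ψ x) + radius (pullMetric (rexp q)) (ψ' x) := by
  rcases eq_or_ne x 0 with rfl | hne
  · rw [h.opp.radius_left, h.opp.radius_right]
    linarith
  · obtain ⟨ℓ, e, h0, h1, he, rfl⟩ := h.exists_smul hx hne
    exact h.opp.pi_le_of_ray he hx h0.le (by linarith [Real.pi_pos])

/-- At a minimum of the sum of the distances to `p` and `q` the directions to `p` and `q` are
opposite to each other. -/
theorem opposite {x : EuclideanSpace ℝ (Fin n)} (hx : x ∈ N)
    (hr : radius (pullMetric (rexp p)) (ψ x) = Real.pi / 2)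
    (hr' : radius (pullMetric (rexp q)) (ψ' x) = Real.pi / 2) :
    tang (rexp p) (ψ x) (ψ x) + tang (rexp q) (ψ' x) (ψ' x) = 0 := by
  have hπ : (0 : ℝ) < Real.pi / 2 := by positivity
  have hNo := h.opp.left.isom.isOpen
  -- The critical point condition for the sum of the distances, in the direction `u`.
  have hu (u : EuclideanSpace ℝ (Fin n)) : ip (rexp m x)
      (tang (rexp p) (ψ x) (ψ x) + tang (rexp q) (ψ' x) (ψ' x)) (tang (rexp m) x u) = 0 := by
    have hl : HasDerivAt (fun s : ℝ ↦ x + s • u) u 0 := hasDerivAt_line x u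
    have hx0 : x + (0 : ℝ) • u ∈ N := by simpa using hx
    have d1 := (h.opp.left.isom.differentiableAt hx0).hasFDerivAt.comp_hasDerivAt 0 hl
    have d2 := (h.opp.right.isom.differentiableAt hx0).hasFDerivAt.comp_hasDerivAt 0 hl
    have hne : ψ (x + (0 : ℝ) • u) ≠ 0 := fun h0 ↦ by
      have := (h.opp.left.radius_mem _ hx0).1
      rw [h0] at this
      simp [radius] at this
    have hne' : ψ' (x + (0 : ℝ) • u) ≠ 0 := fun h0 ↦ by
      have := (h.opp.right.radius_mem _ hx0).1
      rw [h0] at this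
      simp [radius] at this
    have d3 := (h.opp.left.normal.hasDerivAt_radius d1 hne).add
      (h.opp.right.normal.hasDerivAt_radius d2 hne')
    have hev : ∀ᶠ s : ℝ in nhds 0, x + s • u ∈ N := hl.continuousAt.eventually (hNo.mem_nhds hx0)
    have hmin : IsLocalMin ((fun s : ℝ ↦ radius (pullMetric (rexp p)) ((ψ ∘ fun s ↦ x + s • u) s)) +
        fun s : ℝ ↦ radius (pullMetric (rexp q)) ((ψ' ∘ fun s ↦ x + s • u) s)) 0 := by
      filter_upwards [hev] with s hs
      have h1 := h.pi_le hs
      simp only [Pi.add_apply, Function.comp, zero_smul, add_zero, hr, hr']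
      linarith
    have h4 := hmin.hasDerivAt_eq_zero d3
    simp only [Function.comp, zero_smul, add_zero, hr, hr'] at h4
    rw [apply_fderiv_transition hNo h.opp.left.isom.contDiffOn h.opp.left.mapsTo h.left hx,
      apply_fderiv_transition hNo h.opp.right.isom.contDiffOn h.opp.right.mapsTo h.right hx,
      ← add_div, div_eq_zero_iff] at h4
    rw [ip_add]
    exact h4.resolve_right hπ.ne'
  have hinj := (isParam_rexp m).injective x (h.subset hx)
  have hsurj : Function.Surjective (tang (rexp m) x) :=
    LinearMap.surjective_of_injective (f := (tang (rexp m) x).toLinearMap) hinj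
  obtain ⟨u, hu'⟩ := hsurj (tang (rexp p) (ψ x) (ψ x) + tang (rexp q) (ψ' x) (ψ' x))
  by_contra hne
  have h1 := hu u
  rw [hu'] at h1
  exact (ip_pos (rexp m x) hne).ne' h1

/-- If the sum of the distances to `p` and `q` is minimal at a point of the equator, then the rays
to the segment from `m` to that point form spherical sectors. -/
theorem exists_isSector {v w v₀ w₀ x : EuclideanSpace ℝ (Fin n)} (hv : ip p v v = 1)
    (hw : ip q w w = 1) (hv₀ : ψ 0 = (Real.pi / 2) • v₀) (hw₀ : ψ' 0 = (Real.pi / 2) • w₀)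
    (hx : x ∈ N) (hne : x ≠ 0) (hxv : ψ x = (Real.pi / 2) • v) (hxw : ψ' x = (Real.pi / 2) • w) :
    ∃ α e f, 0 < α ∧ α < Real.pi / 2 ∧ IsSector (pullMetric (rexp p)) (normalDom p) v₀ e α ∧
      IsSector (pullMetric (rexp q)) (normalDom q) w₀ f α ∧ rot v₀ e α = v ∧ rot w₀ f α = w ∧
      ∀ θ ∈ Icc 0 α,
        rexp p ((Real.pi / 2) • rot v₀ e θ) = rexp q ((Real.pi / 2) • rot w₀ f θ) ∧
        tang (rexp p) ((Real.pi / 2) • rot v₀ e θ) (rot v₀ e θ) =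
          -tang (rexp q) ((Real.pi / 2) • rot w₀ f θ) (rot w₀ f θ) := by
  have hπ : (0 : ℝ) < Real.pi / 2 := by positivity
  have hππ : Real.pi / 2 < Real.pi := by linarith
  obtain ⟨α, u, hα, hαπ, hu, rfl⟩ := h.exists_smul hx hne
  have hrl : radius (pullMetric (rexp p)) (ψ (α • u)) = Real.pi / 2 := by
    rw [hxv, IsNormalMetric.radius_smul (by rw [pullMetric_rexp_zero, hv]) hπ.le]
  have hrr : radius (pullMetric (rexp q)) (ψ' (α • u)) = Real.pi / 2 := by
    rw [hxw, IsNormalMetric.radius_smul (by rw [pullMetric_rexp_zero, hw]) hπ.le]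
  obtain ⟨hl1, hl2⟩ := h.opp.rigid hu hx hα (hαπ.trans hππ) hrl hrr
  obtain ⟨hr1, hr2⟩ := h.opp.symm.rigid hu hx hα (hαπ.trans hππ) hrr hrl
  obtain ⟨v', e, hS, hve⟩ := h.opp.left.exists_isSector hu hα hx hl1 hl2
  obtain ⟨w', f, hS', hwf⟩ := h.opp.right.exists_isSector hu hα hx hr1 hr2
  have h0α : (0 : ℝ) ∈ Icc 0 α := left_mem_Icc.2 hα.le
  have hαα : α ∈ Icc 0 α := right_mem_Icc.2 hα.le
  have hv' : v' = v₀ := by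
    have := hve 0 h0α
    rw [zero_smul, hv₀, rot_zero] at this
    exact (smul_right_injective _ hπ.ne' this).symm
  have hw' : w' = w₀ := by
    have := hwf 0 h0α
    rw [zero_smul, hw₀, rot_zero] at this
    exact (smul_right_injective _ hπ.ne' this).symm
  subst hv' hw'
  refine ⟨α, e, f, hα, hαπ, hS, hS', ?_, ?_, fun θ hθ ↦ ?_⟩
  · exact smul_right_injective _ hπ.ne' ((hve α hαα).symm.trans hxv)
  · exact smul_right_injective _ hπ.ne' ((hwf α hαα).symm.trans hxw)
  · have hθN := h.opp.left.ray_mem hx hθ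
    have h1 := h.opposite hθN (hl1 θ hθ) (hr1 θ hθ)
    rw [hve θ hθ, hwf θ hθ, map_smul, map_smul, ← smul_add] at h1
    refine ⟨?_, eq_neg_of_add_eq_zero_left ((smul_eq_zero.1 h1).resolve_left hπ.ne')⟩
    rw [← hve θ hθ, ← hwf θ hθ, h.left _ hθN, h.right _ hθN]

end IsMidpoint

end Midpoint

/-! ### Curves of length at most `π` are broken geodesics -/

section Broken

theorem strictMonoOn_Icc_of_hasDerivWithinAt {f : ℝ → ℝ} {a b : ℝ}
    (h : ∀ s ∈ Icc a b, ∃ r > 0, HasDerivWithinAt f r (Icc a b) s) : StrictMonoOn f (Icc a b) := by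
  refine strictMonoOn_of_deriv_pos (convex_Icc a b) (fun s hs ↦ ?_) fun s hs ↦ ?_
  · obtain ⟨r, -, hr⟩ := h s hs
    exact hr.continuousWithinAt
  · rw [interior_Icc] at hs
    obtain ⟨r, hr0, hr⟩ := h s (Ioo_subset_Icc_self hs)
    rwa [(hr.hasDerivAt (Icc_mem_nhds hs.1 hs.2)).deriv]

/-- Two increasing functions on overlapping intervals, which agree on the overlap, combine to a
regular reparametrization. -/
theorem exists_glue {ρ ρ' : ℝ → ℝ} {L t₀ s : ℝ} (ht₀ : t₀ < L)
    (hs : s ∈ Ioo (L - t₀) t₀)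
    (hρ : ContDiffOn ℝ ∞ ρ (Icc 0 t₀))
    (hρd : ∀ t ∈ Icc 0 t₀, ∃ r > 0, HasDerivWithinAt ρ r (Icc 0 t₀) t)
    (hρ' : ContDiffOn ℝ ∞ ρ' (Icc 0 t₀))
    (hρ'd : ∀ t ∈ Icc 0 t₀, ∃ r > 0, HasDerivWithinAt ρ' r (Icc 0 t₀) t)
    (hsum : ∀ t ∈ Icc (L - t₀) t₀, ρ t + ρ' (L - t) = L) :
    ∃ τ : ℝ → ℝ, ContDiffOn ℝ ∞ τ (Icc 0 L) ∧ (∀ t ∈ Icc 0 L, 0 < derivWithin τ (Icc 0 L) t) ∧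
      (∀ t ∈ Icc 0 s, τ t = ρ t ∧ τ t ≤ ρ s) ∧
      ∀ t ∈ Ioc s L, τ t = L - ρ' (L - t) ∧ ρ s < τ t := by
  have hL : 0 < L := by linarith [hs.1, hs.2]
  set τ : ℝ → ℝ := fun t ↦ if t ≤ s then ρ t else L - ρ' (L - t) with hτ
  have hτl (t : ℝ) (ht : t ∈ Icc 0 t₀) : τ t = ρ t := by
    simp only [hτ]
    split_ifs with h
    · rfl
    · linarith [hsum t ⟨by linarith [hs.1], ht.2⟩]
  have hτr (t : ℝ) (ht : t ∈ Icc (L - t₀) L) : τ t = L - ρ' (L - t) := by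
    simp only [hτ]
    split_ifs with h
    · linarith [hsum t ⟨ht.1, by linarith [hs.2]⟩]
    · rfl
  have hloc (t : ℝ) (ht : t ∈ Icc 0 L) : ContDiffWithinAt ℝ ∞ τ (Icc 0 L) t ∧
      ∃ r > 0, HasDerivWithinAt τ r (Icc 0 L) t := by
    rcases lt_or_ge t t₀ with h | h
    · have htm : t ∈ Icc 0 t₀ := ⟨ht.1, h.le⟩
      have hnhds : Icc 0 t₀ ∈ nhdsWithin t (Icc 0 L) := by
        filter_upwards [self_mem_nhdsWithin, mem_nhdsWithin_of_mem_nhds (Iio_mem_nhds h)]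
          with u hu hu' using ⟨hu.1, (mem_Iio.1 hu').le⟩
      obtain ⟨r, hr, hd⟩ := hρd t htm
      exact ⟨((hρ t htm).congr hτl (hτl t htm)).mono_of_mem_nhdsWithin hnhds, r, hr,
        (hd.congr hτl (hτl t htm)).mono_of_mem_nhdsWithin hnhds⟩
    · have htm : t ∈ Icc (L - t₀) L := ⟨by linarith [hs.1, hs.2], ht.2⟩
      have hnhds : Icc (L - t₀) L ∈ nhdsWithin t (Icc 0 L) := by
        filter_upwards [self_mem_nhdsWithin, mem_nhdsWithin_of_mem_nhds
          (Ioi_mem_nhds (show L - t₀ < t by linarith [hs.1, hs.2]))]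
          with u hu hu' using ⟨(mem_Ioi.1 hu').le, hu.2⟩
      have hmaps : MapsTo (fun t ↦ L - t) (Icc (L - t₀) L) (Icc 0 t₀) := fun u hu ↦
        ⟨by linarith [hu.2], by linarith [hu.1]⟩
      obtain ⟨r, hr, hd⟩ := hρ'd (L - t) (hmaps htm)
      have hl : HasDerivWithinAt (fun t ↦ L - t) (-1) (Icc (L - t₀) L) t := by
        simpa using (hasDerivWithinAt_id t (Icc (L - t₀) L)).const_sub L
      have h1 : ContDiffWithinAt ℝ ∞ (fun t ↦ L - ρ' (L - t)) (Icc (L - t₀) L) t :=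
        contDiffWithinAt_const.sub ((hρ' (L - t) (hmaps htm)).comp t
          (contDiffWithinAt_const.sub contDiffWithinAt_id) hmaps)
      have h2 : HasDerivWithinAt (fun t ↦ L - ρ' (L - t)) r (Icc (L - t₀) L) t :=
        ((hd.comp t hl hmaps).const_sub L).congr_deriv (by ring)
      exact ⟨(h1.congr hτr (hτr t htm)).mono_of_mem_nhdsWithin hnhds, r, hr,
        (h2.congr hτr (hτr t htm)).mono_of_mem_nhdsWithin hnhds⟩
  refine ⟨τ, fun t ht ↦ (hloc t ht).1, fun t ht ↦ ?_, fun t ht ↦ ?_, fun t ht ↦ ?_⟩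
  · obtain ⟨-, r, hr, hd⟩ := hloc t ht
    rwa [hd.derivWithin (uniqueDiffOn_Icc hL t ht)]
  all_goals
    have hmono := strictMonoOn_Icc_of_hasDerivWithinAt fun t ht ↦ (hloc t ht).2
    have hsL : s ∈ Icc 0 L := ⟨by linarith [hs.1], by linarith [hs.2]⟩
    have hs0 : s ∈ Icc 0 t₀ := ⟨hsL.1, hs.2.le⟩
  · refine ⟨hτl t ⟨ht.1, ht.2.trans hs.2.le⟩, ?_⟩
    rw [← hτl s hs0]
    exact hmono.monotoneOn ⟨ht.1, ht.2.trans hsL.2⟩ hsL ht.2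
  · refine ⟨hτr t ⟨by linarith [hs.1, ht.1], ht.2⟩, ?_⟩
    rw [← hτl s hs0]
    exact hmono hsL ⟨hsL.1.trans ht.1.le, ht.2⟩ ht.1

variable {n : ℕ} {M : Type*} [TopologicalSpace M] [ChartedSpace (EuclideanSpace ℝ (Fin n)) M]
  [IsManifold (𝓡 n) ∞ M] [RiemannianBundle (fun x : M ↦ TangentSpace (𝓡 n) x)]
  [IsContMDiffRiemannianBundle (𝓡 n) ∞ (EuclideanSpace ℝ (Fin n))
      (fun x : M ↦ TangentSpace (𝓡 n) x)] [T2Space M]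

/-- The points of the variation near the midpoint lie in the neighborhood `N` of `m`, and there the
lifts to normal coordinates around `p` and `q` are given by the transition maps `ψ` and `ψ'`. -/
theorem IsRadialLift.eventually_midpoint {p q m : M} {N : Set (EuclideanSpace ℝ (Fin n))}
    {ψ ψ' : EuclideanSpace ℝ (Fin n) → EuclideanSpace ℝ (Fin n)} (h : IsMidpoint p q m N ψ ψ')
    {V : ℝ → ℝ → M} {T ε : ℝ} {v₀ w₀ : EuclideanSpace ℝ (Fin n)}
    {O O' : Set (ℝ × EuclideanSpace ℝ (Fin n))} {Y Y' : ℝ × ℝ → EuclideanSpace ℝ (Fin n)}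
    (L : IsRadialLift V p v₀ T ε O Y) (L' : IsRadialLift (fun σ t ↦ V σ (Real.pi - t)) q w₀ T ε O' Y')
    (hε : 0 < ε) (hT : Real.pi / 2 < T) (hTπ : T < Real.pi)
    (hψ : ψ 0 = (Real.pi / 2) • v₀) (hψ' : ψ' 0 = (Real.pi / 2) • w₀)
    (hV : ContMDiffAt 𝓘(ℝ, ℝ × ℝ) (𝓡 n) ∞ (fun z : ℝ × ℝ ↦ V z.1 z.2) (0, Real.pi / 2)) :
    ∀ᶠ z : ℝ × ℝ in nhds (0, Real.pi / 2), (z.1 ∈ Ioo (-ε) ε ∧ z.2 ∈ Ioo (Real.pi - T) T) ∧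
      ∃ x ∈ N, ψ x = Y z ∧ ψ' x = Y' (z.1, Real.pi - z.2) := by
  have hπ := Real.pi_pos
  have h0N := h.opp.left.center.zero_mem
  have hmem : ∀ᶠ z : ℝ × ℝ in nhds (0, Real.pi / 2),
      z.1 ∈ Ioo (-ε) ε ∧ z.2 ∈ Ioo (Real.pi - T) T :=
    (continuous_fst.continuousAt.eventually (isOpen_Ioo.mem_nhds ⟨neg_lt_zero.2 hε, hε⟩)).and
      (continuous_snd.continuousAt.eventually (isOpen_Ioo.mem_nhds ⟨by
        change Real.pi - T < Real.pi / 2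
        linarith, hT⟩))
  have h0 : rexp m (0 : EuclideanSpace ℝ (Fin n)) = V 0 (Real.pi / 2) := by
    rw [← h.left 0 h0N, hψ, ← L.center _ ⟨by positivity, hT.le⟩,
      L.lift 0 ⟨neg_lt_zero.2 hε, hε⟩ _ ⟨by positivity, hT.le⟩]
  obtain ⟨f, hf, hf0, hfV⟩ := (isParam_rexp m).exists_local_lift (S := univ)
    (z := (0, Real.pi / 2)) hV.contMDiffWithinAt (isNormalMetric_rexp m).zero_mem h0
  rw [nhdsWithin_univ] at hfV
  rw [contDiffWithinAt_univ] at hf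
  have hψc : ContinuousAt ψ (f (0, Real.pi / 2)) := by
    rw [hf0]; exact (h.opp.left.isom.contDiffAt h0N).continuousAt
  have hψ'c : ContinuousAt ψ' (f (0, Real.pi / 2)) := by
    rw [hf0]; exact (h.opp.right.isom.contDiffAt h0N).continuousAt
  have e1 : ∀ᶠ z : ℝ × ℝ in nhds (0, Real.pi / 2), f z ∈ N :=
    hf.continuousAt.eventually (h.opp.left.isom.isOpen.mem_nhds (by rw [hf0]; exact h0N))
  have e2 : ∀ᶠ z : ℝ × ℝ in nhds (0, Real.pi / 2), (z.2, ψ (f z)) ∈ O := by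
    refine (continuousAt_snd.prodMk (hψc.comp hf.continuousAt)).eventually (L.isOpen.mem_nhds ?_)
    simp only [Function.comp, hf0, hψ]
    exact L.ray_mem _ ⟨by positivity, hT.le⟩
  have e3 : ∀ᶠ z : ℝ × ℝ in nhds (0, Real.pi / 2), (Real.pi - z.2, ψ' (f z)) ∈ O' := by
    refine ((continuousAt_const.sub continuousAt_snd).prodMk
      (hψ'c.comp hf.continuousAt)).eventually (L'.isOpen.mem_nhds ?_)
    simp only [Function.comp, hf0, hψ']
    change (Real.pi - Real.pi / 2, (Real.pi / 2) • w₀) ∈ O'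
    rw [sub_half]
    exact L'.ray_mem _ ⟨by positivity, hT.le⟩
  filter_upwards [hmem, hfV, e1, e2, e3] with z hz h1 h2 h3 h4
  have hzT : z.2 ∈ Icc 0 T := ⟨by linarith [hz.2.1], hz.2.2.le⟩
  have hzT' : Real.pi - z.2 ∈ Icc 0 T := ⟨by linarith [hz.2.2], by linarith [hz.2.1]⟩
  refine ⟨hz, f z, h2, L.eq_of_rexp_eq h3 (L.mem z.1 hz.1 z.2 hzT) ?_,
    L'.eq_of_rexp_eq h4 (L'.mem z.1 hz.1 _ hzT') ?_⟩
  · rw [h.left _ h2, h1, L.lift z.1 hz.1 z.2 hzT]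
  · rw [h.right _ h2, h1, L'.lift z.1 hz.1 _ hzT', sub_sub_cancel]

theorem IsRadialLift.continuousAt_radius {p : M} {V : ℝ → ℝ → M} {T ε : ℝ}
    {v₀ : EuclideanSpace ℝ (Fin n)} {O : Set (ℝ × EuclideanSpace ℝ (Fin n))}
    {Y : ℝ × ℝ → EuclideanSpace ℝ (Fin n)} (L : IsRadialLift V p v₀ T ε O Y) (hε : 0 < ε) {t : ℝ}
    (ht : t ∈ Icc 0 T) : ContinuousAt (fun σ ↦ radius (pullMetric (rexp p)) (Y (σ, t))) 0 := by
  have h1 : ContinuousOn (fun σ ↦ Y (σ, t)) (Ioo (-ε) ε) :=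
    L.contDiffOn.continuousOn.comp (continuousOn_id.prodMk continuousOn_const)
      fun σ hσ ↦ ⟨hσ, ht⟩
  have h2 := h1.continuousAt (isOpen_Ioo.mem_nhds ⟨neg_lt_zero.2 hε, hε⟩)
  exact ((continuousAt_const.clm_apply h2).clm_apply h2).sqrt

/-- Consider a variation of a geodesic of length `π` from `p` to `q` by curves of length at most
`π`. The sum of the distances of a point near the midpoint to `p` and `q` is at least `π`. Hence the
curves of the variation consist of a geodesic from `p` and a geodesic to `q`, which meet in a point
`x` at distance `π / 2` to both `p` and `q`. -/
theorem exists_broken_geodesic {p q m : M} {N : Set (EuclideanSpace ℝ (Fin n))}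
    {ψ ψ' : EuclideanSpace ℝ (Fin n) → EuclideanSpace ℝ (Fin n)} (h : IsMidpoint p q m N ψ ψ')
    {V : ℝ → ℝ → M} {T ε : ℝ} {v₀ w₀ : EuclideanSpace ℝ (Fin n)}
    {O O' : Set (ℝ × EuclideanSpace ℝ (Fin n))} {Y Y' : ℝ × ℝ → EuclideanSpace ℝ (Fin n)}
    (L : IsRadialLift V p v₀ T ε O Y) (L' : IsRadialLift (fun σ t ↦ V σ (Real.pi - t)) q w₀ T ε O' Y')
    (hε : 0 < ε) (hT : Real.pi / 2 < T) (hTπ : T < Real.pi)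
    (hψ : ψ 0 = (Real.pi / 2) • v₀) (hψ' : ψ' 0 = (Real.pi / 2) • w₀)
    (hV : ContMDiffAt 𝓘(ℝ, ℝ × ℝ) (𝓡 n) ∞ (fun z : ℝ × ℝ ↦ V z.1 z.2) (0, Real.pi / 2))
    (hrev : ∀ σ ∈ Ioo (-ε) ε, ∀ t ∈ Icc 0 T, pathELength (𝓡 n) (fun t ↦ V σ (Real.pi - t)) 0 t =
      pathELength (𝓡 n) (V σ) (Real.pi - t) Real.pi)
    (hlen : ∀ σ ∈ Ioo (-ε) ε, pathELength (𝓡 n) (V σ) 0 Real.pi ≤ ENNReal.ofReal Real.pi) :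
    ∃ ε', 0 < ε' ∧ ε' ≤ ε ∧ ∀ σ ∈ Ioo (-ε') ε', ∃ v w : EuclideanSpace ℝ (Fin n), ∃ x ∈ N,
      ∃ τ : ℝ → ℝ, ip p v v = 1 ∧ ip q w w = 1 ∧
      ψ x = (Real.pi / 2) • v ∧ ψ' x = (Real.pi / 2) • w ∧
      ContDiffOn ℝ ∞ τ (Icc 0 Real.pi) ∧
      (∀ t ∈ Icc 0 Real.pi, 0 < derivWithin τ (Icc 0 Real.pi) t) ∧ τ 0 = 0 ∧ τ Real.pi = Real.pi ∧
      ∀ t ∈ Icc 0 Real.pi, (τ t ≤ Real.pi / 2 → V σ t = rexp p (τ t • v)) ∧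
        (Real.pi / 2 < τ t → V σ t = rexp q ((Real.pi - τ t) • w)) := by
  have hπ := Real.pi_pos
  obtain ⟨r, hr, hball⟩ := Metric.eventually_nhds_iff_ball.1
    (L.eventually_midpoint h L' hε hT hTπ hψ hψ' hV)
  have hnear (σ t : ℝ) (hσ : |σ| < r) (ht : |t - Real.pi / 2| < r) := hball (σ, t) (by
    rw [Metric.mem_ball, Prod.dist_eq, max_lt_iff, Real.dist_eq, Real.dist_eq, sub_zero]
    exact ⟨hσ, ht⟩)
  set η := r / 2 with hη
  have hη0 : 0 < η := by positivity
  have hin (t : ℝ) (ht : t ∈ Icc (Real.pi / 2 - η) (Real.pi / 2 + η)) : |t - Real.pi / 2| < r := by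
    rw [abs_lt]; constructor <;> linarith [ht.1, ht.2]
  have hT1 := (hnear 0 (Real.pi / 2 - η) (by simpa) (hin _ ⟨le_rfl, by linarith⟩)).1.2
  have hT2 := (hnear 0 (Real.pi / 2 + η) (by simpa) (hin _ ⟨by linarith, le_rfl⟩)).1.2
  set ρ : ℝ → ℝ → ℝ := fun σ t ↦ radius (pullMetric (rexp p)) (Y (σ, t)) with hρ
  set ρ' : ℝ → ℝ → ℝ := fun σ t ↦ radius (pullMetric (rexp q)) (Y' (σ, t)) with hρ'
  have hc0 (t : ℝ) (ht : t ∈ Icc 0 T) : ρ 0 t = t := by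
    simp only [hρ, L.center t ht]
    exact IsNormalMetric.radius_smul (by rw [pullMetric_rexp_zero, L.unit]) ht.1
  have hm1 : Real.pi / 2 - η ∈ Icc 0 T := ⟨by linarith [hT1.1], hT1.2.le⟩
  have hm2 : Real.pi / 2 + η ∈ Icc 0 T := ⟨by positivity, hT2.2.le⟩
  have hev : ∀ᶠ σ in nhds (0 : ℝ), (ρ σ (Real.pi / 2 - η) < Real.pi / 2 ∧
      Real.pi / 2 < ρ σ (Real.pi / 2 + η)) ∧ |σ| < r := by
    refine ((((L.continuousAt_radius hε hm1).eventually (gt_mem_nhds ?_)).and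
      ((L.continuousAt_radius hε hm2).eventually (lt_mem_nhds ?_)))).and
      (continuous_abs.continuousAt.eventually (gt_mem_nhds (by simpa)))
    · change ρ 0 _ < _
      rw [hc0 _ hm1]; linarith
    · change _ < ρ 0 _
      rw [hc0 _ hm2]; linarith
  obtain ⟨r', hr', hball'⟩ := Metric.eventually_nhds_iff_ball.1 hev
  refine ⟨min r' ε, lt_min hr' hε, min_le_right _ _, fun σ hσ' ↦ ?_⟩
  have hσ : σ ∈ Ioo (-ε) ε := ⟨by linarith [hσ'.1, min_le_right r' ε],
    hσ'.2.trans_le (min_le_right _ _)⟩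
  obtain ⟨⟨hlt1, hlt2⟩, hσr⟩ := hball' σ (by
    rw [Metric.mem_ball, Real.dist_eq, sub_zero, abs_lt]
    exact ⟨by linarith [hσ'.1, min_le_left r' ε], hσ'.2.trans_le (min_le_left _ _)⟩)
  set t₀ := Real.pi / 2 + η with ht₀
  have ht₀T : t₀ ≤ T := hT2.2.le
  have ht₀0 : 0 < t₀ := by positivity
  have hπt : Real.pi - t₀ = Real.pi / 2 - η := by rw [ht₀]; ring
  -- Near the middle the two parts of the curve are at least as long as the distances to `p` and
  -- `q`, whose sum is at least `π`. Since the total length is at most `π`, equality holds.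
  have hcmp (t : ℝ) (ht : t ∈ Icc (Real.pi - t₀) t₀) :
      pathELength (𝓡 n) (V σ) 0 t ≤ ENNReal.ofReal (ρ σ t) ∧
      pathELength (𝓡 n) (fun t ↦ V σ (Real.pi - t)) 0 (Real.pi - t) ≤
        ENNReal.ofReal (ρ' σ (Real.pi - t)) ∧ ρ σ t + ρ' σ (Real.pi - t) = Real.pi := by
    have ht' : t ∈ Icc (Real.pi / 2 - η) (Real.pi / 2 + η) := by rwa [hπt] at ht
    obtain ⟨-, x, hxN, hx1, hx2⟩ := hnear σ t hσr (hin t ht')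
    have hpi := h.pi_le hxN
    rw [hx1, hx2] at hpi
    change Real.pi ≤ ρ σ t + ρ' σ (Real.pi - t) at hpi
    have htT : t ∈ Icc 0 T := ⟨by linarith [ht'.1, hm1.1], by linarith [ht'.2]⟩
    have htT' : Real.pi - t ∈ Icc 0 T := ⟨by linarith [htT.2], by linarith [ht.1]⟩
    have hn : 0 ≤ ρ σ t := Real.sqrt_nonneg _
    have hn' : 0 ≤ ρ' σ (Real.pi - t) := Real.sqrt_nonneg _
    have h1 : ENNReal.ofReal (ρ σ t) ≤ _ := L.radius_le_pathELength hσ htT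
    have h2 : ENNReal.ofReal (ρ' σ (Real.pi - t)) ≤ _ := L'.radius_le_pathELength hσ htT'
    have h3 := hrev σ hσ _ htT'
    rw [sub_sub_cancel] at h3
    have h4 := hlen σ hσ
    rw [← pathELength_add htT.1 (by linarith [htT.2] : t ≤ Real.pi), ← h3] at h4
    have h5 : ENNReal.ofReal Real.pi ≤
        ENNReal.ofReal (ρ σ t) + ENNReal.ofReal (ρ' σ (Real.pi - t)) := by
      rw [← ENNReal.ofReal_add hn hn']
      exact ENNReal.ofReal_le_ofReal hpi
    refine ⟨?_, ?_, le_antisymm ?_ hpi⟩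
    · exact ENNReal.le_of_add_le_add_right ENNReal.ofReal_ne_top
        ((add_le_add_right h2 _).trans (h4.trans h5))
    · exact ENNReal.le_of_add_le_add_left ENNReal.ofReal_ne_top
        ((add_le_add_left h1 _).trans (h4.trans h5))
    · have h6 := (add_le_add h1 h2).trans h4
      rw [← ENNReal.ofReal_add hn hn'] at h6
      exact (ENNReal.ofReal_le_ofReal_iff hπ.le).1 h6
  have hord : Real.pi - t₀ ≤ t₀ := by linarith
  have hle1 := (hcmp t₀ (right_mem_Icc.2 hord)).1
  have hle2 := (hcmp (Real.pi - t₀) (left_mem_Icc.2 hord)).2.1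
  rw [sub_sub_cancel] at hle2
  obtain ⟨v, hv, hvY, hρs, hρd⟩ := L.exists_ray hσ ht₀0 ht₀T hle1
  obtain ⟨w, hw, hwY, hρ's, hρ'd⟩ := L'.exists_ray hσ ht₀0 ht₀T hle2
  have hIc : ContinuousOn (ρ σ) (Icc (Real.pi - t₀) t₀) :=
    hρs.continuousOn.mono (Icc_subset_Icc_left (by linarith))
  -- The time at which the curve has distance `π / 2` to `p`.
  obtain ⟨s, hs, hsρ⟩ := intermediate_value_Ioo hord hIc
    (show Real.pi / 2 ∈ Ioo (ρ σ (Real.pi - t₀)) (ρ σ t₀) from ⟨by rw [hπt]; exact hlt1, hlt2⟩)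
  have hs' := Ioo_subset_Icc_self hs
  obtain ⟨τ, hτs, hτd, hτl, hτr⟩ := exists_glue (by linarith : t₀ < Real.pi) hs hρs hρd hρ's hρ'd
    (fun t ht ↦ (hcmp t ht).2.2)
  have hs0 : 0 ≤ s := by linarith [hs.1]
  have hsπ : s < Real.pi := by linarith [hs.2]
  obtain ⟨-, x, hxN, hx1, hx2⟩ := hnear σ s hσr (hin s (by rwa [hπt] at hs'))
  have hsρ' : ρ' σ (Real.pi - s) = Real.pi / 2 := by linarith [(hcmp s hs').2.2]
  have hz (hT0 : (0 : ℝ) ∈ Icc 0 T) : ρ σ 0 = 0 ∧ ρ' σ 0 = 0 := by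
    obtain ⟨y, hy⟩ := L.radial σ hσ
    obtain ⟨y', hy'⟩ := L'.radial σ hσ
    have h1 : Y (σ, 0) = 0 := hy.zero
    have h2 : Y' (σ, 0) = 0 := hy'.zero
    simp [hρ, hρ', h1, h2, radius]
  have hz' := hz ⟨le_rfl, by linarith⟩
  refine ⟨v, w, x, hxN, τ, hv, hw, ?_, ?_, hτs, hτd, ?_, ?_, fun t ht ↦ ⟨fun hle ↦ ?_,
    fun hlt ↦ ?_⟩⟩
  · rw [hx1]
    exact (hvY s ⟨hs0, hs.2.le⟩).trans (by rw [← hsρ])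
  · rw [hx2]
    exact (hwY (Real.pi - s) ⟨by linarith, by linarith [hs.1]⟩).trans (by rw [← hsρ'])
  · rw [(hτl 0 ⟨le_rfl, hs0⟩).1]
    exact hz'.1
  · rw [(hτr Real.pi ⟨hsπ, le_rfl⟩).1, sub_self]
    have := hz'.2
    simp only [hρ'] at this
    rw [this, sub_zero]
  · have hts : t ≤ s := by
      by_contra hlt
      push Not at hlt
      have h1 := (hτr t ⟨hlt, ht.2⟩).2
      change ρ σ s < τ t at h1
      linarith
    rw [(hτl t ⟨ht.1, hts⟩).1, ← hvY t ⟨ht.1, by linarith [hs.2]⟩]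
    exact (L.lift σ hσ t ⟨ht.1, by linarith [hs.2]⟩).symm
  · have hts : s < t := by
      by_contra hle
      push Not at hle
      have h1 := (hτl t ⟨ht.1, hle⟩).2
      change τ t ≤ ρ σ s at h1
      linarith
    have htm : Real.pi - t ∈ Icc 0 t₀ := ⟨by linarith [ht.2], by linarith [hs.1]⟩
    rw [(hτr t ⟨hts, ht.2⟩).1, sub_sub_cancel, ← hwY _ htm]
    have := L'.lift σ hσ (Real.pi - t) ⟨htm.1, htm.2.trans ht₀T⟩
    rw [sub_sub_cancel] at this
    exact this.symm

end Broken

/-! ### The function `t / sin t` of the variable `cos t` -/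

section Kappa

/-- The power series `∑ (-1)ⁿ qⁿ / (2n + 1)` of the function `arctan √q / √q`. -/
noncomputable def arctanSeries (q : ℝ) : ℝ :=
  FormalMultilinearSeries.ofScalarsSum (fun n : ℕ ↦ (-1 : ℝ) ^ n / (2 * n + 1)) q

theorem contDiffAt_arctanSeries {q : ℝ} (hq : |q| < 1) : ContDiffAt ℝ ∞ arctanSeries q := by
  set c : ℕ → ℝ := fun n ↦ (-1 : ℝ) ^ n / (2 * n + 1) with hc
  set P := FormalMultilinearSeries.ofScalars ℝ c with hP
  have hr : 1 ≤ P.radius := by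
    refine P.le_radius_of_bound 1 (r := 1) fun n ↦ ?_
    rw [hP, FormalMultilinearSeries.ofScalars_norm]
    simp only [hc, NNReal.coe_one, one_pow, mul_one, norm_div, norm_pow, norm_neg, norm_one,
      Real.norm_eq_abs]
    rw [div_le_one (by positivity), abs_of_pos (by positivity)]
    have : (0 : ℝ) ≤ n := Nat.cast_nonneg n
    linarith
  have h1 := (P.hasFPowerSeriesOnBall (zero_lt_one.trans_le hr)).analyticOnNhd
  refine (h1 q ?_).contDiffAt
  rw [Metric.mem_eball, edist_zero_right]
  refine lt_of_lt_of_le ?_ hr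
  rw [← ofReal_norm]
  exact ENNReal.ofReal_lt_one.2 hq

theorem mul_arctanSeries {x : ℝ} (hx : |x| < 1) : x * arctanSeries (x ^ 2) = Real.arctan x := by
  rw [← (Real.hasSum_arctan (by simpa using hx)).tsum_eq, arctanSeries,
    FormalMultilinearSeries.ofScalarsSum_eq_tsum, ← tsum_mul_left]
  refine tsum_congr fun n ↦ ?_
  simp only [smul_eq_mul]
  push_cast
  ring

/-- The function with the value `t / sin t` at `cos t` for `0 < t < π`, extended smoothly beyond
`1 = cos 0`. -/
noncomputable def sinRatio (c : ℝ) : ℝ :=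
  if c < 1 then Real.arccos c / √(1 - c ^ 2) else 2 * arctanSeries ((1 - c) / (1 + c)) / (1 + c)

theorem sinRatio_one : sinRatio 1 = 1 := by
  have : arctanSeries 0 = 1 := by
    rw [arctanSeries, FormalMultilinearSeries.ofScalarsSum_zero]
    simp
  rw [sinRatio, if_neg (lt_irrefl _)]
  norm_num [this]

theorem sinRatio_cos_mul_sin {t : ℝ} (ht : t ∈ Ico 0 Real.pi) :
    sinRatio (Real.cos t) * Real.sin t = t := by
  rcases ht.1.eq_or_lt with rfl | h0
  · simp
  have hs := Real.sin_pos_of_pos_of_lt_pi h0 ht.2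
  have hc : Real.cos t < 1 := by nlinarith [Real.sin_sq_add_cos_sq t, Real.cos_le_one t]
  have h1 : 1 - Real.cos t ^ 2 = Real.sin t ^ 2 := by linarith [Real.sin_sq_add_cos_sq t]
  rw [sinRatio, if_pos hc, Real.arccos_cos ht.1 ht.2.le, h1, Real.sqrt_sq hs.le,
    div_mul_cancel₀ _ hs.ne']

/-- With `x = tan (t / 2)` one has `t = 2 arctan x`, `sin t = x (1 + cos t)` and
`x² = (1 - cos t) / (1 + cos t)`. -/
theorem sinRatio_eq_series {c : ℝ} (hc : 0 < c) :
    sinRatio c = 2 * arctanSeries ((1 - c) / (1 + c)) / (1 + c) := by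
  by_cases h : c < 1
  swap
  · rw [sinRatio, if_neg h]
  set t := Real.arccos c with ht
  have hct : Real.cos t = c := Real.cos_arccos (by linarith) h.le
  have h0 : 0 < t := Real.arccos_pos.2 h
  have h2 : t < Real.pi / 2 := Real.arccos_lt_pi_div_two.2 hc
  have hs := Real.sin_pos_of_pos_of_lt_pi h0 (by linarith)
  have h3 := sinRatio_cos_mul_sin ⟨h0.le, by linarith⟩
  set x := Real.tan (t / 2) with hx
  have hcos : 0 < Real.cos (t / 2) := Real.cos_pos_of_mem_Ioo ⟨by linarith, by linarith⟩
  have hx0 : 0 < x := Real.tan_pos_of_pos_of_lt_pi_div_two (by linarith) (by linarith)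
  have hx1 : x < 1 := by
    rw [← Real.tan_pi_div_four]
    exact Real.tan_lt_tan_of_lt_of_lt_pi_div_two (by linarith) (by linarith) (by linarith)
  have hat : Real.arctan x = t / 2 := Real.arctan_tan (by linarith) (by linarith)
  have e1 : Real.sin t = 2 * Real.sin (t / 2) * Real.cos (t / 2) := by
    rw [← Real.sin_two_mul]; ring_nf
  have e2 : Real.cos t = 2 * Real.cos (t / 2) ^ 2 - 1 := by
    rw [← Real.cos_two_mul]; ring_nf
  have e3 : x * Real.cos (t / 2) = Real.sin (t / 2) := Real.tan_mul_cos hcos.ne'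
  have e4 : Real.sin t = x * (1 + c) := by
    rw [← hct, e1, e2, ← e3]; ring
  have e5 : (1 - c) / (1 + c) = x ^ 2 := by
    rw [div_eq_iff (by linarith), ← hct, e2]
    have := Real.sin_sq_add_cos_sq (t / 2)
    rw [← e3] at this
    linarith
  have h4 := mul_arctanSeries (x := x) (by rw [abs_of_pos hx0]; exact hx1)
  rw [hat] at h4
  rw [hct, e4] at h3
  rw [e5, eq_div_iff (by linarith)]
  refine mul_left_cancel₀ hx0.ne' ?_
  linarith

/-- The point `c = 1`, where `arccos` and the square root are not smooth, is covered by the power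
series. -/
theorem contDiffAt_sinRatio {c : ℝ} (hc : -1 < c) : ContDiffAt ℝ ∞ sinRatio c := by
  rcases lt_or_ge 0 c with h | h
  · have h1 : sinRatio =ᶠ[nhds c] fun c ↦ 2 * arctanSeries ((1 - c) / (1 + c)) / (1 + c) := by
      filter_upwards [lt_mem_nhds h] with z hz using sinRatio_eq_series hz
    refine ContDiffAt.congr_of_eventuallyEq ?_ h1
    have hne : 1 + c ≠ 0 := by linarith
    have h2 : ContDiffAt ℝ ∞ (fun c : ℝ ↦ 1 + c) c := contDiffAt_const.add contDiffAt_id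
    have h3 : ContDiffAt ℝ ∞ (fun c : ℝ ↦ (1 - c) / (1 + c)) c :=
      (contDiffAt_const.sub contDiffAt_id).div h2 hne
    have h4 : ContDiffAt ℝ ∞ (fun c ↦ arctanSeries ((1 - c) / (1 + c))) c := by
      refine (contDiffAt_arctanSeries ?_).comp c h3
      rw [abs_lt]
      constructor
      · rw [lt_div_iff₀ (by linarith)]; linarith
      · rw [div_lt_iff₀ (by linarith)]; linarith
    exact (contDiffAt_const.mul h4).div h2 hne
  · have h1 : sinRatio =ᶠ[nhds c] fun c ↦ Real.arccos c / √(1 - c ^ 2) := by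
      filter_upwards [gt_mem_nhds (show c < 1 by linarith)] with z hz
      rw [sinRatio, if_pos hz]
    refine ContDiffAt.congr_of_eventuallyEq ?_ h1
    have hpos : 0 < 1 - c ^ 2 := by nlinarith
    exact (Real.contDiffAt_arccos (by linarith) (by linarith)).div
      ((contDiffAt_const.sub (contDiffAt_id.pow 2)).sqrt hpos.ne') (Real.sqrt_pos.2 hpos).ne'

/-- The differential equations satisfied by `sinRatio`. -/
theorem hasDerivAt_sinRatio {c : ℝ} (hc : c ∈ Ioo (-1) 1) :
    HasDerivAt sinRatio ((sinRatio c * c - 1) / (1 - c ^ 2)) c := by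
  have hd := (contDiffAt_sinRatio hc.1).differentiableAt (by simp)
  have hpos : 0 < 1 - c ^ 2 := by nlinarith [hc.1, hc.2]
  have hs := Real.sqrt_pos.2 hpos
  have h1 : sinRatio =ᶠ[nhds c] fun c ↦ Real.arccos c / √(1 - c ^ 2) := by
    filter_upwards [gt_mem_nhds hc.2] with z hz
    rw [sinRatio, if_pos hz]
  have h2 : HasDerivAt (fun c : ℝ ↦ 1 - c ^ 2) (-(2 * c)) c := by
    simpa using (hasDerivAt_pow 2 c).const_sub 1
  refine (((Real.hasDerivAt_arccos hc.1.ne' hc.2.ne).div (h2.sqrt hpos.ne')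
    hs.ne').congr_of_eventuallyEq h1).congr_deriv ?_
  rw [h1.self_of_nhds, Real.sq_sqrt hpos.le]
  have h3 : √(1 - c ^ 2) ^ 2 = 1 - c ^ 2 := Real.sq_sqrt hpos.le
  field_simp
  ring

theorem hasDerivAt_deriv_sinRatio {c : ℝ} (hc : c ∈ Ioo (-1) 1) :
    HasDerivAt (fun c ↦ (sinRatio c * c - 1) / (1 - c ^ 2))
      ((3 * c * ((sinRatio c * c - 1) / (1 - c ^ 2)) + sinRatio c) / (1 - c ^ 2)) c := by
  have hpos : 0 < 1 - c ^ 2 := by nlinarith [hc.1, hc.2]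
  have h2 : HasDerivAt (fun c : ℝ ↦ 1 - c ^ 2) (-(2 * c)) c := by
    simpa using (hasDerivAt_pow 2 c).const_sub 1
  refine ((((hasDerivAt_sinRatio hc).mul (hasDerivAt_id c)).sub_const 1).div h2
    hpos.ne').congr_deriv ?_
  simp only [Pi.mul_apply, id]
  field_simp
  ring

end Kappa

/-! ### Normal coordinates around a pole of the unit sphere -/

section SphereCoord

/-- The point of the unit sphere at distance `t` from the pole `(s, 0, 0)`, where `s = ± 1`, on the
meridian with longitude `θ`. -/
noncomputable def spherePoint (s θ t : ℝ) : EuclideanSpace ℝ (Fin 3) :=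
  !₂[s * Real.cos t, Real.sin t * Real.cos θ, Real.sin t * Real.sin θ]

/-- A tangent vector of the unit sphere in terms of its component `m` along the meridian and its
component `β` orthogonal to the meridian. -/
theorem exists_polar_components {s θ t : ℝ} {b : EuclideanSpace ℝ (Fin 3)}
    (hb : inner ℝ (spherePoint s θ t) b = 0) :
    ∃ m β, s * b 0 = -Real.sin t * m ∧ b 1 = Real.cos t * m * Real.cos θ - β * Real.sin θ ∧
      b 2 = Real.cos t * m * Real.sin θ + β * Real.cos θ := by
  have h0 : s * b 0 * Real.cos t + Real.sin t * (b 1 * Real.cos θ + b 2 * Real.sin θ) = 0 := by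
    rw [← hb]
    simp only [spherePoint, PiLp.inner_apply, Fin.sum_univ_three, RCLike.inner_apply]
    simp
    ring
  have h1 := Real.sin_sq_add_cos_sq t
  have h2 := Real.sin_sq_add_cos_sq θ
  refine ⟨Real.cos t * (b 1 * Real.cos θ + b 2 * Real.sin θ) - Real.sin t * (s * b 0),
    b 2 * Real.cos θ - b 1 * Real.sin θ, ?_, ?_, ?_⟩
  · linear_combination Real.cos t * h0 - s * b 0 * h1
  · linear_combination Real.cos θ * Real.sin t * h0 -
      (b 1 * Real.cos θ + b 2 * Real.sin θ) * Real.cos θ * h1 - b 1 * h2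
  · linear_combination Real.sin θ * Real.sin t * h0 -
      (b 1 * Real.cos θ + b 2 * Real.sin θ) * Real.sin θ * h1 - b 2 * h2

theorem inner_of_polar {s θ t m β m' β' : ℝ} (hs : s * s = 1) {b b' : EuclideanSpace ℝ (Fin 3)}
    (h0 : s * b 0 = -Real.sin t * m) (h1 : b 1 = Real.cos t * m * Real.cos θ - β * Real.sin θ)
    (h2 : b 2 = Real.cos t * m * Real.sin θ + β * Real.cos θ)
    (h0' : s * b' 0 = -Real.sin t * m')
    (h1' : b' 1 = Real.cos t * m' * Real.cos θ - β' * Real.sin θ)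
    (h2' : b' 2 = Real.cos t * m' * Real.sin θ + β' * Real.cos θ) :
    inner ℝ b b' = m * m' + β * β' := by
  have h3 : b 0 * b' 0 = Real.sin t ^ 2 * m * m' := by
    have : b 0 * b' 0 = (s * b 0) * (s * b' 0) := by linear_combination -b 0 * b' 0 * hs
    rw [this, h0, h0']
    ring
  have h4 : inner ℝ b b' = b 0 * b' 0 + b 1 * b' 1 + b 2 * b' 2 := by
    simp only [PiLp.inner_apply, Fin.sum_univ_three, RCLike.inner_apply]
    simp
    ring
  rw [h4, h3, h1, h2, h1', h2']
  linear_combination (Real.cos t ^ 2 * m * m' + β * β') * Real.sin_sq_add_cos_sq θ +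
    m * m' * Real.sin_sq_add_cos_sq t

variable {E : Type*} [NormedAddCommGroup E] [NormedSpace ℝ E]

/-- Normal coordinates around the pole `(s, 0, 0)` of the unit sphere, where `s = ± 1`, with values
in the plane spanned by `v` and `e`. -/
noncomputable def sphereCoord (s : ℝ) (v e : E) (z : EuclideanSpace ℝ (Fin 3)) : E :=
  sinRatio (s * z 0) • (z 1 • v + z 2 • e)

theorem sphereCoord_spherePoint {s θ t : ℝ} (hs : s * s = 1) (ht : t ∈ Ico 0 Real.pi) (v e : E) :
    sphereCoord s v e (spherePoint s θ t) = t • rot v e θ := by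
  conv_rhs => rw [← sinRatio_cos_mul_sin ht]
  simp only [sphereCoord, spherePoint, rot]
  simp [← mul_assoc, hs]
  module

theorem contDiffAt_sphereCoord {s : ℝ} {z : EuclideanSpace ℝ (Fin 3)} (hz : -1 < s * z 0)
    (v e : E) : ContDiffAt ℝ ∞ (sphereCoord s v e) z := by
  have hp (i : Fin 3) : ContDiffAt ℝ ∞ (fun z : EuclideanSpace ℝ (Fin 3) ↦ (z i : ℝ)) z :=
    (EuclideanSpace.proj i : EuclideanSpace ℝ (Fin 3) →L[ℝ] ℝ).contDiff.contDiffAt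
  have h0 : ContDiffAt ℝ ∞ (fun z : EuclideanSpace ℝ (Fin 3) ↦ s * z 0) z :=
    contDiffAt_const.mul (hp 0)
  have h1 : ContDiffAt ℝ ∞ (fun z : EuclideanSpace ℝ (Fin 3) ↦ sinRatio (s * z 0)) z :=
    ContDiffAt.comp (g := sinRatio) z (contDiffAt_sinRatio hz) h0
  have h2 : ContDiffAt ℝ ∞ (fun z : EuclideanSpace ℝ (Fin 3) ↦ z 1 • v + z 2 • e) z :=
    ((hp 1).smul (contDiffAt_const (c := v))).add ((hp 2).smul (contDiffAt_const (c := e)))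
  exact h1.smul h2

theorem hasDerivAt_euclidean_apply {ι : Type*} [Fintype ι] {z : ℝ → EuclideanSpace ℝ ι}
    {z' : EuclideanSpace ℝ ι} {r : ℝ} (hz : HasDerivAt z z' r) (i : ι) :
    HasDerivAt (fun r ↦ z r i) (z' i) r :=
  (EuclideanSpace.proj i : EuclideanSpace ℝ ι →L[ℝ] ℝ).hasFDerivAt.comp_hasDerivAt r hz

theorem hasDerivAt_sphereCoord {s : ℝ} {z : ℝ → EuclideanSpace ℝ (Fin 3)}
    {z' : EuclideanSpace ℝ (Fin 3)} {r d : ℝ} (hz : HasDerivAt z z' r)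
    (hd : HasDerivAt sinRatio d (s * z r 0)) (v e : E) :
    HasDerivAt (fun r ↦ sphereCoord s v e (z r)) ((d * (s * z' 0)) • (z r 1 • v + z r 2 • e)
      + sinRatio (s * z r 0) • (z' 1 • v + z' 2 • e)) r := by
  have hp := hasDerivAt_euclidean_apply hz
  have h1 : HasDerivAt (fun r ↦ sinRatio (s * z r 0)) (d * (s * z' 0)) r :=
    HasDerivAt.comp (h := fun r ↦ s * z r 0) r hd ((hp 0).const_mul s)
  refine (h1.smul (((hp 1).smul_const v).add ((hp 2).smul_const e))).congr_deriv ?_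
  simp only [Pi.add_apply]
  abel

theorem fderiv_sphereCoord {s d : ℝ} {z : EuclideanSpace ℝ (Fin 3)} (hz : -1 < s * z 0)
    (hd : HasDerivAt sinRatio d (s * z 0)) (v e : E) (a : EuclideanSpace ℝ (Fin 3)) :
    fderiv ℝ (sphereCoord s v e) z a = (d * (s * a 0)) • (z 1 • v + z 2 • e)
      + sinRatio (s * z 0) • (a 1 • v + a 2 • e) := by
  have h1 := (((contDiffAt_sphereCoord hz v e).differentiableAt (by simp)).hasFDerivAt)
  have hl := hasDerivAt_line z a
  have h2 : HasFDerivAt (sphereCoord s v e) (fderiv ℝ (sphereCoord s v e) z) (z + (0 : ℝ) • a) := by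
    simpa using h1
  have h3 := h2.comp_hasDerivAt 0 hl
  have h4 := hasDerivAt_sphereCoord (s := s) hl (d := d) (by simpa using hd) v e
  have h5 := h3.unique h4
  simpa using h5

/-- The differential of the normal coordinates at a point different from the pole. -/
theorem fderiv_sphereCoord_polar {s θ t m β : ℝ} (hs : s * s = 1) (ht : t ∈ Ioo 0 Real.pi)
    {b : EuclideanSpace ℝ (Fin 3)}
    (h0 : s * b 0 = -Real.sin t * m) (h1 : b 1 = Real.cos t * m * Real.cos θ - β * Real.sin θ)
    (h2 : b 2 = Real.cos t * m * Real.sin θ + β * Real.cos θ) (v e : E) :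
    fderiv ℝ (sphereCoord s v e) (spherePoint s θ t) b =
      m • rot v e θ + (β / Real.sin t) • t • rot' v e θ := by
  have hS := Real.sin_pos_of_pos_of_lt_pi ht.1 ht.2
  have hsq := Real.sin_sq_add_cos_sq t
  have hc : s * spherePoint s θ t 0 = Real.cos t := by simp [spherePoint, ← mul_assoc, hs]
  have hcm : Real.cos t ∈ Ioo (-1 : ℝ) 1 := by
    constructor <;> nlinarith
  have hk := sinRatio_cos_mul_sin (Ioo_subset_Ico_self ht)
  have hd := hasDerivAt_sinRatio hcm
  rw [← hc] at hd hcm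
  rw [fderiv_sphereCoord hcm.1 hd, hc, h0, h1, h2]
  have h3 : 1 - Real.cos t ^ 2 = Real.sin t ^ 2 := by linarith
  rw [h3]
  set k := sinRatio (Real.cos t)
  have h4 : spherePoint s θ t 1 = Real.sin t * Real.cos θ := by simp [spherePoint]
  have h5 : spherePoint s θ t 2 = Real.sin t * Real.sin θ := by simp [spherePoint]
  have h6 : β / Real.sin t * t = k * β := by
    rw [div_mul_eq_mul_div, div_eq_iff hS.ne']
    linear_combination -β * hk
  have h7 : (k * Real.cos t - 1) / Real.sin t ^ 2 * (-Real.sin t * m) * Real.sin t =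
      -(k * Real.cos t - 1) * m := by field_simp
  rw [h4, h5, smul_smul, h6]
  have h8 : ((Real.sin t * Real.cos θ) • v + (Real.sin t * Real.sin θ) • e) =
      Real.sin t • (Real.cos θ • v + Real.sin θ • e) := by module
  rw [h8, smul_smul, h7, rot, rot']
  module

variable [FiniteDimensional ℝ E] {g : E → E →L[ℝ] E →L[ℝ] ℝ} {U : Set E} {v e : E} {α : ℝ}

namespace IsSector

theorem apply_rot (h : IsSector g U v e α) (hg : IsNormalMetric g U) (θ : ℝ) :
    g 0 (rot v e θ) (rot v e θ) = 1 ∧ g 0 (rot v e θ) (rot' v e θ) = 0 := by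
  have h1 := hg.metric.symm 0 hg.zero_mem e v
  have h2 := Real.sin_sq_add_cos_sq θ
  simp only [rot, rot', map_add, map_smul, add_apply, smul_apply, smul_eq_mul, h.unit_left, h.orth,
    h.unit_right, h1]
  constructor
  · linear_combination h2
  · ring

/-- The normal coordinates of a sector are isometric to those of the unit sphere. -/
theorem apply_fderiv (h : IsSector g U v e α) (hg : IsNormalMetric g U) {s θ t : ℝ}
    (hs : s * s = 1) (hθ : θ ∈ Icc 0 α) (ht : t ∈ Icc 0 (Real.pi / 2))
    {a b : EuclideanSpace ℝ (Fin 3)} (ha : inner ℝ (spherePoint s θ t) a = 0)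
    (hb : inner ℝ (spherePoint s θ t) b = 0) :
    g (sphereCoord s v e (spherePoint s θ t)) (fderiv ℝ (sphereCoord s v e) (spherePoint s θ t) a)
      (fderiv ℝ (sphereCoord s v e) (spherePoint s θ t) b) = inner ℝ a b := by
  have hπ := Real.pi_pos
  obtain ⟨m, β, h0, h1, h2⟩ := exists_polar_components ha
  obtain ⟨m', β', h0', h1', h2'⟩ := exists_polar_components hb
  rw [inner_of_polar hs h0 h1 h2 h0' h1' h2', sphereCoord_spherePoint hs ⟨ht.1, by linarith [ht.2]⟩]
  have hU := h.mem θ hθ t ht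
  have hsymm := hg.metric.symm _ hU
  obtain ⟨g1, g2⟩ := h.apply_rot hg θ
  rcases ht.1.eq_or_lt with rfl | ht0
  · have hz : s * spherePoint s θ 0 0 = 1 := by simp [spherePoint, hs]
    have hd := ((contDiffAt_sinRatio (show (-1 : ℝ) < 1 by norm_num)).differentiableAt
      (by simp)).hasDerivAt
    rw [← hz] at hd
    have e1 : spherePoint s θ 0 1 = 0 := by simp [spherePoint]
    have e2 : spherePoint s θ 0 2 = 0 := by simp [spherePoint]
    rw [fderiv_sphereCoord (by rw [hz]; norm_num) hd, fderiv_sphereCoord (by rw [hz]; norm_num) hd,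
      hz, e1, e2, sinRatio_one, h1, h2, h1', h2']
    have e3 := hg.metric.symm 0 hg.zero_mem e v
    simp only [zero_smul, add_zero, smul_zero, zero_add, one_smul, map_add, map_smul, add_apply,
      smul_apply, smul_eq_mul, h.unit_left, h.orth, h.unit_right, e3, Real.cos_zero]
    linear_combination (m * m' + β * β') * Real.sin_sq_add_cos_sq θ
  · have ht' : t ∈ Ioo 0 Real.pi := ⟨ht0, by linarith [ht.2]⟩
    have hS := Real.sin_pos_of_pos_of_lt_pi ht'.1 ht'.2
    rw [fderiv_sphereCoord_polar hs ht' h0 h1 h2, fderiv_sphereCoord_polar hs ht' h0' h1' h2']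
    have hj := h.jacobi θ hθ t ⟨ht0, ht.2⟩
    have e1 : g (t • rot v e θ) (rot v e θ) (rot v e θ) = 1 := by rw [hg.gauss_smul hU, g1]
    have e2 : g (t • rot v e θ) (rot v e θ) (t • rot' v e θ) = 0 := by
      rw [hg.gauss_smul hU, map_smul, g2, smul_zero]
    have e3 := hsymm (t • rot' v e θ) (rot v e θ)
    rw [e2] at e3
    generalize t • rot' v e θ = J at *
    simp only [map_add, map_smul, add_apply, smul_apply, smul_eq_mul, e1, e2, e3, hj]
    field_simp
    ring

/-- Great circles are geodesics in the normal coordinates of a sector. -/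
theorem accel_eq_zero (h : IsSector g U v e α) (hg : IsNormalMetric g U) {s θ t : ℝ}
    (hs : s * s = 1) (hθ : θ ∈ Icc 0 α) (ht : t ∈ Ioc 0 (Real.pi / 2))
    {u w : EuclideanSpace ℝ (Fin 3)} {r : ℝ} (hr : rot u w r = spherePoint s θ t)
    (hperp : inner ℝ (rot u w r) (rot' u w r) = 0)
    (hunit : inner ℝ (rot' u w r) (rot' u w r) = 1) :
    accel g (fun r ↦ sphereCoord s v e (rot u w r)) r = 0 := by
  have hπ := Real.pi_pos
  have ht' : t ∈ Ioo 0 Real.pi := ⟨ht.1, by linarith [ht.2]⟩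
  have hS := Real.sin_pos_of_pos_of_lt_pi ht'.1 ht'.2
  have hsq := Real.sin_sq_add_cos_sq t
  have hc : s * rot u w r 0 = Real.cos t := by rw [hr]; simp [spherePoint, ← mul_assoc, hs]
  have hcm : s * rot u w r 0 ∈ Ioo (-1 : ℝ) 1 := by
    rw [hc]; constructor <;> nlinarith
  have hk := sinRatio_cos_mul_sin (Ioo_subset_Ico_self ht')
  have hcc : Continuous fun r ↦ s * rot u w r 0 :=
    continuous_const.mul ((EuclideanSpace.proj (0 : Fin 3) :
      EuclideanSpace ℝ (Fin 3) →L[ℝ] ℝ).continuous.comp (continuous_rot u w))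
  have hd1 : deriv (fun r ↦ sphereCoord s v e (rot u w r)) =ᶠ[nhds r] fun r ↦
      ((sinRatio (s * rot u w r 0) * (s * rot u w r 0) - 1) / (1 - (s * rot u w r 0) ^ 2) *
        (s * rot' u w r 0)) • (rot u w r 1 • v + rot u w r 2 • e)
      + sinRatio (s * rot u w r 0) • (rot' u w r 1 • v + rot' u w r 2 • e) := by
    filter_upwards [hcc.continuousAt.eventually (isOpen_Ioo.mem_nhds hcm)] with r' hr'
    exact (hasDerivAt_sphereCoord (hasDerivAt_rot u w r') (hasDerivAt_sinRatio hr') v e).deriv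
  have hp := hasDerivAt_euclidean_apply (hasDerivAt_rot u w r)
  have hp' := hasDerivAt_euclidean_apply (hasDerivAt_rot' u w r)
  have hd2 := (((hasDerivAt_deriv_sinRatio hcm).comp r ((hp 0).const_mul s)).mul
    ((hp' 0).const_mul s)).smul (((hp 1).smul_const v).add ((hp 2).smul_const e))
  have hd3 := ((hasDerivAt_sinRatio hcm).comp r ((hp 0).const_mul s)).smul
    (((hp' 1).smul_const v).add ((hp' 2).smul_const e))
  have hd4 := (hd2.add hd3).congr_of_eventuallyEq hd1
  rw [hr] at hperp
  obtain ⟨m, β, h0, h1, h2⟩ := exists_polar_components hperp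
  have hmβ := inner_of_polar hs h0 h1 h2 h0 h1 h2
  rw [hunit] at hmβ
  have hv1 : deriv (fun r ↦ sphereCoord s v e (rot u w r)) r =
      m • rot v e θ + (β / Real.sin t) • t • rot' v e θ := by
    rw [← fderiv_sphereCoord_polar hs ht' h0 h1 h2, ← hr]
    refine HasDerivAt.deriv ?_
    have := ((contDiffAt_sphereCoord hcm.1 v e).differentiableAt (by simp)).hasFDerivAt
    exact this.comp_hasDerivAt r (hasDerivAt_rot u w r)
  have e1 : rot u w r 1 = Real.sin t * Real.cos θ := by rw [hr]; simp [spherePoint]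
  have e2 : rot u w r 2 = Real.sin t * Real.sin θ := by rw [hr]; simp [spherePoint]
  have hx : sphereCoord s v e (rot u w r) = t • rot v e θ := by
    rw [hr, sphereCoord_spherePoint hs (Ioo_subset_Ico_self ht')]
  have hU := h.mem θ hθ t (Ioc_subset_Icc_self ht)
  -- the Christoffel symbols along the sector
  have c1 : chris g (t • rot v e θ) (rot v e θ) (rot v e θ) = 0 := hg.radial_smul hU
  have c2 := h.conn θ hθ t ht
  have c3 := h.second θ hθ t ht
  have c4 := hg.metric.chris_symm hU (t • rot' v e θ) (rot v e θ)
  rw [jacobiDeriv] at c2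
  have c2' : chris g (t • rot v e θ) (rot v e θ) (t • rot' v e θ) =
      (Real.cos t / Real.sin t * t - 1) • rot' v e θ := by
    rw [eq_sub_of_add_eq' c2]
    module
  have c3' : chris g (t • rot v e θ) (t • rot' v e θ) (t • rot' v e θ) =
      (t - Real.sin t * Real.cos t) • rot v e θ := by
    have : chris g (t • rot v e θ) (t • rot' v e θ) (t • rot' v e θ) =
        (t • -rot v e θ + chris g (t • rot v e θ) (t • rot' v e θ) (t • rot' v e θ)
        + (Real.sin t * Real.cos t) • rot v e θ) + (t - Real.sin t * Real.cos t) • rot v e θ := by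
      module
    rw [this, c3, zero_add]
  rw [c2'] at c4
  have hchris : chris g (t • rot v e θ) (m • rot v e θ + (β / Real.sin t) • t • rot' v e θ)
      (m • rot v e θ + (β / Real.sin t) • t • rot' v e θ) =
      (2 * m * (β / Real.sin t) * (Real.cos t / Real.sin t * t - 1)) • rot' v e θ +
      ((β / Real.sin t) ^ 2 * (t - Real.sin t * Real.cos t)) • rot v e θ := by
    generalize t • rot' v e θ = J at *
    simp only [map_add, map_smul, add_apply, smul_apply, c1, c2', c3', c4]
    module
  rw [accel, hv1, hx, hchris, hd4.deriv]
  have h3 : 1 - Real.cos t ^ 2 = Real.sin t ^ 2 := by linarith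
  simp only [Function.comp, Pi.add_apply, Pi.mul_apply, PiLp.neg_apply, mul_neg, hc, e1, e2, h0,
    h1, h2, h3]
  set S := Real.sin t
  set C := Real.cos t
  set k := sinRatio C
  have hkC : (k * C - 1) / S ^ 2 * S ^ 2 = k * C - 1 := div_mul_cancel₀ _ (by positivity)
  set K := (k * C - 1) / S ^ 2
  clear_value K
  have r1 : (C * m * Real.cos θ - β * Real.sin θ) • v + (C * m * Real.sin θ + β * Real.cos θ) • e =
      (C * m) • rot v e θ + β • rot' v e θ := by
    rw [rot, rot']; module
  have r2 : (S * Real.cos θ) • v + (S * Real.sin θ) • e = S • rot v e θ := by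
    rw [rot]; module
  have r3 : -(S * Real.cos θ) • v + -(S * Real.sin θ) • e = -S • rot v e θ := by
    rw [rot]; module
  rw [r1, r2, r3, ← hk]
  have a1 : 2 * (K * (-S * m)) * β + 2 * m * (β / S) * (C / S * (k * S) - 1) = 0 := by
    have : 2 * m * (β / S) * (C / S * (k * S) - 1) = 2 * m * β * (k * C - 1) / S := by
      field_simp
    rw [this, ← hkC]
    field_simp
    ring
  have a2 : 2 * (K * (-S * m)) * (C * m)
      + ((3 * C * K + k) / S ^ 2 * (-S * m) * (-S * m) + -(K * C)) * S - k * S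
      + (β / S) ^ 2 * (k * S - S * C) = 0 := by
    have b1 : (3 * C * K + k) / S ^ 2 * (-S * m) * (-S * m) = (3 * C * K + k) * m ^ 2 := by
      field_simp
    have b2 : (β / S) ^ 2 * (k * S - S * C) = β ^ 2 * S * (C * K + k) := by
      have : k * S - S * C = S * (C * K + k) * S ^ 2 := by
        linear_combination -S * C * hkC - S * k * hsq
      rw [this]
      field_simp
    rw [b1, b2]
    linear_combination (-S * (C * K + k)) * hmβ
  generalize rot v e θ = R at *
  generalize rot' v e θ = R' at *
  linear_combination (norm := module) a1 • R' + a2 • R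

end IsSector

end SphereCoord

/-! ### The totally geodesic slice -/

section Slice

variable {n : ℕ} {M : Type*} [TopologicalSpace M] [ChartedSpace (EuclideanSpace ℝ (Fin n)) M]
  [IsManifold (𝓡 n) ∞ M] [RiemannianBundle (fun x : M ↦ TangentSpace (𝓡 n) x)]
  [IsContMDiffRiemannianBundle (𝓡 n) ∞ (EuclideanSpace ℝ (Fin n))
      (fun x : M ↦ TangentSpace (𝓡 n) x)] [T2Space M]

/-- Two spherical sectors around `p` and `q` with the same equator, whose rays meet smoothly along
the equator. -/
structure IsSlice (p q : M) (v e w f : EuclideanSpace ℝ (Fin n)) (α : ℝ) : Prop where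
  left : IsSector (pullMetric (rexp p)) (normalDom p) v e α
  right : IsSector (pullMetric (rexp q)) (normalDom q) w f α
  equator : ∀ θ ∈ Icc 0 α,
    rexp p ((Real.pi / 2) • rot v e θ) = rexp q ((Real.pi / 2) • rot w f θ) ∧
    tang (rexp p) ((Real.pi / 2) • rot v e θ) (rot v e θ) =
      -tang (rexp q) ((Real.pi / 2) • rot w f θ) (rot w f θ)

/-- Rays are geodesics. -/
theorem geoAt_rexp_smul {p : M} {w : EuclideanSpace ℝ (Fin n)} {t : ℝ} (h : t • w ∈ normalDom p) :
    GeoAt n (fun s ↦ rexp p (s • w)) t := by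
  have hd : deriv (fun s : ℝ ↦ s • w) = fun _ ↦ w := by
    ext1 s
    exact (hasDerivAt_smul_const' w s).deriv
  have hx : ContDiffAt ℝ ∞ (fun s : ℝ ↦ s • w) t := contDiffAt_id.smul contDiffAt_const
  refine ((isParam_rexp p).geoAt_iff hx h).2 ?_
  rw [accel, hd]
  simp [(isNormalMetric_rexp p).radial_smul h]

namespace IsSlice

variable {p q : M} {v e w f : EuclideanSpace ℝ (Fin n)} {α : ℝ} (h : IsSlice p q v e w f α)
include h

/-- The rays from `p` and `q` agree as long as both are defined in normal coordinates. -/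
theorem exists_overlap : ∃ η, 0 < η ∧ η < Real.pi / 2 ∧ ∀ θ ∈ Icc 0 α,
    ∀ t ∈ Ioo (Real.pi / 2 - η) (Real.pi / 2 + η), t • rot v e θ ∈ normalDom p ∧
      (Real.pi - t) • rot w f θ ∈ normalDom q ∧
      rexp p (t • rot v e θ) = rexp q ((Real.pi - t) • rot w f θ) := by
  have hπ : (0 : ℝ) < Real.pi / 2 := by positivity
  have hhalf : Real.pi - Real.pi / 2 = Real.pi / 2 := by ring
  -- Both normal coordinates are still defined slightly beyond the equator, where the rays agree as
  -- geodesics with the same position and velocity.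
  have hev : ∀ᶠ t : ℝ in nhds (Real.pi / 2), ∀ θ ∈ Icc 0 α, t • rot v e θ ∈ normalDom p ∧
      (Real.pi - t) • rot w f θ ∈ normalDom q := by
    refine isCompact_Icc.eventually_forall_of_forall_eventually fun θ hθ ↦ ?_
    have hmem : Real.pi / 2 ∈ Icc 0 (Real.pi / 2) := right_mem_Icc.2 hπ.le
    have c1 : Continuous fun z : ℝ × ℝ ↦ z.1 • rot v e z.2 :=
      continuous_fst.smul ((continuous_rot v e).comp continuous_snd)
    have c2 : Continuous fun z : ℝ × ℝ ↦ (Real.pi - z.1) • rot w f z.2 :=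
      (continuous_const.sub continuous_fst).smul ((continuous_rot w f).comp continuous_snd)
    refine (c1.continuousAt.eventually ((isOpen_normalDom p).mem_nhds ?_)).and
      (c2.continuousAt.eventually ((isOpen_normalDom q).mem_nhds ?_))
    · exact h.left.mem θ hθ _ hmem
    · change (Real.pi - Real.pi / 2) • rot w f θ ∈ _
      rw [hhalf]
      exact h.right.mem θ hθ _ hmem
  obtain ⟨η, hη, hball⟩ := Metric.eventually_nhds_iff.1 hev
  refine ⟨min η (Real.pi / 4), lt_min hη (by positivity),
    (min_le_right _ _).trans_lt (by linarith), fun θ hθ ↦ ?_⟩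
  set I := Ioo (Real.pi / 2 - min η (Real.pi / 4)) (Real.pi / 2 + min η (Real.pi / 4)) with hI
  have hmem (t : ℝ) (ht : t ∈ I) := hball (y := t) (by
    rw [Real.dist_eq, abs_lt]
    constructor <;> linarith [ht.1, ht.2, min_le_left η (Real.pi / 4)]) θ hθ
  have h0 : Real.pi / 2 ∈ I := by
    have : 0 < min η (Real.pi / 4) := lt_min hη (by positivity)
    constructor <;> linarith
  have g1 (t : ℝ) (ht : t ∈ I) := geoAt_rexp_smul (hmem t ht).1
  have g2 (t : ℝ) (ht : t ∈ I) : GeoAt n (fun s ↦ rexp q ((Real.pi - s) • rot w f θ)) t := by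
    have := GeoAt.comp_affine (γ := fun s ↦ rexp q (s • rot w f θ)) (a := -1) (b := Real.pi)
      (t := t) (geoAt_rexp_smul (by
        have := (hmem t ht).2
        rwa [show Real.pi - t = -1 * t + Real.pi by ring] at this))
    simpa [sub_eq_neg_add] using this
  have hl : HasDerivAt (fun s : ℝ ↦ (Real.pi - s) • rot w f θ) (-rot w f θ) (Real.pi / 2) := by
    simpa using ((hasDerivAt_id (Real.pi / 2)).const_sub Real.pi).smul_const (rot w f θ)
  have heq := geo_eqOn isOpen_Ioo isPreconnected_Ioo g1 g2 h0
    (by beta_reduce; rw [hhalf]; exact (h.equator θ hθ).1) (by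
      rw [vel_comp ((isParam_rexp p).mdifferentiableAt (hmem _ h0).1) (hasDerivAt_smul_const' _ _),
        vel_comp ((isParam_rexp q).mdifferentiableAt (hmem _ h0).2) hl, hhalf, map_neg]
      exact (h.equator θ hθ).2)
  exact fun t ht ↦ ⟨(hmem t ht).1, (hmem t ht).2, heq ht⟩

end IsSlice

end Slice

/-! ### The lune as a region of the unit sphere -/

section Lune

theorem coe_meridian (θ t : ℝ) :
    (meridian θ t : EuclideanSpace ℝ (Fin 3)) = spherePoint 1 θ t := by
  simp [meridian, spherePoint]

theorem spherePoint_neg (θ t : ℝ) : spherePoint (-1) θ (Real.pi - t) = spherePoint 1 θ t := by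
  simp [spherePoint]

/-- The lune is the intersection of the sphere with a convex cone. -/
theorem mem_lune_iff {α : ℝ} (hα : 0 < α) (hα2 : α < Real.pi / 2) {x : UnitSphere} :
    x ∈ lune α ↔ 0 ≤ (x : EuclideanSpace ℝ (Fin 3)) 2 ∧
      0 ≤ (x : EuclideanSpace ℝ (Fin 3)) 1 * Real.sin α -
        (x : EuclideanSpace ℝ (Fin 3)) 2 * Real.cos α := by
  have hπ := Real.pi_pos
  constructor
  · rintro ⟨θ, hθ, t, ht, rfl⟩
    have h1 := Real.sin_nonneg_of_nonneg_of_le_pi ht.1 ht.2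
    have h2 := Real.sin_nonneg_of_nonneg_of_le_pi hθ.1 (by linarith [hθ.2])
    have h3 := Real.sin_nonneg_of_nonneg_of_le_pi (sub_nonneg.2 hθ.2) (by linarith [hθ.1])
    rw [Real.sin_sub] at h3
    rw [coe_meridian]
    simp only [spherePoint]
    refine ⟨by simpa using mul_nonneg h1 h2, ?_⟩
    have := mul_nonneg h1 h3
    simp
    linarith
  · obtain ⟨x, hx⟩ := x
    rintro ⟨h2, h1⟩
    simp only at h1 h2
    have hn : x 0 ^ 2 + x 1 ^ 2 + x 2 ^ 2 = 1 := by
      rw [mem_sphere_zero_iff_norm, EuclideanSpace.norm_eq, Real.sqrt_eq_one] at hx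
      simpa [Fin.sum_univ_three] using hx
    set z : ℂ := ⟨x 1, x 2⟩ with hz
    have hzn : ‖z‖ ^ 2 = x 1 ^ 2 + x 2 ^ 2 := by
      rw [← Complex.normSq_eq_norm_sq, Complex.normSq_apply]
      simp only [hz]
      ring
    have hc : ‖z‖ * Real.cos z.arg = x 1 := Complex.norm_mul_cos_arg z
    have hs : ‖z‖ * Real.sin z.arg = x 2 := Complex.norm_mul_sin_arg z
    have hx0 : -1 ≤ x 0 ∧ x 0 ≤ 1 := by
      constructor <;> nlinarith [sq_nonneg (x 1), sq_nonneg (x 2)]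
    have hst : Real.sin (Real.arccos (x 0)) = ‖z‖ := by
      rw [Real.sin_arccos, show 1 - x 0 ^ 2 = ‖z‖ ^ 2 by rw [hzn]; linarith,
        Real.sqrt_sq (norm_nonneg z)]
    have harg : z.arg ∈ Icc 0 α := by
      refine ⟨Complex.arg_nonneg_iff.2 h2, ?_⟩
      rcases eq_or_ne z 0 with h0 | h0
      · rw [h0, Complex.arg_zero]; exact hα.le
      by_contra! hlt
      have h3 : 0 < Real.sin (z.arg - α) :=
        Real.sin_pos_of_pos_of_lt_pi (by linarith) (by linarith [Complex.arg_le_pi z])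
      rw [Real.sin_sub] at h3
      have := mul_pos (norm_pos_iff.2 h0) h3
      rw [← hc, ← hs] at h1
      linarith
    refine ⟨z.arg, harg, Real.arccos (x 0), ⟨Real.arccos_nonneg _, Real.arccos_le_pi _⟩, ?_⟩
    rw [Subtype.ext_iff, coe_meridian]
    simp only [spherePoint, Real.cos_arccos hx0.1 hx0.2, hst, hc, hs]
    ext i
    fin_cases i <;> simp

/-- The differential of the inclusion of the unit sphere in `ℝ³`. -/
noncomputable def sphereTang (x : UnitSphere) :
    EuclideanSpace ℝ (Fin 2) →L[ℝ] EuclideanSpace ℝ (Fin 3) :=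
  mfderiv (𝓡 2) 𝓘(ℝ, EuclideanSpace ℝ (Fin 3))
    (fun z : UnitSphere ↦ (z : EuclideanSpace ℝ (Fin 3))) x

theorem injective_sphereTang (x : UnitSphere) : Function.Injective (sphereTang x) :=
  injective_mvfderiv_subtypeVal_sphere x

theorem inner_sphereTang (x : UnitSphere) (u : EuclideanSpace ℝ (Fin 2)) :
    inner ℝ (x : EuclideanSpace ℝ (Fin 3)) (sphereTang x u) = 0 := by
  have h : sphereTang x u ∈ (Submodule.span ℝ {(x : EuclideanSpace ℝ (Fin 3))})ᗮ := by
    rw [← range_mvfderiv_subtypeVal (n := 2) x]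
    exact ⟨u, rfl⟩
  exact (Submodule.mem_orthogonal_singleton_iff_inner_right).1 h

theorem contMDiff_coe_unitSphere : ContMDiff (𝓡 2) 𝓘(ℝ, EuclideanSpace ℝ (Fin 3)) ∞
    (fun z : UnitSphere ↦ (z : EuclideanSpace ℝ (Fin 3))) := contMDiff_coe_sphere

theorem inner_tangent_proj (x : UnitSphere) (z : EuclideanSpace ℝ (Fin 3)) :
    inner ℝ (x : EuclideanSpace ℝ (Fin 3)) ((x : EuclideanSpace ℝ (Fin 3)) + z -
      inner ℝ (x : EuclideanSpace ℝ (Fin 3)) z • (x : EuclideanSpace ℝ (Fin 3))) = (1 : ℝ) := by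
  have : inner ℝ (x : EuclideanSpace ℝ (Fin 3)) (x : EuclideanSpace ℝ (Fin 3)) = (1 : ℝ) := by
    rw [real_inner_self_eq_norm_sq, mem_sphere_zero_iff_norm.1 x.2, one_pow]
  rw [inner_sub_right, inner_add_right, real_inner_smul_right, this]
  ring

/-- The lune is locally the image of a convex set with nonempty interior under central
projection of the tangent plane. -/
theorem uniqueMDiffWithinAt_lune {α : ℝ} (hα : 0 < α) (hα2 : α < Real.pi / 2) {x : UnitSphere}
    (hx : x ∈ lune α) : UniqueMDiffWithinAt (𝓡 2) (lune α) x := by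
  have hπ := Real.pi_pos
  set X : EuclideanSpace ℝ (Fin 3) := (x : EuclideanSpace ℝ (Fin 3)) with hX
  set G : EuclideanSpace ℝ (Fin 3) → EuclideanSpace ℝ (Fin 3) := fun z ↦ X + z - inner ℝ X z • X
    with hG
  have hXX : inner ℝ X X = (1 : ℝ) := by
    rw [real_inner_self_eq_norm_sq, mem_sphere_zero_iff_norm.1 x.2, one_pow]
  have hGne (z : EuclideanSpace ℝ (Fin 3)) : G z ≠ 0 := fun h0 ↦ by
    have := inner_tangent_proj x z
    change inner ℝ X (G z) = 1 at this
    rw [h0, inner_zero_right] at this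
    exact zero_ne_one this
  have hGc : ContDiff ℝ ∞ G :=
    (contDiff_const.add contDiff_id).sub ((contDiff_const.inner ℝ contDiff_id).smul contDiff_const)
  have hPc : ContDiff ℝ ∞ (fun z ↦ ‖G z‖⁻¹ • G z) := by
    refine contDiff_iff_contDiffAt.2 fun z ↦ ?_
    have h1 : ContDiffAt ℝ ∞ (fun z ↦ ‖G z‖) z := hGc.contDiffAt.norm ℝ (hGne z)
    exact (h1.inv (norm_ne_zero_iff.2 (hGne z))).smul hGc.contDiffAt
  have hPm (z : EuclideanSpace ℝ (Fin 3)) :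
      ‖G z‖⁻¹ • G z ∈ Metric.sphere (0 : EuclideanSpace ℝ (Fin 3)) 1 := by
    rw [mem_sphere_zero_iff_norm, norm_smul, norm_inv, norm_norm,
      inv_mul_cancel₀ (norm_ne_zero_iff.2 (hGne z))]
  have hPs : ContMDiff 𝓘(ℝ, EuclideanSpace ℝ (Fin 3)) (𝓡 2) ∞
      (Set.codRestrict (fun z ↦ ‖G z‖⁻¹ • G z) _ hPm : _ → UnitSphere) :=
    ContMDiff.codRestrict_sphere hPc.contMDiff hPm
  set P : EuclideanSpace ℝ (Fin 3) → UnitSphere := Set.codRestrict (fun z ↦ ‖G z‖⁻¹ • G z) _ hPm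
    with hP
  have hP0 : P 0 = x := by
    rw [Subtype.ext_iff]
    change ‖G 0‖⁻¹ • G 0 = X
    have : G 0 = X := by simp [hG]
    rw [this, mem_sphere_zero_iff_norm.1 x.2, inv_one, one_smul]
  -- the differential of the central projection at the origin is onto
  have hd : HasMFDerivAt 𝓘(ℝ, EuclideanSpace ℝ (Fin 3)) (𝓡 2) P 0 (mfderiv
      𝓘(ℝ, EuclideanSpace ℝ (Fin 3)) (𝓡 2) P 0) :=
    ((hPs 0).mdifferentiableAt (by simp)).hasMFDerivAt
  set A : EuclideanSpace ℝ (Fin 3) →L[ℝ] EuclideanSpace ℝ (Fin 2) :=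
    mfderiv 𝓘(ℝ, EuclideanSpace ℝ (Fin 3)) (𝓡 2) P 0 with hA
  have hAd (a : EuclideanSpace ℝ (Fin 3)) (ha : inner ℝ X a = (0 : ℝ)) : sphereTang x (A a) = a := by
    have h1 := (((contMDiff_coe_unitSphere (P 0)).mdifferentiableAt (by simp)).hasMFDerivAt.comp
      0 hd).hasFDerivAt
    rw [hP0] at h1
    have h2 : HasDerivAt (fun s : ℝ ↦ ‖G (s • a)‖⁻¹ • G (s • a)) (sphereTang x (A a)) 0 := by
      have hl : HasDerivAt (fun s : ℝ ↦ s • a) a 0 := hasDerivAt_smul_const' a 0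
      have h0 : HasFDerivAt (fun z ↦ ‖G z‖⁻¹ • G z) ((sphereTang x).comp A) ((0 : ℝ) • a) := by
        rw [zero_smul]
        exact h1
      exact h0.comp_hasDerivAt (f := fun s : ℝ ↦ s • a) (0 : ℝ) hl
    have h3 (s : ℝ) : G (s • a) = X + s • a := by
      simp [hG, real_inner_smul_right, ha]
    have h4 (s : ℝ) : ‖X + s • a‖ = Real.sqrt (1 + s ^ 2 * ‖a‖ ^ 2) := by
      rw [norm_eq_sqrt_real_inner, inner_add_add_self, real_inner_smul_right, real_inner_smul_left,
        real_inner_smul_right, real_inner_smul_left, real_inner_comm X a, ha, hXX,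
        real_inner_self_eq_norm_sq]
      ring_nf
    simp only [h3, h4] at h2
    have h5 : HasDerivAt (fun s : ℝ ↦ 1 + s ^ 2 * ‖a‖ ^ 2) 0 0 := by
      simpa using (((hasDerivAt_id (0 : ℝ)).pow 2).mul_const (‖a‖ ^ 2)).const_add 1
    have h6 := (h5.sqrt (by simp)).inv (by simp)
    have h7 := h6.smul (((hasDerivAt_smul_const' a 0)).const_add X)
    have h8 := h2.unique h7
    simpa using h8
  have hAs : Function.Surjective A := fun u ↦
    ⟨sphereTang x u, injective_sphereTang x (hAd _ (inner_sphereTang x u))⟩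
  -- the convex set
  set C : Set (EuclideanSpace ℝ (Fin 3)) := {z | 0 ≤ G z 2 ∧
    0 ≤ G z 1 * Real.sin α - G z 2 * Real.cos α} with hC
  have hGapp (z : EuclideanSpace ℝ (Fin 3)) (i : Fin 3) : G z i = X i + z i - inner ℝ X z * X i := by
    simp [hG]
  have hconv : Convex ℝ C := by
    have haff (a b : ℝ) (hab : a + b = 1) (y z : EuclideanSpace ℝ (Fin 3)) (i : Fin 3) :
        G (a • y + b • z) i = a * G y i + b * G z i := by
      rw [hGapp, hGapp, hGapp, inner_add_right, real_inner_smul_right, real_inner_smul_right]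
      simp
      linear_combination -X i * hab
    intro y hy z hz a b ha hb hab
    refine ⟨?_, ?_⟩
    · rw [haff a b hab]
      exact add_nonneg (mul_nonneg ha hy.1) (mul_nonneg hb hz.1)
    · rw [haff a b hab, haff a b hab]
      have := add_nonneg (mul_nonneg ha hy.2) (mul_nonneg hb hz.2)
      linarith
  have hlune (z : EuclideanSpace ℝ (Fin 3)) (hz : z ∈ C) : P z ∈ lune α := by
    have hn : 0 ≤ ‖G z‖⁻¹ := by positivity
    refine (mem_lune_iff hα hα2).2 ⟨?_, ?_⟩
    · exact mul_nonneg hn hz.1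
    · have := mul_nonneg hn hz.2
      have e : ∀ i, (P z : EuclideanSpace ℝ (Fin 3)) i = ‖G z‖⁻¹ * G z i := fun i ↦ rfl
      rw [e, e]
      linarith
  have hxC : (0 : EuclideanSpace ℝ (Fin 3)) ∈ C := by
    have h := (mem_lune_iff hα hα2).1 hx
    have e (i : Fin 3) : G 0 i = X i := by simp [hG]
    refine ⟨?_, ?_⟩
    · rw [e]; exact h.1
    · rw [e, e]; exact h.2
  -- the direction of the midpoint of the lune points to the interior of the convex set
  have hint : (interior C).Nonempty := by
    have hp (i : Fin 3) : Continuous fun z ↦ G z i :=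
      (EuclideanSpace.proj i : EuclideanSpace ℝ (Fin 3) →L[ℝ] ℝ).continuous.comp hGc.continuous
    have ho : IsOpen {z | 0 < G z 2 ∧ 0 < G z 1 * Real.sin α - G z 2 * Real.cos α} :=
      (isOpen_lt continuous_const (hp 2)).inter (isOpen_lt continuous_const
        (((hp 1).mul continuous_const).sub ((hp 2).mul continuous_const)))
    have hsub : {z | 0 < G z 2 ∧ 0 < G z 1 * Real.sin α - G z 2 * Real.cos α} ⊆ C :=
      fun z hz ↦ ⟨hz.1.le, hz.2.le⟩
    refine ⟨!₂[0, Real.cos (α / 2), Real.sin (α / 2)], interior_maximal hsub ho ?_⟩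
    set d : EuclideanSpace ℝ (Fin 3) := !₂[0, Real.cos (α / 2), Real.sin (α / 2)] with hdd
    have hdn : ‖d‖ = 1 := by
      rw [EuclideanSpace.norm_eq, Real.sqrt_eq_one]
      simp [hdd, Fin.sum_univ_three]
    have hin : inner ℝ X d ≤ (1 : ℝ) := by
      have := real_inner_le_norm X d
      rwa [hdn, mem_sphere_zero_iff_norm.1 x.2, one_mul] at this
    have h := (mem_lune_iff hα hα2).1 hx
    have hs : 0 < Real.sin (α / 2) := Real.sin_pos_of_pos_of_lt_pi (by linarith) (by linarith)
    have hs2 : Real.cos (α / 2) * Real.sin α - Real.sin (α / 2) * Real.cos α =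
        Real.sin (α / 2) := by
      have := Real.sin_sub α (α / 2)
      rw [show α - α / 2 = α / 2 by ring] at this
      linarith
    have d1 : d 1 = Real.cos (α / 2) := by simp [hdd]
    have d2 : d 2 = Real.sin (α / 2) := by simp [hdd]
    have m1 := mul_nonneg (sub_nonneg.2 hin) h.1
    have m2 := mul_nonneg (sub_nonneg.2 hin) h.2
    rw [← hX] at m1 m2
    refine ⟨?_, ?_⟩
    · rw [hGapp, d2]
      linarith
    · rw [hGapp, hGapp, d1, d2]
      linarith
  have hu : UniqueMDiffWithinAt 𝓘(ℝ, EuclideanSpace ℝ (Fin 3)) C 0 :=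
    (uniqueDiffWithinAt_convex hconv hint (subset_closure hxC)).uniqueMDiffWithinAt
  have h := hu.image_denseRange hd.hasMFDerivWithinAt hAs.denseRange
  rw [hP0] at h
  exact h.mono (image_subset_iff.2 hlune)

end Lune

/-! ### The totally geodesic immersion of the lune -/

section SliceMap

variable {n : ℕ} {M : Type*} [TopologicalSpace M] [ChartedSpace (EuclideanSpace ℝ (Fin n)) M]
  [IsManifold (𝓡 n) ∞ M] [RiemannianBundle (fun x : M ↦ TangentSpace (𝓡 n) x)]
  [IsContMDiffRiemannianBundle (𝓡 n) ∞ (EuclideanSpace ℝ (Fin n))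
      (fun x : M ↦ TangentSpace (𝓡 n) x)] [T2Space M]

/-- The map from the sphere to `M` which is given by normal coordinates around `p` on the
hemisphere around the pole `(1, 0, 0)`, and by normal coordinates around `q` on the opposite
hemisphere. -/
noncomputable def sliceMap (p q : M) (v e w f : EuclideanSpace ℝ (Fin n)) (x : UnitSphere) : M :=
  if 0 ≤ (x : EuclideanSpace ℝ (Fin 3)) 0 then
    rexp p (sphereCoord 1 v e (x : EuclideanSpace ℝ (Fin 3)))
  else rexp q (sphereCoord (-1) w f (x : EuclideanSpace ℝ (Fin 3)))

/-- Near the point `x` of the lune of angle `α`, the map `F` is given by the normal coordinates of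
a spherical sector. -/
structure IsSectorAt (F : UnitSphere → M) (α : ℝ) (x : UnitSphere) (p : M)
    (v e : EuclideanSpace ℝ (Fin n)) (s θ t : ℝ) : Prop where
  sector : IsSector (pullMetric (rexp p)) (normalDom p) v e α
  sign : s * s = 1
  longitude : θ ∈ Icc 0 α
  distance : t ∈ Icc 0 (Real.pi / 2)
  coe_eq : (x : EuclideanSpace ℝ (Fin 3)) = spherePoint s θ t
  eventuallyEq : F =ᶠ[nhdsWithin x (lune α)]
    fun z ↦ rexp p (sphereCoord s v e (z : EuclideanSpace ℝ (Fin 3)))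

theorem sphereCoord_meridian {θ t : ℝ} (ht : t ∈ Ico 0 Real.pi) (v e : EuclideanSpace ℝ (Fin n)) :
    sphereCoord 1 v e (meridian θ t : EuclideanSpace ℝ (Fin 3)) = t • rot v e θ := by
  rw [coe_meridian, sphereCoord_spherePoint (by norm_num) ht]

theorem sphereCoord_meridian' {θ t : ℝ} (ht : t ∈ Ioc 0 Real.pi) (w f : EuclideanSpace ℝ (Fin n)) :
    sphereCoord (-1) w f (meridian θ t : EuclideanSpace ℝ (Fin 3)) =
      (Real.pi - t) • rot w f θ := by
  rw [coe_meridian, ← spherePoint_neg, sphereCoord_spherePoint (by norm_num)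
    ⟨by linarith [ht.2], by linarith [ht.1]⟩]

theorem meridian_apply_zero (θ t : ℝ) :
    (meridian θ t : EuclideanSpace ℝ (Fin 3)) 0 = Real.cos t := by
  simp [meridian]

theorem sliceMap_meridian (p q : M) (v e w f : EuclideanSpace ℝ (Fin n)) {θ t : ℝ}
    (ht : t ∈ Icc 0 Real.pi) : sliceMap p q v e w f (meridian θ t) =
      if t ≤ Real.pi / 2 then rexp p (t • rot v e θ) else rexp q ((Real.pi - t) • rot w f θ) := by
  have hπ := Real.pi_pos
  have hc : 0 ≤ Real.cos t ↔ t ≤ Real.pi / 2 := by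
    constructor
    · intro h
      by_contra! hlt
      exact h.not_gt (Real.cos_neg_of_pi_div_two_lt_of_lt hlt (by linarith [ht.2]))
    · exact fun h ↦ Real.cos_nonneg_of_mem_Icc ⟨by linarith [ht.1], h⟩
  rw [sliceMap, meridian_apply_zero]
  by_cases h : t ≤ Real.pi / 2
  · rw [if_pos (hc.2 h), if_pos h, sphereCoord_meridian ⟨ht.1, by linarith⟩]
  · rw [if_neg (mt hc.1 h), if_neg h, sphereCoord_meridian' ⟨by linarith, ht.2⟩]

namespace IsSlice

variable {p q : M} {v e w f : EuclideanSpace ℝ (Fin n)} {α : ℝ} (h : IsSlice p q v e w f α)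
include h

/-- Points on the equator belong to the sector around `p`. A neighborhood of them reaches beyond the
equator, where the map is given by the other sector, but agrees with the first by
`exists_overlap`. -/
theorem exists_isSectorAt {x : UnitSphere} (hx : x ∈ lune α) :
    ∃ (p' : M) (v' e' : EuclideanSpace ℝ (Fin n)) (s θ t : ℝ),
      IsSectorAt (sliceMap p q v e w f) α x p' v' e' s θ t := by
  have hπ := Real.pi_pos
  obtain ⟨η, hη, hη2, hov⟩ := h.exists_overlap
  obtain ⟨θ, hθ, t, ht, rfl⟩ := hx
  have hc : Continuous fun z : UnitSphere ↦ (z : EuclideanSpace ℝ (Fin 3)) 0 :=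
    (EuclideanSpace.proj (0 : Fin 3) : EuclideanSpace ℝ (Fin 3) →L[ℝ] ℝ).continuous.comp
      continuous_subtype_val
  by_cases htπ : t ≤ Real.pi / 2
  · refine ⟨p, v, e, 1, θ, t, h.left, by norm_num, hθ, ⟨ht.1, htπ⟩, coe_meridian θ t, ?_⟩
    have h1 : Real.cos (Real.pi / 2 + η) < (meridian θ t : EuclideanSpace ℝ (Fin 3)) 0 := by
      rw [meridian_apply_zero]
      exact Real.cos_lt_cos_of_nonneg_of_le_pi ht.1 (by linarith) (by linarith)
    filter_upwards [mem_nhdsWithin_of_mem_nhds (hc.continuousAt.eventually (lt_mem_nhds h1)),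
      self_mem_nhdsWithin] with z hz hzl
    obtain ⟨θ', hθ', t', ht', rfl⟩ := hzl
    rw [meridian_apply_zero] at hz
    have ht2 : t' < Real.pi / 2 + η := by
      by_contra! hle
      exact hz.not_ge (Real.cos_le_cos_of_nonneg_of_le_pi (by linarith) ht'.2 hle)
    rw [sliceMap_meridian p q v e w f ht', sphereCoord_meridian ⟨ht'.1, by linarith⟩]
    split_ifs with hle
    · rfl
    · exact (hov θ' hθ' t' ⟨by linarith, ht2⟩).2.2.symm
  · push Not at htπ
    refine ⟨q, w, f, -1, θ, Real.pi - t, h.right, by norm_num, hθ,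
      ⟨by linarith [ht.2], by linarith⟩, by rw [coe_meridian, spherePoint_neg], ?_⟩
    have h1 : (meridian θ t : EuclideanSpace ℝ (Fin 3)) 0 < 0 := by
      rw [meridian_apply_zero]
      exact Real.cos_neg_of_pi_div_two_lt_of_lt htπ (by linarith [ht.2])
    filter_upwards [mem_nhdsWithin_of_mem_nhds (hc.continuousAt.eventually (gt_mem_nhds h1))]
      with z hz
    rw [sliceMap, if_neg (not_le.2 hz)]

end IsSlice

namespace IsSectorAt

variable {F : UnitSphere → M} {α : ℝ} {x : UnitSphere} {p : M} {v e : EuclideanSpace ℝ (Fin n)}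
  {s θ t : ℝ} (h : IsSectorAt F α x p v e s θ t)
include h

theorem sphereCoord_eq :
    sphereCoord s v e (x : EuclideanSpace ℝ (Fin 3)) = t • rot v e θ := by
  rw [h.coe_eq, sphereCoord_spherePoint h.sign
    ⟨h.distance.1, by linarith [h.distance.2, Real.pi_pos]⟩]

theorem mem_normalDom :
    sphereCoord s v e (x : EuclideanSpace ℝ (Fin 3)) ∈ normalDom p := by
  rw [h.sphereCoord_eq]
  exact h.sector.mem θ h.longitude t h.distance

theorem contDiffAt : ContDiffAt ℝ ∞ (sphereCoord s v e) (x : EuclideanSpace ℝ (Fin 3)) := by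
  have hπ := Real.pi_pos
  refine contDiffAt_sphereCoord ?_ v e
  have h1 : s * (x : EuclideanSpace ℝ (Fin 3)) 0 = Real.cos t := by
    rw [h.coe_eq]
    simp [spherePoint, ← mul_assoc, h.sign]
  rw [h1]
  have := Real.cos_nonneg_of_mem_Icc (x := t) ⟨by linarith [h.distance.1], h.distance.2⟩
  linarith

theorem contMDiffAt : ContMDiffAt (𝓡 2) (𝓡 n) ∞
    (fun z : UnitSphere ↦ rexp p (sphereCoord s v e (z : EuclideanSpace ℝ (Fin 3)))) x := by
  have h1 : ContMDiffAt (𝓡 2) 𝓘(ℝ, EuclideanSpace ℝ (Fin n)) ∞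
      (fun z : UnitSphere ↦ sphereCoord s v e (z : EuclideanSpace ℝ (Fin 3))) x :=
    ContMDiffAt.comp (g := sphereCoord s v e) x h.contDiffAt.contMDiffAt
      (contMDiff_coe_unitSphere x)
  exact ContMDiffAt.comp (g := rexp p) x ((isParam_rexp p).contMDiffAt h.mem_normalDom) h1

theorem mfderiv_eq (u : EuclideanSpace ℝ (Fin 2)) :
    (mfderiv (𝓡 2) (𝓡 n) (fun z : UnitSphere ↦
      rexp p (sphereCoord s v e (z : EuclideanSpace ℝ (Fin 3)))) x :
      EuclideanSpace ℝ (Fin 2) →L[ℝ] EuclideanSpace ℝ (Fin n)) u =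
    tang (rexp p) (sphereCoord s v e (x : EuclideanSpace ℝ (Fin 3)))
      (fderiv ℝ (sphereCoord s v e) (x : EuclideanSpace ℝ (Fin 3)) (sphereTang x u)) := by
  have h0 := ((contMDiff_coe_unitSphere x).mdifferentiableAt (by simp)).hasMFDerivAt
  have h1 := (h.contDiffAt.differentiableAt (by simp)).hasFDerivAt.hasMFDerivAt.comp x h0
  have h2 := ((isParam_rexp p).mdifferentiableAt h.mem_normalDom).hasMFDerivAt.comp x h1
  exact congrArg (fun L : EuclideanSpace ℝ (Fin 2) →L[ℝ] EuclideanSpace ℝ (Fin n) ↦ L u) h2.mfderiv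

theorem inner_mfderivWithin (hx : x ∈ lune α) (hu : UniqueMDiffWithinAt (𝓡 2) (lune α) x)
    (a b : EuclideanSpace ℝ (Fin 2)) :
    ip (F x) (mfderivWithin (𝓡 2) (𝓡 n) F (lune α) x a) (mfderivWithin (𝓡 2) (𝓡 n) F (lune α) x b)
      = inner ℝ (sphereTang x a) (sphereTang x b) := by
  have hF := h.eventuallyEq.self_of_nhdsWithin hx
  have hd (u : EuclideanSpace ℝ (Fin 2)) :
      (mfderivWithin (𝓡 2) (𝓡 n) F (lune α) x u : EuclideanSpace ℝ (Fin n)) =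
      tang (rexp p) (sphereCoord s v e (x : EuclideanSpace ℝ (Fin 3)))
        (fderiv ℝ (sphereCoord s v e) (x : EuclideanSpace ℝ (Fin 3)) (sphereTang x u)) := by
    rw [← h.mfderiv_eq u, ← mfderivWithin_eq_mfderiv hu (h.contMDiffAt.mdifferentiableAt (by simp))]
    exact congrArg (fun L : EuclideanSpace ℝ (Fin 2) →L[ℝ] EuclideanSpace ℝ (Fin n) ↦ L u)
      (h.eventuallyEq.mfderivWithin_eq hF)
  have ha := inner_sphereTang x a
  have hb := inner_sphereTang x b
  have key := h.sector.apply_fderiv (isNormalMetric_rexp p) h.sign h.longitude h.distance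
    (a := sphereTang x a) (b := sphereTang x b) (by rw [← h.coe_eq, ha]) (by rw [← h.coe_eq, hb])
  rw [← h.coe_eq, pullMetric_apply] at key
  rw [← key]
  have e1 := hd a
  have e2 := hd b
  rw [hF]
  exact congrArg₂ (ip _) e1 e2

/-- Great circles through `x` are mapped to geodesics. -/
theorem geoAt {γ : ℝ → UnitSphere} {u w : EuclideanSpace ℝ (Fin 3)}
    (hγ : ∀ r, (γ r : EuclideanSpace ℝ (Fin 3)) = rot u w r) (hu : ‖u‖ = 1) (hw : ‖w‖ = 1)
    (huw : inner ℝ u w = (0 : ℝ)) {r : ℝ} (hr : γ r = x) (ht : t ≠ 0)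
    (hγr : ∀ᶠ r' in nhds r, γ r' ∈ lune α) (hγc : Continuous γ) :
    GeoAt n (fun r ↦ F (γ r)) r := by
  have hrot := hγ r
  rw [hr] at hrot
  have huu : inner ℝ u u = (1 : ℝ) := by rw [real_inner_self_eq_norm_sq, hu, one_pow]
  have hww : inner ℝ w w = (1 : ℝ) := by rw [real_inner_self_eq_norm_sq, hw, one_pow]
  have hwu : inner ℝ w u = (0 : ℝ) := by rw [real_inner_comm, huw]
  have hc : ContDiffAt ℝ ∞ (fun r ↦ sphereCoord s v e (rot u w r)) r := by
    refine ContDiffAt.comp (g := sphereCoord s v e) r ?_ (contDiff_rot u w).contDiffAt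
    rw [← hrot]
    exact h.contDiffAt
  have hU : sphereCoord s v e (rot u w r) ∈ normalDom p := by
    rw [← hrot]
    exact h.mem_normalDom
  have hg := ((isParam_rexp p).geoAt_iff hc hU).2 (h.sector.accel_eq_zero (isNormalMetric_rexp p)
    h.sign h.longitude ⟨h.distance.1.lt_of_ne' ht, h.distance.2⟩ (hrot.symm.trans h.coe_eq)
    (by
      simp only [rot, rot', inner_add_left, inner_add_right, real_inner_smul_left,
        real_inner_smul_right, huu, hww, huw, hwu]
      ring)
    (by
      simp only [rot', inner_add_left, inner_add_right, real_inner_smul_left,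
        real_inner_smul_right, huu, hww, huw, hwu]
      linear_combination Real.sin_sq_add_cos_sq r))
  refine hg.congr ?_
  have htend : Filter.Tendsto γ (nhds r) (nhdsWithin x (lune α)) :=
    tendsto_nhdsWithin_iff.2 ⟨hr ▸ hγc.continuousAt, hγr⟩
  filter_upwards [htend.eventually h.eventuallyEq] with r' hr'
  rw [hr', hγ]

end IsSectorAt

/-- An arc of a great circle in a lune of angle less than `π / 2` passes through the corners of the
lune at most at its endpoints. -/
theorem ne_zero_of_great_arc {α : ℝ} (hα : 0 < α) (hα2 : α < Real.pi / 2) {γ : ℝ → UnitSphere}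
    {u w : EuclideanSpace ℝ (Fin 3)} (hγ : ∀ r, (γ r : EuclideanSpace ℝ (Fin 3)) = rot u w r)
    (hu : ‖u‖ = 1) (hw : ‖w‖ = 1) (huw : inner ℝ u w = (0 : ℝ)) {r : ℝ}
    (hγr : ∀ᶠ r' in nhds r, γ r' ∈ lune α) {s θ t : ℝ} (hs : s * s = 1)
    (hr : (γ r : EuclideanSpace ℝ (Fin 3)) = spherePoint s θ t) : t ≠ 0 := by
  rintro rfl
  rw [hγ] at hr
  have hd := hasDerivAt_euclidean_apply (hasDerivAt_rot u w r)
  -- The coordinates `x₁` and `x₂` are nonnegative on the lune and vanish at the corners. An arc with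
  -- a corner in its interior has its velocity there along `x₀`, which is normal to the sphere.
  have hpos (i : Fin 3) (hi : ∀ x ∈ lune α, 0 ≤ (x : EuclideanSpace ℝ (Fin 3)) i)
      (h0 : rot u w r i = 0) : rot' u w r i = 0 := by
    refine IsLocalMin.hasDerivAt_eq_zero ?_ (hd i)
    filter_upwards [hγr] with r' hr'
    rw [h0, ← hγ]
    exact hi _ hr'
  have h2 : ∀ x ∈ lune α, 0 ≤ (x : EuclideanSpace ℝ (Fin 3)) 2 :=
    fun x hx ↦ ((mem_lune_iff hα hα2).1 hx).1
  have h1 : ∀ x ∈ lune α, 0 ≤ (x : EuclideanSpace ℝ (Fin 3)) 1 := fun x hx ↦ by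
    have h := (mem_lune_iff hα hα2).1 hx
    have hsin : 0 < Real.sin α := Real.sin_pos_of_pos_of_lt_pi hα (by linarith)
    have hcos : 0 ≤ Real.cos α := Real.cos_nonneg_of_mem_Icc ⟨by linarith, hα2.le⟩
    have := mul_nonneg h.1 hcos
    exact nonneg_of_mul_nonneg_left (by linarith [h.2]) hsin
  have d1 := hpos 1 h1 (by rw [hr]; simp [spherePoint])
  have d2 := hpos 2 h2 (by rw [hr]; simp [spherePoint])
  have huu : inner ℝ u u = (1 : ℝ) := by rw [real_inner_self_eq_norm_sq, hu, one_pow]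
  have hww : inner ℝ w w = (1 : ℝ) := by rw [real_inner_self_eq_norm_sq, hw, one_pow]
  have hwu : inner ℝ w u = (0 : ℝ) := by rw [real_inner_comm, huw]
  have hin (y z : EuclideanSpace ℝ (Fin 3)) : inner ℝ y z = y 0 * z 0 + y 1 * z 1 + y 2 * z 2 := by
    simp only [PiLp.inner_apply, Fin.sum_univ_three, RCLike.inner_apply]
    simp
    ring
  have e1 : inner ℝ (rot u w r) (rot' u w r) = (0 : ℝ) := by
    simp only [rot, rot', inner_add_left, inner_add_right, real_inner_smul_left,
      real_inner_smul_right, huu, hww, huw, hwu]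
    ring
  have e2 : inner ℝ (rot' u w r) (rot' u w r) = (1 : ℝ) := by
    simp only [rot', inner_add_left, inner_add_right, real_inner_smul_left,
      real_inner_smul_right, huu, hww, huw, hwu]
    linear_combination Real.sin_sq_add_cos_sq r
  have e0 : rot u w r 0 = s := by rw [hr]; simp [spherePoint]
  rw [hin, d1, d2, e0] at e1
  rw [hin, d1, d2] at e2
  have : rot' u w r 0 = 0 := by linear_combination s * e1 - rot' u w r 0 * hs
  rw [this] at e2
  norm_num at e2

namespace IsSlice

variable {p q : M} {v e w f : EuclideanSpace ℝ (Fin n)} {α : ℝ} (h : IsSlice p q v e w f α)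
include h

theorem contMDiffOn : ContMDiffOn (𝓡 2) (𝓡 n) ∞ (sliceMap p q v e w f) (lune α) := fun x hx ↦ by
  obtain ⟨p', v', e', s, θ, t, hS⟩ := h.exists_isSectorAt hx
  exact hS.contMDiffAt.contMDiffWithinAt.congr_of_eventuallyEq hS.eventuallyEq
    (hS.eventuallyEq.self_of_nhdsWithin hx)

theorem isIsometricImmersionOn (hα : 0 < α) (hα2 : α < Real.pi / 2) :
    IsIsometricImmersionOn n (sliceMap p q v e w f) (lune α) := by
  refine ⟨h.contMDiffOn, fun x hx a b ↦ ?_⟩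
  obtain ⟨p', v', e', s, θ, t, hS⟩ := h.exists_isSectorAt hx
  exact hS.inner_mfderivWithin hx (uniqueMDiffWithinAt_lune hα hα2 hx) a b

theorem isTotallyGeodesicOn (hα : 0 < α) (hα2 : α < Real.pi / 2) :
    IsTotallyGeodesicOn n (sliceMap p q v e w f) (lune α) := by
  rintro γ ⟨u, w', hu, hw', huw, hγ⟩ a b hab hmem
  have hm (r : ℝ) : rot u w' r ∈ Metric.sphere (0 : EuclideanSpace ℝ (Fin 3)) 1 := by
    rw [rot, ← hγ]
    exact (γ r).2
  have hγs : ContMDiff 𝓘(ℝ, ℝ) (𝓡 2) ∞ γ := by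
    have h1 : ContMDiff 𝓘(ℝ, ℝ) (𝓡 2) ∞ (Set.codRestrict (rot u w') _ hm : ℝ → UnitSphere) :=
      ContMDiff.codRestrict_sphere (contDiff_rot u w').contMDiff hm
    have h2 : γ = Set.codRestrict (rot u w') _ hm := funext fun r ↦ Subtype.ext (hγ r)
    rwa [h2]
  refine isGeodesicOn_of_geoAt (h.contMDiffOn.comp hγs.contMDiffOn hmem) fun r hr ↦ ?_
  have hr' := Ioo_subset_Icc_self hr
  have hev : ∀ᶠ r' in nhds r, γ r' ∈ lune α := by
    filter_upwards [Icc_mem_nhds hr.1 hr.2] using hmem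
  obtain ⟨p', v', e', s, θ, t, hS⟩ := h.exists_isSectorAt (hmem r hr')
  exact hS.geoAt hγ hu hw' huw rfl
    (ne_zero_of_great_arc hα hα2 hγ hu hw' huw hev hS.sign hS.coe_eq) hev hγs.continuous

end IsSlice

end SliceMap

/-! ### Variations of a geodesic of length `π` -/

section Variation

variable {n : ℕ} {M : Type*} [TopologicalSpace M] [ChartedSpace (EuclideanSpace ℝ (Fin n)) M]
  [IsManifold (𝓡 n) ∞ M] [RiemannianBundle (fun x : M ↦ TangentSpace (𝓡 n) x)]
  [IsContMDiffRiemannianBundle (𝓡 n) ∞ (EuclideanSpace ℝ (Fin n))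
      (fun x : M ↦ TangentSpace (𝓡 n) x)] [T2Space M]

theorem contMDiff_reverse (b : ℝ) : ContMDiff 𝓘(ℝ, ℝ) 𝓘(ℝ, ℝ) ∞ (fun t : ℝ ↦ b - t) :=
  (contDiff_const.sub contDiff_id).contMDiff

theorem reverse_mem {b t : ℝ} (ht : t ∈ Icc 0 b) : b - t ∈ Icc 0 b :=
  ⟨by linarith [ht.2], by linarith [ht.1]⟩

theorem IsGeodesicOn.geoAt_reverse {c : ℝ → M} {b : ℝ} (hc : IsGeodesicOn n c 0 b) {t : ℝ}
    (ht : t ∈ Ioo 0 b) : GeoAt n (fun s ↦ c (b - s)) t ∧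
      vel n (fun s ↦ c (b - s)) t = -vel n c (b - t) := by
  have h1 : GeoAt n c (-1 * t + b) := hc.geoAt ⟨by linarith [ht.2], by linarith [ht.1]⟩
  have h2 := h1.comp_affine
  have h3 := vel_comp_affine h1
  simp only [neg_one_mul, neg_add_eq_sub, neg_smul, one_smul] at h2 h3
  exact ⟨h2, h3⟩

theorem IsGeodesicOn.reverse {c : ℝ → M} {b : ℝ} (hc : IsGeodesicOn n c 0 b) :
    IsGeodesicOn n (fun t ↦ c (b - t)) 0 b :=
  isGeodesicOn_of_geoAt (hc.1.comp (contMDiff_reverse b).contMDiffOn fun _ ↦ reverse_mem)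
    fun _ ht ↦ (hc.geoAt_reverse ht).1

/-- The length of an arc does not change if the curve is reversed. -/
theorem pathELength_reverse {γ : ℝ → M} {b : ℝ}
    (hγ : ContMDiffOn 𝓘(ℝ, ℝ) (𝓡 n) ∞ γ (Icc 0 b)) {t : ℝ} (ht : t ∈ Icc 0 b) :
    pathELength (𝓡 n) (fun s ↦ γ (b - s)) 0 t = pathELength (𝓡 n) γ (b - t) b := by
  have h := pathELength_comp_of_antitoneOn (I := 𝓡 n) (γ := γ) (f := fun s ↦ b - s) ht.1
    (fun s _ s' _ hss ↦ sub_le_sub_left hss b) (by fun_prop) (by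
      refine (hγ.mono (Icc_subset_Icc ?_ ?_)).mdifferentiableOn (by simp)
      · linarith [ht.2]
      · simp)
  simp only [sub_zero] at h
  exact h

/-- A geodesic of length `π` is a union of two rays with opposite directions at the midpoint. -/
theorem IsGeodesicOn.exists_rays (hsec : SectionalCurvatureLE n M 1) {c : ℝ → M}
    (hc : IsGeodesicOn n c 0 Real.pi) (hc1 : HasUnitVelocityOn n c 0 Real.pi) :
    ∃ v w : EuclideanSpace ℝ (Fin n), ip (c 0) v v = 1 ∧ ip (c Real.pi) w w = 1 ∧
      (∀ t ∈ Ico 0 Real.pi, t • v ∈ normalDom (c 0) ∧ rexp (c 0) (t • v) = c t) ∧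
      (∀ t ∈ Ico 0 Real.pi, t • w ∈ normalDom (c Real.pi) ∧
        rexp (c Real.pi) (t • w) = c (Real.pi - t)) ∧
      tang (rexp (c 0)) ((Real.pi / 2) • v) v +
        tang (rexp (c Real.pi)) ((Real.pi / 2) • w) w = 0 := by
  have hπ := Real.pi_pos
  obtain ⟨v, hv, hvr⟩ := hc.exists_ray hsec fun t ht ↦ hc1.ip_vel ht
  obtain ⟨w, hw, hwr⟩ := hc.reverse.exists_ray hsec fun t ht ↦ by
    rw [(hc.geoAt_reverse ht).2, ← neg_one_smul ℝ, ip_smul, ip_symm, ip_smul,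
      hc1.ip_vel ⟨by linarith [ht.2], by linarith [ht.1]⟩]
    norm_num
  simp only [sub_zero] at hw hwr
  refine ⟨v, w, hv, hw, hvr, hwr, ?_⟩
  have hmid : Real.pi / 2 ∈ Ioo 0 Real.pi := ⟨by positivity, by linarith⟩
  have key {p : M} {v : EuclideanSpace ℝ (Fin n)} {c : ℝ → M}
      (hvr : ∀ t ∈ Ico 0 Real.pi, t • v ∈ normalDom p ∧ rexp p (t • v) = c t) :
      tang (rexp p) ((Real.pi / 2) • v) v = vel n c (Real.pi / 2) := by
    rw [← vel_comp ((isParam_rexp p).mdifferentiableAt (hvr _ (Ioo_subset_Ico_self hmid)).1)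
      (hasDerivAt_smul_const' _ _)]
    refine vel_congr ?_
    filter_upwards [isOpen_Ioo.mem_nhds hmid] with t ht using (hvr t (Ioo_subset_Ico_self ht)).2
  rw [key hvr, key hwr, (hc.geoAt_reverse hmid).2, show Real.pi - Real.pi / 2 = Real.pi / 2 by ring,
    add_neg_cancel]

/-- A function with positive derivative which fixes the endpoints of an interval maps the interval
to itself. -/
theorem mem_Icc_of_derivWithin_pos {τ : ℝ → ℝ} {a b : ℝ} (hab : a ≤ b)
    (hτ : ContDiffOn ℝ ∞ τ (Icc a b)) (hpos : ∀ t ∈ Icc a b, 0 < derivWithin τ (Icc a b) t)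
    (ha : τ a = a) (hb : τ b = b) {t : ℝ} (ht : t ∈ Icc a b) : τ t ∈ Icc a b := by
  have hmono : StrictMonoOn τ (Icc a b) := by
    refine strictMonoOn_of_deriv_pos (convex_Icc a b) hτ.continuousOn fun s hs ↦ ?_
    rw [interior_Icc] at hs
    rw [← derivWithin_of_mem_nhds (Icc_mem_nhds hs.1 hs.2)]
    exact hpos s (Ioo_subset_Icc_self hs)
  have h1 := hmono.monotoneOn (left_mem_Icc.2 hab) ht ht.1
  have h2 := hmono.monotoneOn ht (right_mem_Icc.2 hab) ht.2
  rw [ha] at h1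
  rw [hb] at h2
  exact ⟨h1, h2⟩

/-- The curves of the variation for small parameters are broken geodesics that break at a point `x`
near the midpoint. If `x` is the midpoint, then the curve is a reparametrization of `c`; otherwise
the segment from the midpoint to `x` is the equator of a spherical slice. -/
theorem exists_slice_of_variation (hsec : SectionalCurvatureLE n M 1) {c : ℝ → M}
    (hc : IsGeodesicOn n c 0 Real.pi) (hc1 : HasUnitVelocityOn n c 0 Real.pi)
    {δ : ℝ} (hδ : 0 < δ) {V : ℝ → ℝ → M}
    (hV : ContMDiffOn 𝓘(ℝ, ℝ × ℝ) (𝓡 n) ∞ (fun x : ℝ × ℝ ↦ V x.1 x.2)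
      (Ioo (-δ) δ ×ˢ Icc 0 Real.pi))
    (hV0 : ∀ t ∈ Icc 0 Real.pi, V 0 t = c t)
    (hVp : ∀ s ∈ Ioo (-δ) δ, V s 0 = c 0) (hVq : ∀ s ∈ Ioo (-δ) δ, V s Real.pi = c Real.pi)
    (hlen : ∀ s ∈ Ioo (-δ) δ, pathELength (𝓡 n) (V s) 0 Real.pi ≤ ENNReal.ofReal Real.pi) :
    ∃ ε : ℝ, 0 < ε ∧ ε ≤ δ ∧ ∀ σ ∈ Ioo (-ε) ε,
      ¬ IsReparametrizationOn (V σ) c 0 Real.pi →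
        SpanTotallyGeodesicSphericalSlice n c (V σ) := by
  have hπ := Real.pi_pos
  obtain ⟨v₀, w₀, hv, hw, hvr, hwr, hvw⟩ := hc.exists_rays hsec hc1
  have hmid : Real.pi / 2 ∈ Ico 0 Real.pi := ⟨by positivity, by linarith⟩
  set T := 3 * Real.pi / 4 with hT
  have hT0 : 0 < T := by positivity
  have hTπ : T < Real.pi := by linarith
  have hT2 : Real.pi / 2 < T := by linarith
  have hTico (t : ℝ) (ht : t ∈ Icc 0 T) : t ∈ Ico 0 Real.pi := ⟨ht.1, ht.2.trans_lt hTπ⟩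
  have hTicc (t : ℝ) (ht : t ∈ Icc 0 T) : t ∈ Icc 0 Real.pi := Ico_subset_Icc_self (hTico t ht)
  have hV' : ContMDiffOn 𝓘(ℝ, ℝ × ℝ) (𝓡 n) ∞ (fun x : ℝ × ℝ ↦ V x.1 (Real.pi - x.2))
      (Ioo (-δ) δ ×ˢ Icc 0 Real.pi) := by
    have hf : ContMDiff 𝓘(ℝ, ℝ × ℝ) 𝓘(ℝ, ℝ × ℝ) ∞ (fun x : ℝ × ℝ ↦ (x.1, Real.pi - x.2)) :=
      (contDiff_fst.prodMk (contDiff_const.sub contDiff_snd)).contMDiff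
    exact hV.comp hf.contMDiffOn fun x hx ↦ ⟨hx.1, reverse_mem hx.2⟩
  have hsub : Ioo (-δ) δ ×ˢ Icc 0 T ⊆ Ioo (-δ) δ ×ˢ Icc 0 Real.pi := prod_mono subset_rfl hTicc
  obtain ⟨O, ε₁, Y, hε₁, hε₁δ, L⟩ := exists_isRadialLift hv hT0 hδ
    (fun t ht ↦ (hvr t (hTico t ht)).1) (hV.mono hsub)
    (fun t ht ↦ (hV0 t (hTicc t ht)).trans (hvr t (hTico t ht)).2.symm) hVp
  obtain ⟨O', ε₂, Y', hε₂, hε₂δ, L'⟩ := exists_isRadialLift (V := fun σ t ↦ V σ (Real.pi - t))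
    hw hT0 hδ (fun t ht ↦ (hwr t (hTico t ht)).1) (hV'.mono hsub)
    (fun t ht ↦ (hV0 _ (reverse_mem (hTicc t ht))).trans (hwr t (hTico t ht)).2.symm)
    (fun s hs ↦ by simpa using hVq s hs)
  obtain ⟨N, ψ, ψ', h, hψ, hψ'⟩ := exists_isMidpoint hsec hv hw (hvr _ hmid).1 (hwr _ hmid).1
    (hvr _ hmid).2 (by
      rw [(hwr _ hmid).2]
      congr 1
      ring) hvw
  set ε₀ := min ε₁ ε₂ with hε₀
  have hε₀δ : ε₀ ≤ δ := (min_le_left _ _).trans hε₁δ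
  have hmem (σ : ℝ) (hσ : σ ∈ Ioo (-ε₀) ε₀) : σ ∈ Ioo (-δ) δ :=
    Ioo_subset_Ioo (neg_le_neg hε₀δ) hε₀δ hσ
  have hVσ (σ : ℝ) (hσ : σ ∈ Ioo (-ε₀) ε₀) :
      ContMDiffOn 𝓘(ℝ, ℝ) (𝓡 n) ∞ (V σ) (Icc 0 Real.pi) := by
    have hf : ContMDiff 𝓘(ℝ, ℝ) 𝓘(ℝ, ℝ × ℝ) ∞ (fun t : ℝ ↦ (σ, t)) :=
      (contDiff_const.prodMk contDiff_id).contMDiff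
    exact hV.comp hf.contMDiffOn fun t ht ↦ ⟨hmem σ hσ, ht⟩
  have hVat : ContMDiffAt 𝓘(ℝ, ℝ × ℝ) (𝓡 n) ∞ (fun z : ℝ × ℝ ↦ V z.1 z.2) (0, Real.pi / 2) :=
    hV.contMDiffAt (prod_mem_nhds (isOpen_Ioo.mem_nhds ⟨neg_lt_zero.2 hδ, hδ⟩)
      (Icc_mem_nhds (by positivity) (by linarith)))
  obtain ⟨ε, hε, hεε, hbroken⟩ := exists_broken_geodesic h (L.mono (min_le_left ε₁ ε₂))
    (L'.mono (min_le_right ε₁ ε₂)) (lt_min hε₁ hε₂) hT2 hTπ hψ hψ' hVat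
    (fun σ hσ t ht ↦ pathELength_reverse (hVσ σ hσ) (hTicc t ht))
    (fun σ hσ ↦ hlen σ (hmem σ hσ))
  refine ⟨ε, hε, hεε.trans hε₀δ, fun σ hσ hne ↦ ?_⟩
  obtain ⟨v, w, x, hxN, τ, hv1, hw1, hxv, hxw, hτ, hτpos, hτ0, hτπ, hVτ⟩ := hbroken σ hσ
  have hτm (t : ℝ) (ht : t ∈ Icc 0 Real.pi) : τ t ∈ Icc 0 Real.pi :=
    mem_Icc_of_derivWithin_pos hπ.le hτ hτpos hτ0 hτπ ht
  -- both geodesics are given by a ray from `p` and a ray from `q`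
  have hcray (t : ℝ) (ht : t ∈ Icc 0 Real.pi) : c t = if t ≤ Real.pi / 2 then
      rexp (c 0) (t • v₀) else rexp (c Real.pi) ((Real.pi - t) • w₀) := by
    split_ifs with hle
    · exact ((hvr t ⟨ht.1, by linarith⟩).2).symm
    · rw [(hwr (Real.pi - t) ⟨by linarith [ht.2], by linarith⟩).2, sub_sub_cancel]
  have hVray (t : ℝ) (ht : t ∈ Icc 0 Real.pi) : V σ t = if τ t ≤ Real.pi / 2 then
      rexp (c 0) (τ t • v) else rexp (c Real.pi) ((Real.pi - τ t) • w) := by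
    split_ifs with hle
    · exact (hVτ t ht).1 hle
    · exact (hVτ t ht).2 (not_le.1 hle)
  have hx0 : x ≠ 0 := by
    rintro rfl
    have hπ2 : Real.pi / 2 ≠ 0 := by positivity
    have e1 : v = v₀ := smul_right_injective _ hπ2 (hxv.symm.trans hψ)
    have e2 : w = w₀ := smul_right_injective _ hπ2 (hxw.symm.trans hψ')
    subst e1 e2
    exact hne ⟨τ, hτ, hτpos, hτ0, hτπ, fun t ht ↦
      (hVray t ht).trans (hcray _ (hτm t ht)).symm⟩
  obtain ⟨α, e, f, hα, hα2, hS, hS', rfl, rfl, hglue⟩ :=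
    h.exists_isSector hv1 hw1 hψ hψ' hxN hx0 hxv hxw
  have hslice : IsSlice (c 0) (c Real.pi) v₀ e w₀ f α := ⟨hS, hS', hglue⟩
  refine ⟨α, hα, hα2, sliceMap (c 0) (c Real.pi) v₀ e w₀ f, hslice.isIsometricImmersionOn hα hα2,
    hslice.isTotallyGeodesicOn hα hα2, fun t ht ↦ ?_, τ, hτ, hτpos, hτ0, hτπ, fun t ht ↦ ?_⟩
  · rw [sliceMap_meridian _ _ _ _ _ _ ht, hcray t ht, rot_zero, rot_zero]
  · exact (hVray t ht).trans (sliceMap_meridian _ _ _ _ _ _ (hτm t ht)).symm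

end Variation

theorem proposition1p3 (n : ℕ) {M : Type*} [EMetricSpace M]
    [ChartedSpace (EuclideanSpace ℝ (Fin n)) M] [IsManifold (𝓡 n) ∞ M]
    [RiemannianBundle (fun x : M ↦ TangentSpace (𝓡 n) x)]
    [IsContMDiffRiemannianBundle (𝓡 n) ∞ (EuclideanSpace ℝ (Fin n))
      (fun x : M ↦ TangentSpace (𝓡 n) x)]
    [IsRiemannianManifold (𝓡 n) M] [CompleteSpace M] [SimplyConnectedSpace M]
    (hsec : SectionalCurvatureLE n M 1)
    (p q : M) (c : ℝ → M) (hc : IsGeodesicOn n c 0 Real.pi) (hc1 : HasUnitVelocityOn n c 0 Real.pi)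
    (hp : c 0 = p) (hq : c Real.pi = q)
    (δ : ℝ) (hδ : 0 < δ) (V : ℝ → ℝ → M)
    (hV : ContMDiffOn 𝓘(ℝ, ℝ × ℝ) (𝓡 n) ∞ (fun x : ℝ × ℝ ↦ V x.1 x.2)
      (Ioo (-δ) δ ×ˢ Icc 0 Real.pi))
    (hV0 : ∀ t ∈ Icc 0 Real.pi, V 0 t = c t)
    (hVp : ∀ s ∈ Ioo (-δ) δ, V s 0 = p) (hVq : ∀ s ∈ Ioo (-δ) δ, V s Real.pi = q)
    (hlen : ∀ s ∈ Ioo (-δ) δ, pathELength (𝓡 n) (V s) 0 Real.pi ≤ ENNReal.ofReal Real.pi) :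
    ∃ ε : ℝ, 0 < ε ∧ ε ≤ δ ∧ ∀ σ ∈ Ioo (-ε) ε,
      ¬ IsReparametrizationOn (V σ) c 0 Real.pi →
        SpanTotallyGeodesicSphericalSlice n c (V σ) := by
  subst hp hq
  exact exists_slice_of_variation hsec hc hc1 hδ hV hV0 hVp hVq hlen
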